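/- Let $M$ be a smooth $d$-dimensional manifold (Hausdorff, second countable) with a smooth torsion-free linear connection $\nabla$, with Christoffel symbols $\Gamma_{ij}^k$ in local coordinates $x^i$ and curvature $R(\partial_i,\partial_j)\partial_k=R_{ijk}^l\partial_l$. Let $y^i$ be the linear coordinates on $T_xM$ defined by the $x^i$, and let $m\ge 0$. A section of $\mathcal T_{poly}$ with $m$ arguments is a formal sum $\mathcal F(x;y)=\sum_{n\ge 0}\mathcal F_{i_1\ldots i_n}^{j_1\ldots j_m}(x)\,y^{i_1}\cdots y^{i_n}\,\partial_{y^{j_1}}\wedge\dots\wedge\partial_{y^{j_m}}$, whose coefficients are smooth tensor fields, symmetric in the $i$'s and antisymmetric in the $j$'s. A section of $\mathcal D_{poly}$ with $m$ arguments is a formal sum $\mathcal O(x;y)=\sum_{n\ge0}\sum_{J_1,\ldots,J_m}\mathcal O_{i_1\ldots i_n}^{J_1,\ldots,J_m}(x)\,y^{i_1}\cdots y^{i_n}\,\partial_{y^{J_1}}\otimes\dots\otimes\partial_{y^{J_m}}$, whose coefficients are smooth tensor fields, symmetric in the $i$'s and within each block $J_l$, the orders $|J_l|$ being bounded locally on $M$.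 Polydifferential operators on $M$ are likewise of locally bounded order. Let $D_F\Phi=\nabla\Phi-\delta\Phi+[A,\Phi]$, where $\nabla\Phi=d\Phi-[dx^i\,\Gamma_{ij}^k y^j\partial_{y^k},\Phi]$, $\delta\Phi=[dx^i\,\partial_{y^i},\Phi]$, and $[\cdot,\cdot]$ is the Schouten–Nijenhuis bracket on $\mathcal T_{poly}$ and the Gerstenhaber bracket on $\mathcal D_{poly}$. Here $A=dx^i A_i^k(x;y)\partial_{y^k}$ is the $1$-form with values in the fiberwise formal vector fields determined, inductively on the degree in $y$, by $A=\delta^{-1}R^{\nabla'}+\delta^{-1}(\nabla' A+\tfrac12[A,A])$, with $\nabla'=d-[dx^i\,\Gamma_{ij}^k y^j\partial_{y^k},\cdot\,]$, $R^{\nabla'}=-\tfrac12R_{ijk}^l\,dx^i\wedge dx^j\,y^k\partial_{y^l}$, $\tfrac12[A,A](X,Y)=[A(X),A(Y)]$, and $\delta^{-1}$ equal to $\frac1{p+q}\,y^j\,\iota_{\partial_{x^j}}$ on $q$-forms of degree $p$ in $y$ for $p+q>0$. For $f\in C^\infty(M)$ let $f_\phi(x;y)$ be the Taylor expansion at $y=0$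 of $f(\exp_x y)$, where $\exp$ is the exponential map of $\nabla$. For a polyvector field $F$ on $M$ (a smooth antisymmetric contravariant $m$-tensor field) let $F_\phi(x;y)$ be the Taylor expansion at $y=0$ of the push-forward $(\exp_x)^{-1}_*F(\exp_x y)$. For a polydifferential operator $O$ with $m$ arguments on $M$ let $O_\phi$ be the section of $\mathcal D_{poly}$ determined by $O_\phi(f^1_\phi,\ldots,f^m_\phi)=(O(f^1,\ldots,f^m))_\phi$ for all $f^j\in C^\infty(M)$. The tensors associated to $O$ are the contravariant tensor fields $O^{J_1,\ldots,J_m}$, symmetric in each block, with $O(f_1,\ldots,f_m)=\sum O^{J_1,\ldots,J_m}\nabla^{sym}_{J_1}f_1\cdots\nabla^{sym}_{J_m}f_m$, where $\nabla^{sym}_J f$ is the symmetrised iterated covariant derivative of $f$. Proposition. (1) For every polyvector field $F$ the section $F_\phi$ of $\mathcal T_{poly}$ exists and is unique, and a section $\mathcal F$ of $\mathcal T_{poly}$ satisfies $D_F\mathcal F=0$ if and only if $\mathcal F=F_\phi$ for some polyvector field $F$ on $M$. (2) For every polydifferential operator $O$ the section $O_\phi$ of $\mathcal D_{poly}$ exists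 and is unique, and so does the family of tensors associated to $O$; a section $\mathcal O$ of $\mathcal D_{poly}$ satisfies $D_F\mathcal O=0$ if and only if $\mathcal O=O_\phi$ for some polydifferential operator $O$ on $M$. (3) The tensors in these flat sections are universal polynomials of no-loop type. A universal polynomial of no-loop type in given tensors is a finite linear combination, with constant coefficients, of products of iterated covariant derivatives of these tensors and of the curvature, in which covariant indices may be contracted with contravariant indices of different factors only, never within one factor. For all $m,n$ there is such a polynomial, depending only on $m,n$, which for all $(M,\nabla,F)$ expresses the tensor $(F_\phi)_{i_1\ldots i_n}^{j_1\ldots j_m}$ through $F$ and $R$. For all $m,n,N$ and $a_1,\ldots,a_m$ there is such a polynomial, depending only on these numbers, which for all $(M,\nabla,O)$ expresses the tensor $(O_\phi)_{i_1\ldots i_n}^{J_1,\ldots,J_m}$ with $|J_l|=a_l$ through the tensors associated to $O$ and $R$, at every point of $M$ near which $O$ has order at most $N$ in each argument, that is, near which the tensors associated to $O$ with some $|J_l|>N$ vanish. -/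

import Mathlib

open scoped Manifold ContDiff Topology

universe u

noncomputable section

namespace FormalGeometry

/-! ## Formal fiberwise calculus in one coordinate chart -/

section LocalCalculus

/-- The model space `ℝ^d`. -/
abbrev Vec (d : ℕ) : Type := EuclideanSpace ℝ (Fin d)

variable {d : ℕ}

/-- The `i`-th standard basis vector of `ℝ^d`. -/
def basisVec (i : Fin d) : Vec d := EuclideanSpace.single i 1

/-- The partial derivative `∂g/∂x^i` at `q`. -/
def pd (i : Fin d) (g : Vec d → ℝ) (q : Vec d) : ℝ := fderiv ℝ g q (basisVec i)

/-- The formal functions `ℝ[[y^1, …, y^d]]` of one fiber. -/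
abbrev FPS (d : ℕ) : Type := MvPowerSeries (Fin d) ℝ

/-- The formal vector fields `∑ V^k(y) ∂/∂y^k` of one fiber, given by their components. -/
abbrev FVF (d : ℕ) : Type := Fin d → FPS d

/-- A formal vector field acting on a formal function. -/
def applyField (V : FVF d) (s : FPS d) : FPS d := ∑ k, V k * MvPowerSeries.pderiv ℝ k s

/-- The Lie bracket of formal vector fields. -/
def lieField (V W : FVF d) : FVF d := fun l => applyField V (W l) - applyField W (V l)

/-- The derivative `∂/∂x^i`, coefficient by coefficient, of a family of formal series
depending on the base point `x`. -/
def xDeriv (i : Fin d) (s : Vec d → FPS d) (q : Vec d) : FPS d :=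
  fun α => pd i (fun q' => MvPowerSeries.coeff α (s q')) q

/-- Christoffel symbols: `Γ q i j k` is `Γ_{ij}^k(q)`, i.e. `∇_{∂_i} ∂_j = ∑_k Γ_{ij}^k ∂_k`. -/
abbrev Christoffel (d : ℕ) : Type := Vec d → Fin d → Fin d → Fin d → ℝ

/-- The fiberwise vector field `- ∑_{j,k} Γ_{ij}^k y^j ∂/∂y^k`, the `dx^i`-component of
`∇' - d`. -/
def connField (Γ : Christoffel d) (q : Vec d) (i : Fin d) : FVF d :=
  fun k => - ∑ j, MvPowerSeries.C (Γ q i j k) * MvPowerSeries.X j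

/-- The components `R_{ijk}^l` of the curvature: `R(∂_i, ∂_j) ∂_k = ∑_l R_{ijk}^l ∂_l`. -/
def curv (Γ : Christoffel d) (q : Vec d) (i j k l : Fin d) : ℝ :=
  pd i (fun q' => Γ q' j k l) q - pd j (fun q' => Γ q' i k l) q
    + ∑ b, (Γ q j k b * Γ q i b l - Γ q i k b * Γ q j b l)

/-- One-forms on the base with values in the fiberwise vector fields: `A q i k` is the formal
series `A_i^k(q; y)` in `∑ dx^i A_i^k(q; y) ∂/∂y^k`. -/
abbrev VFForm (d : ℕ) : Type := Vec d → Fin d → FVF d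

/-- The `(∂_i, ∂_j)`-component of the two-form
`R^{∇'} = -1/2 R_{ijk}^l dx^i ∧ dx^j y^k ∂/∂y^l`. -/
def curvField (Γ : Christoffel d) (q : Vec d) (i j : Fin d) : FVF d :=
  fun l => - ∑ k, MvPowerSeries.C (curv Γ q i j k l) * MvPowerSeries.X k

/-- The `(∂_i, ∂_j)`-component of the two-form `∇' A`. -/
def covExt (Γ : Christoffel d) (A : VFForm d) (q : Vec d) (i j : Fin d) : FVF d := fun l =>
  (xDeriv i (fun q' => A q' j l) q + lieField (connField Γ q i) (A q j) l)
    - (xDeriv j (fun q' => A q' i l) q + lieField (connField Γ q j) (A q i) l)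

/-- The map `A ↦ δ⁻¹ R^{∇'} + δ⁻¹(∇' A + 1/2 [A, A])`, where `1/2 [A, A](X, Y) = [A(X), A(Y)]`,
and where `δ⁻¹` of a two-form `B` of degree `p` in `y` is `1/(p+2)` times the one-form whose
`dx^j`-component is `∑_i y^i B(∂_i, ∂_j)`, a series of degree `p+1` in `y`. -/
def fedosovStep (Γ : Christoffel d) (A : VFForm d) : VFForm d := fun q j l α =>
  ((α.degree : ℝ) + 1)⁻¹ * MvPowerSeries.coeff α (∑ i, MvPowerSeries.X i *
    (curvField Γ q i j l + covExt Γ A q i j l + lieField (A q i) (A q j) l))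

/-- The one-form `A` with values in the fiberwise vector fields, defined inductively on the degree
in `y` by `A = δ⁻¹ R^{∇'} + δ⁻¹(∇' A + 1/2 [A, A])`: the terms of degree at most `n` in `y` are
those of the `n`-th iterate of this map started at `0`. -/
def fedosovForm (Γ : Christoffel d) : VFForm d := fun q i k α =>
  MvPowerSeries.coeff α ((fedosovStep Γ)^[α.degree] 0 q i k)

/-- The bracket of a formal vector field with a fiberwise polyvector field or polydifferential
operator, everything viewed as acting on formal functions:
`[V, Φ](s_1, …, s_m) = V(Φ(s_1, …, s_m)) - ∑_a Φ(s_1, …, V s_a, …, s_m)`. On polyvector fields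
this is the Schouten-Nijenhuis bracket (the Lie derivative along `V`), on polydifferential
operators the Gerstenhaber bracket. -/
def fiberBracket {m : ℕ} (V : FVF d) (Φ : (Fin m → FPS d) → FPS d) : (Fin m → FPS d) → FPS d :=
  fun s => applyField V (Φ s) - ∑ a, Φ (Function.update s a (applyField V (s a)))

/-- The `dx^i`-component of `D_F Φ = ∇ Φ - δ Φ + [A, Φ]` at `q`, where `Φ` is the value at `q` of a
section and `dΦ` is its coefficientwise derivative along `∂/∂x^i`; here
`∇ Φ = dΦ - [∑ dx^i Γ_{ij}^k y^j ∂/∂y^k, Φ]` and `δ Φ = [∑ dx^i ∂/∂y^i, Φ]`. -/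
def fedosovD {m : ℕ} (Γ : Christoffel d) (q : Vec d) (i : Fin d)
    (dΦ Φ : (Fin m → FPS d) → FPS d) : (Fin m → FPS d) → FPS d := fun s =>
  (dΦ s + fiberBracket (connField Γ q i) Φ s)
    - fiberBracket (Pi.single i (1 : FPS d)) Φ s
    + fiberBracket (fedosovForm Γ q i) Φ s

/-- The formal series `∑_n ∑_{i_1, …, i_n} T_{i_1 … i_n} y^{i_1} ⋯ y^{i_n}`. -/
def genSeries (T : (n : ℕ) → (Fin n → Fin d) → ℝ) : FPS d := fun α =>
  ∑ I : Fin α.degree → Fin d, if ∑ j, Finsupp.single (I j) 1 = α then T α.degree I else 0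

/-- The fiberwise polyvector field with components `c^{j_1 … j_m}(y)`, acting on formal
functions: `(s_1, …, s_m) ↦ ∑ c^{j_1 … j_m} ∂_{j_1} s_1 ⋯ ∂_{j_m} s_m`. -/
def tpolyOp {m : ℕ} (c : (Fin m → Fin d) → FPS d) : (Fin m → FPS d) → FPS d := fun s =>
  ∑ J : Fin m → Fin d, c J * ∏ a, MvPowerSeries.pderiv ℝ (J a) (s a)

/-- The iterated formal derivative `∂/∂y^{J_1} ⋯ ∂/∂y^{J_n}`. -/
def iterPderiv {n : ℕ} (J : Fin n → Fin d) (s : FPS d) : FPS d :=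
  (List.ofFn J).foldr (fun i t => MvPowerSeries.pderiv ℝ i t) s

/-- Indices for `m` blocks of contravariant slots, the `l`-th block having `a l` slots. -/
abbrev Blocks {m : ℕ} (a : Fin m → ℕ) : Type := Σ l : Fin m, Fin (a l)

/-- The fiberwise polydifferential operator with components `c^{J_1, …, J_m}(y)`, acting on formal
functions: `(s_1, …, s_m) ↦ ∑ c^{J_1, …, J_m} ∂_{J_1} s_1 ⋯ ∂_{J_m} s_m`, where the orders
`a_l = |J_l|` of differentiation vary and only finitely many orders contribute. -/
def dpolyOp {m : ℕ} (c : (a : Fin m → ℕ) → (Blocks a → Fin d) → FPS d) :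
    (Fin m → FPS d) → FPS d := fun s =>
  ∑ᶠ a : Fin m → ℕ, ∑ J : Blocks a → Fin d, c a J * ∏ l, iterPderiv (fun j => J ⟨l, j⟩) (s l)

/-- Components, near a point of `ℝ^d`, of a tensor field with contravariant slots indexed by `κ`:
the covariant indices are given as a list, the contravariant ones as a function on `κ`. -/
abbrev Comp (d : ℕ) (κ : Type) : Type := Vec d → List (Fin d) → (κ → Fin d) → ℝ

/-- The covariant derivative of a tensor field, in components; the index of the direction of
differentiation is the first covariant index of the result. -/
def covDeriv {κ : Type} [Fintype κ] [DecidableEq κ] (Γ : Christoffel d) (T : Comp d κ) :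
    Comp d κ := fun q L J =>
  match L with
  | [] => 0
  | i :: I => pd i (fun q' => T q' I J) q
      - ∑ a : Fin I.length, ∑ l, Γ q i (I.get a) l * T q (I.set a l) J
      + ∑ b : κ, ∑ l, Γ q i l (J b) * T q I (Function.update J b l)

/-- A tensor field without covariant slots, as a component array. -/
def contraComp {κ : Type} (T : Vec d → (κ → Fin d) → ℝ) : Comp d κ := fun q L J =>
  match L with
  | [] => T q J
  | _ => 0

/-- The curvature tensor `R_{ijk}^l` as a component array. -/
def curvComp (Γ : Christoffel d) : Comp d Unit := fun q L J =>
  match L with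
  | [i, j, k] => curv Γ q i j k (J ())
  | _ => 0

/-- The symmetrised covariant derivative `∇^{sym}_J f`, with
`∇^n f (X_1, …, X_n) = (∇_{X_1} (∇^{n-1} f)) (X_2, …, X_n)`. -/
def covDerivSym (Γ : Christoffel d) (f : Vec d → ℝ) (q : Vec d) {n : ℕ} (J : Fin n → Fin d) : ℝ :=
  (n.factorial : ℝ)⁻¹ * ∑ σ : Equiv.Perm (Fin n),
    ((covDeriv Γ)^[n] (contraComp (κ := Empty) fun q' _ => f q')) q
      (List.ofFn (J ∘ σ)) Empty.elim

end LocalCalculus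

/-! ## Universal polynomials without loops -/

section Universal

/-- Contravariant slots of a letter: the letter `none` is the curvature tensor (one contravariant
slot), the letter `some l` is the `l`-th of the given contravariant tensors. -/
def UpSlot {L : Type} (up : L → Type) : Option L → Type
  | none => Unit
  | some l => up l

instance {L : Type} (up : L → Type) [∀ l, Fintype (up l)] (o : Option L) :
    Fintype (UpSlot up o) :=
  match o with
  | none => inferInstanceAs (Fintype Unit)
  | some l => inferInstanceAs (Fintype (up l))

instance {L : Type} (up : L → Type) [∀ l, DecidableEq (up l)] (o : Option L) :
    DecidableEq (UpSlot up o) :=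
  match o with
  | none => inferInstanceAs (DecidableEq Unit)
  | some l => inferInstanceAs (DecidableEq (up l))

/-- Number of covariant slots of a letter: three for the curvature, none for the given tensors. -/
def lowArity {L : Type} : Option L → ℕ
  | none => 3
  | some _ => 0

/-- A universal monomial of no-loop type, whose value is a tensor with `n` covariant slots and with
contravariant slots indexed by `κ`. It has `size` factors, the `f`-th one being the covariant
derivative of order `order f` of the tensor `letter f`. The bijection `wire` tells where each
covariant slot of a factor and each contravariant slot of the result is connected: to a
contravariant slot of a factor or to a covariant slot of the result. Concatenations only occur
between different factors, never within a factor. -/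
structure NoLoopMonomial (L : Type) (up : L → Type) (n : ℕ) (κ : Type) where
  size : ℕ
  letter : Fin size → Option L
  order : Fin size → ℕ
  wire : ((Σ f : Fin size, Fin (lowArity (letter f) + order f)) ⊕ κ) ≃
    ((Σ f : Fin size, UpSlot up (letter f)) ⊕ Fin n)
  no_loop : ∀ f s t, wire (Sum.inl ⟨f, s⟩) ≠ Sum.inl ⟨f, t⟩
  no_delta : ∀ j i, wire (Sum.inr j) ≠ Sum.inr i

/-- A universal polynomial of no-loop type: a finite linear combination, with constant
coefficients, of monomials. -/
abbrev NoLoopPolynomial (L : Type) (up : L → Type) (n : ℕ) (κ : Type) : Type :=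
  List (ℝ × NoLoopMonomial L up n κ)

variable {d : ℕ} {L : Type} {up : L → Type}

/-- The component array of a letter, for given Christoffel symbols and given tensors `T`. -/
def letterComp (Γ : Christoffel d) (T : (l : L) → Vec d → (up l → Fin d) → ℝ) :
    (o : Option L) → Comp d (UpSlot up o)
  | none => curvComp Γ
  | some l => contraComp (T l)

variable [∀ l, Fintype (up l)] [∀ l, DecidableEq (up l)] {n : ℕ} {κ : Type} [Fintype κ]

open Classical in
/-- The components of the value of a monomial: the sum, over all values `c` of the contravariant
indices of the factors which agree with the prescribed free indices `J`, of the products of the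
components of the factors. -/
def NoLoopMonomial.eval (P : NoLoopMonomial L up n κ) (Γ : Christoffel d)
    (T : (l : L) → Vec d → (up l → Fin d) → ℝ) (q : Vec d) (I : Fin n → Fin d) (J : κ → Fin d) :
    ℝ :=
  ∑ c : (Σ f : Fin P.size, UpSlot up (P.letter f)) → Fin d,
    if ∀ j v, P.wire (Sum.inr j) = Sum.inl v → c v = J j then
      ∏ f, ((covDeriv Γ)^[P.order f] (letterComp Γ T (P.letter f))) q
        (List.ofFn fun s => Sum.elim c I (P.wire (Sum.inl ⟨f, s⟩))) (fun v => c ⟨f, v⟩)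
    else 0

/-- The components of the value of a universal polynomial. -/
def NoLoopPolynomial.eval (P : NoLoopPolynomial L up n κ) (Γ : Christoffel d)
    (T : (l : L) → Vec d → (up l → Fin d) → ℝ) (q : Vec d) (I : Fin n → Fin d) (J : κ → Fin d) :
    ℝ :=
  (P.map fun t => t.1 * t.2.eval Γ T q I J).sum

end Universal

/-! ## Tensor fields, polyvector fields, polydifferential operators on a manifold -/

section Manifold

variable {d : ℕ} {M : Type u} [TopologicalSpace M] [ChartedSpace (Vec d) M]

/-- The smooth coordinate charts of `M`. -/
abbrev IsChart (e : OpenPartialHomeomorph M (Vec d)) : Prop :=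
  e ∈ IsManifold.maximalAtlas (𝓡 d) ∞ M

/-- The coordinate vector `∂/∂x^i` at the point with coordinates `q` in the chart `e`. -/
def coordVec (e : OpenPartialHomeomorph M (Vec d)) (i : Fin d) (q : Vec d) :
    TangentSpace (𝓡 d) (e.symm q) :=
  mfderiv (𝓡 d) (𝓡 d) e.symm q (basisVec i)

/-- The coordinate vector field `∂/∂x^i` of the chart `e` (meaningful on `e.source`). -/
def coordField (e : OpenPartialHomeomorph M (Vec d)) (i : Fin d) (p : M) :
    TangentSpace (𝓡 d) p :=
  (mfderiv (𝓡 d) (𝓡 d) e.symm (e p) (basisVec i) : Vec d)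

/-- The coordinate covector `dx^i` at the point with coordinates `q` in the chart `e`. -/
def coordCovec (e : OpenPartialHomeomorph M (Vec d)) (i : Fin d) (q : Vec d) :
    TangentSpace (𝓡 d) (e.symm q) →L[ℝ] ℝ :=
  mfderiv (𝓡 d) 𝓘(ℝ, ℝ) (fun p => e p i) (e.symm q)

variable [IsManifold (𝓡 d) ∞ M]

variable (d M) in
/-- Linear connections on `M`. -/
abbrev Connection : Type u := CovariantDerivative (𝓡 d) (Vec d) (TangentSpace (𝓡 d) : M → Type _)

/-- The Christoffel symbols of a connection in the chart `e`. -/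
def christoffel (nabla : Connection d M) (e : OpenPartialHomeomorph M (Vec d)) : Christoffel d :=
  fun q i j k => coordCovec e k q (nabla (coordField e j) (e.symm q) (coordVec e i q))

variable (d M) in
/-- Smooth tensor fields on `M` with `n` covariant slots and with contravariant slots indexed
by `κ`. -/
structure TensorField (n : ℕ) (κ : Type) where
  toFun : (x : M) → MultilinearMap ℝ (fun _ : Fin n => TangentSpace (𝓡 d) x)
    (MultilinearMap ℝ (fun _ : κ => TangentSpace (𝓡 d) x →L[ℝ] ℝ) ℝ)
  smooth : ∀ e : OpenPartialHomeomorph M (Vec d), IsChart e → ∀ (I : Fin n → Fin d) (J : κ → Fin d),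
    ContDiffOn ℝ ∞ (fun q => toFun (e.symm q) (fun a => coordVec e (I a) q)
      (fun b => coordCovec e (J b) q)) e.target

/-- The components `T_{i_1 … i_n}^{j_1 … }` of a tensor field in the chart `e`. -/
def TensorField.comp {n : ℕ} {κ : Type} (T : TensorField d M n κ)
    (e : OpenPartialHomeomorph M (Vec d)) (q : Vec d) (I : Fin n → Fin d) (J : κ → Fin d) : ℝ :=
  T.toFun (e.symm q) (fun a => coordVec e (I a) q) (fun b => coordCovec e (J b) q)

variable (d M) in
/-- Polyvector fields on `M`: smooth antisymmetric tensor fields with `m` contravariant slots. -/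
structure PolyvectorField (m : ℕ) where
  tensor : TensorField d M 0 (Fin m)
  alt : ∀ x v (σ : Equiv.Perm (Fin m)) w,
    tensor.toFun x v (w ∘ σ) = (Equiv.Perm.sign σ : ℤ) * tensor.toFun x v w

variable (d M) in
/-- Polydifferential operators on `M` with `m` arguments: multilinear maps on smooth functions
which in coordinates are given by smooth coefficients and finitely many partial derivatives. -/
structure PolyDiffOp (m : ℕ) where
  toFun : MultilinearMap ℝ (fun _ : Fin m => C^∞⟮𝓡 d, M; 𝓘(ℝ, ℝ), ℝ⟯) C^∞⟮𝓡 d, M; 𝓘(ℝ, ℝ), ℝ⟯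
  local_form : ∀ x : M, ∃ e : OpenPartialHomeomorph M (Vec d), IsChart e ∧ x ∈ e.source ∧
    ∃ (N : ℕ) (c : (a : Fin m → Fin (N + 1)) → ((Blocks fun l => (a l : ℕ)) → Fin d) → Vec d → ℝ),
      (∀ a J, ContDiffOn ℝ ∞ (c a J) e.target) ∧
      ∀ f : Fin m → C^∞⟮𝓡 d, M; 𝓘(ℝ, ℝ), ℝ⟯, ∀ q ∈ e.target,
        toFun f (e.symm q) = ∑ a, ∑ J, c a J q * ∏ l : Fin m,
          iteratedFDeriv ℝ (a l) (fun q' => f l (e.symm q')) q (fun j => basisVec (J ⟨l, j⟩))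

variable (d M) in
/-- Sections of the bundle of formal fiberwise polyvector fields with `m` arguments:
`∑_n F_{i_1 … i_n}^{j_1 … j_m}(x) y^{i_1} ⋯ y^{i_n} ∂/∂y^{j_1} ∧ ⋯ ∧ ∂/∂y^{j_m}`, the coefficients
being smooth tensor fields, symmetric in the `i`'s and antisymmetric in the `j`'s. -/
structure TPolySection (m : ℕ) where
  tensor : (n : ℕ) → TensorField d M n (Fin m)
  symm : ∀ n x (σ : Equiv.Perm (Fin n)) v w,
    (tensor n).toFun x (v ∘ σ) w = (tensor n).toFun x v w
  alt : ∀ n x v (σ : Equiv.Perm (Fin m)) w,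
    (tensor n).toFun x v (w ∘ σ) = (Equiv.Perm.sign σ : ℤ) * (tensor n).toFun x v w

variable (d M) in
/-- Sections of the bundle of formal fiberwise polydifferential operators with `m` arguments:
`∑_n ∑_J O_{i_1 … i_n}^{J_1, …, J_m}(x) y^{i_1} ⋯ y^{i_n} ∂_{J_1} ⊗ ⋯ ⊗ ∂_{J_m}`. The
coefficients with `|J_l| = a l` form a smooth tensor field, symmetric in the `i`'s and within each
block `J_l`, and locally on `M` the orders of differentiation are bounded. -/
structure DPolySection (m : ℕ) where
  tensor : (n : ℕ) → (a : Fin m → ℕ) → TensorField d M n (Blocks a)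
  symm : ∀ n a x (σ : Equiv.Perm (Fin n)) v w,
    (tensor n a).toFun x (v ∘ σ) w = (tensor n a).toFun x v w
  block_symm : ∀ n a x v (σ : (l : Fin m) → Equiv.Perm (Fin (a l))) w,
    (tensor n a).toFun x v (w ∘ Equiv.sigmaCongrRight σ) = (tensor n a).toFun x v w
  order_bdd : ∀ x : M, ∃ N : ℕ, ∀ᶠ p in 𝓝 x, ∀ n a, (∃ l, N < a l) → (tensor n a).toFun p = 0

variable (d M) in
/-- Families of contravariant tensor fields `T^{J_1, …, J_m}`, symmetric in each block `J_l`, which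
locally on `M` vanish for all but finitely many orders `(|J_1|, …, |J_m|)`. -/
structure OperatorTensors (m : ℕ) where
  tensor : (a : Fin m → ℕ) → TensorField d M 0 (Blocks a)
  block_symm : ∀ a x v (σ : (l : Fin m) → Equiv.Perm (Fin (a l))) w,
    (tensor a).toFun x v (w ∘ Equiv.sigmaCongrRight σ) = (tensor a).toFun x v w
  order_bdd : ∀ x : M, ∃ N : ℕ, ∀ᶠ p in 𝓝 x, ∀ a, (∃ l, N < a l) → (tensor a).toFun p = 0

/-- `T` consists of the tensors associated to the polydifferential operator `O` for the given
connection: `O(f_1, …, f_m) = ∑ T^{J_1, …, J_m} ∇^{sym}_{J_1} f_1 ⋯ ∇^{sym}_{J_m} f_m`. -/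
def IsAssociated (nabla : Connection d M) {m : ℕ} (O : PolyDiffOp d M m)
    (T : OperatorTensors d M m) : Prop :=
  ∀ e : OpenPartialHomeomorph M (Vec d), IsChart e → ∀ q ∈ e.target,
    ∀ f : Fin m → C^∞⟮𝓡 d, M; 𝓘(ℝ, ℝ), ℝ⟯,
      O.toFun f (e.symm q) = ∑ᶠ a : Fin m → ℕ, ∑ J : Blocks a → Fin d,
        (T.tensor a).comp e q Fin.elim0 J * ∏ l : Fin m,
          covDerivSym (christoffel nabla e) (fun q' => f l (e.symm q')) q (fun j => J ⟨l, j⟩)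

/-! ### Horizontal sections -/

/-- The component series `F^{j_1 … j_m}(q; y)` of a section in the chart `e`. -/
def TPolySection.series {m : ℕ} (F : TPolySection d M m) (e : OpenPartialHomeomorph M (Vec d))
    (q : Vec d) (J : Fin m → Fin d) : FPS d :=
  genSeries fun n I => (F.tensor n).comp e q I J

/-- The component series `O^{J_1, …, J_m}(q; y)` of a section in the chart `e`. -/
def DPolySection.series {m : ℕ} (O : DPolySection d M m) (e : OpenPartialHomeomorph M (Vec d))
    (q : Vec d) (a : Fin m → ℕ) (J : Blocks a → Fin d) : FPS d :=
  genSeries fun n I => (O.tensor n a).comp e q I J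

/-- `D_F F = 0` for a section of the bundle of formal fiberwise polyvector fields: in every chart
all `dx^i`-components of `D_F F` vanish. -/
def TPolySection.IsHorizontal (nabla : Connection d M) {m : ℕ} (F : TPolySection d M m) : Prop :=
  ∀ e : OpenPartialHomeomorph M (Vec d), IsChart e → ∀ q ∈ e.target, ∀ i : Fin d,
    fedosovD (christoffel nabla e) q i
      (tpolyOp fun J => xDeriv i (fun q' => F.series e q' J) q)
      (tpolyOp (F.series e q)) = 0

/-- `D_F O = 0` for a section of the bundle of formal fiberwise polydifferential operators. -/
def DPolySection.IsHorizontal (nabla : Connection d M) {m : ℕ} (O : DPolySection d M m) : Prop :=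
  ∀ e : OpenPartialHomeomorph M (Vec d), IsChart e → ∀ q ∈ e.target, ∀ i : Fin d,
    fedosovD (christoffel nabla e) q i
      (dpolyOp fun a J => xDeriv i (fun q' => O.series e q' a J) q)
      (dpolyOp (O.series e q)) = 0

/-! ### Taylor expansions along the exponential map -/

/-- `γ` is, near the parameter `0`, a geodesic of the connection. -/
def IsGeodesicNearZero (nabla : Connection d M) (γ : ℝ → M) : Prop :=
  ∀ᶠ t in 𝓝 (0 : ℝ), ContMDiffAt 𝓘(ℝ, ℝ) (𝓡 d) ∞ γ t ∧
    ∀ e : OpenPartialHomeomorph M (Vec d), IsChart e → γ t ∈ e.source → ∀ k : Fin d,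
      deriv (deriv fun τ => e (γ τ) k) t =
        - ∑ r, ∑ s, christoffel nabla e (e (γ t)) r s k *
          deriv (fun τ => e (γ τ) r) t * deriv (fun τ => e (γ τ) s) t

/-- The series `p(y)` is the Taylor expansion at `0 ∈ T_x M` of `g ∘ exp_x`, in the linear
coordinates `y^i` of `T_x M` defined by the chart `e`. As `exp_x (t v) = γ(t)` for the geodesic `γ`
with `γ(0) = x` and `γ'(0) = v`, this means that the homogeneous part of degree `n` of `p` takes at
every `v` the value `1/n! d^n/dt^n g(γ(t))` at `t = 0`. -/
def IsExpTaylor (nabla : Connection d M) (e : OpenPartialHomeomorph M (Vec d)) (x : M) (g : M → ℝ)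
    (p : FPS d) : Prop :=
  ∀ γ : ℝ → M, IsGeodesicNearZero nabla γ → γ 0 = x → ∀ n : ℕ,
    ∑ α ∈ Finset.finsuppAntidiag (Finset.univ : Finset (Fin d)) n,
        MvPowerSeries.coeff α p * ∏ i, deriv (fun t => e (γ t) i) 0 ^ α i =
      iteratedDeriv n (fun t => g (γ t)) 0 / n.factorial

open Classical in
/-- The Taylor expansion at `0 ∈ T_x M` of `g ∘ exp_x`, for a function `g` smooth near `x`, in the
linear coordinates of `T_x M` defined by the chart `e`. -/
def expTaylor (nabla : Connection d M) (e : OpenPartialHomeomorph M (Vec d)) (x : M) (g : M → ℝ) :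
    FPS d :=
  if h : ∃ p, IsExpTaylor nabla e x g p then h.choose else 0

/-- `S = F_φ`: at every `x`, the formal polyvector field `S(x; y)` is the Taylor expansion at
`y = 0` of the push-forward by `exp_x⁻¹` of `F`. In a chart, with `φ^i(y)` the Taylor expansion of
the coordinate `x^i` of `exp_x(y)`, this reads
`∑_J S^{j_1 … j_m}(x; y) ∂φ^{i_1}/∂y^{j_1} ⋯ ∂φ^{i_m}/∂y^{j_m} = F^{i_1 … i_m}(exp_x y)`. -/
def TPolySection.IsTaylorExpansion (nabla : Connection d M) {m : ℕ} (S : TPolySection d M m)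
    (F : PolyvectorField d M m) : Prop :=
  ∀ e : OpenPartialHomeomorph M (Vec d), IsChart e → ∀ x ∈ e.source, ∀ I : Fin m → Fin d,
    tpolyOp (S.series e (e x)) (fun a => expTaylor nabla e x fun p => e p (I a)) =
      expTaylor nabla e x fun p => F.tensor.comp e (e p) Fin.elim0 I

/-- `S = O_φ`: the section `S` determined by
`S(f^1_φ, …, f^m_φ) = (O(f^1, …, f^m))_φ` for all smooth functions `f^j`, where `f_φ(x; y)` is the
Taylor expansion at `y = 0` of `f(exp_x y)`. -/
def DPolySection.IsTaylorExpansion (nabla : Connection d M) {m : ℕ} (S : DPolySection d M m)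
    (O : PolyDiffOp d M m) : Prop :=
  ∀ e : OpenPartialHomeomorph M (Vec d), IsChart e → ∀ x ∈ e.source,
    ∀ f : Fin m → C^∞⟮𝓡 d, M; 𝓘(ℝ, ℝ), ℝ⟯,
      dpolyOp (S.series e (e x)) (fun l => expTaylor nabla e x (f l)) =
        expTaylor nabla e x (O.toFun f)

end Manifold

end FormalGeometry

end

open FormalGeometry

noncomputable section

namespace FormalGeometry

open Finset (card_pos card_univ finsuppAntidiag induction_on mem_filter mem_insert_of_mem
  mem_insert_self mem_map mem_powerset mem_singleton mem_univ mul_prod_erase mul_sum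
  ne_of_mem_erase prod_congr prod_insert prod_mul_distrib prod_univ_sum smul_sum sum_add_distrib
  sum_coe_sort sum_comm sum_congr sum_const sum_empty sum_eq_single sum_eq_zero sum_filter
  sum_insert sum_ite_eq sum_ite_eq' sum_mul sum_mul_sum sum_neg_distrib sum_singleton
  sum_sub_distrib sum_subset univ)
open MvPowerSeries (X C coeff coeff_C coeff_C_mul coeff_X coeff_mul coeff_mul_C coeff_pderiv
  coeff_zero_eq_constantCoeff_apply constantCoeff constantCoeff_C pderiv pderiv_C pderiv_X
  pderiv_X_of_ne smul_eq_C_mul)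
/-- Formal power series in `d` variables. -/
abbrev Series (d : ℕ) (R : Type*) : Type _ := MvPowerSeries (Fin d) R


/-- Families of coefficients of fiberwise operators with `m` arguments. -/
abbrev Coeffs (m d : ℕ) (P : Type*) : Type _ := (a : Fin m → ℕ) → (Blocks a → Fin d) → P

/-! ## Graded calculus of formal power series -/

section Graded

variable {d : ℕ} {R : Type*} [CommRing R]

/-- The homogeneous component of degree `n` of a formal power series. -/
def hom (n : ℕ) : Series d R →ₗ[R] Series d R where
  toFun s := fun α => if α.degree = n then coeff α s else 0
  map_add' s t := by
    funext α
    change (if α.degree = n then s α + t α else 0) =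
      (if α.degree = n then s α else 0) + (if α.degree = n then t α else 0)
    split_ifs <;> simp
  map_smul' r s := by
    funext α
    change (if α.degree = n then r * s α else 0) = r * (if α.degree = n then s α else 0)
    split_ifs <;> simp

lemma coeff_hom (n : ℕ) (s : Series d R) (α : Fin d →₀ ℕ) :
    coeff α (hom n s) = if α.degree = n then coeff α s else 0 := rfl

lemma ext_hom {s t : Series d R} (h : ∀ n, hom n s = hom n t) : s = t := by
  ext α
  have := congrArg (coeff α) (h α.degree)
  simpa [coeff_hom] using this

lemma hom_hom (m n : ℕ) (s : Series d R) : hom m (hom n s) = if m = n then hom n s else 0 := by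
  ext α
  simp only [coeff_hom]
  split_ifs with h1 h2 h3 <;> simp_all [coeff_hom]

lemma hom_mul (n : ℕ) (s t : Series d R) :
    hom n (s * t) = ∑ p ∈ Finset.HasAntidiagonal.antidiagonal n, hom p.1 s * hom p.2 t := by
  classical
  ext α
  rw [coeff_hom, map_sum]
  simp only [coeff_mul, coeff_hom]
  rw [sum_comm]
  split_ifs with h
  · refine sum_congr rfl fun b hb => ?_
    have hb' : b.1.degree + b.2.degree = n := by
      rw [← map_add, Finset.HasAntidiagonal.mem_antidiagonal.mp hb, h]
    rw [sum_eq_single (b.1.degree, b.2.degree)]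
    · simp
    · rintro ⟨i, j⟩ - hij
      by_cases h1 : b.1.degree = i
      · by_cases h2 : b.2.degree = j
        · simp [h1, h2] at hij
        · simp [h2]
      · simp [h1]
    · intro hn
      simp [hb'] at hn
  · symm
    refine sum_eq_zero fun b hb => sum_eq_zero ?_
    rintro ⟨i, j⟩ hij
    by_cases h1 : b.1.degree = i
    · by_cases h2 : b.2.degree = j
      · exfalso
        apply h
        rw [← Finset.HasAntidiagonal.mem_antidiagonal.mp hb, map_add, h1, h2]
        simpa using hij
      · simp [h2]
    · simp [h1]

lemma hom_C (n : ℕ) (r : R) : hom n (C (σ := Fin d) r) = if n = 0 then C r else 0 := by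
  classical
  ext α
  by_cases hα : α = 0
  · subst hα
    by_cases hn : n = 0
    · simp [hn, coeff_hom]
    · have : ¬ (0 = n) := fun h => hn h.symm
      simp [hn, coeff_hom, this]
  · split_ifs <;> simp [coeff_hom, coeff_C, hα]

lemma hom_X (n : ℕ) (i : Fin d) : hom n (X i : Series d R) = if n = 1 then X i else 0 := by
  classical
  ext α
  by_cases hα : α = Finsupp.single i 1
  · subst hα
    by_cases hn : n = 1
    · simp [hn, coeff_hom]
    · have : ¬ (1 = n) := fun h => hn h.symm
      simp [hn, coeff_hom, this]
  · split_ifs <;> simp [coeff_hom, coeff_X, hα]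

lemma hom_C_mul (n : ℕ) (r : R) (s : Series d R) : hom n (C r * s) = C r * hom n s := by
  rw [← smul_eq_C_mul, map_smul, smul_eq_C_mul]

lemma hom_succ_X_mul (n : ℕ) (i : Fin d) (s : Series d R) :
    hom (n + 1) (X i * s) = X i * hom n s := by
  rw [hom_mul, sum_eq_single (1, n)]
  · simp [hom_X]
  · rintro ⟨a, b⟩ hab hne
    rw [hom_X, if_neg, zero_mul]
    rintro rfl
    apply hne
    simp only [Finset.HasAntidiagonal.mem_antidiagonal] at hab
    simp; omega
  · intro h
    simp [add_comm] at h

lemma hom_zero_X_mul (i : Fin d) (s : Series d R) : hom 0 (X i * s) = 0 := by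
  simp [hom_mul, hom_X]

lemma hom_zero_eq (s : Series d R) : hom 0 s = C (constantCoeff s) := by
  classical
  ext α
  by_cases hα : α = 0
  · subst hα; simp [coeff_hom]
  · have : ¬ α.degree = 0 := by rwa [Finsupp.degree_eq_zero_iff]
    rw [coeff_hom, if_neg this, coeff_C, if_neg hα]

lemma hom_pderiv (n : ℕ) (k : Fin d) (s : Series d R) :
    hom n (pderiv R k s) = pderiv R k (hom (n + 1) s) := by
  ext α
  simp only [coeff_hom, coeff_pderiv]
  simp

/-- A product with a factor without constant term. -/
lemma hom_mul_eq_zero_of_lt {a s : Series d R} (n : ℕ)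
    (ha : constantCoeff a = 0) (hs : ∀ m < n, hom m s = 0) :
    hom n (a * s) = 0 := by
  rw [hom_mul]
  refine sum_eq_zero ?_
  rintro ⟨i, j⟩ hij
  rw [Finset.HasAntidiagonal.mem_antidiagonal] at hij
  rcases Nat.eq_zero_or_pos i with rfl | hi
  · simp [hom_zero_eq, ha]
  · rw [hs j (by simp at hij; omega), mul_zero]

lemma pderiv_comm (i j : Fin d) (s : Series d R) : pderiv R i (pderiv R j s) =
      pderiv R j (pderiv R i s) := by
  ext α
  simp only [coeff_pderiv, Finsupp.add_apply, add_right_comm α]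
  by_cases h : i = j
  · subst h; ring
  · simp [h, Ne.symm h]
    ring

end Graded

/-! ## Differential rings with coordinates and a connection -/

section ConnRing

/-- A commutative `ℝ`-algebra with commuting derivations `∂/∂x^i`, coordinates `x^k` and
symmetric Christoffel symbols. -/
structure ConnRing (d : ℕ) (R : Type*) [CommRing R] [Algebra ℝ R] where
  der : Fin d → Derivation ℝ R R
  der_comm : ∀ i j f, der i (der j f) = der j (der i f)
  coord : Fin d → R
  der_coord : ∀ i k, der i (coord k) = if i = k then 1 else 0
  Gam : Fin d → Fin d → Fin d → R
  Gam_symm : ∀ i j k, Gam i j k = Gam j i k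

variable {d : ℕ} {R : Type*} [CommRing R] [Algebra ℝ R]

/-- A map applied coefficient by coefficient. -/
def mapCoeff (D : R → R) (s : Series d R) : Series d R := fun α => D (coeff α s)

/-- A derivation of the coefficients, extended to formal power series. -/
def mapDer (D : Derivation ℝ R R) : Derivation ℝ (Series d R) (Series d R) := Derivation.mk'
    { toFun := mapCoeff D
      map_add' := fun s t => funext fun α => D.map_add (s α) (t α)
      map_smul' := fun r s => funext fun α => D.map_smul r (s α) }
    (fun s t => by
      classical
      ext α
      change D (coeff α (s * t)) = coeff α (s * mapCoeff D t) + coeff α (t * mapCoeff D s)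
      rw [mul_comm t]
      simp only [coeff_mul]
      rw [map_sum, ← sum_add_distrib]
      refine sum_congr rfl fun p _ => ?_
      rw [Derivation.leibniz, smul_eq_mul, smul_eq_mul, mul_comm (coeff p.2 t)]
      rfl)

lemma coeff_mapDer (D : Derivation ℝ R R) (s : Series d R) (α : Fin d →₀ ℕ) :
    coeff α (mapDer D s) = D (coeff α s) := rfl

@[simp] lemma mapDer_C (D : Derivation ℝ R R) (r : R) : mapDer D (C (σ := Fin d) r) = C (D r) := by
  classical
  ext α
  rw [coeff_mapDer, coeff_C, coeff_C]
  split_ifs <;> simp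

@[simp] lemma mapDer_X (D : Derivation ℝ R R) (i : Fin d) : mapDer D (X i : Series d R) = 0 := by
  classical
  ext α
  rw [coeff_mapDer, coeff_X]
  split_ifs <;> simp

lemma mapDer_pderiv (D : Derivation ℝ R R) (k : Fin d) (s : Series d R) :
    mapDer D (pderiv R k s) = pderiv R k (mapDer D s) := by
  ext α
  rw [coeff_mapDer, coeff_pderiv, coeff_pderiv, coeff_mapDer, Derivation.leibniz]
  simp [mul_comm]

lemma hom_mapDer (n : ℕ) (D : Derivation ℝ R R) (s : Series d R) :
    hom n (mapDer D s) = mapDer D (hom n s) := by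
  ext α
  rw [coeff_hom, coeff_mapDer, coeff_mapDer, coeff_hom]
  split_ifs <;> simp

/-- The vertical derivation `∑ V^k ∂/∂y^k`. -/
def vert (V : Fin d → Series d R) : Derivation ℝ (Series d R) (Series d R) :=
  ∑ k, V k • (pderiv R k).restrictScalars ℝ

lemma vert_apply (V : Fin d → Series d R) (s : Series d R) :
    vert V s = ∑ k, V k * pderiv R k s := by
  have h := congrFun (map_sum (Derivation.coeFnAddMonoidHom (R := ℝ) (A := Series d R)
    (M := Series d R))
    (fun k => V k • (pderiv R k).restrictScalars ℝ) univ) s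
  rw [Finset.sum_apply] at h
  exact h

@[simp] lemma vert_C (V : Fin d → Series d R) (r : R) : vert V (C r) = 0 := by
  simp [vert_apply]

@[simp] lemma vert_X (V : Fin d → Series d R) (k : Fin d) : vert V (X k) = V k := by
  classical
  simp [vert_apply, pderiv_X, Pi.single_apply]

lemma vert_add (V W : Fin d → Series d R) (s : Series d R) :
    vert (fun k => V k + W k) s = vert V s + vert W s := by
  simp [vert_apply, add_mul, sum_add_distrib]

lemma vert_sub (V W : Fin d → Series d R) (s : Series d R) :
    vert (fun k => V k - W k) s = vert V s - vert W s := by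
  simp [vert_apply, sub_mul, sum_sub_distrib]

lemma vert_sum_mul {ι : Type*} (t : Finset ι) (a : ι → Series d R)
    (V : ι → Fin d → Series d R) (s : Series d R) :
    vert (fun k => ∑ i ∈ t, a i * V i k) s = ∑ i ∈ t, a i * vert (V i) s := by
  simp only [vert_apply, sum_mul, mul_sum]
  rw [sum_comm]
  simp only [mul_assoc]

lemma mapDer_vert (D : Derivation ℝ R R) (V : Fin d → Series d R) (s : Series d R) :
    mapDer D (vert V s) = vert (fun k => mapDer D (V k)) s + vert V (mapDer D s) := by
  simp only [vert_apply, map_sum, Derivation.leibniz, smul_eq_mul, mapDer_pderiv, sum_add_distrib]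
  rw [add_comm]
  simp only [mul_comm]

/-- The components of the Lie bracket of two vertical fields. -/
lemma vert_commutator (V W : Fin d → Series d R) (s : Series d R) :
    vert V (vert W s) - vert W (vert V s) = vert (fun k => vert V (W k) - vert W (V k)) s := by
  have key : ∀ V W : Fin d → Series d R, vert V (vert W s) =
      vert (fun k => vert V (W k)) s + ∑ k, ∑ l, V l * W k * pderiv R l (pderiv R k s) := by
    intro V W
    rw [vert_apply W s, map_sum]
    simp only [Derivation.leibniz, smul_eq_mul, sum_add_distrib]
    rw [add_comm, vert_apply _ s]
    congr 1
    · simp only [mul_comm]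
    · refine sum_congr rfl fun k _ => ?_
      rw [vert_apply, mul_sum]
      refine sum_congr rfl fun l _ => ?_
      ring
  rw [key V W, key W V, vert_sub, sum_comm]
  have h : ∀ k l, V k * W l * pderiv R k (pderiv R l s) =
      W l * V k * pderiv R l (pderiv R k s) := fun k l => by
    rw [pderiv_comm, mul_comm (V k)]
  simp only [h]
  ring

namespace ConnRing

variable (Q : ConnRing d R)

local notation "Pw" => Series d R

/-- The coefficientwise derivative `∂/∂x^i`. -/
abbrev dx (i : Fin d) : Derivation ℝ Pw Pw := mapDer (Q.der i)

lemma dx_comm (i j : Fin d) (s : Pw) : Q.dx i (Q.dx j s) = Q.dx j (Q.dx i s) := by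
  ext α
  simp only [coeff_mapDer, Q.der_comm i j]

/-- The fiberwise field `- ∑ Γ_{ij}^k y^j ∂/∂y^k`. -/
def conn (i k : Fin d) : Pw := - ∑ j, C (Q.Gam i j k) * X j

lemma conn_eq (i k : Fin d) : Q.conn i k = ∑ j, X j * C (- Q.Gam i j k) := by
  simp [conn, mul_comm]

/-- The derivation `∇'_i`. -/
def nab (i : Fin d) : Derivation ℝ Pw Pw := Q.dx i + vert (Q.conn i)

lemma nab_apply (i : Fin d) (s : Pw) : Q.nab i s = Q.dx i s + vert (Q.conn i) s := rfl

lemma hom_vert_conn (n : ℕ) (i : Fin d) (s : Pw) :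
    hom n (vert (Q.conn i) s) = vert (Q.conn i) (hom n s) := by
  simp only [vert_apply, map_sum]
  refine sum_congr rfl fun k _ => ?_
  rw [conn_eq, sum_mul, sum_mul, map_sum]
  refine sum_congr rfl fun j _ => ?_
  rw [mul_assoc, mul_assoc]
  cases n with
  | zero =>
    rw [hom_zero_X_mul, hom_zero_eq]
    simp
  | succ n => rw [hom_succ_X_mul, hom_C_mul, hom_pderiv]

lemma hom_nab (n : ℕ) (i : Fin d) (s : Pw) : hom n (Q.nab i s) = Q.nab i (hom n s) := by
  rw [nab_apply, nab_apply, map_add, hom_mapDer, hom_vert_conn]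

/-- The Euler field `∑ y^i ∂/∂y^i`. -/
def eul (s : Pw) : Pw := vert (fun i => X i) s

lemma coeff_eul (s : Pw) (α : Fin d →₀ ℕ) : coeff α (eul s) = (α.degree : R) * coeff α s := by
  classical
  rw [eul, vert_apply, map_sum, Finsupp.degree_eq_sum]
  push_cast
  rw [sum_mul]
  refine sum_congr rfl fun i _ => ?_
  rw [X, MvPowerSeries.coeff_monomial_mul]
  split_ifs with h
  · rw [coeff_pderiv, tsub_add_cancel_of_le h, one_mul, mul_comm]
    congr 1
    have : 1 ≤ α i := by simpa using h i
    simp [Finsupp.tsub_apply, Nat.cast_sub this]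
  · have : α i = 0 := by
      by_contra h0
      apply h
      rw [Finsupp.single_le_iff]
      omega
    simp [this]

lemma hom_eul (n : ℕ) (s : Pw) : hom n (eul s) = n • hom n s := by
  ext α
  rw [coeff_hom, coeff_eul, map_nsmul, coeff_hom]
  split_ifs with h
  · rw [h, nsmul_eq_mul]
  · simp

/-- The derivation `∑ y^i ∇'_i`, which raises the degree by one. -/
def yop : Derivation ℝ Pw Pw := ∑ i, (X i : Pw) • Q.nab i

lemma yop_apply (s : Pw) : Q.yop s = ∑ i, X i * Q.nab i s := by
  have h := congrFun (map_sum (Derivation.coeFnAddMonoidHom (R := ℝ) (A := Pw) (M := Pw))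
    (fun i => (X i : Pw) • Q.nab i) univ) s
  rw [Finset.sum_apply] at h
  exact h

lemma hom_succ_yop (n : ℕ) (s : Pw) : hom (n + 1) (Q.yop s) = Q.yop (hom n s) := by
  simp only [yop_apply, map_sum, hom_succ_X_mul, hom_nab]

lemma hom_zero_yop (s : Pw) : hom 0 (Q.yop s) = 0 := by
  simp [yop_apply, hom_zero_X_mul]

lemma yop_unique {s : Pw} (h : eul s = Q.yop s) (h0 : constantCoeff s = 0) : s = 0 := by
  refine ext_hom fun n => ?_
  rw [map_zero]
  induction n with
  | zero => rw [hom_zero_eq, h0, map_zero]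
  | succ n ih =>
    have h1 := congrArg (hom (n + 1)) h
    rw [hom_eul, hom_succ_yop, ih, map_zero] at h1
    have h2 : ((n + 1 : ℕ) : ℝ) • hom (n + 1) s = 0 := by rw [Nat.cast_smul_eq_nsmul]; exact h1
    exact (smul_eq_zero.mp h2).resolve_left (by positivity)

/-- The formal Taylor expansion of a function along the exponential map. -/
def tau (g : R) : Pw := fun α => ((α.degree.factorial : ℝ)⁻¹) • coeff α ((Q.yop)^[α.degree] (C g))

lemma coeff_tau (g : R) (α : Fin d →₀ ℕ) : coeff α (Q.tau g) = ((α.degree.factorial : ℝ)⁻¹) •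
      coeff α ((Q.yop)^[α.degree] (C g)) := rfl

lemma hom_yop_iterate (n : ℕ) (g : R) : hom n ((Q.yop)^[n] (C g)) = (Q.yop)^[n] (C g) := by
  induction n with
  | zero => simp [hom_C]
  | succ n ih => rw [Function.iterate_succ_apply', hom_succ_yop, ih]

lemma coeff_real_smul (r : ℝ) (s : Pw) (α : Fin d →₀ ℕ) : coeff α (r • s) = r • coeff α s := rfl

lemma hom_tau (n : ℕ) (g : R) : hom n (Q.tau g) = ((n.factorial : ℝ)⁻¹) • (Q.yop)^[n] (C g) := by
  ext α
  rw [← hom_yop_iterate, coeff_hom, coeff_real_smul, coeff_hom, coeff_tau]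
  split_ifs with h
  · rw [h]
  · simp

lemma eul_tau (g : R) : eul (Q.tau g) = Q.yop (Q.tau g) := by
  refine ext_hom fun n => ?_
  cases n with
  | zero => rw [hom_eul, hom_zero_yop, zero_smul]
  | succ n =>
    rw [hom_eul, hom_succ_yop, hom_tau, hom_tau, Derivation.map_smul,
      ← Function.iterate_succ_apply' (f := Q.yop), ← Nat.cast_smul_eq_nsmul ℝ, smul_smul,
      Nat.factorial_succ]
    congr 1
    push_cast
    field_simp

@[simp] lemma constantCoeff_tau (g : R) : constantCoeff (Q.tau g) = g := by
  rw [← coeff_zero_eq_constantCoeff_apply, coeff_tau]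
  simp

lemma eul_sub (s t : Pw) : eul (s - t) = eul s - eul t := by simp [eul]

lemma eq_tau {s : Pw} (h : eul s = Q.yop s) : s = Q.tau (constantCoeff s) := by
  rw [← sub_eq_zero]
  apply Q.yop_unique
  · rw [eul_sub, map_sub, h, eul_tau]
  · simp

lemma tau_mul (f g : R) : Q.tau (f * g) = Q.tau f * Q.tau g := by
  rw [Q.eq_tau (s := Q.tau f * Q.tau g)]
  · simp
  · have hf := Q.eul_tau f
    have hg := Q.eul_tau g
    rw [eul] at *
    simp only [Derivation.leibniz, hf, hg]

lemma tau_add (f g : R) : Q.tau (f + g) = Q.tau f + Q.tau g := by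
  rw [Q.eq_tau (s := Q.tau f + Q.tau g)]
  · simp
  · have hf := Q.eul_tau f
    have hg := Q.eul_tau g
    rw [eul] at *
    simp only [map_add, hf, hg]

lemma nab_C (i : Fin d) (g : R) : Q.nab i (C g) = C (Q.der i g) := by
  simp [nab_apply]

lemma tau_algebraMap (r : ℝ) : Q.tau (algebraMap ℝ R r) = algebraMap ℝ Pw r := by
  rw [Q.eq_tau (s := algebraMap ℝ Pw r)]
  · rfl
  · rw [eul, Derivation.map_algebraMap, Derivation.map_algebraMap]

/-- The Taylor expansion as a homomorphism of algebras. -/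
def tauHom : R →ₐ[ℝ] Pw where
  toFun := Q.tau
  map_one' := by
    have := Q.tau_algebraMap 1
    simpa using this
  map_mul' := Q.tau_mul
  map_zero' := by
    have := Q.tau_algebraMap 0
    simpa using this
  map_add' := Q.tau_add
  commutes' := Q.tau_algebraMap

@[simp] lemma tauHom_apply (g : R) : Q.tauHom g = Q.tau g := rfl

lemma coeff_single_tau (k : Fin d) (g : R) : coeff (Finsupp.single k 1) (Q.tau g) = Q.der k g := by
  classical
  rw [coeff_tau]
  simp [yop_apply, nab_C, coeff_mul_C, coeff_X, Finsupp.single_left_inj]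

/-- The expansions of the coordinates. -/
def phi (k : Fin d) : Pw := Q.tau (Q.coord k)

/-- The Jacobian matrix `∂φ^l/∂y^k`. -/
def jac : Matrix (Fin d) (Fin d) Pw := fun l k => pderiv R k (Q.phi l)

omit [Algebra ℝ R] in
lemma constantCoeff_pderiv (k : Fin d) (s : Pw) : constantCoeff (pderiv R k s) =
      coeff (Finsupp.single k 1) s := by
  rw [← coeff_zero_eq_constantCoeff_apply, coeff_pderiv]
  simp

lemma map_jac : Q.jac.map (constantCoeff (σ := Fin d) (R := R)) = 1 := by
  ext l k
  rw [Matrix.map_apply, jac, constantCoeff_pderiv, phi, coeff_single_tau, der_coord,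
    Matrix.one_apply]
  simp only [eq_comm]

lemma isUnit_det_jac : IsUnit Q.jac.det := by
  rw [MvPowerSeries.isUnit_iff_constantCoeff, RingHom.map_det, RingHom.mapMatrix_apply, map_jac,
    Matrix.det_one]
  exact isUnit_one

/-- The inverse of the Jacobian matrix. -/
def jacInv : Matrix (Fin d) (Fin d) Pw := Q.jac⁻¹

lemma jac_mul_jacInv : Q.jac * Q.jacInv = 1 := Matrix.mul_nonsing_inv _ Q.isUnit_det_jac

lemma jacInv_mul_jac : Q.jacInv * Q.jac = 1 := Matrix.nonsing_inv_mul _ Q.isUnit_det_jac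

lemma constantCoeff_jacInv (k l : Fin d) :
    constantCoeff (Q.jacInv k l) = if k = l then 1 else 0 := by
  have h := congrArg (fun A => A.map (constantCoeff (σ := Fin d) (R := R))) Q.jac_mul_jacInv
  simp only [Matrix.map_mul, map_jac, one_mul] at h
  have h2 := congrFun (congrFun h k) l
  simp only [Matrix.map_apply] at h2
  rw [h2, Matrix.one_apply]
  split_ifs <;> simp

lemma vert_phi (V : Fin d → Pw) (l : Fin d) : vert V (Q.phi l) = (Q.jac.mulVec V) l := by
  rw [vert_apply, Matrix.mulVec, dotProduct]
  simp only [jac, mul_comm]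

lemma vert_eq_zero {V : Fin d → Pw} (h : ∀ l, vert V (Q.phi l) = 0) : V = 0 := by
  have h1 : Q.jac.mulVec V = 0 := by
    ext1 l
    rw [← vert_phi, h]
    rfl
  have h2 := congrArg Q.jacInv.mulVec h1
  rwa [Matrix.mulVec_mulVec, jacInv_mul_jac, Matrix.one_mulVec, Matrix.mulVec_zero] at h2

/-- The vertical part of the flat connection. -/
def flatField (i : Fin d) : Fin d → Pw := - Q.jacInv.mulVec fun l => Q.dx i (Q.phi l)

/-- The flat connection annihilating the expansions of the coordinates. -/
def flatDer (i : Fin d) : Derivation ℝ Pw Pw := Q.dx i + vert (Q.flatField i)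

lemma flatDer_apply (i : Fin d) (s : Pw) : Q.flatDer i s = Q.dx i s + vert (Q.flatField i) s := rfl

lemma flatDer_phi (i l : Fin d) : Q.flatDer i (Q.phi l) = 0 := by
  rw [flatDer_apply, vert_phi, flatField, Matrix.mulVec_neg, Matrix.mulVec_mulVec, jac_mul_jacInv,
    Matrix.one_mulVec]
  simp

/-- The Fedosov form. -/
def fedForm (i : Fin d) : Fin d → Pw := fun k =>
  Q.flatField i k + Pi.single (M := fun _ => Pw) i 1 k - Q.conn i k

lemma vert_single (i : Fin d) (s : Pw) : vert (Pi.single i (1 : Pw)) s = pderiv R i s := by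
  rw [vert_apply, sum_eq_single i]
  · simp
  · intro b _ hb
    simp [hb]
  · simp

lemma flatDer_eq (i : Fin d) (s : Pw) : Q.flatDer i s =
    Q.nab i s - pderiv R i s + vert (Q.fedForm i) s := by
  have : vert (Q.fedForm i) s = vert (Q.flatField i) s + vert (Pi.single i (1 : Pw)) s
      - vert (Q.conn i) s := by
    rw [← vert_add, ← vert_sub]; rfl
  rw [this, vert_single, flatDer_apply, nab_apply]
  ring

lemma sum_X_mul_pderiv (s : Pw) : ∑ i, X i * pderiv R i s = eul s := by
  rw [eul, vert_apply]

lemma sum_X_mul_fedForm (k : Fin d) : ∑ i, X i * Q.fedForm i k = 0 := by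
  have h := Q.vert_eq_zero (V := fun k => ∑ i, X i * Q.fedForm i k) fun l => by
    rw [vert_sum_mul]
    have h1 : ∀ i, vert (Q.fedForm i) (Q.phi l) =
        pderiv R i (Q.phi l) - Q.nab i (Q.phi l) := fun i => by
      have h2 := Q.flatDer_eq i (Q.phi l)
      rw [flatDer_phi] at h2
      linear_combination -h2
    simp only [h1, mul_sub, sum_sub_distrib, sum_X_mul_pderiv, ← yop_apply]
    rw [phi, eul_tau, sub_self]
  exact congrFun h k

lemma constantCoeff_fedForm (i k : Fin d) : constantCoeff (Q.fedForm i k) = 0 := by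
  have h1 : constantCoeff (Q.flatField i k) = - if k = i then 1 else 0 := by
    simp only [flatField, Pi.neg_apply, Matrix.mulVec, dotProduct, map_neg, map_sum, map_mul,
      constantCoeff_jacInv]
    congr 1
    have h2 : ∀ l, constantCoeff (Q.dx i (Q.phi l)) = if i = l then 1 else 0 := by
      intro l
      rw [← coeff_zero_eq_constantCoeff_apply, coeff_mapDer,
        coeff_zero_eq_constantCoeff_apply, phi, constantCoeff_tau, der_coord]
    simp [h2, eq_comm]
  rw [fedForm, map_sub, map_add, h1, conn]
  by_cases h : k = i
  · subst h; simp
  · simp [h]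

/-- Commutators of the flat connection vanish on the expansions of coordinates, hence the
curvature vanishes. -/
lemma flatField_flat (i j l : Fin d) : Q.dx i (Q.flatField j l) - Q.dx j (Q.flatField i l) +
      (vert (Q.flatField i) (Q.flatField j l) - vert (Q.flatField j) (Q.flatField i l)) = 0 := by
  have h := Q.vert_eq_zero (V := fun l => Q.dx i (Q.flatField j l) - Q.dx j (Q.flatField i l) +
      (vert (Q.flatField i) (Q.flatField j l) - vert (Q.flatField j) (Q.flatField i l)))
    fun l => by
      rw [vert_add, vert_sub, ← vert_commutator]
      have h1 := mapDer_vert (Q.der i) (Q.flatField j) (Q.phi l)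
      have h2 := mapDer_vert (Q.der j) (Q.flatField i) (Q.phi l)
      have h3 := Q.flatDer_phi i l
      have h4 := Q.flatDer_phi j l
      rw [flatDer_apply] at h3 h4
      have h5 := congrArg (Q.dx j) h3
      have h6 := congrArg (Q.dx i) h4
      have h7 := congrArg (vert (Q.flatField j)) h3
      have h8 := congrArg (vert (Q.flatField i)) h4
      have h9 := Q.dx_comm i j (Q.phi l)
      simp only [map_add, map_zero] at h5 h6 h7 h8
      linear_combination h6 - h5 + h8 - h7 - h1 + h2 - h9
  exact congrFun h l

lemma flatDer_comm (i j : Fin d) (s : Pw) :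
    Q.flatDer i (Q.flatDer j s) = Q.flatDer j (Q.flatDer i s) := by
  have h : vert (fun l => Q.dx i (Q.flatField j l) - Q.dx j (Q.flatField i l) +
      (vert (Q.flatField i) (Q.flatField j l) - vert (Q.flatField j) (Q.flatField i l))) s = 0 := by
    rw [vert_apply]
    simp only [flatField_flat, zero_mul, Finset.sum_const_zero]
  rw [vert_add, vert_sub, ← vert_commutator] at h
  have h1 := mapDer_vert (Q.der i) (Q.flatField j) s
  have h2 := mapDer_vert (Q.der j) (Q.flatField i) s
  have h9 := Q.dx_comm i j s
  simp only [flatDer_apply, map_add]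
  linear_combination h + h1 - h2 + h9

/-- The components of the curvature. -/
def curvR (i j k l : Fin d) : R := Q.der i (Q.Gam j k l) - Q.der j (Q.Gam i k l)
    + ∑ b, (Q.Gam j k b * Q.Gam i b l - Q.Gam i k b * Q.Gam j b l)

lemma pderiv_conn (i j l : Fin d) : pderiv R i (Q.conn j l) = - C (Q.Gam j i l) := by
  classical
  simp [conn, pderiv_X, Pi.single_apply]

lemma vert_conn_conn (i j l : Fin d) : vert (Q.conn i) (Q.conn j l) =
    ∑ k, C (∑ b, Q.Gam i k b * Q.Gam j b l) * X k := by
  simp only [vert_apply, pderiv_conn]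
  simp only [conn, neg_mul_neg, sum_mul, map_sum, map_mul]
  rw [sum_comm]
  refine sum_congr rfl fun k _ => sum_congr rfl fun b _ => ?_
  ring

lemma conn_curvature (i j l : Fin d) : Q.dx i (Q.conn j l) - Q.dx j (Q.conn i l) +
      (vert (Q.conn i) (Q.conn j l) - vert (Q.conn j) (Q.conn i l)) =
      - ∑ k, C (Q.curvR i j k l) * X k := by
  rw [vert_conn_conn, vert_conn_conn]
  simp only [conn, map_neg, map_sum, Derivation.leibniz, mapDer_X, mapDer_C, smul_eq_mul]
  rw [← sub_eq_zero]
  simp only [← sum_neg_distrib, ← sum_sub_distrib, ← sum_add_distrib]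
  refine sum_eq_zero fun k _ => ?_
  simp only [curvR, map_add, map_sub, map_sum, sum_sub_distrib]
  ring

/-- The components of the curvature of the flat connection, in terms of the Fedosov form. -/
lemma fedForm_flat (i j l : Fin d) : - ∑ k, C (Q.curvR i j k l) * X k
        + ((Q.dx i (Q.fedForm j l) + (vert (Q.conn i) (Q.fedForm j l)
            - vert (Q.fedForm j) (Q.conn i l)))
          - (Q.dx j (Q.fedForm i l) + (vert (Q.conn j) (Q.fedForm i l)
            - vert (Q.fedForm i) (Q.conn j l))))
        + (vert (Q.fedForm i) (Q.fedForm j l) - vert (Q.fedForm j) (Q.fedForm i l)) =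
      pderiv R i (Q.fedForm j l) - pderiv R j (Q.fedForm i l) := by
  classical
  have hF : ∀ i l, Q.flatField i l =
      Q.fedForm i l - Pi.single (M := fun _ => Pw) i 1 l + Q.conn i l := fun i l => by
    rw [fedForm]; ring
  have hV : ∀ i (s : Pw), vert (Q.flatField i) s =
      vert (Q.fedForm i) s - pderiv R i s + vert (Q.conn i) s := fun i s => by
    rw [← vert_single, ← vert_sub, ← vert_add]
    exact congrArg (fun V => vert V s) (funext fun l => hF i l)
  have hc : ∀ (D : Derivation ℝ Pw Pw) (i l : Fin d),
      D (Pi.single (M := fun _ => Pw) i 1 l) = 0 := fun D i l => by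
    rw [Pi.single_apply]
    split_ifs <;> simp
  have hc' : ∀ (k i l : Fin d),
      pderiv R k (Pi.single (M := fun _ => Pw) i 1 l) = 0 := fun k i l => by
    rw [Pi.single_apply]
    split_ifs <;> simp
  have h := Q.flatField_flat i j l
  rw [hV, hV] at h
  simp only [hF, map_add, map_sub, hc, hc', pderiv_conn] at h
  have h2 := Q.conn_curvature i j l
  rw [Q.Gam_symm i j] at h
  linear_combination h - h2

/-- The Fedosov recursion. -/
lemma fedForm_recursion (j l : Fin d) : ∑ i, X i * (- ∑ k, C (Q.curvR i j k l) * X k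
        + ((Q.dx i (Q.fedForm j l) + (vert (Q.conn i) (Q.fedForm j l)
            - vert (Q.fedForm j) (Q.conn i l)))
          - (Q.dx j (Q.fedForm i l) + (vert (Q.conn j) (Q.fedForm i l)
            - vert (Q.fedForm i) (Q.conn j l))))
        + (vert (Q.fedForm i) (Q.fedForm j l) - vert (Q.fedForm j) (Q.fedForm i l))) =
      eul (Q.fedForm j l) + Q.fedForm j l := by
  classical
  simp only [fedForm_flat, mul_sub, sum_sub_distrib, sum_X_mul_pderiv]
  have h := congrArg (pderiv R j) (Q.sum_X_mul_fedForm l)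
  simp only [map_sum, Derivation.leibniz, smul_eq_mul, map_zero, sum_add_distrib,
    pderiv_X, Pi.single_apply] at h
  simp only [mul_ite, mul_one, mul_zero, sum_ite_eq', mem_univ, if_true] at h
  linear_combination -h

/-! ### Flat sections -/

lemma sum_X_mul_flatDer (s : Pw) : ∑ j, X j * Q.flatDer j s = Q.yop s - eul s := by
  simp only [flatDer_eq, mul_add, mul_sub, sum_add_distrib, sum_sub_distrib,
    sum_X_mul_pderiv, ← yop_apply, ← vert_sum_mul, sum_X_mul_fedForm]
  simp [vert_apply]

lemma flatDer_X (i j : Fin d) : Q.flatDer i (X j) = Q.flatField i j := by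
  rw [flatDer_apply, mapDer_X, vert_X, zero_add]

lemma flatDer_tau (i : Fin d) (g : R) : Q.flatDer i (Q.tau g) = 0 := by
  have key : ∀ i, eul (Q.flatDer i (Q.tau g)) = Q.yop (Q.flatDer i (Q.tau g)) +
      ∑ j, Q.flatField i j * Q.flatDer j (Q.tau g) := fun i => by
    have h1 := Q.sum_X_mul_flatDer (Q.flatDer i (Q.tau g))
    have h2 := congrArg (Q.flatDer i) (Q.sum_X_mul_flatDer (Q.tau g))
    rw [eul_tau, sub_self, map_zero, map_sum] at h2
    simp only [Derivation.leibniz, smul_eq_mul, sum_add_distrib, flatDer_X] at h2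
    simp only [Q.flatDer_comm _ i] at h1
    rw [h1] at h2
    simp only [mul_comm (Q.flatField i _)]
    linear_combination -h2
  suffices H : ∀ n, ∀ m < n, ∀ i, hom m (Q.flatDer i (Q.tau g)) = 0 by
    refine ext_hom fun n => ?_
    rw [map_zero]
    exact H (n + 1) n (by omega) i
  intro n
  induction n with
  | zero => intro m hm; omega
  | succ n ih =>
    intro m hm i
    rcases Nat.lt_succ_iff_lt_or_eq.mp hm with hm | rfl
    · exact ih m hm i
    have hy : hom m (Q.yop (Q.flatDer i (Q.tau g))) = 0 := by
      cases m with
      | zero => exact Q.hom_zero_yop _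
      | succ m => rw [hom_succ_yop, ih m (by omega), map_zero]
    have hF : ∀ j, Q.flatField i j = (Q.fedForm i j + Q.conn i j) -
        Pi.single (M := fun _ => Pw) i 1 j := fun j => by rw [fedForm]; ring
    have hB : hom m (∑ j, Q.flatField i j * Q.flatDer j (Q.tau g)) =
        - hom m (Q.flatDer i (Q.tau g)) := by
      rw [map_sum]
      have h1 : ∀ j, hom m (Q.flatField i j * Q.flatDer j (Q.tau g)) =
          - hom m (Pi.single (M := fun _ => Pw) i 1 j * Q.flatDer j (Q.tau g)) := fun j => by
        rw [hF, sub_mul, map_sub, hom_mul_eq_zero_of_lt, zero_sub]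
        · rw [map_add, constantCoeff_fedForm]
          simp [conn]
        · intro m' hm'
          exact ih m' hm' j
      simp only [h1, sum_neg_distrib]
      rw [sum_eq_single i]
      · simp
      · intro j _ hj
        simp [hj]
      · simp
    have h := congrArg (hom m) (key i)
    rw [hom_eul, map_add, hy, hB, zero_add] at h
    have h3 : ((m + 1 : ℕ) : ℝ) • hom m (Q.flatDer i (Q.tau g)) = 0 := by
      rw [Nat.cast_smul_eq_nsmul, succ_nsmul, h, neg_add_cancel]
    exact (smul_eq_zero.mp h3).resolve_left (by positivity)

lemma eq_tau_of_flat {s : Pw} (h : ∀ i, Q.flatDer i s = 0) : s = Q.tau (constantCoeff s) := by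
  apply Q.eq_tau
  have h1 := Q.sum_X_mul_flatDer s
  simp only [h, mul_zero, Finset.sum_const_zero] at h1
  linear_combination h1

/-- The vertical fields dual to the differentials of the expansions of the coordinates. -/
def nrm (k : Fin d) : Derivation ℝ Pw Pw := vert fun j => Q.jacInv j k

lemma nrm_phi (k l : Fin d) : Q.nrm k (Q.phi l) = if l = k then 1 else 0 := by
  rw [nrm, vert_phi, ← Matrix.one_apply, ← jac_mul_jacInv]
  rfl

lemma flatDer_nrm (i k : Fin d) (s : Pw) : Q.flatDer i (Q.nrm k s) = Q.nrm k (Q.flatDer i s) := by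
  have key : ∀ s : Pw, Q.flatDer i (Q.nrm k s) - Q.nrm k (Q.flatDer i s) =
      vert (fun j => Q.dx i (Q.jacInv j k) + (vert (Q.flatField i) (Q.jacInv j k) -
        vert (fun j => Q.jacInv j k) (Q.flatField i j))) s := fun s => by
    rw [vert_add, ← vert_commutator]
    have h1 := mapDer_vert (Q.der i) (fun j => Q.jacInv j k) s
    simp only [flatDer_apply, nrm, map_add]
    linear_combination h1
  rw [← sub_eq_zero, key]
  rw [Q.vert_eq_zero (V := fun j => Q.dx i (Q.jacInv j k) + (vert (Q.flatField i) (Q.jacInv j k) -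
        vert (fun j => Q.jacInv j k) (Q.flatField i j)))]
  · simp [vert_apply]
  · intro l
    rw [← key, flatDer_phi, map_zero, nrm_phi]
    split_ifs <;> simp

lemma nrm_tau (k : Fin d) (g : R) : Q.nrm k (Q.tau g) = Q.tau (Q.der k g) := by
  rw [Q.eq_tau_of_flat (s := Q.nrm k (Q.tau g))]
  · congr 1
    rw [nrm, vert_apply, map_sum]
    simp [constantCoeff_jacInv, constantCoeff_pderiv, coeff_single_tau]
  · intro i
    rw [flatDer_nrm, flatDer_tau, map_zero]

/-- The chain rule for expansions. -/
lemma pderiv_tau (j : Fin d) (g : R) : pderiv R j (Q.tau g) =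
    ∑ k, Q.tau (Q.der k g) * Q.jac k j := by
  simp only [← nrm_tau, nrm, vert_apply, sum_mul]
  rw [sum_comm]
  have h : ∀ i, ∑ k, Q.jacInv i k * pderiv R i (Q.tau g) * Q.jac k j =
      (if i = j then 1 else 0) * pderiv R i (Q.tau g) := fun i => by
    rw [← Matrix.one_apply, ← jacInv_mul_jac, Matrix.mul_apply, sum_mul]
    exact sum_congr rfl fun k _ => by ring
  simp [h]

end ConnRing

end ConnRing

/-! ## The ring of smooth functions on an open set of `ℝ^d` -/

section SmoothRing

open TopologicalSpace (Opens)

variable {d : ℕ}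

/-- Extension by zero of a function on an open set. -/
def extZero (U : Opens (Vec d)) (f : U → ℝ) (q : Vec d) : ℝ :=
  open Classical in if h : q ∈ U then f ⟨q, h⟩ else 0

lemma extZero_of_mem {U : Opens (Vec d)} (f : U → ℝ) {q : Vec d} (h : q ∈ U) :
    extZero U f q = f ⟨q, h⟩ := by
  simp [extZero, h]

/-- The algebra of smooth functions on an open set. -/
def smoothRing (U : Opens (Vec d)) : Subalgebra ℝ (U → ℝ) where
  carrier := {f | ContDiffOn ℝ ∞ (extZero U f) U}
  mul_mem' {f g} hf hg := (ContDiffOn.mul hf hg).congr fun q hq => by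
    simp [extZero_of_mem _ (show q ∈ U from hq)]
  add_mem' {f g} hf hg := (ContDiffOn.add hf hg).congr fun q hq => by
    simp [extZero_of_mem _ (show q ∈ U from hq)]
  algebraMap_mem' r := (contDiffOn_const (c := r)).congr fun q hq => by
    simp [extZero_of_mem _ (show q ∈ U from hq)]

variable {U : Opens (Vec d)}

/-- A smooth function on `U`, extended by zero. -/
def smoothFn (f : smoothRing U) : Vec d → ℝ := extZero U f

lemma contDiffOn_smoothFn (f : smoothRing U) : ContDiffOn ℝ ∞ (smoothFn f) U := f.2

/-- The element of the ring given by a function which is smooth on `U`. -/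
def smoothMk (g : Vec d → ℝ) (hg : ContDiffOn ℝ ∞ g U) : smoothRing U :=
  ⟨fun q => g q, hg.congr fun q hq => extZero_of_mem _ (show q ∈ U from hq)⟩

/-- Evaluation at a point. -/
def evalAt (q : U) : smoothRing U →ₐ[ℝ] ℝ :=
  (Pi.evalAlgHom ℝ (fun _ : U => ℝ) q).comp (smoothRing U).val

@[simp] lemma evalAt_mk (q : U) (g : Vec d → ℝ) (hg : ContDiffOn ℝ ∞ g U) :
    evalAt q (smoothMk g hg) = g q := rfl

lemma smoothFn_eq (f : smoothRing U) (q : U) : (smoothFn f) q = evalAt q f := extZero_of_mem _ q.2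

lemma smoothRing.ext_evalAt {f g : smoothRing U} (h : ∀ q, evalAt q f = evalAt q g) : f = g :=
  Subtype.ext (funext h)

lemma eventually_mem (q : U) : ∀ᶠ p in 𝓝 (q : Vec d), p ∈ U := U.isOpen.mem_nhds q.2

lemma pd_congr {f g : Vec d → ℝ} {q : Vec d} (h : f =ᶠ[𝓝 q] g) (i : Fin d) :
    pd i f q = pd i g q := by
  rw [pd, pd, h.fderiv_eq]

lemma pd_congr_on {f g : Vec d → ℝ} (q : U) (h : ∀ p : U, f p = g p) (i : Fin d) :
    pd i f q = pd i g q :=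
  pd_congr ((eventually_mem q).mono fun p hp => h ⟨p, hp⟩) i

lemma contDiffOn_pd {f : Vec d → ℝ} (hf : ContDiffOn ℝ ∞ f U) (i : Fin d) :
    ContDiffOn ℝ ∞ (pd i f) U := by
  have h := hf.fderiv_of_isOpen U.isOpen (m := ∞) (by simp)
  exact h.clm_apply contDiffOn_const

lemma differentiableAt_of_contDiffOn {f : Vec d → ℝ} (hf : ContDiffOn ℝ ∞ f U) (q : U) :
    DifferentiableAt ℝ f q :=
  (hf.contDiffAt (U.isOpen.mem_nhds q.2)).differentiableAt (by simp)

/-- The partial derivative as a derivation of the ring of smooth functions. -/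
def partialDer (U : Opens (Vec d)) (i : Fin d) : Derivation ℝ (smoothRing U) (smoothRing U) :=
  Derivation.mk'
    { toFun := fun f => smoothMk (pd i (smoothFn f)) (contDiffOn_pd (contDiffOn_smoothFn f) i)
      map_add' := fun f g => by
        refine smoothRing.ext_evalAt fun q => ?_
        rw [map_add, evalAt_mk, evalAt_mk, evalAt_mk]
        rw [pd_congr_on q (g := smoothFn f + smoothFn g) (fun p => by simp [smoothFn_eq]), pd,
          fderiv_add (differentiableAt_of_contDiffOn (contDiffOn_smoothFn f) q)
            (differentiableAt_of_contDiffOn (contDiffOn_smoothFn g) q)]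
        rfl
      map_smul' := fun r f => by
        refine smoothRing.ext_evalAt fun q => ?_
        rw [RingHom.id_apply, map_smul, evalAt_mk, evalAt_mk]
        rw [pd_congr_on q (g := r • (smoothFn f)) (fun p => by simp [smoothFn_eq]), pd,
          fderiv_const_smul (differentiableAt_of_contDiffOn (contDiffOn_smoothFn f) q)]
        rfl }
    (fun f g => by
      refine smoothRing.ext_evalAt fun q => ?_
      simp only [LinearMap.coe_mk, AddHom.coe_mk, smul_eq_mul]
      rw [map_add, map_mul, map_mul, evalAt_mk, evalAt_mk, evalAt_mk]
      rw [pd_congr_on q (g := smoothFn f * smoothFn g) (fun p => by simp [smoothFn_eq]), pd,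
        fderiv_mul (differentiableAt_of_contDiffOn (contDiffOn_smoothFn f) q)
          (differentiableAt_of_contDiffOn (contDiffOn_smoothFn g) q)]
      simp [pd, smoothFn_eq])

lemma evalAt_partialDer (i : Fin d) (f : smoothRing U) (q : U) :
    evalAt q (partialDer U i f) = pd i (smoothFn f) q := rfl

lemma evalAt_partialDer_of_eq (i : Fin d) (f : smoothRing U) (g : Vec d → ℝ)
    (h : ∀ p : U, evalAt p f = g p) (q : U) : evalAt q (partialDer U i f) = pd i g q := by
  rw [evalAt_partialDer]
  exact pd_congr_on q (fun p => by rw [smoothFn_eq, h]) i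

lemma two_le_infty : (2 : ℕ∞ω) ≤ ∞ := WithTop.coe_le_coe.2 (le_top (a := (2 : ℕ∞)))

lemma pd_comm {f : Vec d → ℝ} (hf : ContDiffOn ℝ ∞ f U) (i j : Fin d) (q : U) :
    pd i (pd j f) q = pd j (pd i f) q := by
  have hc : ContDiffAt ℝ ∞ f q := hf.contDiffAt (U.isOpen.mem_nhds q.2)
  have hs := (hc.isSymmSndFDerivAt (by simpa using two_le_infty)).eq (basisVec i) (basisVec j)
  have hd : DifferentiableAt ℝ (fderiv ℝ f) q :=
    (hc.fderiv_right (m := 1) (by norm_num; exact two_le_infty)).differentiableAt (by simp)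
  have key : ∀ i j : Fin d, pd i (pd j f) q = fderiv ℝ (fderiv ℝ f) q (basisVec i) (basisVec j) := by
    intro i j
    change fderiv ℝ (fun p => fderiv ℝ f p (basisVec j)) q (basisVec i) = _
    rw [fderiv_clm_apply hd (differentiableAt_const _)]
    simp
  rw [key, key, hs]

/-- Smooth symmetric Christoffel symbols on an open set. -/
structure LocalConn (d : ℕ) where
  dom : Opens (Vec d)
  Γ : Christoffel d
  smooth : ∀ i j k, ContDiffOn ℝ ∞ (fun q => Γ q i j k) dom
  symm : ∀ q ∈ dom, ∀ i j k, Γ q i j k = Γ q j i k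

/-- The differential ring of smooth functions on the domain of Christoffel symbols. -/
def LocalConn.ring (c : LocalConn d) : ConnRing d (smoothRing c.dom) where
  der := partialDer c.dom
  der_comm i j f := smoothRing.ext_evalAt fun q => by
    rw [evalAt_partialDer_of_eq i _ (pd j (smoothFn f)) (fun _ => rfl),
      evalAt_partialDer_of_eq j _ (pd i (smoothFn f)) (fun _ => rfl), pd_comm (contDiffOn_smoothFn f)]
  coord k := smoothMk (fun q => q k) (by fun_prop)
  der_coord i k := smoothRing.ext_evalAt fun q => by
    rw [evalAt_partialDer_of_eq i _ (fun q => q k) (fun _ => rfl), pd]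
    have : fderiv ℝ (fun q : Vec d => q k) q = EuclideanSpace.proj k :=
      (EuclideanSpace.proj (𝕜 := ℝ) k).fderiv
    rw [this]
    by_cases h : i = k
    · subst h; simp [basisVec]
    · simp [basisVec, h, Ne.symm h]
  Gam i j k := smoothMk (fun q => c.Γ q i j k) (c.smooth i j k)
  Gam_symm i j k := smoothRing.ext_evalAt fun q => c.symm q q.2 i j k

end SmoothRing

/-! ## Evaluation of families of formal series at a point -/

section Evaluation

open TopologicalSpace (Opens)

variable {d : ℕ} {U : Opens (Vec d)}

/-- The value at a point of a formal series with smooth coefficients. -/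
def evalSeries (q : U) : Series d (smoothRing U) →+* FPS d :=
  MvPowerSeries.map (evalAt q : smoothRing U →+* ℝ)

lemma coeff_evalSeries (q : U) (s : Series d (smoothRing U)) (α : Fin d →₀ ℕ) :
    coeff α (evalSeries q s) = evalAt q (coeff α s) := rfl

lemma ext_evalSeries {s t : Series d (smoothRing U)}
    (h : ∀ q, evalSeries q s = evalSeries q t) : s = t := by
  ext1 α
  exact smoothRing.ext_evalAt fun q => congrArg (coeff α) (h q)

lemma evalSeries_pderiv (q : U) (k : Fin d) (s : Series d (smoothRing U)) :
    evalSeries q (pderiv _ k s) = pderiv ℝ k (evalSeries q s) := by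
  ext α
  rw [coeff_evalSeries, coeff_pderiv, coeff_pderiv, coeff_evalSeries]
  simp

@[simp] lemma evalSeries_C (q : U) (f : smoothRing U) : evalSeries q (C f) = C (evalAt q f) :=
  MvPowerSeries.map_C _ _

@[simp] lemma evalSeries_X (q : U) (i : Fin d) : evalSeries q (X i) = X i := MvPowerSeries.map_X _ _

lemma evalSeries_vert (q : U) (V : Fin d → Series d (smoothRing U)) (s : Series d (smoothRing U)) :
    evalSeries q (vert V s) = applyField (fun k => evalSeries q (V k)) (evalSeries q s) := by
  rw [vert_apply, applyField, map_sum]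
  simp only [map_mul, evalSeries_pderiv]

lemma hom_evalSeries (n : ℕ) (q : U) (s : Series d (smoothRing U)) :
    hom n (evalSeries q s) = evalSeries q (hom n s) := by
  ext α
  rw [coeff_hom, coeff_evalSeries, coeff_evalSeries, coeff_hom]
  split_ifs <;> simp

/-- A family of formal series with smooth coefficients. -/
def SmoothSeriesOn (U : Opens (Vec d)) (S : Vec d → FPS d) : Prop :=
  ∀ α, ContDiffOn ℝ ∞ (fun q => coeff α (S q)) U

/-- The formal series with smooth coefficients defined by a family. -/
def liftSeries (S : Vec d → FPS d) (hS : SmoothSeriesOn U S) : Series d (smoothRing U) :=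
  fun α => smoothMk (fun q => coeff α (S q)) (hS α)

lemma xDeriv_eq (i : Fin d) {S : Vec d → FPS d} {s : Series d (smoothRing U)}
    (h : ∀ q : U, evalSeries q s = S q) (q : U) :
    xDeriv i S q = evalSeries q (mapDer (partialDer U i) s) := by
  ext α
  rw [coeff_evalSeries, coeff_mapDer]
  rw [evalAt_partialDer_of_eq i _ (fun q => coeff α (S q))]
  · rfl
  · intro p
    rw [← h, coeff_evalSeries]

variable (c : LocalConn d)

lemma evalSeries_conn (q : c.dom) (i k : Fin d) :
    evalSeries q (c.ring.conn i k) = connField c.Γ q i k := by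
  rw [ConnRing.conn, connField, map_neg, map_sum]
  simp only [map_mul, evalSeries_C, evalSeries_X]
  rfl

lemma evalAt_curvR (q : c.dom) (i j k l : Fin d) :
    evalAt q (c.ring.curvR i j k l) = curv c.Γ q i j k l := by
  rw [ConnRing.curvR, curv, map_add, map_sub, map_sum]
  congr 1
  congr 1
  · exact evalAt_partialDer_of_eq _ _ _ (fun _ => rfl) q
  · exact evalAt_partialDer_of_eq _ _ _ (fun _ => rfl) q

lemma lieField_eq (q : c.dom) {V W : Fin d → Series d (smoothRing c.dom)}
    {V' W' : FVF d} (hV : ∀ k, evalSeries q (V k) = V' k) (hW : ∀ k, evalSeries q (W k) = W' k)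
    (l : Fin d) : lieField V' W' l = evalSeries q (vert V (W l) - vert W (V l)) := by
  obtain rfl : (fun k => evalSeries q (V k)) = V' := funext hV
  obtain rfl : (fun k => evalSeries q (W k)) = W' := funext hW
  rw [lieField, map_sub, evalSeries_vert, evalSeries_vert]

lemma hom_applyField_congr {V V' : FVF d} {s s' : FPS d} (n : ℕ)
    (hV0 : ∀ k, hom 0 (V k) = 0) (hV0' : ∀ k, hom 0 (V' k) = 0)
    (hV : ∀ k, ∀ m ≤ n, hom m (V k) = hom m (V' k)) (hs : ∀ m ≤ n, hom m s = hom m s') :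
    hom n (applyField V s) = hom n (applyField V' s') := by
  simp only [applyField, map_sum, hom_mul]
  refine sum_congr rfl fun k _ => sum_congr rfl ?_
  rintro ⟨a, b⟩ hab
  rw [Finset.HasAntidiagonal.mem_antidiagonal] at hab
  simp only at hab
  rcases Nat.eq_zero_or_pos a with rfl | ha
  · rw [hV0, hV0']; simp
  · rw [hV k a (by omega), hom_pderiv, hom_pderiv, hs (b + 1) (by omega)]

lemma coeff_eq_of_hom_eq {R : Type*} [CommRing R] {s t : Series d R}
    {α : Fin d →₀ ℕ} (h : hom α.degree s = hom α.degree t) :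
    coeff α s = coeff α t := by
  simpa [coeff_hom] using congrArg (coeff α) h

lemma hom_eq_of_coeff_eq {R : Type*} [CommRing R] {s t : Series d R}
    {n : ℕ} (h : ∀ α : Fin d →₀ ℕ, α.degree = n →
      coeff α s = coeff α t) : hom n s = hom n t := by
  ext α
  rw [coeff_hom, coeff_hom]
  split_ifs with hα
  · exact h α hα
  · rfl

lemma hom_xDeriv_congr {S T : Vec d → FPS d} (i : Fin d) (n : ℕ) (q : U)
    (h : ∀ p : U, hom n (S p) = hom n (T p)) : hom n (xDeriv i S q) = hom n (xDeriv i T q) := by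
  refine hom_eq_of_coeff_eq fun α hα => ?_
  subst hα
  exact pd_congr_on q (fun p => coeff_eq_of_hom_eq (h p)) i

lemma hom_zero_connField (Γ : Christoffel d) (q : Vec d) (i k : Fin d) :
    hom 0 (connField Γ q i k) = 0 := by
  rw [hom_zero_eq]; simp [connField]

/-- The right hand side of the Fedosov recursion, before `δ⁻¹`. -/
def fedosovRHS (Γ : Christoffel d) (A : VFForm d) (q : Vec d) (j l : Fin d) : FPS d := ∑ i, X i *
    (curvField Γ q i j l + covExt Γ A q i j l + lieField (A q i) (A q j) l)

lemma coeff_fedosovStep (Γ : Christoffel d) (A : VFForm d) (q : Vec d) (j l : Fin d)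
    (α : Fin d →₀ ℕ) : coeff α (fedosovStep Γ A q j l) =
      ((α.degree : ℝ) + 1)⁻¹ * coeff α (fedosovRHS Γ A q j l) := rfl

lemma hom_zero_fedosovRHS (Γ : Christoffel d) (A : VFForm d) (q : Vec d) (j l : Fin d) :
    hom 0 (fedosovRHS Γ A q j l) = 0 := by
  simp [fedosovRHS, hom_zero_X_mul]

lemma hom_fedosovRHS_congr (Γ : Christoffel d) (A A' : VFForm d) (n : ℕ)
    (h0 : ∀ (q : U) i k, hom 0 (A q i k) = 0) (h0' : ∀ (q : U) i k, hom 0 (A' q i k) = 0)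
    (h : ∀ (q : U) i k, ∀ m ≤ n, hom m (A q i k) = hom m (A' q i k)) (q : U) (j l : Fin d) :
    hom (n + 1) (fedosovRHS Γ A q j l) = hom (n + 1) (fedosovRHS Γ A' q j l) := by
  have hc := hom_zero_connField Γ q
  have hx : ∀ i j, hom n (xDeriv i (fun q' => A q' j l) q) =
      hom n (xDeriv i (fun q' => A' q' j l) q) := fun i j =>
    hom_xDeriv_congr i n q fun p => h p j l n le_rfl
  simp only [fedosovRHS, map_sum, hom_succ_X_mul, map_add, covExt, map_sub, lieField, hx]
  refine sum_congr rfl fun i _ => ?_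
  rw [hom_applyField_congr n (hc i) (hc i) (fun _ _ _ => rfl) (h q j l),
    hom_applyField_congr n (hc j) (hc j) (fun _ _ _ => rfl) (h q i l),
    hom_applyField_congr n (h0 q j) (h0' q j) (h q j) (fun _ _ => rfl),
    hom_applyField_congr n (h0 q i) (h0' q i) (h q i) (fun _ _ => rfl),
    hom_applyField_congr n (h0 q i) (h0' q i) (h q i) (h q j l),
    hom_applyField_congr n (h0 q j) (h0' q j) (h q j) (h q i l)]

lemma fedosovRHS_fedForm (q : c.dom) (A : VFForm d)
    (hA : ∀ (q : c.dom) i k, A q i k = evalSeries q (c.ring.fedForm i k)) (j l : Fin d) :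
    fedosovRHS c.Γ A q j l =
      evalSeries q (ConnRing.eul (c.ring.fedForm j l) + c.ring.fedForm j l) := by
  rw [← ConnRing.fedForm_recursion, fedosovRHS, map_sum]
  refine sum_congr rfl fun i _ => ?_
  rw [map_mul, evalSeries_X, map_add, map_add]
  congr 1
  congr 1
  · congr 1
    · rw [curvField, map_neg, map_sum]
      simp only [map_mul, evalSeries_C, evalSeries_X, evalAt_curvR]
    · rw [covExt, map_sub, map_add, map_add, ← lieField_eq c q (V' := connField c.Γ q i) (W' := A q j),
        ← lieField_eq c q (V' := connField c.Γ q j) (W' := A q i)]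
      · congr 1
        · congr 1
          exact xDeriv_eq i (fun p => (hA p j l).symm) q
        · congr 1
          exact xDeriv_eq j (fun p => (hA p i l).symm) q
      all_goals intro k
      all_goals first | exact evalSeries_conn c q _ k | exact (hA q _ k).symm
  · exact lieField_eq c q (fun k => (hA q i k).symm) (fun k => (hA q j k).symm) l

lemma hom_fedosovStep (Γ : Christoffel d) (A : VFForm d) (q : Vec d) (j l : Fin d) (n : ℕ) :
    hom n (fedosovStep Γ A q j l) = ((n : ℝ) + 1)⁻¹ • hom n (fedosovRHS Γ A q j l) := by
  ext α
  rw [coeff_hom, map_smul, coeff_hom, coeff_fedosovStep, smul_eq_mul]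
  split_ifs with h
  · rw [h]
  · simp

/-- The Fedosov form is the form of the flat connection annihilating the expansions. -/
theorem fedosovForm_eq (q : c.dom) (i k : Fin d) :
    fedosovForm c.Γ q i k = evalSeries q (c.ring.fedForm i k) := by
  let A' : VFForm d := fun q i k =>
    open Classical in if h : q ∈ c.dom then evalSeries ⟨q, h⟩ (c.ring.fedForm i k) else 0
  have hA' : ∀ (q : c.dom) i k, A' q i k = evalSeries q (c.ring.fedForm i k) := fun q i k => by
    simp [A']
  have h0' : ∀ (q : c.dom) i k, hom 0 (A' q i k) = 0 := fun q i k => by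
    rw [hA', hom_evalSeries, hom_zero_eq, ConnRing.constantCoeff_fedForm]
    simp
  have h0 : ∀ n (q : c.dom) i k, hom 0 ((fedosovStep c.Γ)^[n] 0 q i k) = 0 := fun n q i k => by
    cases n with
    | zero => simp
    | succ n => rw [Function.iterate_succ_apply', hom_fedosovStep, hom_zero_fedosovRHS, smul_zero]
  have key : ∀ n, ∀ m ≤ n, ∀ (q : c.dom) i k,
      hom m ((fedosovStep c.Γ)^[n] 0 q i k) = hom m (A' q i k) := by
    intro n
    induction n with
    | zero =>
      intro m hm q i k
      obtain rfl : m = 0 := by omega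
      rw [h0, h0']
    | succ n ih =>
      intro m hm q i k
      cases m with
      | zero => rw [h0, h0']
      | succ m =>
        rw [Function.iterate_succ_apply', hom_fedosovStep,
          hom_fedosovRHS_congr (U := c.dom) c.Γ _ A' m (h0 n) h0'
            (fun q i k m' hm' => ih m' (by omega) q i k),
          fedosovRHS_fedForm c q A' hA', hom_evalSeries, map_add, ConnRing.hom_eul, hA',
          hom_evalSeries, ← succ_nsmul, map_nsmul, ← Nat.cast_smul_eq_nsmul ℝ, smul_smul]
        push_cast
        rw [inv_mul_cancel₀ (by positivity), one_smul]
  ext α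
  rw [← hA']
  change coeff α ((fedosovStep c.Γ)^[α.degree] 0 q i k) = _
  exact coeff_eq_of_hom_eq (key α.degree α.degree le_rfl q i k)

end Evaluation

/-! ## Fiberwise polydifferential operators -/

section FiberOperators

variable {d m : ℕ} {B : Type*} [CommRing B]

/-- Iterated formal partial derivatives. -/
def pdList (B : Type*) [CommRing B] : List (Fin d) → Series d B →ₗ[B] Series d B
  | [] => LinearMap.id
  | i :: L => (pderiv B i).toLinearMap ∘ₗ pdList B L

@[simp] lemma pdList_nil (s : Series d B) : pdList B [] s = s := rfl

@[simp] lemma pdList_cons (i : Fin d) (L : List (Fin d)) (s : Series d B) :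
    pdList B (i :: L) s = pderiv B i (pdList B L s) := rfl

lemma iterPderiv_eq {n : ℕ} (J : Fin n → Fin d) (s : FPS d) :
    iterPderiv J s = pdList ℝ (List.ofFn J) s := by
  rw [iterPderiv]
  induction List.ofFn J with
  | nil => rfl
  | cons i L ih => rw [List.foldr_cons, ih, pdList_cons]

lemma hom_pdList (L : List (Fin d)) (n : ℕ) (s : Series d B) :
    hom n (pdList B L s) = pdList B L (hom (n + L.length) s) := by
  induction L generalizing n with
  | nil => rfl
  | cons i L ih =>
    rw [pdList_cons, pdList_cons, hom_pderiv, ih, List.length_cons, add_right_comm, add_assoc]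

/-- The list of indices of a block. -/
def blockList {a : Fin m → ℕ} (J : Blocks a → Fin d) (l : Fin m) : List (Fin d) :=
  List.ofFn fun j => J ⟨l, j⟩

@[simp] lemma length_blockList {a : Fin m → ℕ} (J : Blocks a → Fin d) (l : Fin m) :
    (blockList J l).length = a l := by simp [blockList]

/-- The fiberwise polydifferential operator with components `c a J`, for orders `a ∈ A`. -/
def dop (A : Finset (Fin m → ℕ)) (c : Coeffs m d (Series d B)) :
    MultilinearMap B (fun _ : Fin m => Series d B) (Series d B) :=
  ∑ a ∈ A, ∑ J : Blocks a → Fin d, c a J •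
    (MultilinearMap.mkPiAlgebra B (Fin m) (Series d B)).compLinearMap
      fun l => pdList B (blockList J l)

lemma dop_apply (A : Finset (Fin m → ℕ)) (c : Coeffs m d (Series d B)) (s : Fin m → Series d B) :
    dop A c s = ∑ a ∈ A, ∑ J : Blocks a → Fin d, c a J * ∏ l, pdList B (blockList J l) (s l) := by
  simp [dop]

lemma dpolyOp_eq_dop (A : Finset (Fin m → ℕ))
    (c : Coeffs m d (FPS d)) (hc : ∀ a ∉ A, ∀ J, c a J = 0) :
    dpolyOp c = dop A c := by
  funext s
  rw [dop_apply, dpolyOp, finsum_eq_sum_of_support_subset (s := A)]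
  · simp only [iterPderiv_eq]
    rfl
  · intro a ha
    by_contra h
    exact ha (sum_eq_zero fun J _ => by rw [hc a h, zero_mul])

/-- The components of a fiberwise polyvector field, viewed as a polydifferential operator. -/
def firstOrder {d m : ℕ} {B : Type*} [Zero B] (c : (Fin m → Fin d) → B) (a : Fin m → ℕ)
    (J : Blocks a → Fin d) : B :=
  open Classical in if h : a = 1 then c fun l => J ⟨l, ⟨0, by simp [h]⟩⟩ else 0

lemma firstOrder_one {B : Type*} [Zero B] (c : (Fin m → Fin d) → B)
    (J : Blocks (1 : Fin m → ℕ) → Fin d) :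
    firstOrder c 1 J = c fun l => J ⟨l, ⟨0, by simp⟩⟩ := by
  simp [firstOrder]

lemma firstOrder_of_ne {B : Type*} [Zero B] (c : (Fin m → Fin d) → B) {a : Fin m → ℕ} (h : a ≠ 1)
    (J : Blocks a → Fin d) : firstOrder c a J = 0 := by
  simp [firstOrder, h]

/-- Blocks with one slot each. -/
def blocksOne (m : ℕ) : Fin m ≃ Blocks (1 : Fin m → ℕ) where
  toFun l := ⟨l, ⟨0, by simp⟩⟩
  invFun b := b.1
  left_inv _ := rfl
  right_inv b := by
    rcases b with ⟨l, ⟨j, hj⟩⟩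
    have : j = 0 := by simpa using hj
    subst this
    rfl

lemma tpolyOp_eq_dop (c : (Fin m → Fin d) → FPS d) : tpolyOp c = dop {1} (firstOrder c) := by
  funext s
  rw [dop_apply, tpolyOp, sum_singleton]
  refine Fintype.sum_equiv (Equiv.arrowCongr (blocksOne m) (Equiv.refl _)) _ _ fun J => ?_
  rw [firstOrder_one]
  rfl


/-- The Leibniz rule for finite products. -/
lemma derivation_prod {P : Type*} [CommRing P] [Algebra ℝ P] (D : Derivation ℝ P P)
    {ι : Type*} [DecidableEq ι] (t : Finset ι) (f : ι → P) :
    D (∏ i ∈ t, f i) = ∑ i ∈ t, ∏ j ∈ t, Function.update f i (D (f i)) j := by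
  induction t using induction_on with
  | empty => simp
  | insert a t ha ih =>
    rw [prod_insert ha, Derivation.leibniz, ih, sum_insert ha,
      prod_insert ha, Function.update_self, Finset.prod_update_of_notMem ha, smul_eq_mul,
      smul_eq_mul, mul_sum, add_comm, mul_comm (∏ i ∈ t, f i)]
    congr 1
    refine sum_congr rfl fun i hi => ?_
    rw [prod_insert ha, Function.update_of_ne]
    rintro rfl
    exact ha hi

lemma mapDer_pdList [Algebra ℝ B] (D : Derivation ℝ B B) (L : List (Fin d)) (s : Series d B) :
    mapDer D (pdList B L s) = pdList B L (mapDer D s) := by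
  induction L with
  | nil => rfl
  | cons i L ih => rw [pdList_cons, pdList_cons, mapDer_pderiv, ih]

lemma mapDer_dop [Algebra ℝ B] (D : Derivation ℝ B B) (A : Finset (Fin m → ℕ))
    (c : Coeffs m d (Series d B))
    (s : Fin m → Series d B) :
    mapDer D (dop A c s) = dop A (fun a J => mapDer D (c a J)) s +
      ∑ l, dop A c (Function.update s l (mapDer D (s l))) := by
  simp only [dop_apply, map_sum, Derivation.leibniz, smul_eq_mul, sum_add_distrib]
  rw [add_comm]
  congr 1
  · simp only [mul_comm]
  · rw [sum_comm]
    refine sum_congr rfl fun a _ => ?_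
    rw [sum_comm]
    refine sum_congr rfl fun J _ => ?_
    rw [derivation_prod, mul_sum]
    refine sum_congr rfl fun l _ => ?_
    congr 1
    refine prod_congr rfl fun l' _ => ?_
    rw [mapDer_pdList]
    exact (Function.apply_update (fun l' => pdList B (blockList J l')) s l _ l').symm

/-! ### Continuity for the degree filtration -/

/-- Equality in degrees less than `n`. -/
def AgreeTo (n : ℕ) (s t : Series d B) : Prop := ∀ j < n, hom j s = hom j t

lemma AgreeTo.refl (n : ℕ) (s : Series d B) : AgreeTo n s s := fun _ _ => rfl

lemma AgreeTo.mono {n n' : ℕ} {s t : Series d B} (h : AgreeTo n s t) (hn : n' ≤ n) :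
    AgreeTo n' s t := fun j hj => h j (by omega)

lemma AgreeTo.add {n : ℕ} {s t s' t' : Series d B} (h : AgreeTo n s t)
    (h' : AgreeTo n s' t') : AgreeTo n (s + s') (t + t') := fun j hj => by
  rw [map_add, map_add, h j hj, h' j hj]

lemma AgreeTo.sub {n : ℕ} {s t s' t' : Series d B} (h : AgreeTo n s t)
    (h' : AgreeTo n s' t') : AgreeTo n (s - s') (t - t') := fun j hj => by
  rw [map_sub, map_sub, h j hj, h' j hj]

lemma AgreeTo.sum {ι : Type*} {n : ℕ} (u : Finset ι) {s t : ι → Series d B}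
    (h : ∀ i ∈ u, AgreeTo n (s i) (t i)) : AgreeTo n (∑ i ∈ u, s i) (∑ i ∈ u, t i) :=
  fun j hj => by
    rw [map_sum, map_sum]
    exact sum_congr rfl fun i hi => h i hi j hj

lemma AgreeTo.mul {n : ℕ} {s t s' t' : Series d B} (h : AgreeTo n s t)
    (h' : AgreeTo n s' t') : AgreeTo n (s * s') (t * t') := fun j hj => by
  rw [hom_mul, hom_mul]
  refine sum_congr rfl ?_
  rintro ⟨a, b⟩ hab
  rw [Finset.HasAntidiagonal.mem_antidiagonal] at hab
  simp only at hab
  rw [h a (by omega), h' b (by omega)]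

lemma AgreeTo.prod {ι : Type*} {n : ℕ} (u : Finset ι) {s t : ι → Series d B}
    (h : ∀ i ∈ u, AgreeTo n (s i) (t i)) : AgreeTo n (∏ i ∈ u, s i) (∏ i ∈ u, t i) := by
  classical
  induction u using induction_on with
  | empty => exact AgreeTo.refl _ _
  | insert a u ha ih =>
    rw [prod_insert ha, prod_insert ha]
    exact (h a (mem_insert_self _ _)).mul (ih fun i hi => h i (mem_insert_of_mem hi))

lemma AgreeTo.pdList {n : ℕ} {s t : Series d B} (L : List (Fin d))
    (h : AgreeTo (n + L.length) s t) : AgreeTo n (pdList B L s) (pdList B L t) := fun j hj => by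
  rw [hom_pdList, hom_pdList, h _ (by omega)]

lemma eq_of_agreeTo {s t : Series d B} (h : ∀ n, AgreeTo n s t) : s = t :=
  ext_hom fun n => h (n + 1) n (by omega)

lemma AgreeTo.applyField {n : ℕ} (V : FVF d) {s t : FPS d} (h : AgreeTo (n + 1) s t) :
    AgreeTo n (applyField V s) (applyField V t) :=
  AgreeTo.sum _ fun k _ => (AgreeTo.refl n (V k)).mul (AgreeTo.pdList (n := n) (L := [k]) h)

/-- Continuity for the degree filtration, with a loss of `K` degrees. -/
def FiltContinuous (K : ℕ) (Φ : (Fin m → Series d B) → Series d B) : Prop :=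
  ∀ n s t, (∀ l, AgreeTo (n + K) (s l) (t l)) → AgreeTo n (Φ s) (Φ t)

/-- A bound for the orders of the operators with orders in `A`. -/
def orderBound (A : Finset (Fin m → ℕ)) : ℕ := A.sup fun a => ∑ l, a l

lemma filtContinuous_dop (A : Finset (Fin m → ℕ)) (c : Coeffs m d (Series d B)) :
    FiltContinuous (orderBound A) (dop A c) := by
  intro n s t h
  rw [dop_apply, dop_apply]
  refine AgreeTo.sum _ fun a ha => AgreeTo.sum _ fun J _ => (AgreeTo.refl _ _).mul
    (AgreeTo.prod _ fun l _ => AgreeTo.pdList _ ((h l).mono ?_))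
  rw [length_blockList]
  have h1 : a l ≤ ∑ l, a l := Finset.single_le_sum (fun _ _ => Nat.zero_le _) (mem_univ l)
  have h2 : ∑ l, a l ≤ orderBound A := Finset.le_sup (f := fun a : Fin m → ℕ => ∑ l, a l) ha
  omega

lemma FiltContinuous.fiberBracket {K : ℕ} {Φ : (Fin m → FPS d) → FPS d} (h : FiltContinuous K Φ)
    (V : FVF d) : FiltContinuous (K + 1) (fiberBracket V Φ) := by
  intro n s t hst
  refine AgreeTo.sub (AgreeTo.applyField V (h (n + 1) s t fun l => (hst l).mono (by omega)))
    (AgreeTo.sum _ fun a _ => h n _ _ fun l => ?_)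
  by_cases hl : l = a
  · subst hl
    rw [Function.update_self, Function.update_self]
    exact AgreeTo.applyField V ((hst l).mono (by omega))
  · rw [Function.update_of_ne hl, Function.update_of_ne hl]
    exact (hst l).mono (by omega)

lemma FiltContinuous.mono {K K' : ℕ} {Φ : (Fin m → Series d B) → Series d B}
    (h : FiltContinuous K Φ) (hK : K ≤ K') : FiltContinuous K' Φ :=
  fun n s t hst => h n s t fun l => (hst l).mono (by omega)

lemma FiltContinuous.fedosovD {K : ℕ} {Φ dΦ : (Fin m → FPS d) → FPS d} (h : FiltContinuous K Φ)
    (h' : FiltContinuous K dΦ) (Γ : Christoffel d) (q : Vec d) (i : Fin d) :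
    FiltContinuous (K + 1) (fedosovD Γ q i dΦ Φ) := fun n s t hst =>
  ((((h'.mono (Nat.le_succ K)) n s t hst).add (h.fiberBracket _ n s t hst)).sub
    (h.fiberBracket _ n s t hst)).add (h.fiberBracket _ n s t hst)

/-! ### Density of polynomials -/

lemma lowest_mul {a b : ℕ} {s t : Series d B} (hs : ∀ j < a, hom j s = 0)
    (ht : ∀ j < b, hom j t = 0) :
    (∀ j < a + b, hom j (s * t) = 0) ∧ hom (a + b) (s * t) = hom a s * hom b t := by
  constructor
  · intro j hj
    rw [hom_mul]
    refine sum_eq_zero ?_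
    rintro ⟨x, y⟩ hxy
    rw [Finset.HasAntidiagonal.mem_antidiagonal] at hxy
    simp only at hxy
    rcases lt_or_ge x a with hx | hx
    · rw [hs x hx, zero_mul]
    · rw [ht y (by omega), mul_zero]
  · rw [hom_mul, sum_eq_single (a, b)]
    · rintro ⟨x, y⟩ hxy hne
      rw [Finset.HasAntidiagonal.mem_antidiagonal] at hxy
      simp only at hxy
      rcases lt_or_ge x a with hx | hx
      · rw [hs x hx, zero_mul]
      · rw [ht y, mul_zero]
        by_contra hy
        apply hne
        ext <;> simp <;> omega
    · intro h
      simp at h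

lemma lowest_aeval_monomial {ψ : Fin d → FPS d} (h0 : ∀ k, hom 0 (ψ k) = 0)
    (h1 : ∀ k, hom 1 (ψ k) = X k) (α : Fin d →₀ ℕ) :
    (∀ j < α.degree, hom j (MvPolynomial.aeval ψ (MvPolynomial.monomial α (1 : ℝ))) = 0) ∧
      hom α.degree (MvPolynomial.aeval ψ (MvPolynomial.monomial α (1 : ℝ))) =
        MvPowerSeries.monomial α 1 := by
  induction α using Finsupp.induction_linear with
  | zero =>
    refine ⟨fun j hj => by simp at hj, ?_⟩
    rw [MvPolynomial.monomial_zero', map_one, map_one, map_zero, hom_zero_eq, map_one, map_one]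
    rfl
  | add f g hf hg =>
    have h := lowest_mul hf.1 hg.1
    rw [← map_mul, MvPolynomial.monomial_mul, one_mul, hf.2, hg.2,
      MvPowerSeries.monomial_mul_monomial, one_mul, ← map_add] at h
    exact h
  | single k n =>
    rw [Finsupp.degree_single]
    induction n with
    | zero =>
      refine ⟨fun j hj => by simp at hj, ?_⟩
      rw [Finsupp.single_zero, MvPolynomial.monomial_zero', map_one, map_one, hom_zero_eq, map_one,
        map_one]
      rfl
    | succ n ih =>
      have h := lowest_mul (b := 1) (t := ψ k) ih.1 fun j hj => by
        obtain rfl : j = 0 := by omega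
        exact h0 k
      rw [ih.2, h1, X, MvPowerSeries.monomial_mul_monomial, one_mul, ← Finsupp.single_add] at h
      have h2 : MvPolynomial.aeval ψ (MvPolynomial.monomial (Finsupp.single k (n + 1)) (1 : ℝ)) =
          MvPolynomial.aeval ψ (MvPolynomial.monomial (Finsupp.single k n) (1 : ℝ)) * ψ k := by
        rw [← MvPolynomial.aeval_X (R := ℝ) ψ k, ← map_mul, MvPolynomial.X,
          MvPolynomial.monomial_mul, one_mul, ← Finsupp.single_add]
      rw [h2]
      exact h

lemma exists_polynomial_agreeTo {ψ : Fin d → FPS d} (h0 : ∀ k, hom 0 (ψ k) = 0)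
    (h1 : ∀ k, hom 1 (ψ k) = X k) (t : FPS d) (n : ℕ) :
    ∃ p : MvPolynomial (Fin d) ℝ, AgreeTo n (MvPolynomial.aeval ψ p) t := by
  induction n with
  | zero => exact ⟨0, fun j hj => absurd hj (by omega)⟩
  | succ n ih =>
    obtain ⟨p, hp⟩ := ih
    let r := t - MvPolynomial.aeval ψ p
    let F : Finset (Fin d →₀ ℕ) := (Finsupp.finite_of_degree_eq (σ := Fin d) n).toFinset
    refine ⟨p + ∑ α ∈ F, MvPolynomial.C (coeff α r) * MvPolynomial.monomial α 1, fun j hj => ?_⟩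
    have hF : ∀ α ∈ F, α.degree = n := fun α hα => by simpa [F] using hα
    have hsum : ∀ j, hom j (MvPolynomial.aeval ψ (∑ α ∈ F, MvPolynomial.C (coeff α r) *
      MvPolynomial.monomial α 1)) = ∑ α ∈ F, C (coeff α r) *
        hom j (MvPolynomial.aeval ψ (MvPolynomial.monomial α (1 : ℝ))) := fun j => by
      rw [map_sum, map_sum]
      refine sum_congr rfl fun α _ => ?_
      rw [map_mul, MvPolynomial.aeval_C, ← hom_C_mul]
      rfl
    rw [map_add, map_add, hsum]
    rcases Nat.lt_succ_iff_lt_or_eq.mp hj with hj | rfl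
    · rw [hp j hj, sum_eq_zero, add_zero]
      intro α hα
      rw [(lowest_aeval_monomial h0 h1 α).1 j (by rw [hF α hα]; exact hj), mul_zero]
    · have : hom j t = hom j (MvPolynomial.aeval ψ p) + hom j r := by
        rw [← map_add]; congr 1; simp [r]
      rw [this]
      congr 1
      ext β
      rw [map_sum, coeff_hom]
      have h3 : ∀ α ∈ F, coeff β (C (coeff α r) *
          hom j (MvPolynomial.aeval ψ (MvPolynomial.monomial α (1 : ℝ)))) =
          if β = α then coeff β r else 0 := fun α hα => by
        have h4 := (lowest_aeval_monomial h0 h1 α).2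
        rw [hF α hα] at h4
        rw [h4, coeff_C_mul, MvPowerSeries.coeff_monomial]
        split_ifs with h
        · rw [h, mul_one]
        · rw [mul_zero]
      rw [sum_congr rfl h3, sum_ite_eq]
      simp [F]

end FiberOperators

/-! ## Horizontality and flat values -/

section Horizontal

open TopologicalSpace (Opens)

variable {d m : ℕ} {U : Opens (Vec d)}

lemma evalSeries_pdList (q : U) (L : List (Fin d)) (s : Series d (smoothRing U)) :
    evalSeries q (pdList _ L s) = pdList ℝ L (evalSeries q s) := by
  induction L with
  | nil => rfl
  | cons i L ih => rw [pdList_cons, pdList_cons, evalSeries_pderiv, ih]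

lemma evalSeries_dop (q : U) (A : Finset (Fin m → ℕ)) (c : Coeffs m d (Series d (smoothRing U)))
    (s : Fin m → Series d (smoothRing U)) :
    evalSeries q (dop A c s) =
      dop A (fun a J => evalSeries q (c a J)) fun l => evalSeries q (s l) := by
  simp only [dop_apply, map_sum, map_mul, map_prod, evalSeries_pdList]

variable (c : LocalConn d)

/-- The Taylor expansion at a point. -/
def tauAt (q : c.dom) : smoothRing c.dom →ₐ[ℝ] FPS d :=
  (MvPowerSeries.mapAlgHom (evalAt q)).comp c.ring.tauHom

lemma tauAt_apply (q : c.dom) (g : smoothRing c.dom) :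
    tauAt c q g = evalSeries q (c.ring.tau g) := rfl

/-- Polynomials have arbitrary Taylor expansions up to any given degree. -/
lemma exists_tauAt_agreeTo (q : c.dom) (t : FPS d) (n : ℕ) : ∃ g, AgreeTo n (tauAt c q g) t := by
  let ψ : Fin d → FPS d := fun k => tauAt c q (c.ring.coord k - algebraMap ℝ _ ((q : Vec d) k))
  have h0 : ∀ k, hom 0 (ψ k) = 0 := fun k => by
    simp only [ψ, tauAt_apply]
    rw [hom_evalSeries, hom_zero_eq, ConnRing.constantCoeff_tau, evalSeries_C, map_sub]
    have : evalAt q (c.ring.coord k) = (q : Vec d) k := rfl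
    rw [this, AlgHom.commutes]
    simp
  have h1 : ∀ k, hom 1 (ψ k) = X k := fun k => by
    classical
    ext α
    rw [coeff_hom, coeff_X]
    split_ifs with h h' h'
    · subst h'
      simp only [ψ, tauAt_apply, coeff_evalSeries, ConnRing.coeff_single_tau, map_sub,
        ConnRing.der_coord]
      simp
    · obtain ⟨i, rfl⟩ : ∃ i, α = Finsupp.single i 1 := by
        have hne : α ≠ 0 := by rintro rfl; simp at h
        obtain ⟨i, hi⟩ := Finsupp.ne_iff.mp hne
        refine ⟨i, ?_⟩
        have h2 : Finsupp.single i 1 ≤ α := by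
          rw [Finsupp.single_le_iff]
          exact Nat.one_le_iff_ne_zero.mpr hi
        obtain ⟨β, rfl⟩ := exists_add_of_le h2
        rw [map_add, Finsupp.degree_single] at h
        have h3 : β = 0 := by
          rw [← Finsupp.degree_eq_zero_iff]; omega
        rw [h3, add_zero]
      simp only [ψ, tauAt_apply, coeff_evalSeries, ConnRing.coeff_single_tau, map_sub,
        ConnRing.der_coord]
      rw [if_neg]
      · simp
      · rintro rfl; exact h' rfl
    · exact absurd (by rw [h']; simp) h
    · rfl
  obtain ⟨p, hp⟩ := exists_polynomial_agreeTo h0 h1 t n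
  exact ⟨MvPolynomial.aeval (fun k => c.ring.coord k - algebraMap ℝ _ ((q : Vec d) k)) p, by
    rwa [MvPolynomial.comp_aeval_apply]⟩

/-- The vertical part of the flat connection at a point. -/
def flatAt (q : c.dom) (i k : Fin d) : FPS d := evalSeries q (c.ring.flatField i k)

lemma flatAt_eq (q : c.dom) (i : Fin d) : flatAt c q i =
    fun k => connField c.Γ q i k - Pi.single (M := fun _ => FPS d) i 1 k + fedosovForm c.Γ q i k := by
  funext k
  rw [flatAt, fedosovForm_eq, ConnRing.fedForm, ← evalSeries_conn, map_sub, map_add]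
  have : evalSeries q (Pi.single (M := fun _ => Series d (smoothRing c.dom)) i 1 k) =
      Pi.single (M := fun _ => FPS d) i 1 k := by
    rw [Pi.single_apply, Pi.single_apply]
    split_ifs <;> simp
  rw [this]
  ring

lemma applyField_add (V W : FVF d) (s : FPS d) :
    applyField (fun k => V k + W k) s = applyField V s + applyField W s := by
  simp [applyField, add_mul, sum_add_distrib]

lemma applyField_sub (V W : FVF d) (s : FPS d) :
    applyField (fun k => V k - W k) s = applyField V s - applyField W s := by
  simp [applyField, sub_mul, sum_sub_distrib]

lemma fiberBracket_add (V W : FVF d)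
    (Φ : MultilinearMap ℝ (fun _ : Fin m => FPS d) (FPS d)) (s : Fin m → FPS d) :
    fiberBracket (fun k => V k + W k) Φ s = fiberBracket V Φ s + fiberBracket W Φ s := by
  simp only [fiberBracket, applyField_add, MultilinearMap.map_update_add, sum_add_distrib]
  ring

lemma fiberBracket_sub (V W : FVF d)
    (Φ : MultilinearMap ℝ (fun _ : Fin m => FPS d) (FPS d)) (s : Fin m → FPS d) :
    fiberBracket (fun k => V k - W k) Φ s = fiberBracket V Φ s - fiberBracket W Φ s := by
  simp only [fiberBracket, applyField_sub, MultilinearMap.map_update_sub, sum_sub_distrib]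
  ring

lemma fedosovD_eq (q : c.dom) (i : Fin d) (dΦ : (Fin m → FPS d) → FPS d)
    (Φ : MultilinearMap ℝ (fun _ : Fin m => FPS d) (FPS d)) (s : Fin m → FPS d) :
    fedosovD c.Γ q i dΦ Φ s = dΦ s + fiberBracket (flatAt c q i) Φ s := by
  rw [flatAt_eq, fiberBracket_add, fiberBracket_sub, fedosovD]
  ring

variable (A : Finset (Fin m → ℕ)) (C : Coeffs m d (Series d (smoothRing c.dom)))

/-- The operator `D_F Φ` at a point. -/
def fedosovAt (q : c.dom) (i : Fin d) : (Fin m → FPS d) → FPS d :=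
  fedosovD c.Γ q i (dop A fun a J => evalSeries q (c.ring.dx i (C a J)))
    (dop A fun a J => evalSeries q (C a J))

lemma evalSeries_flatDer (q : c.dom) (i : Fin d) (s : Series d (smoothRing c.dom)) :
    evalSeries q (c.ring.flatDer i s) =
      evalSeries q (c.ring.dx i s) + applyField (flatAt c q i) (evalSeries q s) := by
  rw [ConnRing.flatDer_apply, map_add, evalSeries_vert]
  rfl

lemma evalSeries_flatDer_dop (q : c.dom) (i : Fin d) (s : Fin m → Series d (smoothRing c.dom)) :
    evalSeries q (c.ring.flatDer i (dop A C s)) =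
      fedosovAt c A C q i (fun l => evalSeries q (s l)) +
        ∑ l, dop A (fun a J => evalSeries q (C a J)) (Function.update (fun l => evalSeries q (s l)) l
          (evalSeries q (c.ring.flatDer i (s l)))) := by
  have h1 : ∀ (l : Fin m) (x : Series d (smoothRing c.dom)),
      (fun l' => evalSeries q (Function.update s l x l')) =
      Function.update (fun l => evalSeries q (s l)) l (evalSeries q x) := fun l x => by
    funext l'
    exact Function.apply_update (fun _ => evalSeries q) s l x l'
  rw [evalSeries_flatDer, mapDer_dop, map_add, map_sum, fedosovAt, fedosovD_eq, fiberBracket]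
  simp only [evalSeries_dop, h1, evalSeries_flatDer, MultilinearMap.map_update_add, sum_add_distrib]
  ring

/-- A section is horizontal if and only if its values on expansions are flat. -/
theorem fedosovAt_eq_zero_iff : (∀ q i, fedosovAt c A C q i = 0) ↔
      ∀ (g : Fin m → smoothRing c.dom) i, c.ring.flatDer i (dop A C fun l => c.ring.tau (g l)) = 0 := by
  have key : ∀ q i (g : Fin m → smoothRing c.dom),
      evalSeries q (c.ring.flatDer i (dop A C fun l => c.ring.tau (g l))) =
        fedosovAt c A C q i (fun l => tauAt c q (g l)) := fun q i g => by
    rw [evalSeries_flatDer_dop]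
    simp only [ConnRing.flatDer_tau, map_zero, MultilinearMap.map_update_zero,
      Finset.sum_const_zero, add_zero]
    rfl
  constructor
  · intro h g i
    refine ext_evalSeries fun q => ?_
    rw [key, h, map_zero]
    rfl
  · intro h q i
    have hc := FiltContinuous.fedosovD (filtContinuous_dop A fun a J => evalSeries q (C a J))
      (filtContinuous_dop A fun a J => evalSeries q (c.ring.dx i (C a J))) c.Γ q i
    funext t
    refine eq_of_agreeTo fun n => ?_
    choose g hg using fun l => exists_tauAt_agreeTo c q (t l) (n + (orderBound A + 1))
    have h1 := hc n _ _ hg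
    have h2 := key q i g
    rw [h, map_zero] at h2
    intro j hj
    exact (h1 j hj).symm.trans (congrArg (hom j) h2.symm)

end Horizontal

set_option linter.unusedSectionVars false

section Charts

variable {d : ℕ} {M : Type u} [TopologicalSpace M] [ChartedSpace (Vec d) M]
  [IsManifold (𝓡 d) ∞ M] {e e' : OpenPartialHomeomorph M (Vec d)}

open VectorField

theorem IsChart.contMDiffAt (he : IsChart e) {p : M} (hp : p ∈ e.source) :
    ContMDiffAt (𝓡 d) (𝓡 d) ∞ e p := contMDiffAt_of_mem_maximalAtlas he hp

theorem IsChart.contMDiffAt_symm (he : IsChart e) {q : Vec d} (hq : q ∈ e.target) :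
    ContMDiffAt (𝓡 d) (𝓡 d) ∞ e.symm q := contMDiffAt_symm_of_mem_maximalAtlas he hq

theorem IsChart.mdifferentiableAt (he : IsChart e) {p : M} (hp : p ∈ e.source) :
    MDifferentiableAt (𝓡 d) (𝓡 d) e p :=
  (he.contMDiffAt hp).mdifferentiableAt (by simp)

theorem IsChart.mdifferentiableAt_symm (he : IsChart e) {q : Vec d} (hq : q ∈ e.target) :
    MDifferentiableAt (𝓡 d) (𝓡 d) e.symm q :=
  (he.contMDiffAt_symm hq).mdifferentiableAt (by simp)

theorem IsChart.mfderiv_comp_symm (he : IsChart e) {q : Vec d} (hq : q ∈ e.target) (v : Vec d) :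
    mfderiv (𝓡 d) (𝓡 d) e (e.symm q) (mfderiv (𝓡 d) (𝓡 d) e.symm q v) = v := by
  have h1 : (e ∘ e.symm) =ᶠ[𝓝 q] id :=
    Filter.eventuallyEq_of_mem (e.open_target.mem_nhds hq) fun z hz => e.right_inv hz
  have h2 := mfderiv_comp q (he.mdifferentiableAt (e.map_target hq)) (he.mdifferentiableAt_symm hq)
  rw [h1.mfderiv_eq, mfderiv_id] at h2
  exact (DFunLike.congr_fun h2 v).symm

theorem IsChart.mfderiv_symm_comp (he : IsChart e) {p : M} (hp : p ∈ e.source)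
    (v : TangentSpace (𝓡 d) p) :
    mfderiv (𝓡 d) (𝓡 d) e.symm (e p) (mfderiv (𝓡 d) (𝓡 d) e p v) = (v : Vec d) := by
  have h1 : (e.symm ∘ e) =ᶠ[𝓝 p] id :=
    Filter.eventuallyEq_of_mem (e.open_source.mem_nhds hp) fun z hz => e.left_inv hz
  have h2 := mfderiv_comp p (he.mdifferentiableAt_symm (e.map_source hp)) (he.mdifferentiableAt hp)
  rw [h1.mfderiv_eq, mfderiv_id] at h2
  exact (DFunLike.congr_fun h2 v).symm

/-- The differential of a chart, as a map with values in the endomorphisms of the model space. -/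
def chartDeriv (e : OpenPartialHomeomorph M (Vec d)) (p : M) : Vec d →L[ℝ] Vec d :=
  mfderiv (𝓡 d) (𝓡 d) e p

/-- The differential of the inverse of a chart. -/
def chartSymmDeriv (e : OpenPartialHomeomorph M (Vec d)) (q : Vec d) : Vec d →L[ℝ] Vec d :=
  mfderiv (𝓡 d) (𝓡 d) e.symm q

theorem IsChart.chartDeriv_symmDeriv (he : IsChart e) {p : M} (hp : p ∈ e.source) (v : Vec d) :
    chartDeriv e p (chartSymmDeriv e (e p) v) = v := by
  have h : chartDeriv e (e.symm (e p)) (chartSymmDeriv e (e p) v) = v :=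
    he.mfderiv_comp_symm (e.map_source hp) v
  rwa [e.left_inv hp] at h

theorem IsChart.chartSymmDeriv_chartDeriv (he : IsChart e) {p : M} (hp : p ∈ e.source)
    (v : Vec d) : chartSymmDeriv e (e p) (chartDeriv e p v) = v :=
  he.mfderiv_symm_comp hp v

theorem IsChart.inverse_chartDeriv (he : IsChart e) {p : M} (hp : p ∈ e.source) :
    (chartDeriv e p).inverse = chartSymmDeriv e (e p) :=
  ContinuousLinearMap.inverse_eq (by ext1 v; exact he.chartDeriv_symmDeriv hp v)
    (by ext1 v; exact he.chartSymmDeriv_chartDeriv hp v)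

theorem IsChart.inverse_chartSymmDeriv (he : IsChart e) {q : Vec d} (hq : q ∈ e.target) :
    (chartSymmDeriv e q).inverse = chartDeriv e (e.symm q) := by
  have h1 : ∀ v, chartSymmDeriv e (e (e.symm q)) (chartDeriv e (e.symm q) v) = v :=
    he.chartSymmDeriv_chartDeriv (e.map_target hq)
  have h2 := he.chartDeriv_symmDeriv (e.map_target hq)
  rw [e.right_inv hq] at h1 h2
  exact ContinuousLinearMap.inverse_eq (by ext1 v; exact h1 v) (by ext1 v; exact h2 v)

theorem IsChart.chartDeriv_isInvertible (he : IsChart e) {p : M} (hp : p ∈ e.source) :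
    (chartDeriv e p).IsInvertible :=
  ContinuousLinearMap.IsInvertible.of_inverse (g := chartSymmDeriv e (e p))
    (by ext1 v; exact he.chartDeriv_symmDeriv hp v)
    (by ext1 v; exact he.chartSymmDeriv_chartDeriv hp v)

theorem IsChart.chartSymmDeriv_isInvertible (he : IsChart e) {q : Vec d} (hq : q ∈ e.target) :
    (chartSymmDeriv e q).IsInvertible := by
  have h := he.chartDeriv_isInvertible (e.map_target hq)
  have h2 := he.inverse_chartDeriv (e.map_target hq)
  rw [e.right_inv hq] at h2
  rw [← h2]
  exact h.inverse

theorem coordVec_eq (i : Fin d) (q : Vec d) :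
    coordVec e i q = chartSymmDeriv e q (basisVec i) := rfl

theorem IsChart.coordCovec_apply (he : IsChart e) (k : Fin d) {q : Vec d} (hq : q ∈ e.target)
    (v : TangentSpace (𝓡 d) (e.symm q)) :
    coordCovec e k q v = (chartDeriv e (e.symm q) v : Vec d) k := by
  have h1 := (he.mdifferentiableAt (e.map_target hq)).hasMFDerivAt
  have h2 := (((EuclideanSpace.proj k : Vec d →L[ℝ] ℝ).hasFDerivAt
    (x := e (e.symm q))).hasMFDerivAt).comp (e.symm q) h1
  exact DFunLike.congr_fun h2.mfderiv v

theorem vec_eq_sum (v : Vec d) : v = ∑ i, v i • basisVec i := by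
  ext k
  simp [basisVec, Finset.sum_apply, Pi.single_apply]

theorem coordField_eq (i : Fin d) (p : M) :
    coordField e i p = chartSymmDeriv e (e p) (basisVec i) := rfl

theorem coordField_symm (i : Fin d) {q : Vec d} (hq : q ∈ e.target) :
    coordField e i (e.symm q) = coordVec e i q := by
  rw [coordField_eq, coordVec_eq, e.right_inv hq]

theorem IsChart.coordField_eq_mpullback (he : IsChart e) (i : Fin d) {p : M} (hp : p ∈ e.source) :
    coordField e i p = mpullback (𝓡 d) (𝓡 d) e (fun _ => (basisVec i : Vec d)) p := by
  have := he.inverse_chartDeriv hp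
  rw [coordField_eq, ← this]
  rfl

theorem contMDiffAt_constField (v q : Vec d) {n : ℕ∞ω} : ContMDiffAt (𝓡 d) (𝓡 d).tangent n
      (fun z => (Bundle.TotalSpace.mk' (Vec d) z v : TangentBundle (𝓡 d) (Vec d))) q :=
  contMDiffAt_vectorSpace_iff_contDiffAt.2 contDiffAt_const

theorem IsChart.contMDiffAt_coordField (he : IsChart e) (i : Fin d) {p : M} (hp : p ∈ e.source) :
    ContMDiffAt (𝓡 d) (𝓡 d).tangent ∞
      (fun x => (Bundle.TotalSpace.mk' (Vec d) x (coordField e i x) : TangentBundle (𝓡 d) M))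
      p := by
  have h := ContMDiffAt.mpullback_vectorField_preimage (m := ∞) (n := ∞)
    (contMDiffAt_constField (basisVec i) (e p)) (he.contMDiffAt hp)
    (he.chartDeriv_isInvertible hp) (by simp)
  refine h.congr_of_eventuallyEq ?_
  filter_upwards [e.open_source.mem_nhds hp] with x hx
  rw [he.coordField_eq_mpullback i hx]

theorem IsChart.mdifferentiableAt_coordField (he : IsChart e) (i : Fin d) {p : M}
    (hp : p ∈ e.source) :
    MDifferentiableAt (𝓡 d) (𝓡 d).tangent
      (fun x => (Bundle.TotalSpace.mk' (Vec d) x (coordField e i x) : TangentBundle (𝓡 d) M)) p :=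
  (he.contMDiffAt_coordField i hp).mdifferentiableAt (by simp)

end Charts

section ChristoffelSymbols

variable {d : ℕ} {M : Type u} [TopologicalSpace M] [ChartedSpace (Vec d) M]
  [IsManifold (𝓡 d) ∞ M] {e e' : OpenPartialHomeomorph M (Vec d)}

open VectorField

theorem IsChart.contDiffAt_of_contMDiffAt (he : IsChart e) {F : Type*} [NormedAddCommGroup F]
    [NormedSpace ℝ F] {g : M → F} {q : Vec d} (hq : q ∈ e.target)
    (hg : ContMDiffAt (𝓡 d) 𝓘(ℝ, F) ∞ g (e.symm q)) :
    ContDiffAt ℝ ∞ (fun z => g (e.symm z)) q :=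
  (hg.comp q (he.contMDiffAt_symm hq)).contDiffAt

theorem IsChart.contMDiffAt_of_contDiffAt (he : IsChart e) {F : Type*} [NormedAddCommGroup F]
    [NormedSpace ℝ F] {g : Vec d → F} {p : M} (hp : p ∈ e.source)
    (hg : ContDiffAt ℝ ∞ g (e p)) :
    ContMDiffAt (𝓡 d) 𝓘(ℝ, F) ∞ (fun z => g (e z)) p :=
  hg.contMDiffAt.comp p (he.contMDiffAt hp)

/-- The components of a smooth vector field in a chart are smooth. -/
theorem IsChart.contDiffAt_chartDeriv (he : IsChart e) {W : (p : M) → TangentSpace (𝓡 d) p}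
    {q : Vec d} (hq : q ∈ e.target)
    (hW : ContMDiffAt (𝓡 d) (𝓡 d).tangent ∞
      (fun x => (Bundle.TotalSpace.mk' (Vec d) x (W x) : TangentBundle (𝓡 d) M)) (e.symm q)) :
    ContDiffAt ℝ ∞ (fun z => chartDeriv e (e.symm z) (W (e.symm z))) q := by
  have h := ContMDiffAt.mpullback_vectorField_preimage (m := ∞) (n := ∞) hW
    (he.contMDiffAt_symm hq) (he.chartSymmDeriv_isInvertible hq) (by simp)
  have h2 := contMDiffAt_vectorSpace_iff_contDiffAt.1 h
  refine h2.congr_of_eventuallyEq ?_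
  filter_upwards [e.open_target.mem_nhds hq] with z hz
  rw [← he.inverse_chartSymmDeriv hz]
  rfl

theorem exists_bump [T2Space M] {p : M} {s : Set M} (hs : s ∈ 𝓝 p) :
    ∃ ρ : M → ℝ, ContMDiff (𝓡 d) 𝓘(ℝ, ℝ) ∞ ρ ∧ ρ =ᶠ[𝓝 p] 1 ∧ tsupport ρ ⊆ s := by
  obtain ⟨f, -, hf⟩ := (SmoothBumpFunction.nhds_basis_tsupport (I := 𝓡 d) p).mem_iff.1 hs
  exact ⟨f, f.contMDiff, f.eventuallyEq_one, hf⟩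

variable (nabla : Connection d M)

theorem connection_congr {σ σ' : (p : M) → TangentSpace (𝓡 d) p} {p : M}
    (hσ : MDifferentiableAt (𝓡 d) (𝓡 d).tangent
      (fun x => (Bundle.TotalSpace.mk' (Vec d) x (σ x) : TangentBundle (𝓡 d) M)) p)
    (hσ' : MDifferentiableAt (𝓡 d) (𝓡 d).tangent
      (fun x => (Bundle.TotalSpace.mk' (Vec d) x (σ' x) : TangentBundle (𝓡 d) M)) p)
    (h : ∀ᶠ x in 𝓝 p, σ x = σ' x) : nabla σ p = nabla σ' p :=
  (nabla.isCovariantDerivativeOn (s := Set.univ)).congr_of_eventuallyEq hσ hσ' Filter.univ_mem h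

theorem IsChart.contMDiffAt_connection [T2Space M] [nabla.ContMDiffCovariantDerivative ∞]
    (he : IsChart e) {p : M} (hp : p ∈ e.source) (i j : Fin d) :
    ContMDiffAt (𝓡 d) (𝓡 d).tangent ∞ (fun x => (Bundle.TotalSpace.mk' (Vec d) x
      (nabla (coordField e j) x (coordField e i x)) : TangentBundle (𝓡 d) M)) p := by
  obtain ⟨ρ, hρ, hρ1, hρs⟩ := exists_bump (d := d) (e.open_source.mem_nhds hp)
  have hσ : ContMDiff (𝓡 d) (𝓡 d).tangent (∞ + 1) (fun x => (Bundle.TotalSpace.mk' (Vec d) x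
      (ρ x • coordField e j x) : TangentBundle (𝓡 d) M)) := by
    intro x
    rw [show (∞ + 1 : ℕ∞ω) = ∞ from by simp]
    by_cases hx : x ∈ tsupport ρ
    · exact ContMDiffAt.smul_section (hρ x) (he.contMDiffAt_coordField j (hρs hx))
    · refine (Bundle.contMDiffAt_zeroSection ℝ (TangentSpace (𝓡 d) : M → Type _)
        (F := Vec d) (IB := 𝓡 d) (x := x)).congr_of_eventuallyEq ?_
      filter_upwards [notMem_tsupport_iff_eventuallyEq.1 hx] with y hy
      simp only [hy, Pi.zero_apply, zero_smul]
      rfl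
  have hn := (CovariantDerivative.ContMDiffCovariantDerivative.contMDiff
    (cov := nabla) (k := ∞)).contMDiff hσ.contMDiffOn p (Set.mem_univ p)
  have h1 := (hn.contMDiffAt Filter.univ_mem).clm_bundle_apply (he.contMDiffAt_coordField i hp)
  refine h1.congr_of_eventuallyEq ?_
  filter_upwards [e.open_source.mem_nhds hp, hρ1.eventuallyEq_nhds] with x hx hx1
  congr 2
  refine connection_congr nabla (he.mdifferentiableAt_coordField j hx)
    (((hσ x).of_le (by simp)).mdifferentiableAt (n := ∞) (by simp)) ?_
  filter_upwards [hx1] with y hy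
  rw [hy, Pi.one_apply, one_smul]

theorem IsChart.christoffel_eq (he : IsChart e) {q : Vec d} (hq : q ∈ e.target) (i j k : Fin d) :
    christoffel nabla e q i j k = (chartDeriv e (e.symm q)
        (nabla (coordField e j) (e.symm q) (coordField e i (e.symm q))) : Vec d) k := by
  rw [christoffel, he.coordCovec_apply k hq, coordField_symm i hq]

theorem IsChart.contDiffOn_christoffel [T2Space M] [nabla.ContMDiffCovariantDerivative ∞]
    (he : IsChart e) (i j k : Fin d) :
    ContDiffOn ℝ ∞ (fun q => christoffel nabla e q i j k) e.target := by
  intro q hq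
  have h := he.contDiffAt_chartDeriv hq (he.contMDiffAt_connection nabla (e.map_target hq) i j)
  have h2 := ((EuclideanSpace.proj k : Vec d →L[ℝ] ℝ).contDiff (n := ∞)).contDiffAt.comp q h
  refine (h2.congr_of_eventuallyEq ?_).contDiffWithinAt
  filter_upwards [e.open_target.mem_nhds hq] with z hz
  rw [he.christoffel_eq nabla hz]
  rfl

/-- The coordinate vector fields of a chart, as maps with values in the model space. -/
def chartFrame (e : OpenPartialHomeomorph M (Vec d)) (i : Fin d) (p : M) : Vec d :=
  chartSymmDeriv e (e p) (basisVec i)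

/-- The covariant derivative of a vector field, as an endomorphism of the model space. -/
def connLin (σ : (p : M) → TangentSpace (𝓡 d) p) (p : M) : Vec d →L[ℝ] Vec d := nabla σ p

theorem IsChart.eq_sum_chartFrame (he : IsChart e) {p : M} (hp : p ∈ e.source) (v : Vec d) :
    v = ∑ k, (chartDeriv e p v) k • chartFrame e k p := by
  conv_lhs => rw [← he.chartSymmDeriv_chartDeriv hp v, vec_eq_sum (chartDeriv e p v), map_sum]
  refine sum_congr rfl fun k _ => ?_
  rw [map_smul]
  rfl

theorem IsChart.connLin_chartFrame (he : IsChart e) {p : M} (hp : p ∈ e.source) (i j : Fin d) :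
    connLin nabla (coordField e j) p (chartFrame e i p) =
      ∑ k, christoffel nabla e (e p) i j k • chartFrame e k p := by
  rw [he.eq_sum_chartFrame hp (connLin nabla (coordField e j) p (chartFrame e i p))]
  refine sum_congr rfl fun k _ => ?_
  rw [he.christoffel_eq nabla (e.map_source hp), e.left_inv hp]
  rfl

theorem IsChart.mlieBracket_coordField (he : IsChart e) {p : M} (hp : p ∈ e.source) (i j : Fin d) :
    mlieBracket (𝓡 d) (coordField e i) (coordField e j) p = 0 := by
  have hev : ∀ i, coordField e i =ᶠ[𝓝 p]
      mpullback (𝓡 d) (𝓡 d) e (fun _ => (basisVec i : Vec d)) := fun i => by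
    filter_upwards [e.open_source.mem_nhds hp] with x hx
    exact he.coordField_eq_mpullback i hx
  have : IsManifold (𝓡 d) (minSmoothness ℝ 2) M :=
    IsManifold.of_le (n := ∞) (by simpa [minSmoothness_of_isRCLikeNormedField] using two_le_infty)
  rw [(hev i).mlieBracket_vectorField_eq (hev j), ← mpullback_mlieBracket (n := ∞)
      ((contMDiffAt_constField (basisVec i) (e p) (n := 1)).mdifferentiableAt (by simp))
      ((contMDiffAt_constField (basisVec j) (e p) (n := 1)).mdifferentiableAt (by simp))
      (he.contMDiffAt hp) (by simpa [minSmoothness_of_isRCLikeNormedField] using two_le_infty)]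
  have h0 : ∀ V W : Vec d → Vec d, (∀ x, HasFDerivAt V (0 : Vec d →L[ℝ] Vec d) x) →
      (∀ x, HasFDerivAt W (0 : Vec d →L[ℝ] Vec d) x) →
      ∀ x, lieBracketWithin ℝ V W Set.univ x = 0 := by
    intro V W hV hW x
    simp [lieBracketWithin, (hV x).fderiv, (hW x).fderiv]
  have h : ∀ V W : (x : Vec d) → TangentSpace (𝓡 d) x,
      (∀ x, HasFDerivAt V (0 : Vec d →L[ℝ] Vec d) x) →
      (∀ x, HasFDerivAt W (0 : Vec d →L[ℝ] Vec d) x) → ∀ x, mlieBracket (𝓡 d) V W x = 0 := by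
    intro V W hV hW x
    rw [← mlieBracketWithin_univ, mlieBracketWithin_eq_lieBracketWithin]
    exact h0 V W hV hW x
  rw [mpullback_apply, h _ _ (fun x => hasFDerivAt_const _ x) (fun x => hasFDerivAt_const _ x)]
  exact map_zero _

variable {nabla} in
theorem IsChart.christoffel_symm (htor : nabla.torsion = 0) (he : IsChart e) {q : Vec d}
    (hq : q ∈ e.target) (i j k : Fin d) :
    christoffel nabla e q i j k = christoffel nabla e q j i k := by
  have hp := e.map_target hq
  have h := (CovariantDerivative.torsion_eq_zero_iff nabla).1 htor
    (he.mdifferentiableAt_coordField i hp) (he.mdifferentiableAt_coordField j hp)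
  rw [he.mlieBracket_coordField hp, sub_eq_zero] at h
  rw [he.christoffel_eq nabla hq, he.christoffel_eq nabla hq, h]

variable {nabla} in
/-- The local connection defined in a chart by a smooth torsion-free linear connection. -/
def chartConn [T2Space M] [nabla.ContMDiffCovariantDerivative ∞] (htor : nabla.torsion = 0)
    (he : IsChart e) : LocalConn d where
  dom := ⟨e.target, e.open_target⟩
  Γ := christoffel nabla e
  smooth := he.contDiffOn_christoffel nabla
  symm := fun _ hq => he.christoffel_symm htor hq


/-- The components of the Jacobian matrix `∂x'^k/∂x^i` of a change of charts. -/
def chartJac (e e' : OpenPartialHomeomorph M (Vec d)) (i k : Fin d) (q : Vec d) : ℝ :=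
  pd i (fun z => e' (e.symm z) k) q

theorem IsChart.contDiffAt_transition (he : IsChart e) (he' : IsChart e') {q : Vec d}
    (hq : q ∈ e.target) (hq' : e.symm q ∈ e'.source) :
    ContDiffAt ℝ ∞ (fun z => e' (e.symm z)) q :=
  he.contDiffAt_of_contMDiffAt hq (he'.contMDiffAt hq')

theorem IsChart.contDiffAt_transition_apply (he : IsChart e) (he' : IsChart e') {q : Vec d}
    (hq : q ∈ e.target) (hq' : e.symm q ∈ e'.source) (k : Fin d) :
    ContDiffAt ℝ ∞ (fun z => e' (e.symm z) k) q :=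
  ((EuclideanSpace.proj k : Vec d →L[ℝ] ℝ).contDiff (n := ∞)).contDiffAt.comp q
    (he.contDiffAt_transition he' hq hq')

theorem contDiffAt_pd {g : Vec d → ℝ} {q : Vec d} (hg : ContDiffAt ℝ ∞ g q) (i : Fin d) :
    ContDiffAt ℝ ∞ (pd i g) q :=
  ((hg.fderiv_right (m := ∞) (by simp)).clm_apply (contDiffAt_const (c := (basisVec i : Vec d))))

theorem IsChart.contDiffAt_chartJac (he : IsChart e) (he' : IsChart e') {q : Vec d}
    (hq : q ∈ e.target) (hq' : e.symm q ∈ e'.source) (i k : Fin d) :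
    ContDiffAt ℝ ∞ (chartJac e e' i k) q :=
  contDiffAt_pd (he.contDiffAt_transition_apply he' hq hq' k) i

theorem IsChart.chartDeriv_coordVec (he : IsChart e) (he' : IsChart e') {q : Vec d}
    (hq : q ∈ e.target) (hq' : e.symm q ∈ e'.source) (i k : Fin d) :
    (chartDeriv e' (e.symm q) (chartSymmDeriv e q (basisVec i))) k = chartJac e e' i k q := by
  have h1 := ((he'.mdifferentiableAt hq').hasMFDerivAt).comp q
    (he.mdifferentiableAt_symm hq).hasMFDerivAt
  have h2 := (((EuclideanSpace.proj k : Vec d →L[ℝ] ℝ).hasFDerivAt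
    (x := e' (e.symm q))).hasMFDerivAt).comp q h1
  have h3 : mfderiv (𝓡 d) 𝓘(ℝ, ℝ) (fun z => e' (e.symm z) k) q =
    fderiv ℝ (fun z => e' (e.symm z) k) q := mfderiv_eq_fderiv
  rw [chartJac, pd, ← h3]
  exact (DFunLike.congr_fun h2.mfderiv (basisVec i)).symm

/-- The differential of the coordinate functions of the second chart along the coordinate vectors
of the first one. -/
theorem IsChart.chartDeriv_chartFrame (he : IsChart e) (he' : IsChart e') {p : M}
    (hp : p ∈ e.source) (hp' : p ∈ e'.source) (i k : Fin d) :
    chartDeriv e' p (chartFrame e i p) k = chartJac e e' i k (e p) := by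
  have h := he.chartDeriv_coordVec he' (e.map_source hp) (by rwa [e.left_inv hp]) i k
  rw [← h, e.left_inv hp]
  rfl

theorem IsChart.chartFrame_change (he : IsChart e) (he' : IsChart e') {p : M}
    (hp : p ∈ e.source) (hp' : p ∈ e'.source) (i : Fin d) :
    chartFrame e i p = ∑ r, chartJac e e' i r (e p) • chartFrame e' r p := by
  rw [he'.eq_sum_chartFrame hp' (chartFrame e i p)]
  simp only [he.chartDeriv_chartFrame he' hp hp']

theorem connection_sum {ι : Type*} (s : Finset ι) (σ : ι → (p : M) → TangentSpace (𝓡 d) p)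
    {p : M} (hσ : ∀ i ∈ s, MDifferentiableAt (𝓡 d) (𝓡 d).tangent
      (fun x => (Bundle.TotalSpace.mk' (Vec d) x (σ i x) : TangentBundle (𝓡 d) M)) p) :
    MDifferentiableAt (𝓡 d) (𝓡 d).tangent (fun x => (Bundle.TotalSpace.mk' (Vec d) x
      ((∑ i ∈ s, σ i) x) : TangentBundle (𝓡 d) M)) p ∧
    nabla (∑ i ∈ s, σ i) p = ∑ i ∈ s, nabla (σ i) p := by
  classical
  induction s using induction_on with
  | empty =>
    refine ⟨?_, ?_⟩
    · simp only [sum_empty]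
      exact (Bundle.contMDiffAt_zeroSection ℝ (TangentSpace (𝓡 d) : M → Type _) (n := 1)
        (F := Vec d) (IB := 𝓡 d) (x := p)).mdifferentiableAt (by simp)
    · simp [CovariantDerivative.zero nabla]
  | insert a s ha ih =>
    obtain ⟨h1, h2⟩ := ih fun i hi => hσ i (mem_insert_of_mem hi)
    have h3 := hσ a (mem_insert_self a s)
    rw [sum_insert ha, sum_insert ha, ← h2]
    exact ⟨mdifferentiableAt_add_section h3 h1, nabla.isCovariantDerivativeOnUniv.add h3 h1⟩

/-- The transformation law of the Christoffel symbols. -/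
theorem IsChart.christoffel_transform (he : IsChart e) (he' : IsChart e') {p : M}
    (hp : p ∈ e.source) (hp' : p ∈ e'.source) (i j k : Fin d) :
    ∑ l, christoffel nabla e (e p) i j l * chartJac e e' l k (e p) =
      (∑ r, ∑ s, christoffel nabla e' (e' p) r s k * chartJac e e' i r (e p) *
        chartJac e e' j s (e p)) + pd i (chartJac e e' j k) (e p) := by
  have hb : ∀ s, ContMDiffAt (𝓡 d) 𝓘(ℝ, ℝ) ∞ (fun x => chartJac e e' j s (e x)) p := fun s =>
    he.contMDiffAt_of_contDiffAt hp
      (he.contDiffAt_chartJac he' (e.map_source hp) (by rwa [e.left_inv hp]) j s)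
  have hbd : ∀ s, MDifferentiableAt (𝓡 d) 𝓘(ℝ, ℝ) (fun x => chartJac e e' j s (e x)) p :=
    fun s => (hb s).mdifferentiableAt (by simp)
  have hm : ∀ s, MDifferentiableAt (𝓡 d) (𝓡 d).tangent (fun x => (Bundle.TotalSpace.mk' (Vec d) x
        (((fun x => chartJac e e' j s (e x)) • coordField e' s) x) : TangentBundle (𝓡 d) M)) p :=
    fun s => MDifferentiableAt.smul_section (hbd s) (he'.mdifferentiableAt_coordField s hp')
  obtain ⟨h1, h2⟩ := connection_sum nabla univ
    (fun s => (fun x => chartJac e e' j s (e x)) • coordField e' s) fun s _ => hm s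
  have h3 := connection_congr nabla (he.mdifferentiableAt_coordField j hp) h1 (by
    filter_upwards [e.open_source.mem_nhds hp, e'.open_source.mem_nhds hp'] with x hx hx'
    rw [Finset.sum_apply]
    exact he.chartFrame_change he' hx hx' j)
  rw [h2] at h3
  have h4 : ∀ s, connLin nabla ((fun x => chartJac e e' j s (e x)) • coordField e' s) p
      (chartFrame e i p) = chartJac e e' j s (e p) • connLin nabla (coordField e' s) p
        (chartFrame e i p) + pd i (chartJac e e' j s) (e p) • chartFrame e' s p := by
    intro s
    have h5 := nabla.isCovariantDerivativeOnUniv.leibniz (he'.mdifferentiableAt_coordField s hp')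
      (hbd s)
    have h5' := DFunLike.congr_fun h5 (coordField e i p)
    refine h5'.trans ?_
    have h6 : mfderiv (𝓡 d) 𝓘(ℝ, ℝ) (fun x => chartJac e e' j s (e x)) p (coordField e i p) =
        pd i (chartJac e e' j s) (e p) := by
      have h7 := (((he.contDiffAt_chartJac he' (e.map_source hp) (by rwa [e.left_inv hp]) j
        s).differentiableAt (by simp)).hasFDerivAt.hasMFDerivAt).comp p
          (he.mdifferentiableAt hp).hasMFDerivAt
      refine (DFunLike.congr_fun h7.mfderiv (coordField e i p)).trans ?_
      have h8 := he.chartDeriv_symmDeriv hp (basisVec i)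
      exact congrArg (fderiv ℝ (chartJac e e' j s) (e p)) h8
    rw [← h6]
    rfl
  have h5 : connLin nabla (coordField e j) p (chartFrame e i p) = ∑ s,
      connLin nabla ((fun x => chartJac e e' j s (e x)) • coordField e' s) p
        (chartFrame e i p) := by
    have h5 := DFunLike.congr_fun h3 (coordField e i p)
    exact h5.trans (sum_apply _ _ _)
  have h8 : ∀ l, chartDeriv e' p (chartFrame e' l p) k = if l = k then 1 else 0 := by
    intro l
    rw [chartFrame, he'.chartDeriv_symmDeriv hp' (basisVec l)]
    simp [basisVec, eq_comm]
  have h7 := congrArg (fun v : Vec d => (chartDeriv e' p v) k) h5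
  simp only [h4, he.connLin_chartFrame nabla hp i j] at h7
  simp only [he.chartFrame_change he' hp hp' i, map_sum, map_add, map_smul, WithLp.ofLp_sum,
    Finset.sum_apply, PiLp.smul_apply, PiLp.add_apply, smul_eq_mul,
    he.chartDeriv_chartFrame he' hp hp', he'.connLin_chartFrame nabla hp', h8,
    sum_add_distrib, mul_ite, mul_one, mul_zero, sum_ite_eq', mem_univ,
    if_true] at h7
  rw [h7]
  congr 1
  simp only [mul_sum]
  rw [sum_comm]
  exact sum_congr rfl fun r _ => sum_congr rfl fun s _ => by ring

end ChristoffelSymbols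

section Geodesics

open TopologicalSpace (Opens)

variable {d : ℕ}

/-- Local existence of smooth integral curves of a smooth vector field. -/
theorem exists_smooth_integralCurve {E : Type*} [NormedAddCommGroup E] [NormedSpace ℝ E]
    [CompleteSpace E] {F : E → E} {U : Set E} (hU : IsOpen U) (hF : ContDiffOn ℝ ∞ F U) {x : E}
    (hx : x ∈ U) : ∃ α : ℝ → E, α 0 = x ∧
      ∀ᶠ t in 𝓝 (0 : ℝ), α t ∈ U ∧ ContDiffAt ℝ ∞ α t ∧ HasDerivAt α (F (α t)) t := by
  obtain ⟨α, h0, ε, hε, hα⟩ := ((hF.contDiffAt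
    (hU.mem_nhds hx)).of_le (m := 1) (by simp)).exists_forall_mem_closedBall_exists_eq_forall_mem_Ioo_hasDerivAt₀ 0
  refine ⟨α, h0, ?_⟩
  have hc : ContinuousOn α (Set.Ioo (0 - ε) (0 + ε)) := fun t ht =>
    (hα t ht).continuousAt.continuousWithinAt
  have hopen : IsOpen (Set.Ioo (0 - ε) (0 + ε) ∩ α ⁻¹' U) := hc.isOpen_inter_preimage isOpen_Ioo hU
  have hmaps : ∀ t ∈ Set.Ioo (0 - ε) (0 + ε) ∩ α ⁻¹' U, HasDerivAt α (F (α t)) t :=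
    fun t ht => hα t ht.1
  have hsm : ContDiffOn ℝ ∞ α (Set.Ioo (0 - ε) (0 + ε) ∩ α ⁻¹' U) := by
    rw [contDiffOn_infty]
    intro n
    induction n with
    | zero => exact contDiffOn_zero.2 (hc.mono Set.inter_subset_left)
    | succ n ih =>
      rw [Nat.cast_add, Nat.cast_one, contDiffOn_succ_iff_deriv_of_isOpen hopen]
      refine ⟨fun t ht => (hmaps t ht).differentiableAt.differentiableWithinAt,
        fun h => absurd h (by simp), ?_⟩
      exact ((hF.of_le (m := n) (by exact_mod_cast le_top)).comp ih fun t ht => ht.2).congr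
        fun t ht => (hmaps t ht).deriv
  have h0mem : (0 : ℝ) ∈ Set.Ioo (0 - ε) (0 + ε) ∩ α ⁻¹' U :=
    ⟨⟨by linarith, by linarith⟩, by rwa [Set.mem_preimage, h0]⟩
  filter_upwards [hopen.mem_nhds h0mem] with t ht
  exact ⟨ht.2, hsm.contDiffAt (hopen.mem_nhds ht), hmaps t ht⟩

/-- The equation of geodesics in coordinates, at the parameter `t`. -/
def GeodesicEq (Γ : Christoffel d) (c : ℝ → Vec d) (t : ℝ) : Prop := ∀ k : Fin d,
  deriv (deriv fun τ => c τ k) t =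
    - ∑ r, ∑ s, Γ (c t) r s k * deriv (fun τ => c τ r) t * deriv (fun τ => c τ s) t

theorem contDiffAt_apply {c : ℝ → Vec d} {t : ℝ} (h : ContDiffAt ℝ ∞ c t) (k : Fin d) :
    ContDiffAt ℝ ∞ (fun τ => c τ k) t := contDiffAt_euclidean.1 h k

theorem LocalConn.exists_geodesic (c : LocalConn d) (q : c.dom) (v : Vec d) :
    ∃ γ : ℝ → Vec d, γ 0 = q ∧ (∀ k, deriv (fun τ => γ τ k) 0 = v k) ∧
      ∀ᶠ t in 𝓝 (0 : ℝ), γ t ∈ c.dom ∧ ContDiffAt ℝ ∞ γ t ∧ GeodesicEq c.Γ γ t := by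
  let F : Vec d × Vec d → Vec d × Vec d := fun p =>
    (p.2, WithLp.toLp 2 fun k => - ∑ r, ∑ s, c.Γ p.1 r s k * p.2 r * p.2 s)
  have hU : IsOpen ((c.dom : Set (Vec d)) ×ˢ (Set.univ : Set (Vec d))) :=
    c.dom.isOpen.prod isOpen_univ
  have happ : ∀ r : Fin d, ContDiff ℝ ∞ fun p : Vec d × Vec d => p.2 r := fun r =>
    contDiff_euclidean.1 contDiff_snd r
  have hF : ContDiffOn ℝ ∞ F ((c.dom : Set (Vec d)) ×ˢ Set.univ) := by
    refine contDiff_snd.contDiffOn.prodMk (contDiffOn_euclidean.2 fun k => ?_)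
    refine ContDiffOn.neg (ContDiffOn.sum fun r _ => ContDiffOn.sum fun s _ => ?_)
    refine (ContDiffOn.mul ?_ (happ r).contDiffOn).mul (happ s).contDiffOn
    exact (c.smooth r s k).comp contDiff_fst.contDiffOn fun p hp => hp.1
  obtain ⟨α, h0, hα⟩ := exists_smooth_integralCurve hU hF (x := ((q : Vec d), v)) ⟨q.2, trivial⟩
  have h1 : ∀ t, HasDerivAt α (F (α t)) t →
      ∀ k, HasDerivAt (fun τ => (α τ).1 k) ((α t).2 k) t := fun t ht k =>
    ((EuclideanSpace.proj k : Vec d →L[ℝ] ℝ).hasFDerivAt.comp_hasDerivAt t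
      ((ContinuousLinearMap.fst ℝ (Vec d) (Vec d)).hasFDerivAt.comp_hasDerivAt t ht))
  have h2 : ∀ t, HasDerivAt α (F (α t)) t → ∀ k, HasDerivAt (fun τ => (α τ).2 k)
      (- ∑ r, ∑ s, c.Γ (α t).1 r s k * (α t).2 r * (α t).2 s) t := fun t ht k =>
    ((EuclideanSpace.proj k : Vec d →L[ℝ] ℝ).hasFDerivAt.comp_hasDerivAt t
      ((ContinuousLinearMap.snd ℝ (Vec d) (Vec d)).hasFDerivAt.comp_hasDerivAt t ht))
  have h3 := hα.self_of_nhds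
  refine ⟨fun t => (α t).1, by simp [h0], fun k => by rw [(h1 0 h3.2.2 k).deriv, h0], ?_⟩
  filter_upwards [hα, hα.eventually_nhds] with t ht ht'
  refine ⟨ht.1.1, contDiff_fst.contDiffAt.comp t ht.2.1, fun k => ?_⟩
  have h4 : (deriv fun τ => (α τ).1 k) =ᶠ[𝓝 t] fun τ => (α τ).2 k := by
    filter_upwards [ht'] with τ hτ
    exact (h1 τ hτ.2.2 k).deriv
  rw [h4.deriv_eq, (h2 t ht.2.2 k).deriv]
  simp only [(h1 t ht.2.2 _).deriv]

/-- The chain rule along a curve, in coordinates. -/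
theorem hasDerivAt_comp_curve {g : Vec d → ℝ} {c : ℝ → Vec d} {t : ℝ}
    (hg : DifferentiableAt ℝ g (c t)) (hc : DifferentiableAt ℝ c t) :
    HasDerivAt (fun τ => g (c τ)) (∑ i, pd i g (c t) * deriv (fun τ => c τ i) t) t := by
  have h := hg.hasFDerivAt.comp_hasDerivAt t hc.hasDerivAt
  have h1 : ∀ i, deriv (fun τ => c τ i) t = (deriv c t) i := fun i =>
    ((EuclideanSpace.proj i : Vec d →L[ℝ] ℝ).hasFDerivAt.comp_hasDerivAt t hc.hasDerivAt).deriv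
  refine h.congr_deriv ?_
  conv_lhs => rw [vec_eq_sum (deriv c t), map_sum]
  refine sum_congr rfl fun i _ => ?_
  rw [map_smul, smul_eq_mul, h1, mul_comm]
  rfl

theorem hasDerivAt_deriv_of_contDiffAt {f : ℝ → ℝ} {t : ℝ} (h : ContDiffAt ℝ ∞ f t) :
    HasDerivAt (deriv f) (deriv (deriv f) t) t := by
  have h6 : ContDiffAt ℝ 1 (deriv f) t :=
    (h.fderiv_right (m := 1) (by rw [one_add_one_eq_two]; exact two_le_infty)).clm_apply
      contDiffAt_const
  exact (h6.differentiableAt (by simp)).hasDerivAt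

variable {c : LocalConn d}

theorem coe_sum_mvPolynomial {R ι : Type*} [CommRing R] (s : Finset ι)
    (P : ι → MvPolynomial (Fin d) R) :
    ((∑ i ∈ s, P i : MvPolynomial (Fin d) R) : Series d R) = ∑ i ∈ s, (P i : Series d R) :=
  map_sum (MvPolynomial.coeToMvPowerSeries.ringHom (σ := Fin d) (R := R)) _ _

theorem coe_neg_mvPolynomial {R : Type*} [CommRing R] (P : MvPolynomial (Fin d) R) :
    ((-P : MvPolynomial (Fin d) R) : Series d R) = -(P : Series d R) :=
  map_neg (MvPolynomial.coeToMvPowerSeries.ringHom (σ := Fin d) (R := R)) _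

/-- Along a geodesic `γ` the derivative of a function which is polynomial in `γ'` is given by the
derivation `yop`. -/
theorem exists_polynomial_yop (P : MvPolynomial (Fin d) (smoothRing c.dom)) :
    ∃ P' : MvPolynomial (Fin d) (smoothRing c.dom),
      (P' : Series d (smoothRing c.dom)) = c.ring.yop P ∧
      ∀ (γ : ℝ → c.dom) (t : ℝ), (∀ᶠ τ in 𝓝 t, ContDiffAt ℝ ∞ (fun τ => (γ τ : Vec d)) τ) →
        GeodesicEq c.Γ (fun τ => (γ τ : Vec d)) t →
        HasDerivAt (fun τ => MvPolynomial.eval₂ (evalAt (γ τ) : smoothRing c.dom →+* ℝ)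
          (fun i => deriv (fun τ => (γ τ : Vec d) i) τ) P)
          (MvPolynomial.eval₂ (evalAt (γ t) : smoothRing c.dom →+* ℝ)
          (fun i => deriv (fun τ => (γ τ : Vec d) i) t) P') t := by
  induction P using MvPolynomial.induction_on with
  | C a =>
    refine ⟨∑ i, MvPolynomial.X i * MvPolynomial.C (c.ring.der i a), ?_, ?_⟩
    · rw [ConnRing.yop_apply, coe_sum_mvPolynomial]
      refine sum_congr rfl fun i _ => ?_
      rw [MvPolynomial.coe_mul, MvPolynomial.coe_X, MvPolynomial.coe_C, MvPolynomial.coe_C,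
        ConnRing.nab_C]
    · intro γ t hγ hgeo
      simp only [MvPolynomial.eval₂_C, MvPolynomial.eval₂_sum, MvPolynomial.eval₂_mul,
        MvPolynomial.eval₂_X]
      have h := hasDerivAt_comp_curve (differentiableAt_of_contDiffOn (contDiffOn_smoothFn a)
        (γ t)) (hγ.self_of_nhds.differentiableAt (by simp))
      simp only [smoothFn_eq] at h
      refine h.congr_deriv (sum_congr rfl fun i _ => ?_)
      rw [mul_comm]
      exact congrArg _ (evalAt_partialDer i a (γ t)).symm
  | add P Q hP hQ =>
    obtain ⟨P', h1, h2⟩ := hP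
    obtain ⟨Q', h3, h4⟩ := hQ
    refine ⟨P' + Q', by simp [h1, h3], fun γ t hγ hgeo => ?_⟩
    simp only [MvPolynomial.eval₂_add]
    exact (h2 γ t hγ hgeo).add (h4 γ t hγ hgeo)
  | mul_X P i hP =>
    obtain ⟨P', h1, h2⟩ := hP
    refine ⟨P' * MvPolynomial.X i + P * - ∑ r, ∑ s, MvPolynomial.X r *
      (MvPolynomial.C (c.ring.Gam r s i) * MvPolynomial.X s), ?_, fun γ t hγ hgeo => ?_⟩
    · have h3 : c.ring.yop (X i) = - ∑ r, ∑ s, X r * (C (c.ring.Gam r s i) * X s) := by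
        rw [ConnRing.yop_apply, ← sum_neg_distrib]
        refine sum_congr rfl fun r _ => ?_
        rw [ConnRing.nab_apply, vert_X, ConnRing.dx, mapDer_X, zero_add, ConnRing.conn_eq,
          mul_sum, ← sum_neg_distrib]
        refine sum_congr rfl fun s _ => ?_
        rw [map_neg]
        ring
      simp only [MvPolynomial.coe_add, MvPolynomial.coe_mul, coe_neg_mvPolynomial,
        coe_sum_mvPolynomial, MvPolynomial.coe_X, MvPolynomial.coe_C]
      rw [Derivation.leibniz, h3, h1]
      simp only [smul_eq_mul]
      ring
    · have h3 := (h2 γ t hγ hgeo)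
      have h4 : HasDerivAt (fun τ => deriv (fun τ => (γ τ : Vec d) i) τ)
          (deriv (deriv fun τ => (γ τ : Vec d) i) t) t :=
        hasDerivAt_deriv_of_contDiffAt (contDiffAt_apply hγ.self_of_nhds i)
      simp only [MvPolynomial.eval₂_add, MvPolynomial.eval₂_mul, MvPolynomial.eval₂_X,
        MvPolynomial.eval₂_neg, MvPolynomial.eval₂_sum, MvPolynomial.eval₂_C]
      refine (h3.mul h4).congr_deriv ?_
      rw [hgeo i]
      congr 3
      refine sum_congr rfl fun r _ => sum_congr rfl fun s _ => ?_
      have h7 : evalAt (γ t) (c.ring.Gam r s i) = c.Γ (γ t) r s i := rfl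
      rw [RingHom.coe_coe, h7]
      ring


/-- The value at `v` of the homogeneous part of degree `n` of a formal series. -/
def homValue (n : ℕ) (p : FPS d) (v : Fin d → ℝ) : ℝ :=
  ∑ α ∈ finsuppAntidiag (univ : Finset (Fin d)) n, coeff α p * ∏ i, v i ^ α i

theorem mem_finsuppAntidiag_univ {α : Fin d →₀ ℕ} {n : ℕ} :
    α ∈ finsuppAntidiag (univ : Finset (Fin d)) n ↔ α.degree = n := by
  simp [Finset.mem_finsuppAntidiag, Finsupp.degree_eq_sum]

theorem homValue_hom (n : ℕ) (p : FPS d) (v : Fin d → ℝ) :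
    homValue n (hom n p) v = homValue n p v :=
  sum_congr rfl fun α hα => by
    rw [coeff_hom, if_pos (mem_finsuppAntidiag_univ.1 hα)]

/-- A formal series is determined by the values of its homogeneous parts. -/
theorem ext_homValue {p p' : FPS d} (h : ∀ n v, homValue n p v = homValue n p' v) : p = p' := by
  ext α
  let Q : FPS d → MvPolynomial (Fin d) ℝ := fun p =>
    ∑ β ∈ finsuppAntidiag (univ : Finset (Fin d)) α.degree, MvPolynomial.monomial β (coeff β p)
  have h1 : ∀ p v, MvPolynomial.eval v (Q p) = homValue α.degree p v := fun p v => by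
    simp [Q, homValue, MvPolynomial.eval_monomial, Finsupp.prod_fintype]
  have h2 : Q p = Q p' := MvPolynomial.funext fun v => by rw [h1, h1, h]
  have h3 : ∀ p, MvPolynomial.coeff α (Q p) = coeff α p := fun p => by
    simp only [Q, MvPolynomial.coeff_sum, MvPolynomial.coeff_monomial, sum_ite_eq',
      mem_finsuppAntidiag_univ, if_true]
  rw [← h3, ← h3, h2]

theorem homValue_evalSeries_coe (n : ℕ) (q : c.dom) (P : MvPolynomial (Fin d) (smoothRing c.dom))
    (hP : hom n (P : Series d (smoothRing c.dom)) = P) (v : Fin d → ℝ) :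
    homValue n (evalSeries q (P : Series d (smoothRing c.dom))) v =
      MvPolynomial.eval₂ (evalAt q : smoothRing c.dom →+* ℝ) v P := by
  rw [MvPolynomial.eval₂_eq', homValue]
  symm
  refine (sum_subset (fun α hα => ?_) fun α _ hα => ?_).trans (sum_congr rfl fun α _ => ?_)
  · rw [mem_finsuppAntidiag_univ]
    by_contra h
    refine MvPolynomial.mem_support_iff.1 hα ?_
    rw [← MvPolynomial.coeff_coe, ← hP, coeff_hom, if_neg h]
  · rw [MvPolynomial.notMem_support_iff.1 hα, map_zero, zero_mul]
  · rw [coeff_evalSeries, MvPolynomial.coeff_coe]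
    rfl

/-- Along a geodesic, the Taylor coefficients of a function are the values of the homogeneous parts
of the formal series `tau`. -/
theorem homValue_tauAt_geodesic (γ : ℝ → c.dom)
    (hγ : ∀ᶠ τ in 𝓝 (0 : ℝ), ContDiffAt ℝ ∞ (fun τ => (γ τ : Vec d)) τ ∧
      GeodesicEq c.Γ (fun τ => (γ τ : Vec d)) τ) (g : smoothRing c.dom) (n : ℕ) :
    homValue n (tauAt c (γ 0) g) (fun i => deriv (fun τ => (γ τ : Vec d) i) 0) =
      iteratedDeriv n (fun τ => evalAt (γ τ) g) 0 / n.factorial := by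
  have key : ∀ n : ℕ, ∃ P : MvPolynomial (Fin d) (smoothRing c.dom),
      (P : Series d (smoothRing c.dom)) = c.ring.yop^[n] (C g) ∧
      iteratedDeriv n (fun τ => evalAt (γ τ) g) =ᶠ[𝓝 0] fun τ =>
        MvPolynomial.eval₂ (evalAt (γ τ) : smoothRing c.dom →+* ℝ)
          (fun i => deriv (fun τ => (γ τ : Vec d) i) τ) P := by
    intro n
    induction n with
    | zero =>
      exact ⟨MvPolynomial.C g, by simp, Filter.Eventually.of_forall fun τ => by simp⟩
    | succ n ih =>
      obtain ⟨P, h1, h2⟩ := ih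
      obtain ⟨P', h3, h4⟩ := exists_polynomial_yop P
      refine ⟨P', by rw [h3, h1, Function.iterate_succ_apply'], ?_⟩
      filter_upwards [hγ.eventually_nhds, h2.eventuallyEq_nhds] with t ht ht2
      rw [iteratedDeriv_succ, ht2.deriv_eq]
      exact (h4 γ t (ht.mono fun _ h => h.1) ht.self_of_nhds.2).deriv
  obtain ⟨P, h1, h2⟩ := key n
  rw [h2.eq_of_nhds, ← homValue_evalSeries_coe n (γ 0) P, ← homValue_hom, tauAt_apply,
    hom_evalSeries, ConnRing.hom_tau, h1]
  · simp only [homValue, coeff_evalSeries, ConnRing.coeff_real_smul, map_smul, smul_eq_mul, Finset.sum_div]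
    exact sum_congr rfl fun α _ => by ring
  · rw [h1, ConnRing.hom_yop_iterate]

end Geodesics

section ExpTaylor

variable {d : ℕ} {M : Type u} [TopologicalSpace M] [ChartedSpace (Vec d) M]
  [IsManifold (𝓡 d) ∞ M] {e e' : OpenPartialHomeomorph M (Vec d)} (nabla : Connection d M)

theorem geodesic_change_sum (Γ : Fin d → Fin d → Fin d → ℝ) (Γ' : Fin d → Fin d → ℝ)
    (a : Fin d → Fin d → ℝ) (b v : Fin d → ℝ) :
    ∑ i, ((∑ j, ((∑ l, Γ j i l * b l) - ∑ r, ∑ s, Γ' r s * a j r * a i s) * v j) * v i +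
      b i * -∑ r, ∑ s, Γ r s i * v r * v s) =
    -∑ r, ∑ s, Γ' r s * (∑ i, a i r * v i) * ∑ i, a i s * v i := by
  have h1 : ∑ i, b i * ∑ r, ∑ s, Γ r s i * v r * v s =
      ∑ i, (∑ j, (∑ l, Γ j i l * b l) * v j) * v i := by
    simp only [mul_sum, sum_mul]
    rw [Finset.sum_comm_cycle]
    refine sum_congr rfl fun i _ => ?_
    rw [sum_comm]
    exact sum_congr rfl fun j _ => sum_congr rfl fun l _ => by ring
  have h2 : ∑ r, ∑ s, Γ' r s * (∑ i, a i r * v i) * ∑ i, a i s * v i =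
      ∑ i, (∑ j, (∑ r, ∑ s, Γ' r s * a j r * a i s) * v j) * v i := by
    calc _ = ∑ r, ∑ s, ∑ i, ∑ j, Γ' r s * a j r * a i s * v j * v i := by
          refine sum_congr rfl fun r _ => sum_congr rfl fun s _ => ?_
          rw [mul_assoc, mul_comm (∑ i, a i r * v i), sum_mul_sum, mul_sum]
          refine sum_congr rfl fun i _ => ?_
          rw [mul_sum]
          exact sum_congr rfl fun j _ => by ring
      _ = ∑ i, ∑ j, ∑ r, ∑ s, Γ' r s * a j r * a i s * v j * v i := by
          rw [Finset.sum_comm_cycle]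
          exact sum_congr rfl fun i _ => by rw [Finset.sum_comm_cycle]
      _ = _ := by
          simp only [sum_mul]
  rw [h2]
  simp only [sub_mul, sum_sub_distrib, mul_neg, sum_add_distrib, sum_neg_distrib, h1]
  ring

theorem IsChart.contDiffAt_comp_curve (he : IsChart e) {γ : ℝ → M} {t : ℝ}
    (hγ : ContMDiffAt 𝓘(ℝ, ℝ) (𝓡 d) ∞ γ t) (ht : γ t ∈ e.source) :
    ContDiffAt ℝ ∞ (fun τ => e (γ τ)) t :=
  ((he.contMDiffAt ht).comp t hγ).contDiffAt

/-- The velocities of a curve in two charts. -/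
theorem IsChart.deriv_change (he : IsChart e) (he' : IsChart e') {γ : ℝ → M} {t : ℝ}
    (hγ : ContMDiffAt 𝓘(ℝ, ℝ) (𝓡 d) ∞ γ t) (ht : γ t ∈ e.source) (ht' : γ t ∈ e'.source)
    (k : Fin d) : deriv (fun τ => e' (γ τ) k) t =
      ∑ i, chartJac e e' i k (e (γ t)) * deriv (fun τ => e (γ τ) i) t := by
  have h1 := hasDerivAt_comp_curve (((he.contDiffAt_transition_apply he' (e.map_source ht)
    (by rwa [e.left_inv ht]) k).differentiableAt (by simp)))
    ((he.contDiffAt_comp_curve hγ ht).differentiableAt (by simp))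
  have h2 : (fun τ => e' (γ τ) k) =ᶠ[𝓝 t] fun τ => e' (e.symm (e (γ τ))) k := by
    filter_upwards [hγ.continuousAt.preimage_mem_nhds (e.open_source.mem_nhds ht)] with τ hτ
    rw [e.left_inv hτ]
  rw [h2.deriv_eq, h1.deriv]
  rfl

/-- The equation of geodesics does not depend on the chart. -/
theorem IsChart.geodesicEq_change (he : IsChart e) (he' : IsChart e') {γ : ℝ → M} {t : ℝ}
    (hγ : ∀ᶠ τ in 𝓝 t, ContMDiffAt 𝓘(ℝ, ℝ) (𝓡 d) ∞ γ τ) (ht : γ t ∈ e.source)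
    (ht' : γ t ∈ e'.source) (hgeo : GeodesicEq (christoffel nabla e) (fun τ => e (γ τ)) t) :
    GeodesicEq (christoffel nabla e') (fun τ => e' (γ τ)) t := by
  intro k
  have hc := hγ.self_of_nhds.continuousAt
  have h1 : (deriv fun τ => e' (γ τ) k) =ᶠ[𝓝 t] fun τ =>
      ∑ i, chartJac e e' i k (e (γ τ)) * deriv (fun τ => e (γ τ) i) τ := by
    filter_upwards [hγ, hc.preimage_mem_nhds (e.open_source.mem_nhds ht),
      hc.preimage_mem_nhds (e'.open_source.mem_nhds ht')] with τ h2 h3 h4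
    exact he.deriv_change he' h2 h3 h4 k
  have h2 : ∀ i, HasDerivAt (fun τ => chartJac e e' i k (e (γ τ)))
      (∑ j, pd j (chartJac e e' i k) (e (γ t)) * deriv (fun τ => e (γ τ) j) t) t := fun i =>
    hasDerivAt_comp_curve ((he.contDiffAt_chartJac he' (e.map_source ht)
      (by rwa [e.left_inv ht]) i k).differentiableAt (by simp))
      ((he.contDiffAt_comp_curve hγ.self_of_nhds ht).differentiableAt (by simp))
  have h3 : ∀ i, HasDerivAt (fun τ => deriv (fun τ => e (γ τ) i) τ)
      (deriv (deriv fun τ => e (γ τ) i) t) t := fun i =>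
    (hasDerivAt_deriv_of_contDiffAt (contDiffAt_apply
      (he.contDiffAt_comp_curve hγ.self_of_nhds ht) i))
  have h5 := HasDerivAt.fun_sum (u := univ) fun i _ => (h2 i).mul (h3 i)
  rw [h1.deriv_eq]
  refine h5.deriv.trans ?_
  have h4 : ∀ i j, pd j (chartJac e e' i k) (e (γ t)) =
      (∑ l, christoffel nabla e (e (γ t)) j i l * chartJac e e' l k (e (γ t))) -
      ∑ r, ∑ s, christoffel nabla e' (e' (γ t)) r s k * chartJac e e' j r (e (γ t)) *
        chartJac e e' i s (e (γ t)) := fun i j => by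
    rw [he.christoffel_transform nabla he' ht ht' j i k]
    ring
  simp only [hgeo _, h4, he.deriv_change he' hγ.self_of_nhds ht ht']
  exact geodesic_change_sum (fun j i l => christoffel nabla e (e (γ t)) j i l)
    (fun r s => christoffel nabla e' (e' (γ t)) r s k)
    (fun i r => chartJac e e' i r (e (γ t))) (fun i => chartJac e e' i k (e (γ t)))
    (fun i => deriv (fun τ => e (γ τ) i) t)

/-- `IsExpTaylor`, in terms of the values of the homogeneous parts. -/
theorem isExpTaylor_iff {x : M} {g : M → ℝ} {p : FPS d} : IsExpTaylor nabla e x g p ↔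
    ∀ γ : ℝ → M, IsGeodesicNearZero nabla γ → γ 0 = x → ∀ n : ℕ,
      homValue n p (fun i => deriv (fun t => e (γ t) i) 0) =
        iteratedDeriv n (fun t => g (γ t)) 0 / n.factorial := Iff.rfl

variable {nabla} [T2Space M] [nabla.ContMDiffCovariantDerivative ∞] (htor : nabla.torsion = 0)

include htor in
/-- Existence of the geodesics through a given point with a given velocity. -/
theorem IsChart.exists_geodesic (he : IsChart e) {x : M} (hx : x ∈ e.source) (v : Fin d → ℝ) :
    ∃ γ : ℝ → M, IsGeodesicNearZero nabla γ ∧ γ 0 = x ∧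
      (fun k => deriv (fun t => e (γ t) k) 0) = v := by
  obtain ⟨c, h0, h1, h2⟩ := (chartConn htor he).exists_geodesic ⟨e x, e.map_source hx⟩
    (WithLp.toLp 2 v)
  have h3 : (fun t => e (e.symm (c t))) =ᶠ[𝓝 0] c := by
    filter_upwards [h2] with t ht
    exact e.right_inv ht.1
  refine ⟨fun t => e.symm (c t), ?_, ?_, ?_⟩
  · have h4 : ∀ᶠ t in 𝓝 (0 : ℝ), ContMDiffAt 𝓘(ℝ, ℝ) (𝓡 d) ∞ (fun t => e.symm (c t)) t := by
      filter_upwards [h2] with t ht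
      exact (he.contMDiffAt_symm ht.1).comp t ht.2.1.contMDiffAt
    filter_upwards [h2, h3.eventuallyEq_nhds, h4.eventually_nhds] with t ht ht3 ht4
    refine ⟨ht4.self_of_nhds, fun e' he' ht' => ?_⟩
    refine he.geodesicEq_change nabla he' ht4 (e.map_target ht.1) ht' fun k => ?_
    have h5 : ∀ i, (fun τ => e (e.symm (c τ)) i) =ᶠ[𝓝 t] fun τ => c τ i := fun i => by
      filter_upwards [ht3] with τ hτ
      rw [hτ]
    simp only [(h5 _).deriv.deriv_eq, (h5 _).deriv_eq]
    rw [ht3.eq_of_nhds]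
    exact ht.2.2 k
  · simp only [h0, e.left_inv hx]
  · funext k
    rw [← show (WithLp.toLp 2 v : Vec d) k = v k from rfl, ← h1 k]
    refine Filter.EventuallyEq.deriv_eq ?_
    filter_upwards [h3] with τ hτ
    rw [hτ]

include htor in
theorem IsChart.isExpTaylor_unique (he : IsChart e) {x : M} (hx : x ∈ e.source) {g : M → ℝ}
    {p p' : FPS d} (h : IsExpTaylor nabla e x g p) (h' : IsExpTaylor nabla e x g p') : p = p' := by
  refine ext_homValue fun n v => ?_
  obtain ⟨γ, h1, h2, h3⟩ := he.exists_geodesic htor hx v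
  have h4 := (isExpTaylor_iff nabla).1 h γ h1 h2 n
  have h5 := (isExpTaylor_iff nabla).1 h' γ h1 h2 n
  rw [h3] at h4 h5
  rw [h4, h5]

include htor in
theorem IsChart.expTaylor_eq_of (he : IsChart e) {x : M} (hx : x ∈ e.source) {g : M → ℝ}
    {p : FPS d} (h : IsExpTaylor nabla e x g p) : expTaylor nabla e x g = p := by
  have hex : ∃ p, IsExpTaylor nabla e x g p := ⟨p, h⟩
  rw [expTaylor, dif_pos hex]
  exact he.isExpTaylor_unique htor hx hex.choose_spec h

theorem isExpTaylor_congr {x : M} {g g' : M → ℝ} (h : g =ᶠ[𝓝 x] g') {p : FPS d}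
    (hp : IsExpTaylor nabla e x g p) : IsExpTaylor nabla e x g' p := fun γ h1 h2 n => by
  have h3 : (fun t => g (γ t)) =ᶠ[𝓝 0] fun t => g' (γ t) := by
    have hc : Filter.Tendsto γ (𝓝 0) (𝓝 x) := by
      rw [← h2]
      exact h1.self_of_nhds.1.continuousAt
    exact hc.eventually h
  rw [hp γ h1 h2 n, h3.iteratedDeriv_eq]

/-- The Taylor expansion along the exponential map is given by the formal series `tau`. -/
theorem IsChart.isExpTaylor_tauAt (he : IsChart e) (x : (chartConn htor he).dom)
    (g : smoothRing (chartConn htor he).dom) {f : M → ℝ}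
    (hf : (fun p => smoothFn g (e p)) =ᶠ[𝓝 (e.symm x)] f) :
    IsExpTaylor nabla e (e.symm x) f (tauAt (chartConn htor he) x g) := by
  refine isExpTaylor_congr hf ?_
  rw [isExpTaylor_iff]
  intro γ h1 h2 n
  have hc := h1.self_of_nhds.1.continuousAt
  have hs : ∀ᶠ t in 𝓝 (0 : ℝ), γ t ∈ e.source := by
    refine hc.preimage_mem_nhds (e.open_source.mem_nhds ?_)
    rw [h2]
    exact e.map_target x.2
  classical
  let c : ℝ → (chartConn htor he).dom := fun t => if h : e (γ t) ∈ e.target then ⟨e (γ t), h⟩ else x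
  have h3 : ∀ᶠ t in 𝓝 (0 : ℝ), (c t : Vec d) = e (γ t) := by
    filter_upwards [hs] with t ht
    simp only [c, dif_pos (e.map_source ht)]
  have h4 : c 0 = x := Subtype.ext (by rw [h3.self_of_nhds, h2, e.right_inv x.2])
  have h5 : ∀ᶠ t in 𝓝 (0 : ℝ), ContDiffAt ℝ ∞ (fun τ => (c τ : Vec d)) t ∧
      GeodesicEq (chartConn htor he).Γ (fun τ => (c τ : Vec d)) t := by
    filter_upwards [h1, hs, h3.eventually_nhds] with t ht hst ht3
    refine ⟨(he.contDiffAt_comp_curve ht.1 hst).congr_of_eventuallyEq ht3, fun k => ?_⟩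
    have h6 : ∀ i, (fun τ => (c τ : Vec d) i) =ᶠ[𝓝 t] fun τ => e (γ τ) i := fun i => by
      filter_upwards [ht3] with τ hτ
      rw [hτ]
    simp only [(h6 _).deriv.deriv_eq, (h6 _).deriv_eq]
    rw [ht3.self_of_nhds]
    exact ht.2 e he hst k
  have h6 := homValue_tauAt_geodesic c h5 g n
  have h7 : (fun i => deriv (fun τ => (c τ : Vec d) i) 0) =
      fun i => deriv (fun t => e (γ t) i) 0 := funext fun i => by
    refine Filter.EventuallyEq.deriv_eq ?_
    filter_upwards [h3] with τ hτ
    rw [hτ]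
  rw [h4, h7] at h6
  rw [h6]
  congr 1
  refine Filter.EventuallyEq.iteratedDeriv_eq n ?_
  filter_upwards [h3] with τ hτ
  rw [← hτ, smoothFn_eq]

theorem IsChart.expTaylor_eq_tauAt (he : IsChart e) (x : (chartConn htor he).dom)
    (g : smoothRing (chartConn htor he).dom) {f : M → ℝ}
    (hf : (fun p => smoothFn g (e p)) =ᶠ[𝓝 (e.symm x)] f) :
    expTaylor nabla e (e.symm x) f = tauAt (chartConn htor he) x g :=
  he.expTaylor_eq_of htor (e.map_target x.2) (he.isExpTaylor_tauAt htor x g hf)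

end ExpTaylor

section LinearSubstitution

variable {d m : ℕ} (L : Fin d → Fin d → ℝ)

/-- The linear form which replaces the variable `y^k`. -/
def linForm (k : Fin d) : MvPolynomial (Fin d) ℝ := ∑ i, MvPolynomial.C (L i k) * MvPolynomial.X i

theorem hasSubst_linForm : MvPowerSeries.HasSubst fun k => (linForm L k : FPS d) :=
  MvPowerSeries.hasSubst_of_constantCoeff_zero fun k => by
    rw [linForm, coe_sum_mvPolynomial, map_sum]
    simp

/-- The linear substitution `y^k ↦ ∑ L_i^k y^i`. -/
def linSubst : FPS d →ₐ[ℝ] FPS d := MvPowerSeries.substAlgHom (hasSubst_linForm L)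

theorem linSubst_coe (P : MvPolynomial (Fin d) ℝ) :
    linSubst L (P : FPS d) = (MvPolynomial.aeval (linForm L) P : MvPolynomial (Fin d) ℝ) := by
  rw [linSubst, MvPowerSeries.substAlgHom_coe]
  have h : ((MvPolynomial.coeToMvPowerSeries.algHom ℝ).comp (MvPolynomial.aeval (linForm L))) P =
      MvPolynomial.aeval (fun k => (linForm L k : FPS d)) P := by
    congr 1
    ext k : 1
    simp [MvPolynomial.coeToMvPowerSeries.algHom_apply]
  rw [← h]
  simp [MvPolynomial.coeToMvPowerSeries.algHom_apply]

theorem linForm_isHomogeneous (k : Fin d) : (linForm L k).IsHomogeneous 1 :=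
  MvPolynomial.IsHomogeneous.sum _ _ _ fun _ _ => MvPolynomial.isHomogeneous_C_mul_X _ _

theorem hom_linSubst_congr {n : ℕ} {p p' : FPS d} (h : hom n p = hom n p') :
    hom n (linSubst L p) = hom n (linSubst L p') := by
  ext α
  simp only [coeff_hom]
  split_ifs with hα
  · simp only [linSubst, MvPowerSeries.coe_substAlgHom,
      MvPowerSeries.coeff_subst (hasSubst_linForm L)]
    refine finsum_congr fun β => ?_
    by_cases hβ : β.degree = n
    · rw [coeff_eq_of_hom_eq (show hom β.degree p = hom β.degree p' by rw [hβ]; exact h)]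
    · have h1 : coeff α (β.prod fun s e => (linForm L s : FPS d) ^ e) = 0 := by
        have h2 : (β.prod fun s e => (linForm L s : FPS d) ^ e) =
            ((β.prod fun s e => linForm L s ^ e : MvPolynomial (Fin d) ℝ) : FPS d) := by
          simp only [Finsupp.prod]
          rw [← MvPolynomial.coeToMvPowerSeries.ringHom_apply, map_prod]
          simp
        rw [h2, MvPolynomial.coeff_coe]
        have h3 : (β.prod fun s e => linForm L s ^ e).IsHomogeneous (∑ s ∈ β.support, 1 * β s) :=
          MvPolynomial.IsHomogeneous.prod _ _ _ fun s _ => (linForm_isHomogeneous L s).pow _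
        refine h3.coeff_eq_zero ?_
        rw [hα]
        intro h4
        refine hβ ?_
        rw [h4, Finsupp.degree_apply]
        simp
      rw [h1, smul_zero, smul_zero]
  · rfl

/-- The homogeneous part of degree `n`, as a polynomial. -/
def homPoly (n : ℕ) (p : FPS d) : MvPolynomial (Fin d) ℝ :=
  ∑ β ∈ finsuppAntidiag (univ : Finset (Fin d)) n, MvPolynomial.monomial β (coeff β p)

theorem coe_homPoly (n : ℕ) (p : FPS d) : (homPoly n p : FPS d) = hom n p := by
  ext α
  rw [coeff_hom, MvPolynomial.coeff_coe]
  simp only [homPoly, MvPolynomial.coeff_sum, MvPolynomial.coeff_monomial, sum_ite_eq',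
      mem_finsuppAntidiag_univ]

theorem eval_homPoly (n : ℕ) (p : FPS d) (v : Fin d → ℝ) :
    MvPolynomial.eval v (homPoly n p) = homValue n p v := by
  simp [homPoly, homValue, MvPolynomial.eval_monomial, Finsupp.prod_fintype]

theorem homValue_coe (n : ℕ) (P : MvPolynomial (Fin d) ℝ) (hP : hom n (P : FPS d) = P)
    (v : Fin d → ℝ) : homValue n (P : FPS d) v = MvPolynomial.eval v P := by
  rw [← eval_homPoly]
  congr 1
  exact MvPolynomial.coe_injective _ _ (by rw [coe_homPoly, hP])

theorem homValue_linSubst (n : ℕ) (p : FPS d) (v : Fin d → ℝ) :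
    homValue n (linSubst L p) v = homValue n p fun k => ∑ i, L i k * v i := by
  have h1 : hom n (linSubst L p) = hom n (linSubst L (homPoly n p : FPS d)) :=
    hom_linSubst_congr L (by rw [coe_homPoly, hom_hom, if_pos rfl])
  have h2 : hom n (linSubst L (homPoly n p : FPS d)) = linSubst L (homPoly n p : FPS d) := by
    refine ext_hom fun k => ?_
    rw [hom_hom]
    split_ifs with h
    · rw [h]
    · have h3 : hom k (linSubst L (homPoly n p : FPS d)) = hom k (linSubst L 0) :=
        hom_linSubst_congr L (by rw [coe_homPoly, hom_hom, if_neg h, map_zero])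
      rw [h3, map_zero, map_zero]
  rw [← homValue_hom, h1, homValue_hom, ← eval_homPoly n p]
  rw [linSubst_coe] at h2 ⊢
  rw [homValue_coe n _ h2]
  rw [← MvPolynomial.coe_aeval_eq_eval, ← MvPolynomial.coe_aeval_eq_eval]
  have h4 : (MvPolynomial.aeval v).comp (MvPolynomial.aeval (linForm L)) =
      (MvPolynomial.aeval fun k => ∑ i, L i k * v i : MvPolynomial (Fin d) ℝ →ₐ[ℝ] ℝ) := by
    ext k
    simp [linForm]
  exact DFunLike.congr_fun h4 _

theorem pderiv_linSubst (j : Fin d) (p : FPS d) : pderiv ℝ j (linSubst L p) =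
      ∑ k, C (L j k) * linSubst L (pderiv ℝ k p) := by
  have hpoly : ∀ P : MvPolynomial (Fin d) ℝ, pderiv ℝ j (linSubst L (P : FPS d)) =
      ∑ k, C (L j k) * linSubst L (pderiv ℝ k (P : FPS d)) := by
    intro P
    induction P using MvPolynomial.induction_on with
    | C a =>
      rw [linSubst_coe]
      simp
    | add P Q hP hQ => simp only [MvPolynomial.coe_add, map_add, hP, hQ, mul_add, sum_add_distrib]
    | mul_X P i hP =>
      have h1 : linSubst L (X i) = ∑ k, C (L k i) * X k := by
        rw [← MvPolynomial.coe_X, linSubst_coe, MvPolynomial.aeval_X, linForm, coe_sum_mvPolynomial]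
        simp
      have h2 : pderiv ℝ j (linSubst L (X i)) = C (L j i) := by
        simp only [h1, map_sum, Derivation.leibniz, pderiv_C, smul_eq_mul]
        rw [sum_eq_single j]
        · simp
        · intro k _ hk
          simp [pderiv_X_of_ne hk]
        · simp
      simp only [MvPolynomial.coe_mul, MvPolynomial.coe_X, map_mul, Derivation.leibniz, h2, hP,
        smul_eq_mul, map_add, mul_add, sum_add_distrib, mul_sum]
      congr 1
      · rw [sum_eq_single i]
        · simp
          ring
        · intro k _ hk
          simp [pderiv_X_of_ne hk.symm]
        · simp
      · exact sum_congr rfl fun k _ => by ring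
  refine ext_hom fun n => ?_
  have h1 : hom (n + 1) (linSubst L p) = hom (n + 1) (linSubst L (homPoly (n + 1) p : FPS d)) :=
    hom_linSubst_congr L (by rw [coe_homPoly, hom_hom, if_pos rfl])
  rw [hom_pderiv, h1, ← hom_pderiv, hpoly, map_sum, map_sum]
  refine sum_congr rfl fun k _ => ?_
  rw [hom_C_mul, hom_C_mul]
  congr 1
  refine hom_linSubst_congr L ?_
  rw [hom_pderiv, hom_pderiv, coe_homPoly, hom_hom, if_pos rfl]

theorem pdList_linSubst {n : ℕ} (J : Fin n → Fin d) (p : FPS d) :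
    pdList ℝ (List.ofFn J) (linSubst L p) = ∑ K : Fin n → Fin d,
      C (∏ j, L (J j) (K j)) * linSubst L (pdList ℝ (List.ofFn K) p) := by
  induction n with
  | zero => simp
  | succ n ih =>
    rw [List.ofFn_succ, pdList_cons, ih, map_sum, ← (Fin.consEquiv fun _ => Fin d).sum_comp,
      Fintype.sum_prod_type, sum_comm]
    refine sum_congr rfl fun K _ => ?_
    rw [Derivation.leibniz, pderiv_C, smul_zero, add_zero, smul_eq_mul, pderiv_linSubst, mul_sum]
    refine sum_congr rfl fun k _ => ?_
    simp only [Fin.consEquiv, Equiv.coe_fn_mk, Fin.prod_univ_succ, Fin.cons_zero, Fin.cons_succ,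
      List.ofFn_succ, pdList_cons, map_mul]
    ring

theorem prod_sum_blocks {R : Type*} [CommRing R] {a : Fin m → ℕ}
    (f : (l : Fin m) → (Fin (a l) → Fin d) → R) :
    ∏ l, ∑ K, f l K = ∑ K : Blocks a → Fin d, ∏ l, f l fun j => K ⟨l, j⟩ := by
  rw [prod_univ_sum, Fintype.piFinset_univ]
  exact ((Equiv.piCurry fun (l : Fin m) (_ : Fin (a l)) => Fin d).sum_comp
    fun g => ∏ l, f l (g l)).symm

theorem dop_linSubst (A : Finset (Fin m → ℕ)) (c c' : Coeffs m d (FPS d))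
    (h : ∀ a ∈ A, ∀ K, linSubst L (c' a K) = ∑ J : Blocks a → Fin d, c a J * C (∏ b, L (J b) (K b)))
    (s : Fin m → FPS d) :
    dop A c (fun l => linSubst L (s l)) = linSubst L (dop A c' s) := by
  simp only [dop_apply, map_sum, map_mul, map_prod]
  refine sum_congr rfl fun a ha => ?_
  have h1 : ∀ J : Blocks a → Fin d, ∏ l, pdList ℝ (blockList J l) (linSubst L (s l)) =
      ∑ K : Blocks a → Fin d, C (∏ b, L (J b) (K b)) *
        ∏ l, linSubst L (pdList ℝ (blockList K l) (s l)) := by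
    intro J
    simp only [blockList, pdList_linSubst]
    rw [prod_sum_blocks]
    refine sum_congr rfl fun K _ => ?_
    rw [prod_mul_distrib, ← map_prod, ← Fintype.prod_sigma']
  simp only [h1, mul_sum]
  rw [sum_comm]
  refine sum_congr rfl fun K _ => ?_
  rw [h a ha K, sum_mul]
  exact sum_congr rfl fun J _ => by ring

end LinearSubstitution

section PointTensors

variable {d n : ℕ} {κ : Type} [Fintype κ] [DecidableEq κ]

theorem homValue_genSeries (T : (n : ℕ) → (Fin n → Fin d) → ℝ) (n : ℕ) (v : Fin d → ℝ) :
    homValue n (genSeries T) v = ∑ I : Fin n → Fin d, T n I * ∏ j, v (I j) := by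
  classical
  have h1 : ∀ α : Fin d →₀ ℕ, α.degree = n → coeff α (genSeries T) =
      ∑ I : Fin n → Fin d, if ∑ j, Finsupp.single (I j) 1 = α then T n I else 0 := by
    intro α hα
    subst hα
    rfl
  have h2 : homValue n (genSeries T) v =
      ∑ α ∈ finsuppAntidiag (univ : Finset (Fin d)) n, ∑ I : Fin n → Fin d,
        if ∑ j, Finsupp.single (I j) 1 = α then T n I * ∏ j, v (I j) else 0 := by
    refine sum_congr rfl fun α hα => ?_
    rw [h1 α (mem_finsuppAntidiag_univ.1 hα), sum_mul]
    refine sum_congr rfl fun I _ => ?_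
    split_ifs with h
    · rw [← h]
      congr 1
      simp only [Finsupp.coe_finsetSum, Finset.sum_apply, ← Finset.prod_pow_eq_pow_sum]
      rw [Finset.prod_comm]
      refine prod_congr rfl fun j _ => ?_
      rw [Finset.prod_eq_single (I j)]
      · simp
      · intro i _ hi
        simp [hi.symm]
      · simp
    · rw [zero_mul]
  rw [h2, sum_comm]
  refine sum_congr rfl fun I _ => ?_
  rw [sum_ite_eq, if_pos]
  rw [mem_finsuppAntidiag_univ, map_sum]
  simp

/-- Tensors on the model space. -/
abbrev FlatTensor (d n : ℕ) (κ : Type) : Type :=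
  MultilinearMap ℝ (fun _ : Fin n => Vec d) (MultilinearMap ℝ (fun _ : κ => Vec d →L[ℝ] ℝ) ℝ)

theorem FlatTensor.map_sum_univ (A : FlatTensor d n κ) {ι ι' : Type} [Fintype ι] [Fintype ι']
    (x : Fin n → ι → ℝ) (f : ι → Vec d) (y : κ → ι' → ℝ) (g : ι' → Vec d →L[ℝ] ℝ) :
    A (fun a => ∑ i, x a i • f i) (fun b => ∑ j, y b j • g j) =
      ∑ I : Fin n → ι, ∑ J : κ → ι', (∏ a, x a (I a)) * (∏ b, y b (J b)) *
        A (fun a => f (I a)) fun b => g (J b) := by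
  classical
  rw [A.map_sum, sum_apply]
  refine sum_congr rfl fun I _ => ?_
  rw [A.map_smul_univ, smul_apply, MultilinearMap.map_sum, smul_sum]
  refine sum_congr rfl fun J _ => ?_
  rw [MultilinearMap.map_smul_univ, smul_eq_mul, smul_eq_mul, mul_assoc]

variable {M : Type u} [TopologicalSpace M] [ChartedSpace (Vec d) M]
  [IsManifold (𝓡 d) ∞ M] {e e' : OpenPartialHomeomorph M (Vec d)}

/-- The value of a tensor field at a point. -/
def TensorField.at (T : TensorField d M n κ) (x : M) : FlatTensor d n κ := T.toFun x

/-- The coordinate covectors of a chart, as maps with values in the dual of the model space. -/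
def chartCovec (e : OpenPartialHomeomorph M (Vec d)) (k : Fin d) (p : M) : Vec d →L[ℝ] ℝ :=
  (EuclideanSpace.proj k).comp (chartDeriv e p)

/-- The components of a tensor at a point in the frame of a chart. -/
def frameComp (e : OpenPartialHomeomorph M (Vec d)) (p : M) (A : FlatTensor d n κ)
    (I : Fin n → Fin d) (J : κ → Fin d) : ℝ :=
  A (fun a => chartFrame e (I a) p) fun b => chartCovec e (J b) p

theorem chartFrame_symm (i : Fin d) {q : Vec d} (hq : q ∈ e.target) :
    chartFrame e i (e.symm q) = coordVec e i q := by
  rw [chartFrame, e.right_inv hq]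
  rfl

theorem IsChart.chartCovec_symm (he : IsChart e) (k : Fin d) {q : Vec d} (hq : q ∈ e.target) :
    chartCovec e k (e.symm q) = coordCovec e k q := by
  refine ContinuousLinearMap.ext fun v => ?_
  exact (he.coordCovec_apply k hq v).symm

theorem IsChart.comp_eq (he : IsChart e) (T : TensorField d M n κ) {q : Vec d}
    (hq : q ∈ e.target) (I : Fin n → Fin d) (J : κ → Fin d) :
    T.comp e q I J = frameComp e (e.symm q) (T.at (e.symm q)) I J := by
  have h1 : (fun a => chartFrame e (I a) (e.symm q)) = fun a => coordVec e (I a) q :=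
    funext fun a => chartFrame_symm (I a) hq
  have h2 : (fun b => chartCovec e (J b) (e.symm q)) = fun b => coordCovec e (J b) q :=
    funext fun b => he.chartCovec_symm (J b) hq
  rw [frameComp, h1, h2]
  rfl

theorem IsChart.chartCovec_chartFrame (he : IsChart e) {p : M} (hp : p ∈ e.source) (k i : Fin d) :
    chartCovec e k p (chartFrame e i p) = if i = k then 1 else 0 := by
  have h : chartCovec e k p (chartFrame e i p) = chartDeriv e p (chartFrame e i p) k := rfl
  rw [h, chartFrame, he.chartDeriv_symmDeriv hp]
  simp [basisVec, eq_comm]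

theorem IsChart.covec_eq_sum_chartCovec (he : IsChart e) {p : M} (hp : p ∈ e.source)
    (w : Vec d →L[ℝ] ℝ) : w = ∑ i, w (chartFrame e i p) • chartCovec e i p := by
  ext1 v
  conv_lhs => rw [he.eq_sum_chartFrame hp v, map_sum]
  rw [sum_apply]
  exact sum_congr rfl fun i _ => by
    rw [map_smul, smul_apply, smul_eq_mul, smul_eq_mul, mul_comm]
    rfl

theorem IsChart.chartCovec_change (he : IsChart e) (he' : IsChart e') {p : M}
    (hp : p ∈ e.source) (hp' : p ∈ e'.source) (k : Fin d) :
    chartCovec e' k p = ∑ i, chartJac e e' i k (e p) • chartCovec e i p := by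
  conv_lhs => rw [he.covec_eq_sum_chartCovec hp (chartCovec e' k p)]
  refine sum_congr rfl fun i _ => ?_
  rw [← he.chartDeriv_chartFrame he' hp hp' i k]
  rfl

theorem IsChart.flatTensor_apply (he : IsChart e) {p : M} (hp : p ∈ e.source)
    (A : FlatTensor d n κ) (v : Fin n → Vec d) (w : κ → Vec d →L[ℝ] ℝ) :
    A v w = ∑ I : Fin n → Fin d, ∑ J : κ → Fin d, (∏ a, chartDeriv e p (v a) (I a)) *
      (∏ b, w b (chartFrame e (J b) p)) * frameComp e p A I J := by
  have h1 : v = fun a => ∑ k, (chartDeriv e p (v a)) k • chartFrame e k p :=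
    funext fun a => he.eq_sum_chartFrame hp (v a)
  have h2 : w = fun b => ∑ i, w b (chartFrame e i p) • chartCovec e i p :=
    funext fun b => he.covec_eq_sum_chartCovec hp (w b)
  conv_lhs => rw [h1, h2]
  exact A.map_sum_univ _ _ _ _

theorem IsChart.flatTensor_ext (he : IsChart e) {p : M} (hp : p ∈ e.source)
    {A B : FlatTensor d n κ} (h : ∀ I J, frameComp e p A I J = frameComp e p B I J) : A = B := by
  ext v w
  rw [he.flatTensor_apply hp, he.flatTensor_apply hp]
  simp only [h]

/-- The tensor with given components in the frame of a chart. -/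
def tensorOfComp (e : OpenPartialHomeomorph M (Vec d)) (p : M)
    (c : (Fin n → Fin d) → (κ → Fin d) → ℝ) : FlatTensor d n κ :=
  ∑ I, ((MultilinearMap.mkPiAlgebra ℝ (Fin n) ℝ).compLinearMap fun a =>
    (chartCovec e (I a) p : Vec d →ₗ[ℝ] ℝ)).smulRight
      (∑ J, c I J • (MultilinearMap.mkPiAlgebra ℝ κ ℝ).compLinearMap fun b =>
        (LinearMap.applyₗ (chartFrame e (J b) p)).comp (ContinuousLinearMap.coeLM ℝ))

theorem tensorOfComp_apply (p : M) (c : (Fin n → Fin d) → (κ → Fin d) → ℝ) (v : Fin n → Vec d)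
    (w : κ → Vec d →L[ℝ] ℝ) : tensorOfComp e p c v w =
      ∑ I, ∑ J, (∏ a, chartCovec e (I a) p (v a)) * (∏ b, w b (chartFrame e (J b) p)) * c I J := by
  rw [tensorOfComp, sum_apply, sum_apply]
  refine sum_congr rfl fun I _ => ?_
  rw [MultilinearMap.smulRight_apply, smul_apply, sum_apply, smul_sum]
  refine sum_congr rfl fun J _ => ?_
  simp only [MultilinearMap.compLinearMap_apply, MultilinearMap.mkPiAlgebra_apply,
    smul_apply, smul_eq_mul, LinearMap.comp_apply, LinearMap.applyₗ_apply_apply,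
    ContinuousLinearMap.coeLM_apply, ContinuousLinearMap.coe_coe]
  ring

theorem prod_ite_eq_fun {ι : Type*} [Fintype ι] [DecidableEq ι] (I K : ι → Fin d) :
    ∏ a, (if K a = I a then (1 : ℝ) else 0) = if K = I then 1 else 0 := by
  rw [Finset.prod_ite_zero]
  simp [funext_iff]

theorem IsChart.frameComp_tensorOfComp (he : IsChart e) {p : M} (hp : p ∈ e.source)
    (c : (Fin n → Fin d) → (κ → Fin d) → ℝ) (I : Fin n → Fin d) (J : κ → Fin d) :
    frameComp e p (tensorOfComp e p c) I J = c I J := by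
  classical
  rw [frameComp, tensorOfComp_apply]
  simp only [he.chartCovec_chartFrame hp, prod_ite_eq_fun]
  rw [sum_eq_single I, sum_eq_single J]
  · simp
  · intro K _ hK
    simp [hK]
  · simp
  · intro K _ hK
    simp [hK.symm]
  · simp

/-- The transformation law of the series of components of a family of tensors. -/
theorem IsChart.linSubst_genSeries (he : IsChart e) (he' : IsChart e') {p : M}
    (hp : p ∈ e.source) (hp' : p ∈ e'.source) (A : (n : ℕ) → FlatTensor d n κ) (K : κ → Fin d) :
    linSubst (fun i k => chartJac e e' i k (e p)) (genSeries fun n I => frameComp e' p (A n) I K) =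
      ∑ J : κ → Fin d, genSeries (fun n I => frameComp e p (A n) I J) *
        C (∏ b, chartJac e e' (J b) (K b) (e p)) := by
  refine ext_homValue fun n v => ?_
  have h1 : ∀ (e : OpenPartialHomeomorph M (Vec d)) (v : Fin d → ℝ) (w : κ → Vec d →L[ℝ] ℝ),
      ∑ I : Fin n → Fin d, A n (fun a => chartFrame e (I a) p) w * ∏ j, v (I j) =
        A n (fun _ => ∑ i, v i • chartFrame e i p) w := by
    intro e v w
    classical
    rw [MultilinearMap.map_sum, sum_apply]
    refine sum_congr rfl fun I _ => ?_
    rw [MultilinearMap.map_smul_univ, smul_apply, smul_eq_mul, mul_comm]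
  have h2 : homValue n (∑ J : κ → Fin d, genSeries (fun n I => frameComp e p (A n) I J) *
        C (∏ b, chartJac e e' (J b) (K b) (e p))) v =
      ∑ J : κ → Fin d, homValue n (genSeries fun n I => frameComp e p (A n) I J) v *
        ∏ b, chartJac e e' (J b) (K b) (e p) := by
    simp only [homValue, map_sum, coeff_mul_C, sum_mul]
    rw [sum_comm]
    exact sum_congr rfl fun J _ => sum_congr rfl fun α _ => by ring
  rw [h2, homValue_linSubst, homValue_genSeries]
  simp only [homValue_genSeries, frameComp, h1]
  have h3 : ∑ k, (∑ i, chartJac e e' i k (e p) * v i) • chartFrame e' k p =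
      ∑ i, v i • chartFrame e i p := by
    simp only [he.chartFrame_change he' hp hp', Finset.sum_smul, smul_sum, smul_smul]
    rw [sum_comm]
    exact sum_congr rfl fun i _ => sum_congr rfl fun k _ => by rw [mul_comm]
  refine (h1 e' (fun k => ∑ i, chartJac e e' i k (e p) * v i) _).trans ?_
  rw [h3]
  classical
  simp only [he.chartCovec_change he' hp hp']
  rw [MultilinearMap.map_sum]
  refine sum_congr rfl fun J _ => ?_
  rw [MultilinearMap.map_smul_univ, smul_eq_mul, mul_comm]

variable (nabla : Connection d M)

theorem IsChart.isExpTaylor_change (he : IsChart e) (he' : IsChart e') {x : M}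
    (hx : x ∈ e.source) (hx' : x ∈ e'.source) {g : M → ℝ} {p : FPS d}
    (hp : IsExpTaylor nabla e' x g p) :
    IsExpTaylor nabla e x g (linSubst (fun i k => chartJac e e' i k (e x)) p) := by
  rw [isExpTaylor_iff] at hp ⊢
  intro γ h1 h2 n
  rw [homValue_linSubst, ← hp γ h1 h2 n]
  congr 1
  funext k
  rw [he.deriv_change he' h1.self_of_nhds.1 (by rwa [h2]) (by rwa [h2]), h2]

variable {nabla} [T2Space M] [nabla.ContMDiffCovariantDerivative ∞] (htor : nabla.torsion = 0)

include htor in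
theorem IsChart.expTaylor_change (he : IsChart e) (he' : IsChart e') {x : M}
    (hx : x ∈ e.source) (hx' : x ∈ e'.source) {g : M → ℝ}
    (h : ∃ p, IsExpTaylor nabla e' x g p) : expTaylor nabla e x g =
      linSubst (fun i k => chartJac e e' i k (e x)) (expTaylor nabla e' x g) := by
  obtain ⟨p, hp⟩ := h
  rw [he'.expTaylor_eq_of htor hx' hp]
  exact he.expTaylor_eq_of htor hx (he.isExpTaylor_change nabla he' hx hx' hp)

end PointTensors

section Polarization

variable {d : ℕ}

/-- Polarization: if a polynomial function vanishes, then so do its coefficients, symmetrised with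
respect to the bijections which preserve the colours of the slots. -/
theorem polarize {τ C : Type} [Fintype τ] {κ : τ → Type} [∀ t, Fintype (κ t)]
    [∀ t, DecidableEq (κ t)] [DecidableEq C]
    (col : (t : τ) → κ t → C) (Z : (t : τ) → (κ t → Fin d) → ℝ)
    (hZ : ∀ z : C → Fin d → ℝ, ∑ t, ∑ g, Z t g * ∏ k, z (col t k) (g k) = 0)
    {μ : Type} [Fintype μ] [DecidableEq μ] (colμ : μ → C) (f : μ → Fin d) :
    ∑ t, ∑ h : κ t ≃ μ, (if ∀ k, colμ (h k) = col t k then Z t (f ∘ h) else 0) = 0 := by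
  classical
  let P : MvPolynomial μ ℝ := ∑ t, ∑ h : κ t → μ, if ∀ k, colμ (h k) = col t k then
      MvPolynomial.C (Z t (f ∘ h)) * ∏ k, MvPolynomial.X (h k) else 0
  have hP : P = 0 := by
    refine MvPolynomial.funext fun x => ?_
    rw [map_zero, ← hZ fun c i => ∑ j, if colμ j = c ∧ f j = i then x j else 0, map_sum]
    refine sum_congr rfl fun t _ => ?_
    have h1 : ∀ g : κ t → Fin d, ∏ k, (∑ j, if colμ j = col t k ∧ f j = g k then x j else 0) =
        ∑ h : κ t → μ, if (∀ k, colμ (h k) = col t k) ∧ f ∘ h = g then ∏ k, x (h k) else 0 := by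
      intro g
      rw [prod_univ_sum, Fintype.piFinset_univ]
      refine sum_congr rfl fun h _ => ?_
      rw [Finset.prod_ite_zero]
      simp only [mem_univ, forall_true_left, funext_iff, Function.comp_apply, forall_and]
    simp only [h1, mul_sum]
    rw [map_sum, sum_comm]
    refine sum_congr rfl fun h _ => ?_
    simp only [ite_and, mul_ite, mul_zero]
    split_ifs with h2
    · rw [sum_ite_eq]
      simp
    · simp
  have hc := congrArg (MvPolynomial.coeff (∑ j : μ, Finsupp.single j 1)) hP
  rw [MvPolynomial.coeff_zero, MvPolynomial.coeff_sum] at hc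
  refine Eq.trans (sum_congr rfl fun t _ => ?_) hc
  rw [MvPolynomial.coeff_sum]
  have h3 : ∀ h : κ t → μ, MvPolynomial.coeff (∑ j : μ, Finsupp.single j 1)
      (if ∀ k, colμ (h k) = col t k then
        MvPolynomial.C (Z t (f ∘ h)) * ∏ k, MvPolynomial.X (h k) else 0) =
      if Function.Bijective h then
        (if ∀ k, colμ (h k) = col t k then Z t (f ∘ h) else 0) else 0 := by
    intro h
    have h4 : (∏ k, MvPolynomial.X (h k) : MvPolynomial μ ℝ) =
        MvPolynomial.monomial (∑ k, Finsupp.single (h k) 1) 1 := by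
      rw [MvPolynomial.monomial_sum_one]
      rfl
    have h5 : ((∑ k, Finsupp.single (h k) 1 : μ →₀ ℕ) = ∑ j : μ, Finsupp.single j 1) ↔
        Function.Bijective h := by
      have h6 : ∀ j, (∑ k, Finsupp.single (h k) 1 : μ →₀ ℕ) j =
          (univ.filter fun k => h k = j).card := by
        intro j
        rw [Finsupp.coe_finsetSum, Finset.sum_apply, Finset.card_filter]
        simp only [Finsupp.single_apply]
      have h7 : ∀ j, (∑ j : μ, Finsupp.single j 1 : μ →₀ ℕ) j = 1 := fun j => by
        simp [Finsupp.coe_finsetSum, Finsupp.single_apply]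
      rw [DFunLike.ext_iff, Function.bijective_iff_existsUnique]
      simp only [h6, h7]
      refine forall_congr' fun j => ?_
      rw [Finset.card_eq_one]
      constructor
      · rintro ⟨k, hk⟩
        refine ⟨k, ?_, fun k' hk' => ?_⟩
        · have : k ∈ univ.filter fun k => h k = j := by rw [hk]; simp
          simpa using this
        · have : k' ∈ univ.filter fun k => h k = j := by simpa using hk'
          rw [hk] at this
          simpa using this
      · rintro ⟨k, hk, hk'⟩
        refine ⟨k, ?_⟩
        ext k'
        simp only [mem_filter, mem_univ, true_and, mem_singleton]
        exact ⟨hk' k', fun h => h ▸ hk⟩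
    split_ifs with h8 h9 h9
    · rw [MvPolynomial.coeff_C_mul, h4, MvPolynomial.coeff_monomial, if_pos (h5.2 h9), mul_one]
    · rw [MvPolynomial.coeff_C_mul, h4, MvPolynomial.coeff_monomial, if_neg (mt h5.1 h9), mul_zero]
    · rfl
    · rfl
  simp only [h3]
  rw [← sum_filter Function.Bijective]
  refine Finset.sum_bij' (fun h _ => (h : κ t → μ))
    (fun h (hh : h ∈ univ.filter Function.Bijective) => Equiv.ofBijective h (mem_filter.1 hh).2) ?_ ?_ ?_ ?_ ?_
  · intro h _
    exact mem_filter.2 ⟨mem_univ _, h.bijective⟩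
  · intro h _
    exact mem_univ _
  · intro h _
    ext k
    rfl
  · intro h _
    rfl
  · intro h _
    rfl

/-- A bijection of the slots of blocks which preserves the blocks consists of permutations of the
blocks. -/
theorem exists_sigmaCongrRight {m : ℕ} {a : Fin m → ℕ} (h : Blocks a ≃ Blocks a)
    (hh : ∀ b, (h b).1 = b.1) :
    ∃ σ : (l : Fin m) → Equiv.Perm (Fin (a l)), h = Equiv.sigmaCongrRight σ := by
  have h1 : ∀ l j, ∃ k, h ⟨l, j⟩ = ⟨l, k⟩ := fun l j => by
    have h2 := hh ⟨l, j⟩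
    generalize h ⟨l, j⟩ = b at h2
    obtain ⟨l', k⟩ := b
    obtain rfl : l' = l := h2
    exact ⟨k, rfl⟩
  choose g hg using h1
  have hinj : ∀ l, Function.Injective (g l) := fun l j j' hj => by
    have h2 : h ⟨l, j⟩ = h ⟨l, j'⟩ := by rw [hg, hg, hj]
    exact eq_of_heq (Sigma.mk.inj (h.injective h2)).2
  refine ⟨fun l => Equiv.ofBijective (g l) (Finite.injective_iff_bijective.1 (hinj l)), ?_⟩
  ext1 ⟨l, j⟩
  exact hg l j

theorem orders_eq_of_equiv {m : ℕ} {a b : Fin m → ℕ} (h : Blocks a ≃ Blocks b)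
    (hh : ∀ k, (h k).1 = k.1) : a = b := by
  classical
  have key : ∀ (a : Fin m → ℕ) l, (univ.filter fun k : Blocks a => k.1 = l).card = a l := by
    intro a l
    have h1 : (univ.filter fun k : Blocks a => k.1 = l) =
        (univ : Finset (Fin (a l))).map (Function.Embedding.sigmaMk l) := by
      ext ⟨l', j⟩
      simp only [mem_filter, mem_univ, true_and, mem_map, Function.Embedding.sigmaMk_apply]
      constructor
      · rintro rfl
        exact ⟨j, rfl⟩
      · rintro ⟨k, hk⟩
        exact (Sigma.mk.inj hk).1.symm
    rw [h1, Finset.card_map, card_univ, Fintype.card_fin]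
  funext l
  rw [← key a l, ← key b l]
  refine Finset.card_bij (fun k _ => h k) ?_ (fun k _ k' _ hk => h.injective hk) ?_
  · intro k hk
    simpa [hh] using hk
  · intro k hk
    exact ⟨h.symm k, by simpa [← hh (h.symm k)] using hk, by simp⟩

/-- Invariance under the permutations of the slots within each block. -/
def BlockSymm {m : ℕ} {R : Type*} {a : Fin m → ℕ} (c : (Blocks a → Fin d) → R) : Prop :=
  ∀ (σ : (l : Fin m) → Equiv.Perm (Fin (a l))) J, c (J ∘ Equiv.sigmaCongrRight σ) = c J

/-- The coefficients of a polynomial in several vectors, symmetric in the slots of each vector, are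
determined by the polynomial. -/
theorem blockSymm_eq_zero {m : ℕ} {A : Finset (Fin m → ℕ)}
    (c : Coeffs m d ℝ) (hs : ∀ a ∈ A, BlockSymm (c a))
    (h : ∀ ξ : Fin m → Fin d → ℝ, ∑ a ∈ A, ∑ J, c a J * ∏ b : Blocks a, ξ b.1 (J b) = 0) :
    ∀ a ∈ A, ∀ J, c a J = 0 := by
  classical
  intro a ha J
  have h1 := polarize (τ := A) (C := Fin m) (κ := fun a => Blocks a.1) (fun _ b => b.1)
    (fun a => c a.1) (fun z => by
      rw [← h z, ← sum_coe_sort A]) (μ := Blocks a) (fun b => b.1) J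
  rw [sum_eq_single ⟨a, ha⟩] at h1
  · have h2 : ∀ g : Blocks a ≃ Blocks a, (if ∀ k, (g k).1 = k.1 then c a (J ∘ g) else 0) =
        (if ∀ k, (g k).1 = k.1 then 1 else 0) * c a J := by
      intro g
      split_ifs with hg
      · obtain ⟨σ, rfl⟩ := exists_sigmaCongrRight g hg
        rw [hs a ha σ J, one_mul]
      · rw [zero_mul]
    have h3 : ∑ g : Blocks a ≃ Blocks a, (if ∀ k, (g k).1 = k.1 then (1 : ℝ) else 0) * c a J = 0 := by
      refine Eq.trans (sum_congr (by ext; simp) fun g _ => ?_) h1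
      rw [← h2]
    rw [← sum_mul, mul_eq_zero] at h3
    refine h3.resolve_left (ne_of_gt ?_)
    refine Finset.sum_pos' (fun g _ => by split_ifs <;> norm_num) ⟨Equiv.refl _, mem_univ _, ?_⟩
    simp
  · rintro ⟨b, hb⟩ _ hne
    refine sum_eq_zero fun g _ => if_neg fun hg => hne ?_
    exact Subtype.ext (orders_eq_of_equiv g hg)
  · intro h
    exact absurd (mem_univ _) h

end Polarization

section GenPoly

variable {d : ℕ} {R : Type*} [CommRing R]

/-- The homogeneous polynomial `∑ t_{i_1 … i_n} y^{i_1} ⋯ y^{i_n}`. -/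
def genPoly {n : ℕ} (t : (Fin n → Fin d) → R) : Series d R := ∑ I, C (t I) * ∏ j, X (I j)

lemma hom_prod_X {n : ℕ} (k : ℕ) (I : Fin n → Fin d) :
    hom k (∏ j, X (I j) : Series d R) = if k = n then ∏ j, X (I j) else 0 := by
  induction n generalizing k with
  | zero =>
    have h := hom_C (d := d) k (1 : R)
    rw [map_one] at h
    simpa using h
  | succ n ih =>
    rw [Fin.prod_univ_succ]
    cases k with
    | zero => rw [hom_zero_X_mul, if_neg (by omega)]
    | succ k =>
      rw [hom_succ_X_mul, ih]
      simp only [Nat.add_right_cancel_iff]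
      split_ifs <;> simp

lemma hom_genPoly {n : ℕ} (k : ℕ) (t : (Fin n → Fin d) → R) :
    hom k (genPoly t) = if k = n then genPoly t else 0 := by
  rw [genPoly, map_sum]
  simp only [hom_C_mul, hom_prod_X]
  split_ifs <;> simp

lemma hom_genPoly_self {n : ℕ} (t : (Fin n → Fin d) → R) : hom n (genPoly t) = genPoly t := by
  rw [hom_genPoly, if_pos rfl]

lemma genPoly_zero_arity (t : (Fin 0 → Fin d) → R) : genPoly t = C (t Fin.elim0) := by
  rw [genPoly, Fintype.sum_unique]
  simp only [Finset.univ_eq_empty, Finset.prod_empty, mul_one]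
  congr

lemma genPoly_succ {n : ℕ} (t : (Fin (n + 1) → Fin d) → R) :
    genPoly t = ∑ i, X i * genPoly fun I => t (Fin.cons i I) := by
  rw [genPoly, ← (Fin.consEquiv fun _ => Fin d).sum_comp, Fintype.sum_prod_type]
  refine sum_congr rfl fun i _ => ?_
  rw [genPoly, mul_sum]
  refine sum_congr rfl fun I _ => ?_
  rw [Fin.prod_univ_succ]
  simp only [Fin.consEquiv, Equiv.coe_fn_mk, Fin.cons_zero, Fin.cons_succ]
  ring

lemma genPoly_add {n : ℕ} (t t' : (Fin n → Fin d) → R) :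
    genPoly (fun I => t I + t' I) = genPoly t + genPoly t' := by
  simp only [genPoly, map_add, add_mul, sum_add_distrib]

lemma genPoly_neg {n : ℕ} (t : (Fin n → Fin d) → R) : genPoly (fun I => - t I) = - genPoly t := by
  simp only [genPoly, map_neg, neg_mul, sum_neg_distrib]

lemma genPoly_C_mul {n : ℕ} (r : R) (t : (Fin n → Fin d) → R) :
    genPoly (fun I => r * t I) = C r * genPoly t := by
  simp only [genPoly, map_mul, mul_assoc, mul_sum]

lemma genPoly_sum {ι : Type*} (u : Finset ι) {n : ℕ} (t : ι → (Fin n → Fin d) → R) :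
    genPoly (fun I => ∑ i ∈ u, t i I) = ∑ i ∈ u, genPoly (t i) := by
  simp only [genPoly, map_sum, sum_mul]
  exact sum_comm

lemma genPoly_comp_perm {n : ℕ} (t : (Fin n → Fin d) → R) (σ : Equiv.Perm (Fin n)) :
    genPoly (fun I => t (I ∘ σ)) = genPoly t := by
  rw [genPoly, genPoly, ← (Equiv.arrowCongr σ (Equiv.refl (Fin d))).symm.sum_comp (fun I =>
    C (t I) * ∏ j, X (I j))]
  refine sum_congr rfl fun I _ => ?_
  congr 1
  exact (Equiv.prod_comp σ fun j => (X (I j) : Series d R)).symm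

lemma hom_genSeries (T : (n : ℕ) → (Fin n → Fin d) → ℝ) (n : ℕ) :
    hom n (genSeries T) = genPoly (T n) := by
  refine ext_homValue fun k v => ?_
  rw [← homValue_hom, hom_hom, ← homValue_hom k (genPoly _), hom_genPoly]
  split_ifs with h
  · subst h
    rw [homValue_hom, homValue_genSeries]
    have h1 : genPoly (T k) = ((∑ I, MvPolynomial.C (T k I) * ∏ j, MvPolynomial.X (I j) :
        MvPolynomial (Fin d) ℝ) : FPS d) := by
      rw [coe_sum_mvPolynomial]
      refine sum_congr rfl fun I _ => ?_
      rw [MvPolynomial.coe_mul, MvPolynomial.coe_C]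
      congr 1
      have := map_prod (MvPolynomial.coeToMvPowerSeries.ringHom (σ := Fin d) (R := ℝ))
        (fun j => MvPolynomial.X (I j)) univ
      refine Eq.trans (prod_congr rfl fun j _ => ?_) this.symm
      exact (MvPolynomial.coe_X (I j)).symm
    rw [h1, homValue_coe _ _ (by rw [← h1, hom_genPoly_self])]
    simp
  · rfl

lemma genPoly_eq_zero {n : ℕ} {t : (Fin n → Fin d) → ℝ} (hs : ∀ (σ : Equiv.Perm (Fin n)) I,
    t (I ∘ σ) = t I) (h : genPoly t = 0) (I : Fin n → Fin d) : t I = 0 := by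
  have h1 : ∀ v : Fin d → ℝ, ∑ I, t I * ∏ j, v (I j) = 0 := fun v => by
    let T : (k : ℕ) → (Fin k → Fin d) → ℝ := fun k => if h : k = n then h ▸ t else 0
    have h2 : T n = t := by simp [T]
    have h3 := homValue_genSeries T n v
    rw [← homValue_hom, hom_genSeries, h2, h] at h3
    rw [← h3]
    simp [homValue]
  have h2 := polarize (τ := Unit) (C := Unit) (κ := fun _ => Fin n) (fun _ _ => ()) (fun _ => t)
    (fun z => by simpa using h1 (z ())) (μ := Fin n) (fun _ => ()) I
  simp only [implies_true, if_true, Finset.univ_unique, sum_singleton] at h2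
  rw [sum_congr rfl fun σ _ => hs σ I, sum_const, nsmul_eq_mul, mul_eq_zero] at h2
  refine h2.resolve_left ?_
  rw [card_univ, Fintype.card_perm]
  exact_mod_cast (Nat.factorial_ne_zero _)

lemma pdList_pderiv (L : List (Fin d)) (i : Fin d) (s : Series d R) :
    pdList R L (pderiv R i s) = pderiv R i (pdList R L s) := by
  induction L with
  | nil => rfl
  | cons j L ih => rw [pdList_cons, pdList_cons, ih, pderiv_comm]

lemma pdList_perm {L L' : List (Fin d)} (h : L.Perm L') (s : Series d R) :
    pdList R L s = pdList R L' s := by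
  induction h with
  | nil => rfl
  | cons i _ ih => rw [pdList_cons, pdList_cons, ih]
  | swap i j L => rw [pdList_cons, pdList_cons, pdList_cons, pdList_cons, pderiv_comm]
  | trans _ _ h1 h2 => rw [h1, h2]

lemma pdList_ofFn_comp {n : ℕ} (I : Fin n → Fin d) (σ : Equiv.Perm (Fin n))
    (s : Series d R) : pdList R (List.ofFn (I ∘ σ)) s = pdList R (List.ofFn I) s :=
  pdList_perm (σ.ofFn_comp_perm I) s

variable [Algebra ℝ R]

/-- The symmetric coefficients of a formal series. -/
def symCoeff (s : Series d R) (n : ℕ) (I : Fin n → Fin d) : R :=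
  ((n.factorial : ℝ)⁻¹) • constantCoeff (pdList R (List.ofFn I) s)

lemma symCoeff_comp (s : Series d R) (n : ℕ) (I : Fin n → Fin d)
    (σ : Equiv.Perm (Fin n)) : symCoeff s n (I ∘ σ) = symCoeff s n I := by
  rw [symCoeff, symCoeff, pdList_ofFn_comp]

lemma genPoly_symCoeff (s : Series d R) (n : ℕ) : genPoly (symCoeff s n) = hom n s := by
  induction n generalizing s with
  | zero =>
    rw [genPoly_zero_arity, hom_zero_eq, symCoeff]
    simp [pdList_nil]
  | succ n ih =>
    have h1 : (n + 1 : ℕ) • hom (n + 1) s = (n + 1 : ℕ) • genPoly (symCoeff s (n + 1)) := by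
      rw [← ConnRing.hom_eul, ← ConnRing.sum_X_mul_pderiv, map_sum, genPoly_succ, smul_sum]
      refine sum_congr rfl fun i _ => ?_
      rw [hom_succ_X_mul, ← ih, ← mul_smul_comm]
      congr 1
      rw [← Nat.cast_smul_eq_nsmul R, genPoly, genPoly, smul_sum]
      refine sum_congr rfl fun I _ => ?_
      rw [← smul_mul_assoc, smul_eq_C_mul, ← map_mul]
      congr 2
      rw [symCoeff, symCoeff, List.ofFn_succ]
      simp only [Fin.cons_zero, Fin.cons_succ]
      rw [pdList_cons, pdList_pderiv, Nat.factorial_succ, ← nsmul_eq_mul,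
        ← Nat.cast_smul_eq_nsmul ℝ, smul_smul]
      congr 1
      push_cast
      have : (n.factorial : ℝ) ≠ 0 := by exact_mod_cast n.factorial_ne_zero
      have : (n : ℝ) + 1 ≠ 0 := by positivity
      field_simp
    have h2 := congrArg (fun z => (((n + 1 : ℕ) : ℝ)⁻¹) • z) h1
    simp only [← Nat.cast_smul_eq_nsmul ℝ, smul_smul] at h2
    have h3 : (((n + 1 : ℕ) : ℝ)⁻¹ * ((n + 1 : ℕ) : ℝ)) = 1 := inv_mul_cancel₀ (by positivity)
    rw [h3, one_smul, one_smul] at h2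
    exact h2.symm

lemma genSeries_symCoeff (s : FPS d) : genSeries (symCoeff s) = s :=
  ext_hom fun n => by rw [hom_genSeries, genPoly_symCoeff]

/-- A symmetric family of coefficients is determined by its series. -/
lemma symCoeff_genSeries {T : (n : ℕ) → (Fin n → Fin d) → ℝ} {n : ℕ}
    (hs : ∀ (σ : Equiv.Perm (Fin n)) I, T n (I ∘ σ) = T n I) (I : Fin n → Fin d) :
    symCoeff (genSeries T) n I = T n I := by
  refine sub_eq_zero.1 (genPoly_eq_zero (t := fun I => symCoeff (genSeries T) n I - T n I)
    (fun σ I => by rw [symCoeff_comp, hs]) ?_ I)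
  simp only [sub_eq_add_neg]
  rw [genPoly_add, genPoly_neg, genPoly_symCoeff, hom_genSeries, add_neg_cancel]

end GenPoly

section Exponential

variable {d m : ℕ}

/-- The series `exp(ξ_1 y^1 + ⋯ + ξ_d y^d)`. -/
def expSeries (ξ : Fin d → ℝ) : FPS d := fun α => ∏ i, ξ i ^ α i / (α i).factorial

lemma pderiv_expSeries (ξ : Fin d → ℝ) (i : Fin d) :
    pderiv ℝ i (expSeries ξ) = C (ξ i) * expSeries ξ := by
  ext α
  rw [coeff_pderiv, coeff_C_mul]
  change (∏ j : Fin d, ξ j ^ (α + Finsupp.single i 1 : Fin d →₀ ℕ) j /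
    ((α + Finsupp.single i 1 : Fin d →₀ ℕ) j).factorial) * (α i + 1 : ℝ) = ξ i * ∏ j : Fin d, ξ j ^ α j / (α j).factorial
  rw [← mul_prod_erase _ _ (mem_univ i),
    ← mul_prod_erase _ (fun j => ξ j ^ α j / (α j).factorial) (mem_univ i)]
  have h : ∏ j ∈ univ.erase i, ξ j ^ (α + Finsupp.single i 1 : Fin d →₀ ℕ) j /
      ((α + Finsupp.single i 1 : Fin d →₀ ℕ) j).factorial =
      ∏ j ∈ univ.erase i, ξ j ^ α j / (α j).factorial :=
    prod_congr rfl fun j hj => by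
      rw [Finsupp.add_apply, Finsupp.single_eq_of_ne (ne_of_mem_erase hj), add_zero]
  rw [h, Finsupp.add_apply, Finsupp.single_eq_same, Nat.factorial_succ, pow_succ]
  push_cast
  have : ((α i).factorial : ℝ) ≠ 0 := by exact_mod_cast (α i).factorial_ne_zero
  have : (α i : ℝ) + 1 ≠ 0 := by positivity
  field_simp

lemma constantCoeff_expSeries (ξ : Fin d → ℝ) : constantCoeff (expSeries ξ) = 1 := by
  change ∏ i : Fin d, ξ i ^ (0 : Fin d →₀ ℕ) i / (((0 : Fin d →₀ ℕ) i).factorial : ℝ) = 1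
  simp

lemma isUnit_prod_expSeries (ξ : Fin m → Fin d → ℝ) : IsUnit (∏ l, expSeries (ξ l)) := by
  rw [MvPowerSeries.isUnit_iff_constantCoeff, map_prod]
  simp [constantCoeff_expSeries]

lemma pdList_expSeries {n : ℕ} (ξ : Fin d → ℝ) (J : Fin n → Fin d) :
    pdList ℝ (List.ofFn J) (expSeries ξ) = C (∏ j, ξ (J j)) * expSeries ξ := by
  induction n with
  | zero => simp [pdList_nil]
  | succ n ih =>
    rw [List.ofFn_succ, pdList_cons, ih, ← smul_eq_C_mul, Derivation.map_smul,
      pderiv_expSeries, smul_eq_C_mul, ← mul_assoc, ← map_mul, Fin.prod_univ_succ,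
      mul_comm (ξ (J 0))]

lemma dop_expSeries (A : Finset (Fin m → ℕ)) (c : Coeffs m d (FPS d)) (ξ : Fin m → Fin d → ℝ) :
    dop A c (fun l => expSeries (ξ l)) = (∑ a ∈ A, ∑ J, c a J * C (∏ b : Blocks a, ξ b.1 (J b))) *
        ∏ l, expSeries (ξ l) := by
  rw [dop_apply, sum_mul]
  refine sum_congr rfl fun a _ => ?_
  rw [sum_mul]
  refine sum_congr rfl fun J _ => ?_
  simp only [blockList, pdList_expSeries]
  rw [prod_mul_distrib, ← map_prod, Fintype.prod_sigma, mul_assoc]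

/-- A fiberwise polydifferential operator determines its symmetric coefficients. -/
theorem eq_zero_of_dop_eq_zero {A : Finset (Fin m → ℕ)}
    {c : Coeffs m d (FPS d)} (hs : ∀ a ∈ A, BlockSymm (c a))
    (h : ∀ s, dop A c s = 0) : ∀ a ∈ A, ∀ J, c a J = 0 := by
  intro a ha J
  ext α
  refine blockSymm_eq_zero (A := A) (fun a J => coeff α (c a J))
    (fun a ha σ J => congrArg _ (hs a ha σ J)) (fun ξ => ?_) a ha J
  have h1 := h fun l => expSeries (ξ l)
  rw [dop_expSeries, (isUnit_prod_expSeries ξ).mul_left_eq_zero] at h1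
  have h2 := congrArg (coeff α) h1
  rw [map_zero, map_sum] at h2
  simpa only [map_sum, coeff_mul_C] using h2

theorem eq_zero_of_constantCoeff_dop {A : Finset (Fin m → ℕ)}
    {T : Coeffs m d ℝ} (hs : ∀ a ∈ A, BlockSymm (T a))
    (h : ∀ s, hom 0 (dop A (fun a J => C (T a J)) s) = 0) :
    ∀ a ∈ A, ∀ J, T a J = 0 := by
  refine blockSymm_eq_zero (A := A) T hs fun ξ => ?_
  have h1 := h fun l => expSeries (ξ l)
  rw [dop_expSeries, hom_zero_eq, map_mul, map_prod] at h1
  have h2 := congrArg constantCoeff h1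
  simpa [constantCoeff_expSeries] using h2

lemma hom_dop_eq_zero_of_tauAt (c : LocalConn d) (q : c.dom) {A : Finset (Fin m → ℕ)}
    {C : Coeffs m d (FPS d)} (n : ℕ)
    (h : ∀ g : Fin m → smoothRing c.dom, hom n (dop A C fun l => tauAt c q (g l)) = 0)
    (s : Fin m → FPS d) : hom n (dop A C s) = 0 := by
  choose g hg using fun l => exists_tauAt_agreeTo c q (s l) (n + 1 + orderBound A)
  rw [← h g]
  exact (filtContinuous_dop A C (n + 1) _ _ hg n (Nat.lt_succ_self n)).symm

end Exponential

section Expansion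

variable {d m : ℕ}

/-- The composition of the derivations with indices in a list. -/
def derList {R : Type*} [CommRing R] [Algebra ℝ R] (δ : Fin d → Derivation ℝ R R) :
    List (Fin d) → R → R
  | [], x => x
  | i :: L, x => δ i (derList δ L x)

lemma derList_perm {R : Type*} [CommRing R] [Algebra ℝ R] {δ : Fin d → Derivation ℝ R R}
    (hδ : ∀ i j f, δ i (δ j f) = δ j (δ i f)) {L L' : List (Fin d)} (h : L.Perm L') (x : R) :
    derList δ L x = derList δ L' x := by
  induction h with
  | nil => rfl
  | cons i _ ih => rw [derList, derList, ih]
  | swap i j L => rw [derList, derList, derList, derList, hδ]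
  | trans _ _ h1 h2 => rw [h1, h2]

variable {P : Type*} [CommRing P] [Algebra ℝ P] {G : Type*} {δ : Fin d → Derivation ℝ P P}
  {D : List (Fin d) → G → P} {w : Fin d → Fin d → P}

theorem exists_expansion (hD : ∀ k L g, δ k (D L g) = ∑ j, w k j * D (j :: L) g)
    (L : List (Fin d)) : ∃ c : (n : ℕ) → (Fin n → Fin d) → P, (∀ n > L.length, c n = 0) ∧
      ∀ N ≥ L.length, ∀ g, derList δ L (D [] g) =
        ∑ n ∈ Finset.range (N + 1), ∑ J, c n J * D (List.ofFn J) g := by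
  induction L with
  | nil =>
    refine ⟨fun n _ => if n = 0 then 1 else 0, fun n hn => ?_, fun N _ g => ?_⟩
    · funext _
      exact if_neg (Nat.ne_of_gt hn)
    · rw [sum_eq_single 0]
      · rw [Fintype.sum_unique]
        simp [derList]
      · intro n _ hn
        simp [hn]
      · simp
  | cons i L ih =>
    obtain ⟨c, h0, hc⟩ := ih
    let c' : (n : ℕ) → (Fin n → Fin d) → P
      | 0, _ => 0
      | n + 1, J => w i (J 0) * c n (Fin.tail J)
    refine ⟨fun n J => δ i (c n J) + c' n J, fun n hn => ?_, fun N hN g => ?_⟩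
    · cases n with
      | zero => simp at hn
      | succ n =>
        funext J
        rw [List.length_cons] at hn
        simp [c', h0 n (by omega), h0 (n + 1) (by omega)]
    · rw [derList]
      cases N with
      | zero => simp at hN
      | succ N =>
        rw [List.length_cons] at hN
        simp only [add_mul, sum_add_distrib]
        rw [Finset.sum_range_succ' (fun n => ∑ J, c' n J * D (List.ofFn J) g)]
        rw [Finset.sum_range_succ (fun n => ∑ J, δ i (c n J) * D (List.ofFn J) g)]
        have h1 : ∑ J, δ i (c (N + 1) J) * D (List.ofFn J) g = 0 := by
          simp [h0 (N + 1) (by omega)]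
        have h2 : ∑ J, c' 0 J * D (List.ofFn J) g = 0 := by simp [c']
        rw [h1, h2, add_zero, add_zero, hc N (by omega), map_sum, ← sum_add_distrib]
        refine sum_congr rfl fun n _ => ?_
        rw [map_sum, ← (Fin.consEquiv fun _ => Fin d).sum_comp, Fintype.sum_prod_type_right,
          ← sum_add_distrib]
        refine sum_congr rfl fun J _ => ?_
        rw [Derivation.leibniz, hD, smul_eq_mul, smul_eq_mul, add_comm, mul_comm (D _ _)]
        congr 1
        rw [mul_sum]
        refine sum_congr rfl fun j _ => ?_
        simp only [c', Fin.consEquiv, Equiv.coe_fn_mk, Fin.cons_zero, Fin.tail_cons,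
          List.ofFn_succ, Fin.cons_succ]
        ring

/-- The arities bounded by `N`. -/
def arityBox (m N : ℕ) : Finset (Fin m → ℕ) := Fintype.piFinset fun _ => Finset.range (N + 1)

lemma mem_arityBox {N : ℕ} {a : Fin m → ℕ} : a ∈ arityBox m N ↔ ∀ l, a l ≤ N := by
  simp [arityBox]

lemma exists_arityBox (A : Finset (Fin m → ℕ)) : ∃ N, A ⊆ arityBox m N :=
  ⟨A.sup fun a => ∑ l, a l, fun _ ha => mem_arityBox.2 fun l =>
    (Finset.single_le_sum (fun _ _ => Nat.zero_le _) (mem_univ l)).trans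
      (Finset.le_sup (f := fun a => ∑ l, a l) ha)⟩

theorem exists_multi_expansion (hD : ∀ k L g, δ k (D L g) = ∑ j, w k j * D (j :: L) g)
    {N : ℕ} {a : Fin m → ℕ} (ha : ∀ l, a l ≤ N) (J : Blocks a → Fin d) :
    ∃ c : Coeffs m d P, ∀ g : Fin m → G, ∏ l, derList δ (blockList J l) (D [] (g l)) =
        ∑ b ∈ arityBox m N, ∑ K, c b K * ∏ l, D (blockList K l) (g l) := by
  choose c _ hc using fun l => exists_expansion hD (blockList J l)
  refine ⟨fun b K => ∏ l, c l (b l) fun j => K ⟨l, j⟩, fun g => ?_⟩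
  have h1 : ∀ l, derList δ (blockList J l) (D [] (g l)) =
      ∑ n ∈ Finset.range (N + 1), ∑ K, c l n K * D (List.ofFn K) (g l) := fun l =>
    hc l N (by rw [length_blockList]; exact ha l) (g l)
  simp only [h1]
  rw [prod_univ_sum]
  refine sum_congr rfl fun b _ => ?_
  rw [prod_sum_blocks]
  refine sum_congr rfl fun K _ => ?_
  rw [prod_mul_distrib]
  rfl

/-- Every operator which is a polynomial in the derivations `δ` has an expansion with block
symmetric coefficients in terms of the operators `D`. -/
theorem exists_symm_expansion (hD : ∀ k L g, δ k (D L g) = ∑ j, w k j * D (j :: L) g)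
    (hp : ∀ {L L' : List (Fin d)} (_ : L.Perm L') g, D L g = D L' g)
    (A : Finset (Fin m → ℕ)) (k : Coeffs m d P) :
    ∃ (N : ℕ) (c : Coeffs m d P),
      (∀ b, BlockSymm (c b)) ∧ (∀ b ∉ arityBox m N, ∀ J, c b J = 0) ∧ ∀ g : Fin m → G,
      ∑ a ∈ A, ∑ J, k a J * ∏ l, derList δ (blockList J l) (D [] (g l)) =
        ∑ b ∈ arityBox m N, ∑ K, c b K * ∏ l, D (blockList K l) (g l) := by
  classical
  obtain ⟨N, hN⟩ := exists_arityBox A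
  have h1 : ∀ a J, ∃ c : Coeffs m d P, a ∈ A → ∀ g : Fin m → G,
      ∏ l, derList δ (blockList J l) (D [] (g l)) =
        ∑ b ∈ arityBox m N, ∑ K, c b K * ∏ l, D (blockList K l) (g l) := fun a J => by
    by_cases ha : a ∈ A
    · obtain ⟨c, hc⟩ := exists_multi_expansion (m := m) hD (mem_arityBox.1 (hN ha)) J
      exact ⟨c, fun _ => hc⟩
    · exact ⟨fun _ _ => 0, fun h => absurd h ha⟩
  choose c hc using h1
  let c₁ : Coeffs m d P := fun b K => ∑ a ∈ A, ∑ J, k a J * c a J b K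
  have h2 : ∀ g : Fin m → G, ∑ a ∈ A, ∑ J, k a J * ∏ l, derList δ (blockList J l) (D [] (g l)) =
        ∑ b ∈ arityBox m N, ∑ K, c₁ b K * ∏ l, D (blockList K l) (g l) := fun g => by
    have h3 : ∀ a ∈ A, ∑ J, k a J * ∏ l, derList δ (blockList J l) (D [] (g l)) =
        ∑ b ∈ arityBox m N, ∑ K, (∑ J, k a J * c a J b K) * ∏ l, D (blockList K l) (g l) := by
      intro a ha
      have h4 : ∀ J, k a J * ∏ l, derList δ (blockList J l) (D [] (g l)) =
          ∑ b ∈ arityBox m N, ∑ K, k a J * c a J b K * ∏ l, D (blockList K l) (g l) := fun J => by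
        rw [hc a J ha g, mul_sum]
        refine sum_congr rfl fun b _ => ?_
        rw [mul_sum]
        exact sum_congr rfl fun K _ => (mul_assoc _ _ _).symm
      rw [sum_congr rfl fun J _ => h4 J, sum_comm]
      refine sum_congr rfl fun b _ => ?_
      rw [sum_comm]
      exact sum_congr rfl fun K _ => (sum_mul _ _ _).symm
    rw [sum_congr rfl h3, sum_comm]
    refine sum_congr rfl fun b _ => ?_
    rw [sum_comm]
    exact sum_congr rfl fun K _ => (sum_mul _ _ _).symm
  let c₂ : Coeffs m d P := fun b K => if b ∈ arityBox m N then
    ((Fintype.card ((l : Fin m) → Equiv.Perm (Fin (b l))) : ℝ)⁻¹) •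
      ∑ σ : (l : Fin m) → Equiv.Perm (Fin (b l)), c₁ b (K ∘ Equiv.sigmaCongrRight σ) else 0
  refine ⟨N, c₂, fun b ρ J => ?_, fun b hb J => if_neg hb, fun g => ?_⟩
  · simp only [c₂]
    split_ifs
    · congr 1
      exact Eq.trans (sum_congr rfl fun σ _ => rfl)
        (Equiv.sum_comp (Equiv.mulLeft ρ) fun σ => c₁ b (J ∘ Equiv.sigmaCongrRight σ))
    · rfl
  · rw [h2]
    refine sum_congr rfl fun b hb => ?_
    simp only [c₂, if_pos hb, smul_mul_assoc, sum_mul]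
    rw [← smul_sum, sum_comm]
    have h5 : ∀ σ : (l : Fin m) → Equiv.Perm (Fin (b l)),
        ∑ K, c₁ b (K ∘ Equiv.sigmaCongrRight σ) * ∏ l, D (blockList K l) (g l) =
        ∑ K, c₁ b K * ∏ l, D (blockList K l) (g l) := fun σ => by
      rw [← (Equiv.arrowCongr (Equiv.sigmaCongrRight σ) (Equiv.refl (Fin d))).sum_comp]
      refine sum_congr rfl fun K _ => ?_
      congr 1
      · congr 1
        funext x
        simp [Equiv.arrowCongr]
      · refine prod_congr rfl fun l _ => ?_
        refine hp ?_ (g l)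
        exact Equiv.Perm.ofFn_comp_perm (σ l).symm fun j => K ⟨l, j⟩
    rw [sum_congr rfl fun σ _ => h5 σ, sum_const, card_univ,
      ← Nat.cast_smul_eq_nsmul ℝ, smul_smul, inv_mul_cancel₀, one_smul]
    exact_mod_cast Fintype.card_ne_zero

end Expansion

section Quantization

variable {d m : ℕ} {R : Type*} [CommRing R] [Algebra ℝ R]

/-- The polydifferential operator with given coefficients. -/
def diffOp (Q : ConnRing d R) (A : Finset (Fin m → ℕ)) (k : Coeffs m d R) (g : Fin m → R) : R :=
  ∑ a ∈ A, ∑ J, k a J * ∏ l, derList Q.der (blockList J l) (g l)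

variable (Q : ConnRing d R)

lemma ConnRing.tau_sum {ι : Type*} (u : Finset ι) (f : ι → R) :
    Q.tau (∑ i ∈ u, f i) = ∑ i ∈ u, Q.tau (f i) := map_sum Q.tauHom f u

lemma ConnRing.tau_prod {ι : Type*} (u : Finset ι) (f : ι → R) :
    Q.tau (∏ i ∈ u, f i) = ∏ i ∈ u, Q.tau (f i) := map_prod Q.tauHom f u

lemma ConnRing.derList_nrm_tau (L : List (Fin d)) (g : R) :
    derList Q.nrm L (Q.tau g) = Q.tau (derList Q.der L g) := by
  induction L with
  | nil => rfl
  | cons i L ih => rw [derList, derList, ih, Q.nrm_tau]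

theorem ConnRing.exists_lift (A : Finset (Fin m → ℕ)) (k : Coeffs m d R) :
    ∃ (N : ℕ) (C : Coeffs m d (Series d R)),
      (∀ b, BlockSymm (C b)) ∧ (∀ b ∉ arityBox m N, ∀ J, C b J = 0) ∧ ∀ g : Fin m → R,
        dop (arityBox m N) C (fun l => Q.tau (g l)) = Q.tau (diffOp Q A k g) := by
  obtain ⟨N, C, h1, h2, h3⟩ := exists_symm_expansion (m := m) (δ := Q.nrm)
    (D := fun L s => pdList R L s) (w := fun k j => Q.jacInv j k)
    (fun k L s => by rw [ConnRing.nrm, vert_apply]; rfl) (fun h s => pdList_perm h s) A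
    (fun a J => Q.tau (k a J))
  refine ⟨N, C, h1, h2, fun g => ?_⟩
  rw [dop_apply, ← h3, diffOp, Q.tau_sum]
  refine sum_congr rfl fun a _ => ?_
  rw [Q.tau_sum]
  refine sum_congr rfl fun J _ => ?_
  rw [Q.tau_mul, Q.tau_prod]
  simp only [pdList_nil, Q.derList_nrm_tau]

theorem ConnRing.exists_descent (A : Finset (Fin m → ℕ)) (C : Coeffs m d (Series d R)) :
    ∃ (N : ℕ) (k : Coeffs m d R), ∀ g : Fin m → R,
      constantCoeff (dop A C fun l => Q.tau (g l)) = diffOp Q (arityBox m N) k g := by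
  obtain ⟨N, c, -, -, h3⟩ := exists_symm_expansion (m := m)
    (δ := fun k => (pderiv R k).restrictScalars ℝ)
    (D := fun L g => Q.tau (derList Q.der L g)) (w := fun k j => Q.jac j k)
    (fun k L g => by
      refine (Q.pderiv_tau k _).trans (sum_congr rfl fun j _ => mul_comm _ _))
    (fun h g => by rw [derList_perm Q.der_comm h]) A C
  refine ⟨N, fun b J => constantCoeff (c b J), fun g => ?_⟩
  have h4 : ∀ L (s : Series d R),
      derList (fun k => (pderiv R k).restrictScalars ℝ) L s = pdList R L s := by
    intro L s
    induction L with
    | nil => rfl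
    | cons i L ih => rw [derList, pdList_cons, ih]; rfl
  have h5 := h3 g
  simp only [h4] at h5
  rw [dop_apply]
  refine (congrArg _ h5).trans ?_
  simp only [map_sum, map_mul, map_prod, Q.constantCoeff_tau]
  rfl

/-- The components of the lift of a polyvector field. -/
def ConnRing.liftPoly (F : (Fin m → Fin d) → R) (K : Fin m → Fin d) : Series d R :=
  ∑ I : Fin m → Fin d, (∏ a, Q.jacInv (K a) (I a)) * Q.tau (F I)

lemma dop_firstOrder {B : Type*} [CommRing B] (c : (Fin m → Fin d) → Series d B)
    (s : Fin m → Series d B) :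
    dop {1} (firstOrder c) s = ∑ J : Fin m → Fin d, c J * ∏ a, pderiv B (J a) (s a) := by
  rw [dop_apply, sum_singleton, ← (Equiv.arrowCongr (blocksOne m) (Equiv.refl (Fin d))).sum_comp]
  refine sum_congr rfl fun J _ => ?_
  rw [firstOrder_one]
  congr 1

lemma ConnRing.dop_liftPoly (F : (Fin m → Fin d) → R) (g : Fin m → R) :
    dop {1} (firstOrder (Q.liftPoly F)) (fun l => Q.tau (g l)) =
      Q.tau (∑ I : Fin m → Fin d, F I * ∏ a, Q.der (I a) (g a)) := by
  rw [dop_firstOrder, Q.tau_sum]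
  simp only [ConnRing.liftPoly, sum_mul]
  rw [sum_comm]
  refine sum_congr rfl fun I _ => ?_
  rw [Q.tau_mul, Q.tau_prod]
  simp only [← Q.nrm_tau, ConnRing.nrm, vert_apply]
  rw [prod_univ_sum, Fintype.piFinset_univ, mul_sum]
  refine sum_congr rfl fun K _ => ?_
  rw [prod_mul_distrib]
  ring

end Quantization

section LocalAnalysis

variable {d m : ℕ}

lemma evalSeries_flatDer_congr (c : LocalConn d) (q : c.dom) (i : Fin d)
    {s s' : Series d (smoothRing c.dom)}
    (h : ∀ᶠ p in 𝓝 (q : Vec d), ∀ hp : p ∈ c.dom,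
      evalSeries (⟨p, hp⟩ : c.dom) s = evalSeries (⟨p, hp⟩ : c.dom) s') :
    evalSeries q (c.ring.flatDer i s) = evalSeries q (c.ring.flatDer i s') := by
  rw [evalSeries_flatDer, evalSeries_flatDer, h.self_of_nhds q.2]
  congr 1
  ext α
  rw [coeff_evalSeries, coeff_evalSeries, coeff_mapDer, coeff_mapDer]
  refine pd_congr ?_ i
  filter_upwards [h, eventually_mem q] with p hp hpm
  have h1 := congrArg (coeff α) (hp hpm)
  rw [coeff_evalSeries, coeff_evalSeries, ← smoothFn_eq, ← smoothFn_eq] at h1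
  exact h1

lemma evalAt_derList_smoothMk {U : TopologicalSpace.Opens (Vec d)} {f : Vec d → ℝ}
    (hf : ContDiffOn ℝ ∞ f U) {n : ℕ} (J : Fin n → Fin d) (q : U) :
    evalAt q (derList (partialDer U) (List.ofFn J) (smoothMk f hf)) =
      iteratedFDeriv ℝ n f q fun j => basisVec (J j) := by
  induction n generalizing q with
  | zero =>
    rw [iteratedFDeriv_zero_apply]
    rfl
  | succ n ih =>
    rw [List.ofFn_succ, derList, evalAt_partialDer_of_eq _ _ (fun p => iteratedFDeriv ℝ n f p
      fun j => basisVec (J j.succ)) fun p => ih (fun j => J j.succ) p, iteratedFDeriv_succ_apply_left, pd, fderiv_continuousMultilinear_apply_const_apply]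
    · rfl
    · exact (hf.contDiffAt (U.isOpen.mem_nhds q.2)).differentiableAt_iteratedFDeriv
        (by exact_mod_cast WithTop.coe_lt_top n)

end LocalAnalysis

section CovariantDerivatives

variable {d n : ℕ}

/-- The covariant derivative of a covariant tensor, in components. -/
def ConnRing.covLow {R : Type*} [CommRing R] [Algebra ℝ R] (Q : ConnRing d R) {ν : Type*}
    [Fintype ν] [DecidableEq ν] (i : Fin d) (t : (ν → Fin d) → R) (I : ν → Fin d) : R :=
  Q.der i (t I) - ∑ a, ∑ l, Q.Gam i (I a) l * t (Function.update I a l)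

lemma sum_update_swap {R : Type*} [AddCommMonoid R] {ν : Type*} [Fintype ν] [DecidableEq ν] (a : ν)
    (F : (ν → Fin d) → Fin d → R) :
    ∑ I : ν → Fin d, ∑ l, F I l = ∑ I : ν → Fin d, ∑ l, F (Function.update I a l) (I a) := by
  rw [← Fintype.sum_prod_type', ← Fintype.sum_prod_type']
  refine Finset.sum_bij' (fun p _ => (Function.update p.1 a p.2, p.1 a))
    (fun p _ => (Function.update p.1 a p.2, p.1 a)) ?_ ?_ ?_ ?_ ?_ <;> simp

lemma ConnRing.nab_genPoly {R : Type*} [CommRing R] [Algebra ℝ R] (Q : ConnRing d R) (i : Fin d)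
    (t : (Fin n → Fin d) → R) : Q.nab i (genPoly t) = genPoly (Q.covLow i t) := by
  have h1 : ∀ I : Fin n → Fin d, Q.nab i (C (t I) * ∏ j, X (I j)) =
      C (Q.der i (t I)) * ∏ j, X (I j) - ∑ a, ∑ l, C (t I * Q.Gam i l (I a)) *
          ∏ j, X (Function.update I a l j) := by
    intro I
    rw [Derivation.leibniz, Q.nab_C, smul_eq_mul, smul_eq_mul, derivation_prod, mul_comm (∏ j, _),
      sub_eq_add_neg, add_comm]
    congr 1
    rw [← sum_neg_distrib, mul_sum]
    refine sum_congr rfl fun a _ => ?_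
    have h2 : Q.nab i (X (I a)) = Q.conn i (I a) := by
      rw [Q.nab_apply, mapDer_X, vert_X, zero_add]
    have h3 : ∀ (g : Fin n → Series d R) z,
        ∏ j, Function.update g a z j = z * ∏ j ∈ univ.erase a, g j := fun g z => by
      rw [← mul_prod_erase _ _ (mem_univ a), Function.update_self]
      congr 1
      exact prod_congr rfl fun j hj => Function.update_of_ne (ne_of_mem_erase hj) _ _
    have h4 : ∀ l, ∏ j, (X (Function.update I a l j) : Series d R) =
        X l * ∏ j ∈ univ.erase a, X (I j) := fun l => by
      rw [← h3]
      refine prod_congr rfl fun j _ => ?_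
      rcases eq_or_ne j a with rfl | hj
      · simp
      · simp [Function.update_of_ne hj]
    rw [h3, h2, ConnRing.conn, neg_mul, mul_neg, sum_mul, mul_sum]
    congr 1
    refine sum_congr rfl fun l _ => ?_
    rw [h4, map_mul]
    ring
  rw [genPoly, map_sum]
  simp only [h1]
  rw [sum_sub_distrib, sum_comm]
  have h5 : ∀ a : Fin n, ∑ I : Fin n → Fin d, ∑ l, C (t I * Q.Gam i l (I a)) *
      ∏ j, (X (Function.update I a l j) : Series d R) =
      ∑ I : Fin n → Fin d, ∑ l, C (Q.Gam i (I a) l * t (Function.update I a l)) *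
        ∏ j, X (I j) := fun a => by
    rw [sum_update_swap a]
    simp [mul_comm]
  simp only [h5]
  rw [sum_comm, ← sum_sub_distrib, genPoly]
  refine sum_congr rfl fun I _ => ?_
  rw [ConnRing.covLow, map_sub, sub_mul, map_sum, sum_mul]
  congr 1
  refine sum_congr rfl fun a _ => ?_
  rw [map_sum, sum_mul]

lemma ConnRing.yop_genPoly {R : Type*} [CommRing R] [Algebra ℝ R] (Q : ConnRing d R)
    (t : (Fin n → Fin d) → R) :
    Q.yop (genPoly t) = genPoly fun I => Q.covLow (I 0) t (Fin.tail I) := by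
  rw [Q.yop_apply, genPoly_succ]
  refine sum_congr rfl fun i _ => ?_
  rw [Q.nab_genPoly]
  simp only [Fin.cons_zero, Fin.tail_cons]

lemma ofFn_set (I : Fin n → Fin d) (a : Fin n) (l : Fin d) :
    (List.ofFn I).set a l = List.ofFn (Function.update I a l) := by
  refine List.ext_getElem (by simp) fun k h1 h2 => ?_
  rw [List.getElem_set, List.getElem_ofFn, List.getElem_ofFn]
  split_ifs with h
  · subst h
    simp
  · rw [Function.update_of_ne]
    exact fun h' => h (by rw [← h'])

lemma covDeriv_cons {κ : Type} [Fintype κ] [DecidableEq κ] (Γ : Christoffel d) (T : Comp d κ)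
    (q : Vec d) (i : Fin d) (I : Fin n → Fin d) (J : κ → Fin d) :
    covDeriv Γ T q (i :: List.ofFn I) J = pd i (fun q' => T q' (List.ofFn I) J) q
      - ∑ a, ∑ l, Γ q i (I a) l * T q (List.ofFn (Function.update I a l)) J
      + ∑ b : κ, ∑ l, Γ q i l (J b) * T q (List.ofFn I) (Function.update J b l) := by
  rw [covDeriv]
  congr 2
  rw [← (finCongr (List.length_ofFn (f := I))).sum_comp]
  refine sum_congr rfl fun a _ => sum_congr rfl fun l _ => ?_
  have h : ((finCongr (List.length_ofFn (f := I)) a : Fin n) : ℕ) = a := rfl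
  rw [← ofFn_set, h, List.get_ofFn]
  rfl

variable (c : LocalConn d)

/-- The iterated covariant derivatives of a function. -/
lemma exists_yop_iterate (g : smoothRing c.dom) {f : Vec d → ℝ}
    (h : ∀ q : c.dom, evalAt q g = f q) (n : ℕ) : ∃ t : (Fin n → Fin d) → smoothRing c.dom,
      (c.ring.yop)^[n] (C g) = genPoly t ∧ ∀ (q : c.dom) I, evalAt q (t I) =
        ((covDeriv c.Γ)^[n] (contraComp (κ := Empty) fun q' _ => f q')) q (List.ofFn I)
          Empty.elim := by
  induction n with
  | zero =>
    refine ⟨fun _ => g, (genPoly_zero_arity fun _ => g).symm, fun q I => ?_⟩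
    rw [h, List.ofFn_zero]
    rfl
  | succ n ih =>
    obtain ⟨t, h1, h2⟩ := ih
    refine ⟨fun I => c.ring.covLow (I 0) t (Fin.tail I), ?_, fun q I => ?_⟩
    · rw [Function.iterate_succ_apply', h1, c.ring.yop_genPoly]
    · rw [Function.iterate_succ_apply', List.ofFn_succ]
      refine Eq.trans ?_ (covDeriv_cons _ _ _ _ (fun j => I j.succ) _).symm
      rw [Finset.univ_eq_empty (α := Empty), sum_empty, add_zero]
      simp only [ConnRing.covLow, map_sub, map_sum]
      congr 1
      · exact evalAt_partialDer_of_eq _ _ _ (fun p => h2 p _) q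
      · refine sum_congr rfl fun a _ => ?_
        refine sum_congr rfl fun l _ => ?_
        rw [map_mul, h2]
        rfl

lemma evalSeries_genPoly {U : TopologicalSpace.Opens (Vec d)} (q : U)
    (t : (Fin n → Fin d) → smoothRing U) :
    evalSeries q (genPoly t) = genPoly fun I => evalAt q (t I) := by
  simp only [genPoly, map_sum, map_mul, map_prod, evalSeries_C, evalSeries_X]

lemma symCoeff_eq_of_hom {s : FPS d} {t : (Fin n → Fin d) → ℝ} (h : hom n s = genPoly t)
    (I : Fin n → Fin d) :
    symCoeff s n I = (n.factorial : ℝ)⁻¹ * ∑ σ : Equiv.Perm (Fin n), t (I ∘ σ) := by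
  have h0 : (n.factorial : ℝ) ≠ 0 := by exact_mod_cast n.factorial_ne_zero
  refine sub_eq_zero.1 (genPoly_eq_zero (t := fun I => symCoeff s n I -
    (n.factorial : ℝ)⁻¹ * ∑ σ : Equiv.Perm (Fin n), t (I ∘ σ)) (fun ρ I => ?_) ?_ I)
  · rw [symCoeff_comp]
    congr 2
    exact Equiv.sum_comp (Equiv.mulLeft ρ) fun σ => t (I ∘ σ)
  · simp only [sub_eq_add_neg]
    rw [genPoly_add, genPoly_neg, genPoly_symCoeff, genPoly_C_mul, genPoly_sum, h]
    simp only [genPoly_comp_perm]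
    rw [sum_const, card_univ, Fintype.card_perm, Fintype.card_fin,
      ← Nat.cast_smul_eq_nsmul ℝ, smul_eq_C_mul, ← mul_assoc, ← map_mul,
      inv_mul_cancel₀ h0, map_one, one_mul, add_neg_cancel]

lemma constantCoeff_pdList_tauAt (q : c.dom) (g : smoothRing c.dom) {f : Vec d → ℝ}
    (h : ∀ q : c.dom, evalAt q g = f q) (J : Fin n → Fin d) :
    constantCoeff (pdList ℝ (List.ofFn J) (tauAt c q g)) = covDerivSym c.Γ f q J := by
  have h0 : (n.factorial : ℝ) ≠ 0 := by exact_mod_cast n.factorial_ne_zero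
  obtain ⟨t, h1, h2⟩ := exists_yop_iterate c g h n
  have h3 : hom n (tauAt c q g) = genPoly fun I => (n.factorial : ℝ)⁻¹ * evalAt q (t I) := by
    rw [tauAt_apply, hom_evalSeries, ConnRing.hom_tau, h1, genPoly_C_mul, ← evalSeries_genPoly,
      ← smul_eq_C_mul]
    ext α
    rw [coeff_evalSeries, ConnRing.coeff_real_smul, map_smul]
    rfl
  have h4 := symCoeff_eq_of_hom h3 J
  rw [← mul_sum] at h4
  rw [symCoeff, smul_eq_mul] at h4
  have h5 := mul_left_cancel₀ (inv_ne_zero h0) h4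
  rw [h5, covDerivSym]
  congr 1
  exact sum_congr rfl fun σ _ => h2 q _

end CovariantDerivatives

section Transform

variable {d m : ℕ} {B : Type*} [CommRing B]

/-- A matrix acting on all slots of an array. -/
def transform (X : Matrix (Fin d) (Fin d) B) (c : (Fin m → Fin d) → B) (K : Fin m → Fin d) : B :=
  ∑ J : Fin m → Fin d, (∏ a, X (K a) (J a)) * c J

lemma transform_transform (X Y : Matrix (Fin d) (Fin d) B) (c : (Fin m → Fin d) → B) :
    transform X (transform Y c) = transform (X * Y) c := by
  funext K
  simp only [transform, mul_sum]
  rw [sum_comm]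
  refine sum_congr rfl fun J _ => ?_
  simp only [Matrix.mul_apply, ← mul_assoc, ← prod_mul_distrib, ← sum_mul]
  rw [prod_univ_sum, Fintype.piFinset_univ]

lemma transform_one (c : (Fin m → Fin d) → B) : transform 1 c = c := by
  funext K
  rw [transform, sum_eq_single K]
  · simp
  · intro J _ hJ
    obtain ⟨a, ha⟩ := Function.ne_iff.1 hJ
    exact mul_eq_zero_of_left (Finset.prod_eq_zero (mem_univ a)
      (f := fun a => (1 : Matrix (Fin d) (Fin d) B) (K a) (J a)) (Matrix.one_apply_ne ha.symm)) _
  · simp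

lemma transform_comp_perm (X : Matrix (Fin d) (Fin d) B) (c : (Fin m → Fin d) → B)
    (K : Fin m → Fin d) (σ : Equiv.Perm (Fin m)) :
    transform X c (K ∘ σ) = transform X (fun J => c (J ∘ σ)) K := by
  rw [transform, transform, ← (Equiv.arrowCongr σ (Equiv.refl (Fin d))).symm.sum_comp]
  refine sum_congr rfl fun J _ => ?_
  congr 1
  exact Equiv.prod_comp σ fun a => X (K a) (J a)

variable {R : Type*} [CommRing R] [Algebra ℝ R] (Q : ConnRing d R)

lemma ConnRing.liftPoly_eq (F : (Fin m → Fin d) → R) :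
    Q.liftPoly F = transform Q.jacInv fun I => Q.tau (F I) := rfl

lemma ConnRing.eq_liftPoly_iff {c : (Fin m → Fin d) → Series d R}
    {F : (Fin m → Fin d) → R} :
    c = Q.liftPoly F ↔ ∀ I, transform Q.jac c I = Q.tau (F I) := by
  rw [Q.liftPoly_eq]
  constructor
  · rintro rfl I
    rw [transform_transform, Q.jac_mul_jacInv, transform_one]
  · intro h
    rw [← funext h, transform_transform, Q.jacInv_mul_jac, transform_one]

lemma ConnRing.liftPoly_comp_perm {F : (Fin m → Fin d) → R} {σ : Equiv.Perm (Fin m)} {r : ℝ}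
    (h : ∀ I, F (I ∘ σ) = r • F I) (K : Fin m → Fin d) :
    Q.liftPoly F (K ∘ σ) = r • Q.liftPoly F K := by
  rw [Q.liftPoly_eq, transform_comp_perm, transform, transform, smul_sum]
  refine sum_congr rfl fun J _ => ?_
  rw [h, ← mul_smul_comm]
  congr 1
  exact map_smul Q.tauHom r (F J)

lemma dop_phi (c : (Fin m → Fin d) → Series d R) (I : Fin m → Fin d) :
    dop {1} (firstOrder c) (fun a => Q.phi (I a)) = transform Q.jac c I := by
  rw [dop_firstOrder]
  exact sum_congr rfl fun J _ => mul_comm _ _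

/-- A first order operator which maps flat series to flat series is the lift of its constant
term. -/
lemma ConnRing.eq_liftPoly_of_flat {c : (Fin m → Fin d) → Series d R}
    (h : ∀ (g : Fin m → R) i, Q.flatDer i (dop {1} (firstOrder c) fun a => Q.tau (g a)) = 0) :
    c = Q.liftPoly fun I => constantCoeff (c I) := by
  rw [Q.eq_liftPoly_iff]
  intro I
  have h1 := Q.eq_tau_of_flat (h fun a => Q.coord (I a))
  have h2 : dop {1} (firstOrder c) (fun a => Q.tau (Q.coord (I a))) = transform Q.jac c I :=
    dop_phi Q c I
  have h3 : constantCoeff (transform Q.jac c I) = transform 1 (fun J => constantCoeff (c J)) I := by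
    rw [← Q.map_jac]
    simp only [transform, map_sum, map_mul, map_prod, Matrix.map_apply]
  rw [h2, h3, transform_one] at h1
  exact h1

end Transform

section TensorFields

variable {d n : ℕ} {κ : Type} [Fintype κ] [DecidableEq κ] {M : Type u} [TopologicalSpace M]
  [ChartedSpace (Vec d) M] [IsManifold (𝓡 d) ∞ M] {e e' : OpenPartialHomeomorph M (Vec d)}

lemma IsChart.flatTensor_perm_left (he : IsChart e) {p : M} (hp : p ∈ e.source)
    {A : FlatTensor d n κ} {σ : Equiv.Perm (Fin n)}
    (h : ∀ I J, frameComp e p A (I ∘ σ) J = frameComp e p A I J) (v : Fin n → Vec d)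
    (w : κ → Vec d →L[ℝ] ℝ) : A (v ∘ σ) w = A v w := by
  have h1 : A.domDomCongr σ = A := he.flatTensor_ext hp fun I J => h I J
  exact congrArg (fun B : FlatTensor d n κ => B v w) h1

lemma IsChart.flatTensor_perm_right (he : IsChart e) {p : M} (hp : p ∈ e.source)
    {A : FlatTensor d n κ} {σ : Equiv.Perm κ} {r : ℝ}
    (h : ∀ I J, frameComp e p A I (J ∘ σ) = r * frameComp e p A I J) (v : Fin n → Vec d)
    (w : κ → Vec d →L[ℝ] ℝ) : A v (w ∘ σ) = r * A v w := by
  have h1 : LinearMap.compMultilinearMap (MultilinearMap.domDomCongrLinearEquiv ℝ ℝ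
      (Vec d →L[ℝ] ℝ) ℝ σ).toLinearMap A = r • A := he.flatTensor_ext hp fun I J => h I J
  exact congrArg (fun B : FlatTensor d n κ => B v w) h1

lemma IsChart.frameComp_change (he : IsChart e) (he' : IsChart e') {p : M}
    (hp : p ∈ e.source) (hp' : p ∈ e'.source) (A : FlatTensor d n κ) (I' : Fin n → Fin d)
    (J' : κ → Fin d) : frameComp e' p A I' J' =
      ∑ I : Fin n → Fin d, ∑ J : κ → Fin d, (∏ a, chartJac e' e (I' a) (I a) (e' p)) *
        (∏ b, chartJac e e' (J b) (J' b) (e p)) * frameComp e p A I J := by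
  rw [frameComp, he.flatTensor_apply hp]
  refine sum_congr rfl fun I _ => sum_congr rfl fun J _ => ?_
  congr 2
  · refine prod_congr rfl fun a _ => ?_
    exact he'.chartDeriv_chartFrame he hp' hp (I' a) (I a)
  · refine prod_congr rfl fun b _ => ?_
    rw [he.chartCovec_change he' hp hp', sum_apply]
    simp [he.chartCovec_chartFrame hp]

/-- The tensor field with given values, if these are smooth in some chart near every point. -/
def TensorField.ofLocal (t : M → FlatTensor d n κ)
    (h : ∀ x, ∃ e : OpenPartialHomeomorph M (Vec d), IsChart e ∧ x ∈ e.source ∧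
      ∀ I J, ContDiffAt ℝ ∞ (fun q => frameComp e (e.symm q) (t (e.symm q)) I J) (e x)) :
    TensorField d M n κ where
  toFun x := t x
  smooth e' he' I' J' q hq := by
    obtain ⟨e, he, hx, hs⟩ := h (e'.symm q)
    have hev : ∀ᶠ z in 𝓝 q, z ∈ e'.target ∧ e'.symm z ∈ e.source :=
      Filter.Eventually.and (e'.open_target.mem_nhds hq) ((e'.continuousAt_symm hq).eventually
        (e.open_source.mem_nhds hx))
    refine ContDiffAt.contDiffWithinAt (ContDiffAt.congr_of_eventuallyEq (f := fun z =>
      ∑ I : Fin n → Fin d, ∑ J : κ → Fin d, (∏ a, chartJac e' e (I' a) (I a) z) *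
        (∏ b, chartJac e e' (J b) (J' b) (e (e'.symm z))) *
          (fun q => frameComp e (e.symm q) (t (e.symm q)) I J) (e (e'.symm z))) ?_ ?_)
    · have htr := he'.contDiffAt_transition he hq hx
      refine ContDiffAt.sum fun I _ => ContDiffAt.sum fun J _ => ContDiffAt.mul (ContDiffAt.mul
        (contDiffAt_prod fun a _ => he'.contDiffAt_chartJac he hq hx _ _)
        (contDiffAt_prod fun b _ => ?_)) ?_
      · refine ContDiffAt.comp (g := chartJac e e' (J b) (J' b)) q ?_ htr
        exact he.contDiffAt_chartJac he' (e.map_source hx)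
          (by rw [e.left_inv hx]; exact e'.map_target hq) _ _
      · exact ContDiffAt.comp q (hs I J) htr
    · filter_upwards [hev] with z hz
      have h1 := he.frameComp_change he' hz.2 (e'.map_target hz.1) (t (e'.symm z)) I' J'
      rw [e'.right_inv hz.1] at h1
      simp only [e.left_inv hz.2]
      rw [← h1, frameComp]
      simp only [chartFrame_symm _ hz.1, he'.chartCovec_symm _ hz.1]
      rfl

lemma TensorField.ext_at {S T : TensorField d M n κ} (h : ∀ x, S.at x = T.at x) : S = T := by
  cases S
  cases T
  congr
  funext x
  exact h x

end TensorFields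

section SmoothFunctions

variable {d : ℕ} {M : Type u} [TopologicalSpace M] [ChartedSpace (Vec d) M]
  [IsManifold (𝓡 d) ∞ M] {e e' : OpenPartialHomeomorph M (Vec d)}

variable (d M) in
/-- The smooth functions on `M`. -/
abbrev SmoothFun : Type u := C^∞⟮𝓡 d, M; 𝓘(ℝ, ℝ), ℝ⟯

lemma IsChart.contDiffOn_comp_symm (he : IsChart e) (f : SmoothFun d M) :
    ContDiffOn ℝ ∞ (fun q => f (e.symm q)) (⟨e.target, e.open_target⟩ : TopologicalSpace.Opens (Vec d)) :=
  fun _ hq => (he.contDiffAt_of_contMDiffAt hq (f.contMDiff _)).contDiffWithinAt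

variable {nabla : Connection d M} [T2Space M] [nabla.ContMDiffCovariantDerivative ∞]
  (htor : nabla.torsion = 0)

/-- A smooth function in a chart. -/
def chartFn (he : IsChart e) (f : SmoothFun d M) : smoothRing (chartConn htor he).dom :=
  smoothMk (fun q => f (e.symm q)) (he.contDiffOn_comp_symm f)

lemma IsChart.smoothFn_chartFn (he : IsChart e) (f : SmoothFun d M) {p : M} (hp : p ∈ e.source) :
    smoothFn (chartFn htor he f) (e p) = f p := by
  have h := smoothFn_eq (chartFn htor he f) ⟨e p, e.map_source hp⟩
  exact h.trans (congrArg f (e.left_inv hp))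

lemma IsChart.expTaylor_chartFn (he : IsChart e) (q : (chartConn htor he).dom) (f : SmoothFun d M) :
    expTaylor nabla e (e.symm q) f = tauAt (chartConn htor he) q (chartFn htor he f) := by
  refine he.expTaylor_eq_tauAt htor q _ ?_
  filter_upwards [e.open_source.mem_nhds (e.map_target q.2)] with p hp
  exact he.smoothFn_chartFn htor f hp

/-- Every germ of a smooth function in a chart extends to a smooth function on `M`. -/
lemma IsChart.exists_global (he : IsChart e) (q : (chartConn htor he).dom)
    (g : smoothRing (chartConn htor he).dom) :
    ∃ f : SmoothFun d M, (fun p => smoothFn g (e p)) =ᶠ[𝓝 (e.symm q)] f := by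
  obtain ⟨ρ, hρ, hρ1, hρs⟩ := exists_bump (d := d) (e.open_source.mem_nhds (e.map_target q.2))
  have hs : ContMDiff (𝓡 d) 𝓘(ℝ, ℝ) ∞ fun p => ρ p * smoothFn g (e p) := by
    intro x
    by_cases hx : x ∈ tsupport ρ
    · refine (hρ x).mul (he.contMDiffAt_of_contDiffAt (hρs hx) ?_)
      exact (contDiffOn_smoothFn g).contDiffAt (e.open_target.mem_nhds (e.map_source (hρs hx)))
    · refine ContMDiffAt.congr_of_eventuallyEq (f := fun _ => 0) contMDiffAt_const ?_
      filter_upwards [(isClosed_tsupport ρ).isOpen_compl.mem_nhds hx] with y hy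
      rw [image_eq_zero_of_notMem_tsupport hy, zero_mul]
  refine ⟨⟨_, hs⟩, ?_⟩
  filter_upwards [hρ1] with p hp
  change _ = ρ p * smoothFn g (e p)
  rw [hp, Pi.one_apply, one_mul]

lemma IsChart.exists_tauAt_eq (he : IsChart e) (q : (chartConn htor he).dom)
    (g : smoothRing (chartConn htor he).dom) :
    ∃ f : SmoothFun d M, expTaylor nabla e (e.symm q) f = tauAt (chartConn htor he) q g := by
  obtain ⟨f, hf⟩ := he.exists_global htor q g
  exact ⟨f, he.expTaylor_eq_tauAt htor q g hf⟩

end SmoothFunctions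

section Lifts

variable {d m : ℕ} {M : Type u} [TopologicalSpace M] [ChartedSpace (Vec d) M]
  [IsManifold (𝓡 d) ∞ M] {e e' : OpenPartialHomeomorph M (Vec d)}

/-- The component series at `x` of a formal fiberwise tensor. -/
def fiberSeries {κ : Type} [Fintype κ] [DecidableEq κ] (e : OpenPartialHomeomorph M (Vec d))
    (x : M) (t : (n : ℕ) → FlatTensor d n κ) (J : κ → Fin d) : FPS d :=
  genSeries fun n I => frameComp e x (t n) I J

lemma genSeries_zero : genSeries (d := d) (fun _ _ => 0) = 0 :=
  funext fun _ => sum_eq_zero fun _ _ => ite_self _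

lemma fiberSeries_zero {κ : Type} [Fintype κ] [DecidableEq κ] (x : M) (J : κ → Fin d) :
    fiberSeries e x (fun _ => 0) J = 0 := genSeries_zero

variable (nabla : Connection d M)

/-- `t` is, at `x`, the fiberwise polydifferential operator which lifts `O`. -/
structure IsLift (O : (Fin m → SmoothFun d M) → M → ℝ) (x : M)
    (t : (n : ℕ) → (a : Fin m → ℕ) → FlatTensor d n (Blocks a)) : Prop where
  symm : ∀ n a (σ : Equiv.Perm (Fin n)) v w, t n a (v ∘ σ) w = t n a v w
  block_symm : ∀ n a v (σ : (l : Fin m) → Equiv.Perm (Fin (a l))) w,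
    t n a v (w ∘ Equiv.sigmaCongrRight σ) = t n a v w
  order_bdd : ∃ N : ℕ, ∀ n a, (∃ l, N < a l) → t n a = 0
  eq : ∀ e : OpenPartialHomeomorph M (Vec d), IsChart e → x ∈ e.source →
    ∀ f : Fin m → SmoothFun d M,
      dpolyOp (fun a => fiberSeries e x fun n => t n a) (fun l => expTaylor nabla e x (f l)) =
        expTaylor nabla e x (O f)

lemma dpolyOp_fiberSeries {x : M} {t : (n : ℕ) → (a : Fin m → ℕ) → FlatTensor d n (Blocks a)}
    {N : ℕ} (hN : ∀ n a, (∃ l, N < a l) → t n a = 0) :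
    dpolyOp (fun a => fiberSeries e x fun n => t n a) =
      dop (arityBox m N) fun a => fiberSeries e x fun n => t n a := by
  refine dpolyOp_eq_dop _ _ fun a ha J => ?_
  rw [mem_arityBox] at ha
  push Not at ha
  simp only [hN _ a ha]
  exact fiberSeries_zero x J

variable {nabla} [T2Space M] [nabla.ContMDiffCovariantDerivative ∞] (htor : nabla.torsion = 0)

include htor in
lemma IsChart.exists_isExpTaylor (he : IsChart e) {x : M} (hx : x ∈ e.source) (f : SmoothFun d M) :
    ∃ p, IsExpTaylor nabla e x f p := by
  have h := he.isExpTaylor_tauAt htor ⟨e x, e.map_source hx⟩ (chartFn htor he f) (f := f) ?_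
  · rw [e.left_inv hx] at h
    exact ⟨_, h⟩
  · filter_upwards [e.open_source.mem_nhds (e.map_target (e.map_source hx))] with p hp
    exact he.smoothFn_chartFn htor f hp

include htor in
lemma IsChart.dpolyOp_change (he : IsChart e) (he' : IsChart e') {x : M} (hx : x ∈ e.source)
    (hx' : x ∈ e'.source) {t : (n : ℕ) → (a : Fin m → ℕ) → FlatTensor d n (Blocks a)}
    (hN : ∃ N : ℕ, ∀ n a, (∃ l, N < a l) → t n a = 0) (f : Fin m → SmoothFun d M) :
    dpolyOp (fun a => fiberSeries e' x fun n => t n a) (fun l => expTaylor nabla e' x (f l)) =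
      linSubst (fun i k => chartJac e' e i k (e' x))
        (dpolyOp (fun a => fiberSeries e x fun n => t n a) fun l => expTaylor nabla e x (f l)) := by
  obtain ⟨N, hN⟩ := hN
  rw [dpolyOp_fiberSeries hN, dpolyOp_fiberSeries hN]
  have h2 : ∀ l, expTaylor nabla e' x (f l) =
      linSubst (fun i k => chartJac e' e i k (e' x)) (expTaylor nabla e x (f l)) := fun l =>
    he'.expTaylor_change htor he hx' hx (he.exists_isExpTaylor htor hx (f l))
  simp only [h2]
  exact dop_linSubst _ _ (fun a => fiberSeries e' x fun n => t n a)
    (fun a => fiberSeries e x fun n => t n a)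
    (fun a _ K => he'.linSubst_genSeries he hx' hx (fun n => t n a) K) _

include htor in
lemma IsLift.of_chart {O : (Fin m → SmoothFun d M) → M → ℝ} {x : M}
    {t : (n : ℕ) → (a : Fin m → ℕ) → FlatTensor d n (Blocks a)}
    (hs : ∀ n a (σ : Equiv.Perm (Fin n)) v w, t n a (v ∘ σ) w = t n a v w)
    (hb : ∀ n a v (σ : (l : Fin m) → Equiv.Perm (Fin (a l))) w,
      t n a v (w ∘ Equiv.sigmaCongrRight σ) = t n a v w)
    (hN : ∃ N : ℕ, ∀ n a, (∃ l, N < a l) → t n a = 0) (he : IsChart e) (hx : x ∈ e.source)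
    (hO : ∀ f, ∃ p, IsExpTaylor nabla e x (O f) p)
    (h : ∀ f : Fin m → SmoothFun d M,
      dpolyOp (fun a => fiberSeries e x fun n => t n a) (fun l => expTaylor nabla e x (f l)) =
        expTaylor nabla e x (O f)) : IsLift nabla O x t := by
  refine ⟨hs, hb, hN, fun e' he' hx' f => ?_⟩
  rw [he.dpolyOp_change htor he' hx hx' hN, h f]
  exact (he'.expTaylor_change htor he hx' hx (hO f)).symm

lemma blockSymm_fiberSeries {x : M} {a : Fin m → ℕ} {t : (n : ℕ) → FlatTensor d n (Blocks a)}
    (hb : ∀ n v (σ : (l : Fin m) → Equiv.Perm (Fin (a l))) w,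
      t n v (w ∘ Equiv.sigmaCongrRight σ) = t n v w) : BlockSymm (fiberSeries e x t) := by
  intro σ J
  refine congrArg genSeries (funext fun n => funext fun I => ?_)
  exact hb n (fun a => chartFrame e (I a) x) σ fun b => chartCovec e (J b) x

lemma dop_sub_coeff {B : Type*} [CommRing B] (A : Finset (Fin m → ℕ))
    (c c' : Coeffs m d (Series d B)) (s) :
    dop A (fun a J => c a J - c' a J) s = dop A c s - dop A c' s := by
  simp only [dop_apply, sub_mul, sum_sub_distrib]

lemma eq_of_fiberSeries_eq {κ : Type} [Fintype κ] [DecidableEq κ] (he : IsChart e) {x : M}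
    (hx : x ∈ e.source) {t t' : (n : ℕ) → FlatTensor d n κ}
    (hs : ∀ n (σ : Equiv.Perm (Fin n)) v w, t n (v ∘ σ) w = t n v w)
    (hs' : ∀ n (σ : Equiv.Perm (Fin n)) v w, t' n (v ∘ σ) w = t' n v w)
    (h : ∀ J, fiberSeries e x t J = fiberSeries e x t' J) : t = t' := by
  funext n
  refine he.flatTensor_ext hx fun I J => ?_
  have h1 := congrArg (fun s => symCoeff s n I) (h J)
  simp only [fiberSeries] at h1
  rw [symCoeff_genSeries (fun σ I => hs n σ (fun a => chartFrame e (I a) x) fun b => chartCovec e (J b) x),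
    symCoeff_genSeries (fun σ I => hs' n σ (fun a => chartFrame e (I a) x)
      fun b => chartCovec e (J b) x)] at h1
  exact h1

include htor in
lemma IsLift.unique {O : (Fin m → SmoothFun d M) → M → ℝ} {x : M}
    {t t' : (n : ℕ) → (a : Fin m → ℕ) → FlatTensor d n (Blocks a)}
    (h : IsLift nabla O x t) (h' : IsLift nabla O x t') : t = t' := by
  let e := chartAt (Vec d) x
  have he : IsChart e := IsManifold.chart_mem_maximalAtlas x
  have hx : x ∈ e.source := mem_chart_source _ x
  obtain ⟨N, hN⟩ := h.order_bdd
  obtain ⟨N', hN'⟩ := h'.order_bdd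
  have h1 : ∀ n a, (∃ l, max N N' < a l) → t n a = 0 := fun n a ⟨l, hl⟩ =>
    hN n a ⟨l, (le_max_left _ _).trans_lt hl⟩
  have h2 : ∀ n a, (∃ l, max N N' < a l) → t' n a = 0 := fun n a ⟨l, hl⟩ =>
    hN' n a ⟨l, (le_max_right _ _).trans_lt hl⟩
  have h3 : ∀ s, dop (arityBox m (max N N')) (fun a J => fiberSeries e x (fun n => t n a) J -
      fiberSeries e x (fun n => t' n a) J) s = 0 := fun s => ext_hom fun n => by
    rw [map_zero]
    refine hom_dop_eq_zero_of_tauAt (chartConn htor he) ⟨e x, e.map_source hx⟩ n (fun g => ?_) s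
    choose f hf using fun l => he.exists_tauAt_eq htor ⟨e x, e.map_source hx⟩ (g l)
    have h4 := h.eq e he hx f
    have h5 := h'.eq e he hx f
    rw [dpolyOp_fiberSeries h1] at h4
    rw [dpolyOp_fiberSeries h2] at h5
    simp only [← hf]
    rw [dop_sub_coeff]
    simp only [e.left_inv hx]
    rw [h4, h5, sub_self, map_zero]
  have h4 := eq_zero_of_dop_eq_zero (fun a _ σ J => by
    rw [blockSymm_fiberSeries (fun n => h.block_symm n a) σ J,
      blockSymm_fiberSeries (fun n => h'.block_symm n a) σ J]) h3
  funext n a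
  by_cases ha : a ∈ arityBox m (max N N')
  · exact congrFun (eq_of_fiberSeries_eq he hx (fun n => h.symm n a) (fun n => h'.symm n a)
      fun J => sub_eq_zero.1 (h4 a ha J)) n
  · rw [mem_arityBox] at ha
    push Not at ha
    rw [h1 n a ha, h2 n a ha]

/-- In some chart near every point, `O` is a differential operator with smooth coefficients. -/
def HasLocalForm (O : (Fin m → SmoothFun d M) → M → ℝ) : Prop :=
  ∀ x : M, ∃ (e : OpenPartialHomeomorph M (Vec d)) (he : IsChart e), x ∈ e.source ∧
    ∃ (A : Finset (Fin m → ℕ)) (k : Coeffs m d (smoothRing (chartConn htor he).dom)),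
      ∀ f (q : (chartConn htor he).dom), O f (e.symm q) =
        evalAt q (diffOp (chartConn htor he).ring A k fun l => chartFn htor he (f l))

lemma evalAt_symCoeff {U : TopologicalSpace.Opens (Vec d)} (q : U)
    (s : Series d (smoothRing U)) (n : ℕ) (I : Fin n → Fin d) :
    evalAt q (symCoeff s n I) = symCoeff (evalSeries q s) n I := by
  rw [symCoeff, symCoeff, map_smul, ← evalSeries_pdList]
  rfl

lemma IsChart.eventually_eq_of_forall (he : IsChart e) (q : (chartConn htor he).dom)
    {g : smoothRing (chartConn htor he).dom} {f : M → ℝ}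
    (h : ∀ q : (chartConn htor he).dom, f (e.symm q) = evalAt q g) :
    (fun p => smoothFn g (e p)) =ᶠ[𝓝 (e.symm q)] f := by
  filter_upwards [e.open_source.mem_nhds (e.map_target q.2)] with p hp
  have h1 := h ⟨e p, e.map_source hp⟩
  rw [← smoothFn_eq, e.left_inv hp] at h1
  exact h1.symm

/-- The fiberwise operator at `x` whose coefficients are given by series in a chart. -/
def tensorOfSeries (e : OpenPartialHomeomorph M (Vec d)) {U : TopologicalSpace.Opens (Vec d)} (q : U)
    (C : Coeffs m d (Series d (smoothRing U))) (n : ℕ)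
    (a : Fin m → ℕ) : FlatTensor d n (Blocks a) :=
  tensorOfComp e (e.symm q) fun I J => evalAt q (symCoeff (C a J) n I)

lemma IsChart.frameComp_tensorOfSeries (he : IsChart e) (q : (chartConn htor he).dom)
    (C : Coeffs m d (Series d (smoothRing (chartConn htor he).dom))) (n : ℕ)
    (a : Fin m → ℕ) (I : Fin n → Fin d) (J : Blocks a → Fin d) :
    frameComp e (e.symm q) (tensorOfSeries e q C n a) I J = evalAt q (symCoeff (C a J) n I) :=
  he.frameComp_tensorOfComp (e.map_target q.2) _ I J

lemma IsChart.tensorOfSeries_eq_zero (he : IsChart e) (q : (chartConn htor he).dom)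
    {C : Coeffs m d (Series d (smoothRing (chartConn htor he).dom))} {a : Fin m → ℕ}
    (h : ∀ J, C a J = 0) (n : ℕ) : tensorOfSeries e q C n a = 0 := by
  refine he.flatTensor_ext (e.map_target q.2) fun I J => ?_
  rw [he.frameComp_tensorOfSeries htor, h]
  simp [symCoeff, frameComp]

lemma IsChart.isLift_tensorOfSeries {O : (Fin m → SmoothFun d M) → M → ℝ} (he : IsChart e)
    {A : Finset (Fin m → ℕ)} {C : Coeffs m d (Series d (smoothRing (chartConn htor he).dom))}
    {o : (Fin m → SmoothFun d M) → smoothRing (chartConn htor he).dom}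
    (hC1 : ∀ b, BlockSymm (C b)) (hC2 : ∀ b ∉ A, ∀ J, C b J = 0)
    (hO : ∀ f (q : (chartConn htor he).dom), O f (e.symm q) = evalAt q (o f))
    (hC3 : ∀ f, dop A C (fun l => (chartConn htor he).ring.tau (chartFn htor he (f l))) =
      (chartConn htor he).ring.tau (o f)) (q : (chartConn htor he).dom) :
    IsLift nabla O (e.symm q) (tensorOfSeries e q C) := by
  have hx := e.map_target q.2
  obtain ⟨N, hN⟩ := exists_arityBox A
  refine IsLift.of_chart htor ?_ ?_ ⟨N, ?_⟩ he hx ?_ ?_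
  · intro n a σ v w
    refine he.flatTensor_perm_left hx (fun I J => ?_) v w
    rw [he.frameComp_tensorOfSeries htor, he.frameComp_tensorOfSeries htor, symCoeff_comp]
  · intro n a v σ w
    refine (he.flatTensor_perm_right hx (r := 1) (fun I J => ?_) v w).trans (one_mul _)
    rw [he.frameComp_tensorOfSeries htor, he.frameComp_tensorOfSeries htor, hC1 a σ J, one_mul]
  · rintro n a ⟨l, hl⟩
    exact he.tensorOfSeries_eq_zero htor q
      (hC2 a fun ha => absurd (mem_arityBox.1 (hN ha) l) (by omega)) n
  · intro f
    exact ⟨_, he.isExpTaylor_tauAt htor q _ (he.eventually_eq_of_forall htor q (hO f))⟩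
  · intro f
    have h1 : (fun a => fiberSeries e (e.symm q) fun n => tensorOfSeries e q C n a) =
        fun a J => evalSeries q (C a J) := by
      funext a J
      rw [← genSeries_symCoeff (evalSeries q (C a J))]
      refine congrArg genSeries (funext fun n => funext fun I => ?_)
      rw [he.frameComp_tensorOfSeries htor, evalAt_symCoeff]
    rw [h1, dpolyOp_eq_dop A _ fun a ha J => by rw [hC2 a ha J, map_zero],
      he.expTaylor_eq_tauAt htor q _ (he.eventually_eq_of_forall htor q (hO f)),
      tauAt_apply, ← hC3, evalSeries_dop]
    simp only [he.expTaylor_chartFn htor]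
    rfl

/-- The local lift in a chart in which the operator has smooth coefficients. -/
lemma exists_local_lift {O : (Fin m → SmoothFun d M) → M → ℝ} (he : IsChart e)
    {A : Finset (Fin m → ℕ)}
    {k : Coeffs m d (smoothRing (chartConn htor he).dom)}
    (h : ∀ f (q : (chartConn htor he).dom), O f (e.symm q) =
        evalAt q (diffOp (chartConn htor he).ring A k fun l => chartFn htor he (f l))) :
    ∃ (N : ℕ) (C : Coeffs m d (Series d (smoothRing (chartConn htor he).dom))),
      (∀ b ∉ arityBox m N, ∀ J, C b J = 0) ∧ ∀ q : (chartConn htor he).dom,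
        IsLift nabla O (e.symm q) (tensorOfSeries e q C) := by
  obtain ⟨N, C, hC1, hC2, hC3⟩ := (chartConn htor he).ring.exists_lift A k
  exact ⟨N, C, hC2, he.isLift_tensorOfSeries htor hC1 hC2 h fun f => hC3 _⟩

theorem exists_lift_tensors {O : (Fin m → SmoothFun d M) → M → ℝ} (h : HasLocalForm htor O) :
    ∃ t : (n : ℕ) → (a : Fin m → ℕ) → TensorField d M n (Blocks a),
      (∀ x, IsLift nabla O x fun n a => (t n a).at x) ∧
      ∀ x, ∃ N : ℕ, ∀ᶠ p in 𝓝 x, ∀ n a, (∃ l, N < a l) → (t n a).at p = 0 := by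
  have h1 : ∀ x : M, ∃ (e : OpenPartialHomeomorph M (Vec d)) (he : IsChart e),
      x ∈ e.source ∧ ∃ (N : ℕ) (C : Coeffs m d (Series d (smoothRing (chartConn htor he).dom))),
        (∀ b ∉ arityBox m N, ∀ J, C b J = 0) ∧ ∀ q : (chartConn htor he).dom,
          IsLift nabla O (e.symm q) (tensorOfSeries e q C) := fun x => by
    obtain ⟨e, he, hx, A, k, hk⟩ := h x
    exact ⟨e, he, hx, exists_local_lift htor he hk⟩
  choose e he hx N C hC hs using h1
  let t : (x : M) → (n : ℕ) → (a : Fin m → ℕ) → FlatTensor d n (Blocks a) := fun x n a =>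
    tensorOfSeries (e x) (⟨e x x, (e x).map_source (hx x)⟩ : (chartConn htor (he x)).dom) (C x) n a
  have ht : ∀ x, IsLift nabla O x (t x) := fun x => by
    have h2 := hs x ⟨e x x, (e x).map_source (hx x)⟩
    simp only [(e x).left_inv (hx x)] at h2
    exact h2
  have h3 : ∀ x (q : (chartConn htor (he x)).dom) n a, t ((e x).symm q) n a =
      tensorOfSeries (e x) q (C x) n a := fun x q n a =>
    congrFun (congrFun ((ht _).unique htor (hs x q)) n) a
  refine ⟨fun n a => TensorField.ofLocal (fun x => t x n a) fun x => ⟨e x, he x, hx x,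
    fun I J => ?_⟩, ht, fun x => ⟨N x, ?_⟩⟩
  · have h4 : (e x).target ∈ 𝓝 (e x x) := (e x).open_target.mem_nhds ((e x).map_source (hx x))
    refine ((contDiffOn_smoothFn (symCoeff (C x a J) n I)).contDiffAt h4).congr_of_eventuallyEq ?_
    filter_upwards [h4] with q hq
    refine (congrArg (fun A => frameComp (e x) ((e x).symm q) A I J) (h3 x ⟨q, hq⟩ n a)).trans ?_
    exact ((he x).frameComp_tensorOfSeries htor ⟨q, hq⟩ (C x) n a I J).trans
      (smoothFn_eq _ ⟨q, hq⟩).symm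
  · filter_upwards [(e x).open_source.mem_nhds (hx x)] with p hp n a ⟨l, hl⟩
    have h5 := h3 x ⟨e x p, (e x).map_source hp⟩ n a
    simp only [(e x).left_inv hp] at h5
    refine Eq.trans h5 ((he x).tensorOfSeries_eq_zero htor _ (hC x a fun ha => ?_) n)
    exact absurd (mem_arityBox.1 ha l) (by omega)

end Lifts

section Charts

variable {d m : ℕ} {M : Type u} [TopologicalSpace M] [ChartedSpace (Vec d) M]
  [IsManifold (𝓡 d) ∞ M] {e e' : OpenPartialHomeomorph M (Vec d)}

lemma IsChart.exists_restr (he : IsChart e) {x : M} (hx : x ∈ e.source) {P : M → Prop}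
    (hP : ∀ᶠ p in 𝓝 x, P p) : ∃ V : Set M, IsChart (e.restr V) ∧ x ∈ (e.restr V).source ∧
      ∀ p ∈ (e.restr V).source, P p := by
  obtain ⟨V, hV, hVo, hxV⟩ := eventually_nhds_iff.1 hP
  refine ⟨V, restr_mem_maximalAtlas _ he hVo, ?_, fun p hp => ?_⟩
  · rw [OpenPartialHomeomorph.restr_source' _ _ hVo]
    exact ⟨hx, hxV⟩
  · rw [OpenPartialHomeomorph.restr_source' _ _ hVo] at hp
    exact hV p hp.2

variable {nabla : Connection d M} [T2Space M] [nabla.ContMDiffCovariantDerivative ∞]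
  (htor : nabla.torsion = 0)

/-- A section whose operator maps Taylor expansions to Taylor expansions is horizontal. -/
lemma IsChart.fedosovAt_eq_zero (he : IsChart e) {A : Finset (Fin m → ℕ)}
    {C : Coeffs m d (Series d (smoothRing (chartConn htor he).dom))}
    {O : (Fin m → SmoothFun d M) → SmoothFun d M}
    (h : ∀ (q : (chartConn htor he).dom) f, dop A (fun a J => evalSeries q (C a J))
      (fun l => expTaylor nabla e (e.symm q) (f l)) = expTaylor nabla e (e.symm q) (O f)) :
    ∀ q i, fedosovAt (chartConn htor he) A C q i = 0 := by
  rw [fedosovAt_eq_zero_iff]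
  intro g i
  refine ext_evalSeries fun q => ?_
  choose f hf using fun l => he.exists_global htor q (g l)
  rw [evalSeries_flatDer_congr _ q i
    (s' := (chartConn htor he).ring.tau (chartFn htor he (O f))), ConnRing.flatDer_tau]
  have h1 : ∀ᶠ p in 𝓝 (q : Vec d), ∀ l, (fun p => smoothFn (g l) (e p)) =ᶠ[𝓝 (e.symm p)] f l := by
    rw [Filter.eventually_all]
    exact fun l => (e.continuousAt_symm q.2).eventually (eventually_eventually_nhds.2 (hf l))
  filter_upwards [h1] with p hp hpm
  rw [evalSeries_dop, ← tauAt_apply, ← he.expTaylor_chartFn htor, ← h]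
  congr 1
  funext l
  exact (he.expTaylor_eq_tauAt htor ⟨p, hpm⟩ (g l) (hp l)).symm

lemma IsChart.dop_expTaylor_of_fedosovAt (he : IsChart e) {A : Finset (Fin m → ℕ)}
    {C : Coeffs m d (Series d (smoothRing (chartConn htor he).dom))}
    (h : ∀ q i, fedosovAt (chartConn htor he) A C q i = 0)
    (f : Fin m → SmoothFun d M) (q : (chartConn htor he).dom) :
    dop A (fun a J => evalSeries q (C a J)) (fun l => expTaylor nabla e (e.symm q) (f l)) =
      tauAt (chartConn htor he) q (constantCoeff (dop A C fun l =>
        (chartConn htor he).ring.tau (chartFn htor he (f l)))) := by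
  rw [fedosovAt_eq_zero_iff] at h
  rw [tauAt_apply, ← ConnRing.eq_tau_of_flat _ fun i => h _ i, evalSeries_dop]
  simp only [he.expTaylor_chartFn htor]
  rfl

lemma sum_arityBox {N : ℕ} {R : Type*} [AddCommMonoid R] (F : (Fin m → ℕ) → R) :
    ∑ a : Fin m → Fin (N + 1), F (fun l => a l) = ∑ a ∈ arityBox m N, F a := by
  refine Finset.sum_bij (fun a _ l => (a l : ℕ)) ?_ ?_ ?_ fun _ _ => rfl
  · exact fun a _ => mem_arityBox.2 fun l => Nat.lt_succ_iff.1 (a l).2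
  · exact fun a _ b _ h => funext fun l => Fin.ext (congrFun h l)
  · exact fun a ha => ⟨fun l => ⟨a l, Nat.lt_succ_iff.2 (mem_arityBox.1 ha l)⟩, mem_univ _, rfl⟩

lemma evalAt_diffOp_chartFn (he : IsChart e) (A : Finset (Fin m → ℕ))
    (k : Coeffs m d (smoothRing (chartConn htor he).dom))
    (f : Fin m → SmoothFun d M) (q : (chartConn htor he).dom) :
    evalAt q (diffOp (chartConn htor he).ring A k fun l => chartFn htor he (f l)) =
      ∑ a ∈ A, ∑ J, evalAt q (k a J) * ∏ l : Fin m,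
        iteratedFDeriv ℝ (a l) (fun q' => f l (e.symm q')) q fun j => basisVec (J ⟨l, j⟩) := by
  rw [diffOp, map_sum]
  refine sum_congr rfl fun a _ => ?_
  rw [map_sum]
  refine sum_congr rfl fun J _ => ?_
  rw [map_mul, map_prod]
  congr 1
  refine prod_congr rfl fun l _ => ?_
  exact evalAt_derList_smoothMk _ _ q

lemma PolyDiffOp.hasLocalForm (O : PolyDiffOp d M m) :
    HasLocalForm htor fun f x => O.toFun f x := by
  intro x
  obtain ⟨e, he, hx, N, c, hc, hO⟩ := O.local_form x
  refine ⟨e, he, hx, arityBox m N, fun a J => if h : ∀ l, a l < N + 1 then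
    smoothMk (c (fun l => ⟨a l, h l⟩) J) (hc _ _) else 0, fun f q => ?_⟩
  refine (hO f q q.2).trans (Eq.trans ?_ (evalAt_diffOp_chartFn htor he _ _ f q).symm)
  refine Eq.trans ?_ (sum_arityBox _)
  refine sum_congr rfl fun a _ => sum_congr rfl fun J _ => ?_
  congr 1
  rw [dif_pos fun l => (a l).2]
  rfl

lemma DPolySection.isTaylorExpansion_iff (S : DPolySection d M m) (O : PolyDiffOp d M m) :
    S.IsTaylorExpansion nabla O ↔
      ∀ x, IsLift nabla (fun f x => O.toFun f x) x fun n a => (S.tensor n a).at x := by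
  have h1 : ∀ (e : OpenPartialHomeomorph M (Vec d)) (_ : IsChart e) (x : M) (_ : x ∈ e.source),
      S.series e (e x) = fun a => fiberSeries e x fun n => (S.tensor n a).at x := by
    intro e he x hx
    funext a J
    refine congrArg genSeries (funext fun n => funext fun I => ?_)
    rw [he.comp_eq _ (e.map_source hx), e.left_inv hx]
  constructor
  · intro h x
    refine ⟨fun n a => S.symm n a x, fun n a => S.block_symm n a x, ?_, fun e he hx f => ?_⟩
    · obtain ⟨N, hN⟩ := S.order_bdd x
      exact ⟨N, hN.self_of_nhds⟩
    · rw [← h1 e he x hx]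
      exact h e he x hx f
  · intro h e he x hx f
    rw [h1 e he x hx]
    exact (h x).eq e he hx f

lemma DPolySection.ext_at {S S' : DPolySection d M m}
    (h : ∀ n a x, (S.tensor n a).at x = (S'.tensor n a).at x) : S = S' := by
  have h1 : S.tensor = S'.tensor := funext fun n => funext fun a => TensorField.ext_at (h n a)
  cases S
  cases S'
  simpa using h1

include htor in
theorem existsUnique_dPoly (O : PolyDiffOp d M m) :
    ∃! S : DPolySection d M m, S.IsTaylorExpansion nabla O := by
  obtain ⟨t, ht, hN⟩ := exists_lift_tensors htor (O.hasLocalForm htor)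
  let S : DPolySection d M m :=
    { tensor := t
      symm := fun n a x σ v w => (ht x).symm n a σ v w
      block_symm := fun n a x v σ w => (ht x).block_symm n a v σ w
      order_bdd := hN }
  refine ⟨S, (S.isTaylorExpansion_iff O).2 ht, fun S' hS' => ?_⟩
  refine DPolySection.ext_at fun n a x => ?_
  have h1 := ((S'.isTaylorExpansion_iff O).1 hS' x).unique htor (ht x)
  exact congrFun (congrFun h1 n) a

lemma TensorField.smoothSeriesOn {κ : Type} (T : (n : ℕ) → TensorField d M n κ)
    (he : IsChart e) (J : κ → Fin d) :
    SmoothSeriesOn (chartConn htor he).dom fun q => genSeries fun n I => (T n).comp e q I J := by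
  intro α
  change ContDiffOn ℝ ∞ (fun q => ∑ I : Fin α.degree → Fin d,
    if ∑ j, Finsupp.single (I j) 1 = α then (T α.degree).comp e q I J else 0) e.target
  refine ContDiffOn.sum fun I _ => ?_
  split_ifs
  · exact (T α.degree).smooth e he I J
  · exact contDiffOn_const

/-- The series of a family of tensor fields in a chart, with smooth functions as coefficients. -/
def chartSeries {κ : Type} (T : (n : ℕ) → TensorField d M n κ) (he : IsChart e) (J : κ → Fin d) :
    Series d (smoothRing (chartConn htor he).dom) :=
  liftSeries _ (TensorField.smoothSeriesOn htor T he J)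

lemma evalSeries_chartSeries {κ : Type} (T : (n : ℕ) → TensorField d M n κ) (he : IsChart e)
    (J : κ → Fin d) (q : (chartConn htor he).dom) :
    evalSeries q (chartSeries htor T he J) = genSeries fun n I => (T n).comp e q I J := by
  ext α
  rfl

lemma IsChart.genSeries_comp {κ : Type} [Fintype κ] [DecidableEq κ] (he : IsChart e)
    (T : (n : ℕ) → TensorField d M n κ) {q : Vec d} (hq : q ∈ e.target) (J : κ → Fin d) :
    genSeries (fun n I => (T n).comp e q I J) =
      fiberSeries e (e.symm q) (fun n => (T n).at (e.symm q)) J :=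
  congrArg genSeries (funext fun _ => funext fun I => he.comp_eq _ hq I J)

variable (S : DPolySection d M m)

lemma DPolySection.order_bdd_at (x : M) :
    ∃ N : ℕ, ∀ᶠ p in 𝓝 x, ∀ n a, (∃ l, N < a l) → (S.tensor n a).at p = 0 := S.order_bdd x

/-- The coefficients of a section in a chart. -/
def DPolySection.coeffs (he : IsChart e) (a : Fin m → ℕ) (J : Blocks a → Fin d) :
    Series d (smoothRing (chartConn htor he).dom) :=
  chartSeries htor (S.tensor · a) he J

variable {S} {N : ℕ}

lemma DPolySection.coeffs_eq_zero (he : IsChart e)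
    (hN : ∀ p ∈ e.source, ∀ n a, (∃ l, N < a l) → (S.tensor n a).at p = 0) {a : Fin m → ℕ}
    (ha : a ∉ arityBox m N) (J : Blocks a → Fin d) : S.coeffs htor he a J = 0 := by
  rw [mem_arityBox] at ha
  push Not at ha
  refine ext_evalSeries fun q => ?_
  rw [DPolySection.coeffs, evalSeries_chartSeries, he.genSeries_comp _ q.2, map_zero]
  simp only [hN _ (e.map_target q.2) _ a ha]
  exact fiberSeries_zero _ J

lemma DPolySection.dpolyOp_series (he : IsChart e)
    (hN : ∀ p ∈ e.source, ∀ n a, (∃ l, N < a l) → (S.tensor n a).at p = 0)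
    (q : (chartConn htor he).dom) : dpolyOp (S.series e q) =
      dop (arityBox m N) fun a J => evalSeries q (S.coeffs htor he a J) := by
  have h1 : S.series e q = fun a J => evalSeries q (S.coeffs htor he a J) :=
    funext fun a => funext fun J => (evalSeries_chartSeries htor _ he J q).symm
  rw [h1]
  exact dpolyOp_eq_dop _ _ fun a ha J => by
    rw [S.coeffs_eq_zero htor he hN ha, map_zero]

lemma DPolySection.fedosovD_eq (he : IsChart e)
    (hN : ∀ p ∈ e.source, ∀ n a, (∃ l, N < a l) → (S.tensor n a).at p = 0)
    (q : (chartConn htor he).dom) (i : Fin d) :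
    fedosovD (christoffel nabla e) q i
      (dpolyOp fun a J => xDeriv i (fun q' => S.series e q' a J) q) (dpolyOp (S.series e q)) =
    fedosovAt (chartConn htor he) (arityBox m N) (S.coeffs htor he) q i := by
  have h1 : (fun a J => xDeriv i (fun q' => S.series e q' a J) q) = fun a J =>
      evalSeries q ((chartConn htor he).ring.dx i (S.coeffs htor he a J)) :=
    funext fun a => funext fun J => xDeriv_eq i
      (fun q => evalSeries_chartSeries htor (fun n => S.tensor n a) he J q) q
  rw [S.dpolyOp_series htor he hN q, h1, dpolyOp_eq_dop (arityBox m N)]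
  · rfl
  · intro a ha J
    rw [S.coeffs_eq_zero htor he hN ha, map_zero, map_zero]

include htor in
lemma DPolySection.isHorizontal_of_isTaylorExpansion {O : PolyDiffOp d M m}
    (h : S.IsTaylorExpansion nabla O) : S.IsHorizontal nabla := by
  intro e he q hq i
  obtain ⟨N, hN⟩ := S.order_bdd (e.symm q)
  obtain ⟨V, hV, hqV, hVN⟩ := he.exists_restr (e.map_target hq) hN
  have hq' : q ∈ (e.restr V).target := by
    have := (e.restr V).map_source hqV
    rwa [show (e.restr V) (e.symm q) = e (e.symm q) from rfl, e.right_inv hq] at this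
  refine (S.fedosovD_eq htor hV hVN ⟨q, hq'⟩ i).trans ?_
  refine hV.fedosovAt_eq_zero htor (O := O.toFun) (fun q f => ?_) _ _
  have h1 := h _ hV _ ((e.restr V).map_target q.2) f
  rw [(e.restr V).right_inv q.2, S.dpolyOp_series htor hV hVN q] at h1
  exact h1

lemma HasLocalForm.contMDiff {O : (Fin m → SmoothFun d M) → M → ℝ}
    (h : HasLocalForm htor O) (f : Fin m → SmoothFun d M) :
    ContMDiff (𝓡 d) 𝓘(ℝ, ℝ) ∞ (O f) := by
  intro x
  obtain ⟨e, he, hx, A, k, hk⟩ := h x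
  have h1 := he.eventually_eq_of_forall htor ⟨e x, e.map_source hx⟩ (hk f)
  simp only [e.left_inv hx] at h1
  refine ContMDiffAt.congr_of_eventuallyEq (he.contMDiffAt_of_contDiffAt hx
    ((contDiffOn_smoothFn _).contDiffAt (e.open_target.mem_nhds (e.map_source hx)))) h1.symm

/-- The polydifferential operator with given local forms. -/
def PolyDiffOp.ofLocalForm {O : (Fin m → SmoothFun d M) → M → ℝ} (h : HasLocalForm htor O)
    (hm : ∀ x, ∃ Φ : MultilinearMap ℝ (fun _ : Fin m => SmoothFun d M) ℝ, ∀ f, O f x = Φ f) :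
    PolyDiffOp d M m where
  toFun :=
    { toFun := fun f => ⟨O f, h.contMDiff htor f⟩
      map_update_add' := fun {inst} f l g g' => by
        obtain rfl : inst = instDecidableEqFin m := Subsingleton.elim _ _
        ext x
        obtain ⟨Φ, hΦ⟩ := hm x
        change O _ x = O _ x + O _ x
        rw [hΦ, hΦ, hΦ, Φ.map_update_add]
      map_update_smul' := fun {inst} f l r g => by
        obtain rfl : inst = instDecidableEqFin m := Subsingleton.elim _ _
        ext x
        obtain ⟨Φ, hΦ⟩ := hm x
        change O _ x = r • O _ x
        rw [hΦ, hΦ, Φ.map_update_smul] }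
  local_form x := by
    classical
    obtain ⟨e, he, hx, A, k, hk⟩ := h x
    obtain ⟨N, hN⟩ := exists_arityBox A
    refine ⟨e, he, hx, N, fun a J => if (fun l => (a l : ℕ)) ∈ A then
      smoothFn (k (fun l => a l) J) else 0, fun a J => ?_, fun f q hq => ?_⟩
    · dsimp only
      split_ifs
      · exact contDiffOn_smoothFn _
      · exact contDiffOn_const
    · refine (hk f ⟨q, hq⟩).trans ((evalAt_diffOp_chartFn htor he A k f ⟨q, hq⟩).trans ?_)
      refine Eq.trans ?_ (sum_arityBox fun a => ∑ J, (if a ∈ A then smoothFn (k a J) else 0) q *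
        ∏ l : Fin m, iteratedFDeriv ℝ (a l) (fun q' => f l (e.symm q')) q
          fun j => basisVec (J ⟨l, j⟩)).symm
      rw [← sum_subset hN]
      · refine sum_congr rfl fun a ha => sum_congr rfl fun J _ => ?_
        rw [if_pos ha]
        congr 1
        exact (smoothFn_eq (k a J) ⟨q, hq⟩).symm
      · intro a _ ha
        simp [ha]

lemma constantCoeff_linSubst (L : Fin d → Fin d → ℝ) (p : FPS d) :
    constantCoeff (linSubst L p) = constantCoeff p := by
  have h1 : ∀ (p : FPS d) v, homValue 0 p v = constantCoeff p := fun p v => by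
    rw [homValue, Finset.finsuppAntidiag_zero, sum_singleton]
    simp
  rw [← h1 _ 0, ← h1 p fun k => ∑ i, L i k * (0 : Fin d → ℝ) i, homValue_linSubst]

variable (S nabla) in
/-- The operator which belongs to a section. -/
def DPolySection.opValue (f : Fin m → SmoothFun d M) (x : M) : ℝ := constantCoeff (dpolyOp
    (fun a => fiberSeries (chartAt (Vec d) x) x fun n => (S.tensor n a).at x)
    fun l => expTaylor nabla (chartAt (Vec d) x) x (f l))

include htor in
lemma DPolySection.opValue_eq (he : IsChart e) {x : M} (hx : x ∈ e.source)
    (f : Fin m → SmoothFun d M) : S.opValue nabla f x = constantCoeff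
      (dpolyOp (fun a => fiberSeries e x fun n => (S.tensor n a).at x)
        fun l => expTaylor nabla e x (f l)) := by
  obtain ⟨N, hN⟩ := S.order_bdd_at x
  rw [DPolySection.opValue, he.dpolyOp_change htor (IsManifold.chart_mem_maximalAtlas x) hx
    (mem_chart_source _ x) ⟨N, hN.self_of_nhds⟩, constantCoeff_linSubst]

lemma DPolySection.opValue_symm (he : IsChart e)
    (hN : ∀ p ∈ e.source, ∀ n a, (∃ l, N < a l) → (S.tensor n a).at p = 0)
    (f : Fin m → SmoothFun d M) (q : (chartConn htor he).dom) :
    S.opValue nabla f (e.symm q) = evalAt q (constantCoeff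
      (dop (arityBox m N) (S.coeffs htor he) fun l =>
        (chartConn htor he).ring.tau (chartFn htor he (f l)))) := by
  have h1 : (fun a => fiberSeries e (e.symm q) fun n => (S.tensor n a).at (e.symm q)) =
      S.series e q := funext fun a => funext fun J => (he.genSeries_comp _ q.2 J).symm
  rw [S.opValue_eq htor he (e.map_target q.2), h1, S.dpolyOp_series htor he hN q]
  simp only [he.expTaylor_chartFn htor, tauAt_apply]
  rw [← evalSeries_dop]
  rfl

lemma DPolySection.hasLocalForm_opValue : HasLocalForm htor (S.opValue nabla) := by
  intro x
  obtain ⟨N, hN⟩ := S.order_bdd_at x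
  obtain ⟨V, hV, hxV, hVN⟩ := IsChart.exists_restr (d := d)
    (IsManifold.chart_mem_maximalAtlas x) (mem_chart_source (Vec d) x) hN
  obtain ⟨N', k, hk⟩ := (chartConn htor hV).ring.exists_descent (arityBox m N) (S.coeffs htor hV)
  exact ⟨_, hV, hxV, arityBox m N', k, fun f q => by
    rw [S.opValue_symm htor hV hVN, hk]⟩

/-- The restriction of functions to a chart, as a linear map. -/
def chartFnLinear (he : IsChart e) : SmoothFun d M →ₗ[ℝ] smoothRing (chartConn htor he).dom where
  toFun := chartFn htor he
  map_add' _ _ := rfl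
  map_smul' _ _ := rfl

include htor in
lemma DPolySection.exists_multilinear_opValue (x : M) :
    ∃ Φ : MultilinearMap ℝ (fun _ : Fin m => SmoothFun d M) ℝ, ∀ f, S.opValue nabla f x = Φ f := by
  obtain ⟨N, hN⟩ := S.order_bdd_at x
  have he : IsChart (chartAt (Vec d) x) := IsManifold.chart_mem_maximalAtlas x
  have hx : x ∈ (chartAt (Vec d) x).source := mem_chart_source _ x
  refine ⟨(coeff (R := ℝ) (0 : Fin d →₀ ℕ)).compMultilinearMap
    ((dop (arityBox m N) fun a => fiberSeries (chartAt (Vec d) x) x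
      fun n => (S.tensor n a).at x).compLinearMap fun _ =>
        (tauAt (chartConn htor he) ⟨chartAt (Vec d) x x, (chartAt (Vec d) x).map_source hx⟩
          ).toLinearMap ∘ₗ chartFnLinear htor he), fun f => ?_⟩
  rw [DPolySection.opValue, dpolyOp_fiberSeries hN.self_of_nhds]
  have h1 : ∀ l, expTaylor nabla (chartAt (Vec d) x) x (f l) =
      tauAt (chartConn htor he) ⟨chartAt (Vec d) x x, (chartAt (Vec d) x).map_source hx⟩
        (chartFn htor he (f l)) := fun l => by
    rw [← he.expTaylor_chartFn htor, (chartAt (Vec d) x).left_inv hx]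
  simp only [h1]
  rfl

include htor in
theorem DPolySection.isHorizontal_iff :
    S.IsHorizontal nabla ↔ ∃ O : PolyDiffOp d M m, S.IsTaylorExpansion nabla O := by
  refine ⟨fun h => ⟨PolyDiffOp.ofLocalForm htor (S.hasLocalForm_opValue htor)
    (S.exists_multilinear_opValue htor), ?_⟩,
    fun ⟨O, hO⟩ => S.isHorizontal_of_isTaylorExpansion htor hO⟩
  rw [DPolySection.isTaylorExpansion_iff]
  intro x
  obtain ⟨N, hN⟩ := S.order_bdd_at x
  obtain ⟨V, hV, hxV, hVN⟩ := IsChart.exists_restr (d := d)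
    (IsManifold.chart_mem_maximalAtlas x) (mem_chart_source (Vec d) x) hN
  set e := (chartAt (Vec d) x).restr V
  let q : (chartConn htor hV).dom := ⟨e x, e.map_source hxV⟩
  have hq : e.symm q = x := e.left_inv hxV
  have h1 : ∀ f : Fin m → SmoothFun d M, _ := fun f =>
    hV.eventually_eq_of_forall htor q (S.opValue_symm htor hV hVN f)
  rw [hq] at h1
  refine IsLift.of_chart htor (fun n a => S.symm n a x) (fun n a => S.block_symm n a x)
    ⟨N, hN.self_of_nhds⟩ hV hxV (fun f => ?_) fun f => ?_
  · have h2 := hV.isExpTaylor_tauAt htor q _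
      (hV.eventually_eq_of_forall htor q (S.opValue_symm htor hV hVN f))
    rw [hq] at h2
    exact ⟨_, h2⟩
  · have h2 := hV.expTaylor_eq_tauAt htor q _
      (hV.eventually_eq_of_forall htor q (S.opValue_symm htor hV hVN f))
    have h3 := hV.dop_expTaylor_of_fedosovAt htor (fun q i =>
      (S.fedosovD_eq htor hV hVN q i).symm.trans (h e hV q q.2 i)) f q
    rw [← h2, ← S.dpolyOp_series htor hV hVN q] at h3
    have h4 : S.series e q = fun a => fiberSeries e (e.symm q) fun n => (S.tensor n a).at (e.symm q) :=
      funext fun a => funext fun J => hV.genSeries_comp _ q.2 J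
    rw [h4, hq] at h3
    exact h3

lemma constantCoeff_genSeries (T : (n : ℕ) → (Fin n → Fin d) → ℝ) :
    constantCoeff (genSeries T) = T 0 Fin.elim0 := by
  have h := hom_genSeries T 0
  rw [hom_zero_eq, genPoly_zero_arity] at h
  simpa using congrArg constantCoeff h

lemma IsChart.constantCoeff_pdList_expTaylor (he : IsChart e)
    (q : (chartConn htor he).dom) {n : ℕ} (f : SmoothFun d M) (J : Fin n → Fin d) :
    constantCoeff (pdList ℝ (List.ofFn J) (expTaylor nabla e (e.symm q) f)) =
      covDerivSym (christoffel nabla e) (fun q' => f (e.symm q')) q J := by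
  rw [he.expTaylor_chartFn htor]
  exact constantCoeff_pdList_tauAt (chartConn htor he) q _ (fun _ => rfl) J

lemma constantCoeff_expTaylor (he : IsChart e) (q : (chartConn htor he).dom) (f : SmoothFun d M) :
    constantCoeff (expTaylor nabla e (e.symm q) f) = f (e.symm q) := by
  rw [he.expTaylor_chartFn htor, tauAt_apply]
  refine Eq.trans (b := evalAt q (constantCoeff ((chartConn htor he).ring.tau
    (chartFn htor he f)))) rfl ?_
  rw [ConnRing.constantCoeff_tau]
  rfl

lemma finsum_eq_sum_arityBox {N : ℕ} {F : (Fin m → ℕ) → ℝ}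
    (h : ∀ a, (∃ l, N < a l) → F a = 0) : ∑ᶠ a, F a = ∑ a ∈ arityBox m N, F a := by
  refine finsum_eq_sum_of_support_subset _ fun a ha => ?_
  by_contra hn
  rw [Finset.mem_coe, mem_arityBox] at hn
  push Not at hn
  exact ha (h a hn)

/-- The tensors associated to the operator which belongs to a section. -/
def DPolySection.symbolTensors (S : DPolySection d M m) : OperatorTensors d M m where
  tensor := S.tensor 0
  block_symm := S.block_symm 0
  order_bdd x := by
    obtain ⟨N, hN⟩ := S.order_bdd x
    exact ⟨N, hN.mono fun p hp => hp 0⟩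

include htor in
theorem DPolySection.isAssociated_symbolTensors {S : DPolySection d M m} {O : PolyDiffOp d M m}
    (h : S.IsTaylorExpansion nabla O) : IsAssociated nabla O S.symbolTensors := by
  intro e he q hq f
  obtain ⟨N, hN⟩ := S.order_bdd_at (e.symm q)
  have hx := e.map_target hq
  have h1 := h e he _ hx f
  rw [e.right_inv hq] at h1
  have h2 : S.series e q = fun a => fiberSeries e (e.symm q) fun n => (S.tensor n a).at (e.symm q) :=
    funext fun a => funext fun J => he.genSeries_comp _ hq J
  rw [h2, dpolyOp_fiberSeries hN.self_of_nhds, ← h2] at h1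
  have h3 := congrArg constantCoeff h1
  rw [constantCoeff_expTaylor htor he ⟨q, hq⟩, dop_apply] at h3
  rw [← h3, map_sum, finsum_eq_sum_arityBox (N := N)]
  · refine sum_congr rfl fun a _ => ?_
    rw [map_sum]
    refine sum_congr rfl fun J _ => ?_
    rw [map_mul, map_prod, DPolySection.series, constantCoeff_genSeries]
    congr 1
    exact prod_congr rfl fun l _ => he.constantCoeff_pdList_expTaylor htor ⟨q, hq⟩ (f l) _
  · intro a ha
    refine sum_eq_zero fun J _ => ?_
    have h4 : (S.tensor 0 a).comp e q Fin.elim0 J = 0 := by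
      rw [he.comp_eq _ hq, hN.self_of_nhds 0 a ha]
      rfl
    exact mul_eq_zero_of_left h4 _

include htor in
theorem OperatorTensors.unique {O : PolyDiffOp d M m} {T T' : OperatorTensors d M m}
    (h : IsAssociated nabla O T) (h' : IsAssociated nabla O T') : T = T' := by
  have key : ∀ a x, (T.tensor a).at x = (T'.tensor a).at x := by
    intro a x
    let e := chartAt (Vec d) x
    have he : IsChart e := IsManifold.chart_mem_maximalAtlas x
    have hx : x ∈ e.source := mem_chart_source _ x
    let q : (chartConn htor he).dom := ⟨e x, e.map_source hx⟩
    have hq : e.symm q = x := e.left_inv hx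
    obtain ⟨N, hN⟩ := T.order_bdd x
    obtain ⟨N', hN'⟩ := T'.order_bdd x
    have hc : ∀ {T : OperatorTensors d M m} {N : ℕ},
        (∀ᶠ p in 𝓝 x, ∀ a, (∃ l, N < a l) → (T.tensor a).toFun p = 0) → ∀ a, (∃ l, N < a l) →
          ∀ J, (T.tensor a).comp e q Fin.elim0 J = 0 := by
      intro T N hN a ha J
      have h2 : (T.tensor a).at x = 0 := hN.self_of_nhds a ha
      rw [he.comp_eq _ q.2, hq, h2]
      rfl
    have h1 : ∀ a, (∃ l, max N N' < a l) → ∀ J, (T.tensor a).comp e q Fin.elim0 J = 0 :=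
      fun a ⟨l, hl⟩ => hc hN a ⟨l, (le_max_left _ _).trans_lt hl⟩
    have h2 : ∀ a, (∃ l, max N N' < a l) → ∀ J, (T'.tensor a).comp e q Fin.elim0 J = 0 :=
      fun a ⟨l, hl⟩ => hc hN' a ⟨l, (le_max_right _ _).trans_lt hl⟩
    have hs : ∀ (T : OperatorTensors d M m) a,
        BlockSymm fun J => (T.tensor a).comp e q Fin.elim0 J := fun T a σ J =>
      T.block_symm a (e.symm q) (fun a => coordVec e (Fin.elim0 a) q) σ
        (fun b => coordCovec e (J b) q)
    have h3 : ∀ s, hom 0 (dop (arityBox m (max N N')) (fun a J => C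
        ((T.tensor a).comp e q Fin.elim0 J - (T'.tensor a).comp e q Fin.elim0 J)) s) = 0 := by
      refine hom_dop_eq_zero_of_tauAt (chartConn htor he) q 0 fun g => ?_
      choose f hf using fun l => he.exists_tauAt_eq htor q (g l)
      have h4 := h e he q q.2 f
      have h5 := h' e he q q.2 f
      rw [finsum_eq_sum_arityBox (N := max N N') fun a ha => sum_eq_zero fun J _ =>
        mul_eq_zero_of_left (h1 a ha J) _] at h4
      rw [finsum_eq_sum_arityBox (N := max N N') fun a ha => sum_eq_zero fun J _ =>
        mul_eq_zero_of_left (h2 a ha J) _] at h5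
      rw [hom_zero_eq, dop_apply, map_sum]
      have h6 : ∀ a (J : Blocks a → Fin d) l, constantCoeff
          (pdList ℝ (blockList J l) (tauAt (chartConn htor he) q (g l))) =
          covDerivSym (christoffel nabla e) (fun q' => f l (e.symm q')) q fun j => J ⟨l, j⟩ :=
        fun a J l => by
          rw [← hf]
          exact he.constantCoeff_pdList_expTaylor htor q (f l) _
      simp only [map_sum, map_mul, map_prod, constantCoeff_C, h6, sub_mul, sum_sub_distrib]
      rw [← h4, ← h5, sub_self, map_zero]
    have h4 := eq_zero_of_constantCoeff_dop (fun a _ σ J =>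
      congrArg₂ (· - ·) (hs T a σ J) (hs T' a σ J)) h3
    refine he.flatTensor_ext hx fun I J => ?_
    obtain rfl : I = Fin.elim0 := Subsingleton.elim _ _
    have h5 : (T.tensor a).comp e q Fin.elim0 J = (T'.tensor a).comp e q Fin.elim0 J := by
      by_cases ha : a ∈ arityBox m (max N N')
      · exact sub_eq_zero.1 (h4 a ha J)
      · rw [mem_arityBox] at ha
        push Not at ha
        rw [h1 a ha, h2 a ha]
    rw [he.comp_eq _ q.2, he.comp_eq _ q.2, hq] at h5
    exact h5
  have h1 : T.tensor = T'.tensor := funext fun a => TensorField.ext_at (key a)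
  cases T
  cases T'
  simpa using h1

include htor in
theorem existsUnique_operatorTensors (O : PolyDiffOp d M m) :
    ∃! T : OperatorTensors d M m, IsAssociated nabla O T := by
  obtain ⟨S, hS, -⟩ := existsUnique_dPoly htor O
  have h := S.isAssociated_symbolTensors htor hS
  exact ⟨_, h, fun T' hT' => OperatorTensors.unique htor hT' h⟩

/-- The components of a contravariant tensor field in a chart. -/
def TensorField.chartComp {κ : Type} (T : TensorField d M 0 κ) (he : IsChart e) (J : κ → Fin d) :
    smoothRing (chartConn htor he).dom :=
  smoothMk (fun q => T.comp e q Fin.elim0 J) (T.smooth e he Fin.elim0 J)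

/-- The component series of a section in a chart. -/
def TPolySection.coeffs (S : TPolySection d M m) (he : IsChart e) (J : Fin m → Fin d) :
    Series d (smoothRing (chartConn htor he).dom) :=
  chartSeries htor S.tensor he J

lemma TPolySection.tpolyOp_series (S : TPolySection d M m) (he : IsChart e)
    (q : (chartConn htor he).dom) : tpolyOp (S.series e q) =
      dop {1} (firstOrder fun J => evalSeries q (S.coeffs htor he J)) := by
  rw [tpolyOp_eq_dop]
  congr 2

lemma IsChart.expTaylor_coord (he : IsChart e) (q : (chartConn htor he).dom) (k : Fin d) :
    expTaylor nabla e (e.symm q) (fun p => e p k) =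
      evalSeries q ((chartConn htor he).ring.phi k) := by
  refine he.expTaylor_eq_tauAt htor q ((chartConn htor he).ring.coord k) ?_
  filter_upwards [e.open_source.mem_nhds (e.map_target q.2)] with p hp
  exact extZero_of_mem _ (e.map_source hp)

lemma IsChart.expTaylor_comp (he : IsChart e) (q : (chartConn htor he).dom)
    (F : TensorField d M 0 (Fin m)) (I : Fin m → Fin d) :
    expTaylor nabla e (e.symm q) (fun p => F.comp e (e p) Fin.elim0 I) =
      evalSeries q ((chartConn htor he).ring.tau (F.chartComp htor he I)) := by
  refine he.expTaylor_eq_tauAt htor q (F.chartComp htor he I) ?_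
  filter_upwards [e.open_source.mem_nhds (e.map_target q.2)] with p hp
  exact extZero_of_mem _ (e.map_source hp)

lemma evalSeries_transform {U : TopologicalSpace.Opens (Vec d)} (q : U)
    (X : Matrix (Fin d) (Fin d) (Series d (smoothRing U)))
    (c : (Fin m → Fin d) → Series d (smoothRing U)) (I : Fin m → Fin d) :
    evalSeries q (transform X c I) =
      ∑ J : Fin m → Fin d, evalSeries q (c J) * ∏ a, evalSeries q (X (I a) (J a)) := by
  simp only [transform, map_sum, map_mul, map_prod, mul_comm]

theorem TPolySection.isTaylorExpansion_iff (S : TPolySection d M m) (F : PolyvectorField d M m) :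
    S.IsTaylorExpansion nabla F ↔ ∀ (e : OpenPartialHomeomorph M (Vec d)) (he : IsChart e),
      S.coeffs htor he = (chartConn htor he).ring.liftPoly (F.tensor.chartComp htor he) := by
  have key : ∀ (e : OpenPartialHomeomorph M (Vec d)) (he : IsChart e)
      (q : (chartConn htor he).dom) (I : Fin m → Fin d),
      tpolyOp (S.series e q) (fun a => expTaylor nabla e (e.symm q) fun p => e p (I a)) =
        evalSeries q (transform (chartConn htor he).ring.jac
          (S.coeffs htor he) I) := fun e he q I => by
    rw [evalSeries_transform, tpolyOp]
    refine sum_congr rfl fun J _ => ?_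
    rw [TPolySection.coeffs, evalSeries_chartSeries]
    congr 1
    refine prod_congr rfl fun a _ => ?_
    rw [he.expTaylor_coord htor, ← evalSeries_pderiv]
    rfl
  constructor
  · intro h e he
    rw [ConnRing.eq_liftPoly_iff]
    refine fun I => ext_evalSeries fun q => ?_
    have h1 := h e he _ (e.map_target q.2) I
    rw [e.right_inv q.2] at h1
    rw [← he.expTaylor_comp htor, ← h1, key e he q I]
  · intro h e he x hx I
    have h1 := (ConnRing.eq_liftPoly_iff _).1 (h e he) I
    have h2 := key e he ⟨e x, e.map_source hx⟩ I
    rw [h1, ← he.expTaylor_comp htor] at h2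
    simpa only [e.left_inv hx] using h2

lemma TPolySection.ext_at {S S' : TPolySection d M m}
    (h : ∀ n x, (S.tensor n).at x = (S'.tensor n).at x) : S = S' := by
  have h1 : S.tensor = S'.tensor := funext fun n => TensorField.ext_at (h n)
  cases S
  cases S'
  simpa using h1

include htor in
lemma TPolySection.eq_of_coeffs_eq {S S' : TPolySection d M m}
    (h : ∀ (e : OpenPartialHomeomorph M (Vec d)) (he : IsChart e),
      S.coeffs htor he = S'.coeffs htor he) : S = S' := by
  refine TPolySection.ext_at fun n x => ?_
  have he : IsChart (chartAt (Vec d) x) := IsManifold.chart_mem_maximalAtlas x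
  have hx := mem_chart_source (Vec d) x
  refine congrFun (eq_of_fiberSeries_eq he hx (t := fun n => (S.tensor n).at x)
    (t' := fun n => (S'.tensor n).at x) (fun n => S.symm n x) (fun n => S'.symm n x)
    fun J => ?_) n
  have h1 := congrArg (evalSeries ⟨chartAt (Vec d) x x, (chartAt (Vec d) x).map_source hx⟩)
    (congrFun (h _ he) J)
  rw [TPolySection.coeffs, TPolySection.coeffs, evalSeries_chartSeries, evalSeries_chartSeries,
    he.genSeries_comp _ ((chartAt (Vec d) x).map_source hx),
    he.genSeries_comp _ ((chartAt (Vec d) x).map_source hx)] at h1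
  simpa only [(chartAt (Vec d) x).left_inv hx] using h1

lemma TPolySection.fedosovD_eq (S : TPolySection d M m) (he : IsChart e)
    (q : (chartConn htor he).dom) (i : Fin d) :
    fedosovD (christoffel nabla e) q i
      (tpolyOp fun J => xDeriv i (fun q' => S.series e q' J) q) (tpolyOp (S.series e q)) =
    fedosovAt (chartConn htor he) {1} (firstOrder (S.coeffs htor he)) q i := by
  have h1 : (fun J => xDeriv i (fun q' => S.series e q' J) q) = fun J =>
      evalSeries q ((chartConn htor he).ring.dx i (S.coeffs htor he J)) :=
    funext fun J => xDeriv_eq i (fun q => evalSeries_chartSeries htor S.tensor he J q) q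
  have h2 : ∀ (f : Series d (smoothRing (chartConn htor he).dom) → FPS d),
      f 0 = 0 → ∀ c : (Fin m → Fin d) → Series d _,
      firstOrder (fun J => f (c J)) = fun a (J : Blocks a → Fin d) => f (firstOrder c a J) := by
    intro f hf c
    funext a J
    rw [firstOrder, firstOrder]
    split_ifs
    · rfl
    · exact hf.symm
  rw [S.tpolyOp_series htor he q, h1, tpolyOp_eq_dop,
    h2 (fun s => evalSeries q ((chartConn htor he).ring.dx i s)) (by simp),
    h2 (fun s => evalSeries q s) (by simp)]
  rfl

/-- The differential of a function, as a covector in the model space. -/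
def fnDeriv (f : SmoothFun d M) (x : M) : Vec d →L[ℝ] ℝ := mfderiv (𝓡 d) 𝓘(ℝ, ℝ) f x

/-- The first order operator which belongs to a polyvector field. -/
def PolyvectorField.opValue (F : PolyvectorField d M m) (f : Fin m → SmoothFun d M) (x : M) : ℝ :=
  F.tensor.at x Fin.elim0 fun a => fnDeriv (f a) x

lemma IsChart.fnDeriv_chartFrame (he : IsChart e) (f : SmoothFun d M) {q : Vec d}
    (hq : q ∈ e.target) (i : Fin d) :
    fnDeriv f (e.symm q) (chartFrame e i (e.symm q)) = pd i (fun q' => f (e.symm q')) q := by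
  have h1 : MDifferentiableAt (𝓡 d) 𝓘(ℝ, ℝ) f (e.symm q) := f.contMDiff.mdifferentiable (by simp) _
  have h2 := mfderiv_comp_apply q h1 (he.mdifferentiableAt_symm hq) (basisVec i)
  rw [chartFrame_symm i hq, pd, ← mfderiv_eq_fderiv]
  exact h2.symm

lemma PolyvectorField.opValue_symm (F : PolyvectorField d M m) (he : IsChart e)
    (f : Fin m → SmoothFun d M) (q : (chartConn htor he).dom) :
    F.opValue f (e.symm q) = evalAt q (∑ I : Fin m → Fin d, F.tensor.chartComp htor he I *
      ∏ a, (chartConn htor he).ring.der (I a) (chartFn htor he (f a))) := by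
  rw [PolyvectorField.opValue, he.flatTensor_apply (e.map_target q.2), Fintype.sum_unique, map_sum]
  refine sum_congr rfl fun J _ => ?_
  rw [map_mul, map_prod, Fintype.prod_empty, one_mul, mul_comm]
  congr 1
  · refine Eq.trans ?_ (he.comp_eq F.tensor q.2 Fin.elim0 J).symm
    congr 1
  · refine prod_congr rfl fun a _ => ?_
    rw [he.fnDeriv_chartFrame (f a) q.2]
    exact (evalAt_partialDer_of_eq _ _ _ (fun _ => rfl) q).symm

lemma diffOp_firstOrder {R : Type*} [CommRing R] [Algebra ℝ R] (Q : ConnRing d R)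
    (k : (Fin m → Fin d) → R) (g : Fin m → R) :
    diffOp Q {1} (firstOrder k) g = ∑ J : Fin m → Fin d, k J * ∏ a, Q.der (J a) (g a) := by
  rw [diffOp, sum_singleton, ← (Equiv.arrowCongr (blocksOne m) (Equiv.refl (Fin d))).sum_comp]
  refine sum_congr rfl fun J _ => ?_
  rw [firstOrder_one]
  congr 1

lemma PolyvectorField.hasLocalForm_opValue (F : PolyvectorField d M m) :
    HasLocalForm htor F.opValue := fun x =>
  ⟨chartAt (Vec d) x, IsManifold.chart_mem_maximalAtlas x, mem_chart_source _ x, {1}, _,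
    fun f q => (F.opValue_symm htor _ f q).trans
      (congrArg (evalAt q) (diffOp_firstOrder _ _ _).symm)⟩

lemma blockSymm_firstOrder {B : Type*} [Zero B] (c : (Fin m → Fin d) → B) (a : Fin m → ℕ) :
    BlockSymm (firstOrder c a) := by
  intro σ J
  by_cases h : a = 1
  · subst h
    rw [firstOrder_one, firstOrder_one]
    congr 1
    funext l
    have : σ l = 1 := Subsingleton.elim (α := Equiv.Perm (Fin 1)) _ _
    simp [Equiv.sigmaCongrRight, this]
  · rw [firstOrder_of_ne c h, firstOrder_of_ne c h]

/-- Renaming the contravariant slots of a tensor field. -/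
def TensorField.reindex {n : ℕ} {κ κ' : Type} (T : TensorField d M n κ) (σ : κ ≃ κ') :
    TensorField d M n κ' where
  toFun x := (MultilinearMap.domDomCongrLinearEquiv ℝ ℝ (TangentSpace (𝓡 d) x →L[ℝ] ℝ) ℝ
    σ).toLinearMap.compMultilinearMap (T.toFun x)
  smooth e he I J := T.smooth e he I (J ∘ σ)

lemma symCoeff_smul {n : ℕ} (r : ℝ) (s : FPS d) (I : Fin n → Fin d) :
    symCoeff (r • s) n I = r * symCoeff s n I := by
  rw [symCoeff, symCoeff, map_smul, smul_eq_C_mul, map_mul,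
    constantCoeff_C, smul_eq_mul, smul_eq_mul, mul_left_comm]

lemma evalSeries_smul {U : TopologicalSpace.Opens (Vec d)} (q : U) (r : ℝ)
    (s : Series d (smoothRing U)) : evalSeries q (r • s) = r • evalSeries q s := by
  ext α
  rw [coeff_evalSeries, ConnRing.coeff_real_smul, map_smul]
  rfl

include htor in
theorem TPolySection.exists_isTaylorExpansion (F : PolyvectorField d M m) :
    ∃ S : TPolySection d M m, S.IsTaylorExpansion nabla F := by
  obtain ⟨t, ht, -⟩ := exists_lift_tensors htor (F.hasLocalForm_opValue htor)
  let T : (n : ℕ) → TensorField d M n (Fin m) := fun n => (t n 1).reindex (blocksOne m).symm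
  have key : ∀ (e : OpenPartialHomeomorph M (Vec d)) (he : IsChart e)
      (q : (chartConn htor he).dom) n I J, frameComp e (e.symm q) ((T n).at (e.symm q)) I J =
        symCoeff (evalSeries q ((chartConn htor he).ring.liftPoly
          (F.tensor.chartComp htor he) J)) n I := by
    intro e he q n I J
    have h1 := he.isLift_tensorOfSeries htor (O := F.opValue) (A := {1})
      (C := firstOrder ((chartConn htor he).ring.liftPoly (F.tensor.chartComp htor he)))
      (blockSymm_firstOrder _) (fun b hb J => firstOrder_of_ne _ (by simpa using hb) J)
      (F.opValue_symm htor he) (fun f => ConnRing.dop_liftPoly _ _ _) q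
    have h2 := congrFun (congrFun ((ht _).unique htor h1) n) 1
    have h3 : frameComp e (e.symm q) ((T n).at (e.symm q)) I J =
        frameComp e (e.symm q) ((t n 1).at (e.symm q)) I (J ∘ (blocksOne m).symm) := rfl
    rw [h3, h2, he.frameComp_tensorOfSeries htor, evalAt_symCoeff, firstOrder_one]
    rfl
  have hS : ∀ n x (σ : Equiv.Perm (Fin n)) v w, (T n).at x (v ∘ σ) w = (T n).at x v w :=
    fun n x σ v w => (ht x).symm n 1 σ v _
  have hA : ∀ n x v (σ : Equiv.Perm (Fin m)) w,
      (T n).at x v (w ∘ σ) = ((Equiv.Perm.sign σ : ℤ) : ℝ) * (T n).at x v w := by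
    intro n x v σ w
    let e := chartAt (Vec d) x
    have he : IsChart e := IsManifold.chart_mem_maximalAtlas x
    have hx : x ∈ e.source := mem_chart_source (Vec d) x
    refine he.flatTensor_perm_right hx (fun I J => ?_) v w
    have h1 := key e he ⟨e x, e.map_source hx⟩ n I
    simp only [e.left_inv hx] at h1
    rw [h1, h1, ConnRing.liftPoly_comp_perm (r := ((Equiv.Perm.sign σ : ℤ) : ℝ)), evalSeries_smul,
      symCoeff_smul]
    intro I
    refine smoothRing.ext_evalAt fun q => ?_
    rw [map_smul]
    exact F.alt (e.symm q) (fun a => coordVec e (Fin.elim0 a) q) σ fun b => coordCovec e (I b) q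
  refine ⟨⟨T, hS, hA⟩, (TPolySection.isTaylorExpansion_iff htor _ F).2 fun e he => ?_⟩
  refine funext fun J => ext_evalSeries fun q => ?_
  rw [TPolySection.coeffs, evalSeries_chartSeries, ← genSeries_symCoeff (evalSeries q
    ((chartConn htor he).ring.liftPoly (F.tensor.chartComp htor he) J))]
  congr 1
  funext n I
  rw [← key, he.comp_eq _ q.2]

include htor in
theorem existsUnique_tPoly (F : PolyvectorField d M m) :
    ∃! S : TPolySection d M m, S.IsTaylorExpansion nabla F := by
  obtain ⟨S, hS⟩ := TPolySection.exists_isTaylorExpansion htor F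
  refine ⟨S, hS, fun S' hS' => TPolySection.eq_of_coeffs_eq htor fun e he => ?_⟩
  rw [(S.isTaylorExpansion_iff htor F).1 hS, (S'.isTaylorExpansion_iff htor F).1 hS']

include htor in
theorem TPolySection.isHorizontal_iff (S : TPolySection d M m) :
    S.IsHorizontal nabla ↔ ∃ F : PolyvectorField d M m, S.IsTaylorExpansion nabla F := by
  constructor
  · intro h
    refine ⟨⟨S.tensor 0, S.alt 0⟩, (S.isTaylorExpansion_iff htor _).2 fun e he => ?_⟩
    have h1 := (fedosovAt_eq_zero_iff (chartConn htor he) {1}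
      (firstOrder (S.coeffs htor he))).1 fun q i => by
        rw [← S.fedosovD_eq htor he q i, h e he q q.2 i]
    refine (ConnRing.eq_liftPoly_of_flat _ h1).trans ?_
    congr 1
    funext I
    refine smoothRing.ext_evalAt fun q => ?_
    refine Eq.trans (b := constantCoeff (evalSeries q (S.coeffs htor he I))) rfl ?_
    rw [TPolySection.coeffs, evalSeries_chartSeries, constantCoeff_genSeries]
    rfl
  · rintro ⟨F, hF⟩ e he q hq i
    refine (S.fedosovD_eq htor he ⟨q, hq⟩ i).trans ?_
    refine (fedosovAt_eq_zero_iff (chartConn htor he) {1} _).2 (fun g i => ?_) ⟨q, hq⟩ i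
    rw [(S.isTaylorExpansion_iff htor F).1 hF e he, ConnRing.dop_liftPoly, ConnRing.flatDer_tau]

end Charts

section CovariantCalculus

variable {d : ℕ} {R : Type*} [CommRing R] [Algebra ℝ R] (Q : ConnRing d R)
  {ν ν' κ κ' ν₁ ν₂ κ₁ κ₂ τ : Type}

/-- The covariant derivative of a tensor, in components. -/
def ConnRing.cov [Fintype ν] [DecidableEq ν] [Fintype κ] [DecidableEq κ] (i : Fin d)
    (t : (ν → Fin d) → (κ → Fin d) → R) (I : ν → Fin d) (J : κ → Fin d) : R :=
  Q.covLow i (fun I => t I J) I + ∑ b, ∑ l, Q.Gam i l (J b) * t I (Function.update J b l)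

/-- The contraction of some covariant slots of a tensor with contravariant slots of another one. -/
def contract [Fintype τ] [DecidableEq τ] (X : (ν₁ ⊕ τ → Fin d) → (κ₁ → Fin d) → R)
    (Y : (ν₂ → Fin d) → (κ₂ ⊕ τ → Fin d) → R) (I : ν₁ ⊕ ν₂ → Fin d) (J : κ₁ ⊕ κ₂ → Fin d) : R :=
  ∑ c : τ → Fin d, X (Sum.elim (I ∘ Sum.inl) c) (J ∘ Sum.inl) *
    Y (I ∘ Sum.inr) (Sum.elim (J ∘ Sum.inr) c)

section Rules

variable [Fintype ν] [DecidableEq ν] [Fintype κ] [DecidableEq κ] (i : Fin d)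

lemma ConnRing.cov_add (t t' : (ν → Fin d) → (κ → Fin d) → R) (I J) :
    Q.cov i (fun I J => t I J + t' I J) I J = Q.cov i t I J + Q.cov i t' I J := by
  simp only [ConnRing.cov, ConnRing.covLow, map_add, mul_add, sum_add_distrib]
  ring

lemma ConnRing.cov_smul (r : ℝ) (t : (ν → Fin d) → (κ → Fin d) → R) (I J) :
    Q.cov i (fun I J => r • t I J) I J = r • Q.cov i t I J := by
  simp only [ConnRing.cov, ConnRing.covLow, Derivation.map_smul, mul_smul_comm, ← smul_sum, smul_sub,
    smul_add]

lemma ConnRing.cov_zero (I : ν → Fin d) (J : κ → Fin d) :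
    Q.cov i (fun (_ : ν → Fin d) (_ : κ → Fin d) => (0 : R)) I J = 0 := by
  simp [ConnRing.cov, ConnRing.covLow]

lemma ConnRing.cov_reindex [Fintype ν'] [DecidableEq ν'] [Fintype κ'] [DecidableEq κ']
    (φ : ν ≃ ν') (ψ : κ ≃ κ') (t : (ν → Fin d) → (κ → Fin d) → R) (I : ν' → Fin d)
    (J : κ' → Fin d) : Q.cov i (fun I J => t (I ∘ φ) (J ∘ ψ)) I J = Q.cov i t (I ∘ φ) (J ∘ ψ) := by
  simp only [ConnRing.cov, ConnRing.covLow, Function.update_comp_equiv]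
  rw [← φ.sum_comp, ← ψ.sum_comp]
  simp

lemma ConnRing.cov_contract [Fintype ν₁] [DecidableEq ν₁] [Fintype ν₂] [DecidableEq ν₂]
    [Fintype κ₁] [DecidableEq κ₁] [Fintype κ₂] [DecidableEq κ₂] [Fintype τ] [DecidableEq τ]
    (X : (ν₁ ⊕ τ → Fin d) → (κ₁ → Fin d) → R) (Y : (ν₂ → Fin d) → (κ₂ ⊕ τ → Fin d) → R)
    (I : ν₁ ⊕ ν₂ → Fin d) (J : κ₁ ⊕ κ₂ → Fin d) : Q.cov i (contract X Y) I J =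
      contract (Q.cov i X) Y I J + contract X (Q.cov i Y) I J := by
  have h1 : ∀ t : τ, ∑ c : τ → Fin d, ∑ l, Q.Gam i (c t) l *
      X (Sum.elim (I ∘ Sum.inl) (Function.update c t l)) (J ∘ Sum.inl) *
        Y (I ∘ Sum.inr) (Sum.elim (J ∘ Sum.inr) c) =
      ∑ c : τ → Fin d, ∑ l, X (Sum.elim (I ∘ Sum.inl) c) (J ∘ Sum.inl) *
        (Q.Gam i l (c t) * Y (I ∘ Sum.inr) (Sum.elim (J ∘ Sum.inr) (Function.update c t l))) :=
    fun t => by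
      rw [sum_update_swap t]
      refine sum_congr rfl fun c _ => sum_congr rfl fun l _ => ?_
      simp only [Function.update_self, Function.update_idem, Function.update_eq_self]
      ring
  have h2 : ∀ {β : Type} [Fintype β] (G : β → Fin d → R) (H : β → Fin d → (τ → Fin d) → R),
      ∑ a, ∑ l, G a l * ∑ c, H a l c = ∑ c, ∑ a, ∑ l, G a l * H a l c := fun G H => by
    simp only [mul_sum]
    rw [sum_comm (γ := τ → Fin d)]
    exact sum_congr rfl fun a _ => sum_comm
  have h3 : ∑ c : τ → Fin d, ∑ t, ∑ l, Q.Gam i (c t) l *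
      X (Sum.elim (I ∘ Sum.inl) (Function.update c t l)) (J ∘ Sum.inl) *
        Y (I ∘ Sum.inr) (Sum.elim (J ∘ Sum.inr) c) =
      ∑ c : τ → Fin d, ∑ t, ∑ l, X (Sum.elim (I ∘ Sum.inl) c) (J ∘ Sum.inl) *
        (Q.Gam i l (c t) * Y (I ∘ Sum.inr) (Sum.elim (J ∘ Sum.inr) (Function.update c t l))) := by
    rw [sum_comm, sum_congr rfl fun t _ => h1 t, sum_comm]
  simp only [ConnRing.cov, ConnRing.covLow, contract, Fintype.sum_sum_type, map_sum, h2,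
    Sum.update_inl_comp_inl, Sum.update_inl_comp_inr, Sum.update_inr_comp_inl,
    Sum.update_inr_comp_inr, Sum.update_elim_inl, Sum.update_elim_inr, Sum.elim_inl, Sum.elim_inr,
    Function.comp_apply, Derivation.leibniz, smul_eq_mul]
  rw [← sub_eq_zero] at h3 ⊢
  rw [← h3]
  simp only [← sum_add_distrib, ← sum_sub_distrib]
  refine sum_congr rfl fun c _ => ?_
  simp only [add_mul, sub_mul, mul_add, mul_sub, sum_mul, mul_sum, sum_sub_distrib]
  simp only [mul_assoc, mul_left_comm (X _ _)]
  ring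

end Rules

end CovariantCalculus

section UniversalFamilies

variable (L : Type) (up : L → Type)

/-- A connection on an open set, together with tensor fields. -/
structure Situation where
  d : ℕ
  conn : LocalConn d
  tensor : (l : L) → (up l → Fin d) → smoothRing conn.dom

variable {L up} [∀ l, Fintype (up l)] [∀ l, DecidableEq (up l)]

/-- The components of the iterated covariant derivatives of a letter. -/
def Situation.letter (s : Situation L up) (o : Option L) :
    (k : ℕ) → (Fin (lowArity o + k) → Fin s.d) → (UpSlot up o → Fin s.d) → smoothRing s.conn.dom
  | 0 => match o with
    | none => fun I J => s.conn.ring.curvR (I (0 : Fin 3)) (I (1 : Fin 3)) (I (2 : Fin 3)) (J ())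
    | some l => fun _ J => s.tensor l J
  | k + 1 => fun I J => s.conn.ring.cov (I (0 : Fin (lowArity o + k + 1)))
      (s.letter o k) (fun a => I (Fin.succ a)) J

lemma ofFn_three {d : ℕ} (I : Fin 3 → Fin d) : List.ofFn I = [I 0, I 1, I 2] := by
  simp [List.ofFn_succ]

lemma Situation.evalAt_letter (s : Situation L up) {T : (l : L) → Vec s.d → (up l → Fin s.d) → ℝ}
    (hT : ∀ l J (q : s.conn.dom), evalAt q (s.tensor l J) = T l q J) (o : Option L) (k : ℕ)
    (q : s.conn.dom) (I : Fin (lowArity o + k) → Fin s.d) (J : UpSlot up o → Fin s.d) :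
    evalAt q (s.letter o k I J) =
      ((covDeriv s.conn.Γ)^[k] (letterComp s.conn.Γ T o)) q (List.ofFn I) J := by
  induction k generalizing q J with
  | zero =>
    match o, I, J with
    | none, I, J =>
      refine (evalAt_curvR s.conn q _ _ _ _).trans ?_
      exact (congrArg (fun K => curvComp s.conn.Γ q K J) (ofFn_three I)).symm
    | some l, I, J =>
      refine (hT l J q).trans ?_
      exact (congrArg (fun K => contraComp (T l) q K J) (List.ofFn_zero (f := I))).symm
  | succ k ih =>
    rw [Function.iterate_succ_apply']
    have h : List.ofFn I = I (0 : Fin (lowArity o + k + 1)) ::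
      List.ofFn fun a : Fin (lowArity o + k) => I (Fin.succ a) := List.ofFn_succ
    rw [h, covDeriv_cons]
    simp only [Situation.letter, ConnRing.cov, ConnRing.covLow, map_add, map_sub, map_sum, map_mul, ih]
    congr 2
    exact evalAt_partialDer_of_eq _ _ _ (fun p => ih p _ J) q

variable {ι : Type} (sit : ι → Situation L up)

/-- Families of tensors, one in each situation. -/
abbrev Family (ν κ : Type) : Type :=
  (s : ι) → (ν → Fin (sit s).d) → (κ → Fin (sit s).d) → smoothRing (sit s).conn.dom

/-- The families of tensors generated by the letters and contractions without loops. -/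
inductive Univ : (ν κ : Type) → Family sit ν κ → Prop
  | letter (o : Option L) (k : ℕ) :
      Univ (Fin (lowArity o + k)) (UpSlot up o) fun s => (sit s).letter o k
  | zero (ν κ : Type) : Univ ν κ fun _ _ _ => 0
  | add {ν κ : Type} {X Y : Family sit ν κ} : Univ ν κ X → Univ ν κ Y →
      Univ ν κ fun s I J => X s I J + Y s I J
  | smul {ν κ : Type} {X : Family sit ν κ} (r : ℝ) : Univ ν κ X → Univ ν κ fun s I J => r • X s I J
  | reindex {ν κ ν' κ' : Type} {X : Family sit ν κ} (φ : ν ≃ ν') (ψ : κ ≃ κ') : Univ ν κ X →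
      Univ ν' κ' fun s I J => X s (I ∘ φ) (J ∘ ψ)
  | contract {ν₁ ν₂ κ₁ κ₂ τ : Type} [Fintype ν₁] [DecidableEq ν₁] [Fintype ν₂] [DecidableEq ν₂]
      [Fintype κ₁] [DecidableEq κ₁] [Fintype κ₂] [DecidableEq κ₂] [Fintype τ] [DecidableEq τ]
      {X : Family sit (ν₁ ⊕ τ) κ₁} {Y : Family sit ν₂ (κ₂ ⊕ τ)} : Univ (ν₁ ⊕ τ) κ₁ X →
      Univ ν₂ (κ₂ ⊕ τ) Y → Univ (ν₁ ⊕ ν₂) (κ₁ ⊕ κ₂) fun s => contract (X s) (Y s)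

variable {sit} {ν κ ν' κ' : Type}

lemma Univ.congr {X Y : Family sit ν κ} (h : Univ sit ν κ X) (he : ∀ s I J, X s I J = Y s I J) :
    Univ sit ν κ Y := by
  obtain rfl : X = Y := funext fun s => funext fun I => funext fun J => he s I J
  exact h

lemma Univ.sum {β : Type*} (u : Finset β) {X : β → Family sit ν κ}
    (h : ∀ b ∈ u, Univ sit ν κ (X b)) : Univ sit ν κ fun s I J => ∑ b ∈ u, X b s I J := by
  classical
  induction u using induction_on with
  | empty => exact (Univ.zero ν κ).congr fun _ _ _ => by simp
  | insert b u hb ih =>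
    exact ((h b (mem_insert_self b u)).add
      (ih fun b hb => h b (mem_insert_of_mem hb))).congr fun _ _ _ => by
        rw [sum_insert hb]

lemma Univ.covariant {X : Family sit ν κ} (h : Univ sit ν κ X) :
    ∀ [Fintype ν] [DecidableEq ν] [Fintype κ] [DecidableEq κ], Univ sit (Unit ⊕ ν) κ fun s I J =>
      (sit s).conn.ring.cov (I (Sum.inl ())) (X s) (I ∘ Sum.inr) J := by
  induction h with
  | letter o k =>
    have key : Univ sit (Unit ⊕ Fin (lowArity o + k)) (UpSlot up o) fun s I J =>
        (sit s).conn.ring.cov (I (Sum.inl ())) ((sit s).letter o k) (I ∘ Sum.inr) J := by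
      let φ : Fin (lowArity o + k + 1) ≃ Unit ⊕ Fin (lowArity o + k) :=
        ((finSuccEquiv _).trans (Equiv.optionEquivSumPUnit.{0} _)).trans (Equiv.sumComm _ _)
      refine ((Univ.letter o (k + 1)).reindex φ (Equiv.refl _)).congr fun s I J => ?_
      have h0 : φ 0 = Sum.inl () := by simp [φ]
      have h1 : ∀ a, φ (Fin.succ a) = Sum.inr a := fun a => by simp [φ]
      simp only [Situation.letter, Function.comp_apply]
      rw [h0]
      simp only [h1]
      rfl
    intro _ _ _ _
    convert key
  | zero ν κ =>
    intro _ _ _ _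
    exact (Univ.zero _ κ).congr fun s I J => ((sit s).conn.ring.cov_zero _ _ _).symm
  | add _ _ h h' =>
    intro _ _ _ _
    exact (h.add h').congr fun s I J => ((sit s).conn.ring.cov_add _ _ _ _ _).symm
  | smul r _ h =>
    intro _ _ _ _
    exact (h.smul r).congr fun s I J => ((sit s).conn.ring.cov_smul _ _ _ _ _).symm
  | @reindex ν κ ν' κ' X φ ψ _ h =>
    intro _ _ _ _
    classical
    let _ := Fintype.ofEquiv _ φ.symm
    let _ := Fintype.ofEquiv _ ψ.symm
    exact (h.reindex (Equiv.sumCongr (Equiv.refl Unit) φ) ψ).congr fun s I J =>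
      ((sit s).conn.ring.cov_reindex (I (Sum.inl ())) φ ψ (X s) (I ∘ Sum.inr) J).symm
  | @contract ν₁ ν₂ κ₁ κ₂ τ _ _ _ _ _ _ _ _ _ _ X Y hX hY h h' =>
    have key : Univ sit (Unit ⊕ (ν₁ ⊕ ν₂)) (κ₁ ⊕ κ₂) fun s I J => (sit s).conn.ring.cov
        (I (Sum.inl ())) (FormalGeometry.contract (X s) (Y s)) (I ∘ Sum.inr) J := by
      have h1 := (Univ.contract (h.reindex (Equiv.sumAssoc Unit ν₁ τ).symm (Equiv.refl κ₁)) hY).reindex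
        (Equiv.sumAssoc Unit ν₁ ν₂) (Equiv.refl _)
      have h2 := (Univ.contract hX h').reindex ((Equiv.sumAssoc ν₁ Unit ν₂).symm.trans
        ((Equiv.sumCongr (Equiv.sumComm ν₁ Unit) (Equiv.refl ν₂)).trans (Equiv.sumAssoc Unit ν₁ ν₂)))
        (Equiv.refl _)
      refine (h1.add h2).congr fun s I J => ?_
      rw [ConnRing.cov_contract]
      refine congrArg₂ (· + ·) (sum_congr rfl fun c _ => ?_) (sum_congr rfl fun c _ => rfl)
      have h3 : (Sum.elim ((I ∘ Equiv.sumAssoc Unit ν₁ ν₂) ∘ Sum.inl) c ∘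
          (Equiv.sumAssoc Unit ν₁ τ).symm) ∘ Sum.inr = Sum.elim ((I ∘ Sum.inr) ∘ Sum.inl) c := by
        funext x
        rcases x with x | x <;> rfl
      exact congrArg (fun K => (sit s).conn.ring.cov (I (Sum.inl ())) (X s) K (J ∘ Sum.inl) *
        Y s ((I ∘ Sum.inr) ∘ Sum.inr) (Sum.elim (J ∘ Sum.inr) c)) h3
    intro _ _ _ _
    convert key

end UniversalFamilies

section Wiring

variable {A₁ A₂ U₁ U₂ κ₁ κ₂ ν₁ ν₂ τ β : Type}

/-- Regrouping of the slots when slots of type `τ` get connected. -/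
def connectSlots (A₂ U₁ κ₂ ν₁ τ : Type) :
    (U₁ ⊕ (ν₁ ⊕ τ)) ⊕ (A₂ ⊕ κ₂) ≃ (U₁ ⊕ ν₁) ⊕ (A₂ ⊕ (κ₂ ⊕ τ)) where
  toFun := Sum.elim (Sum.elim (fun u => Sum.inl (Sum.inl u))
    (Sum.elim (fun n => Sum.inl (Sum.inr n)) fun t => Sum.inr (Sum.inr (Sum.inr t))))
    (Sum.elim (fun a => Sum.inr (Sum.inl a)) fun k => Sum.inr (Sum.inr (Sum.inl k)))
  invFun := Sum.elim (Sum.elim (fun u => Sum.inl (Sum.inl u)) fun n => Sum.inl (Sum.inr (Sum.inl n)))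
    (Sum.elim (fun a => Sum.inr (Sum.inl a))
      (Sum.elim (fun k => Sum.inr (Sum.inr k)) fun t => Sum.inl (Sum.inr (Sum.inr t))))
  left_inv := by rintro ((u | n | t) | a | k) <;> rfl
  right_inv := by rintro ((u | n) | a | k | t) <;> rfl

/-- The wiring of a contraction. -/
def contractWire (w₁ : A₁ ⊕ κ₁ ≃ U₁ ⊕ (ν₁ ⊕ τ)) (w₂ : A₂ ⊕ (κ₂ ⊕ τ) ≃ U₂ ⊕ ν₂) :
    (A₁ ⊕ A₂) ⊕ (κ₁ ⊕ κ₂) ≃ (U₁ ⊕ U₂) ⊕ (ν₁ ⊕ ν₂) :=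
  (Equiv.sumSumSumComm A₁ A₂ κ₁ κ₂).trans ((Equiv.sumCongr w₁ (Equiv.refl _)).trans
    ((connectSlots A₂ U₁ κ₂ ν₁ τ).trans ((Equiv.sumCongr (Equiv.refl _) w₂).trans
      (Equiv.sumSumSumComm U₁ ν₁ U₂ ν₂))))

variable (w₁ : A₁ ⊕ κ₁ ≃ U₁ ⊕ (ν₁ ⊕ τ)) (w₂ : A₂ ⊕ (κ₂ ⊕ τ) ≃ U₂ ⊕ ν₂)

lemma contractWire_fst (x : A₁ ⊕ κ₁) : contractWire w₁ w₂ (Sum.map Sum.inl Sum.inl x) =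
    Sum.elim (fun u => Sum.inl (Sum.inl u)) (Sum.elim (fun n => Sum.inr (Sum.inl n))
      fun t => Sum.map Sum.inr Sum.inr (w₂ (Sum.inr (Sum.inr t)))) (w₁ x) := by
  have h : Equiv.sumSumSumComm A₁ A₂ κ₁ κ₂ (Sum.map Sum.inl Sum.inl x) = Sum.inl x := by
    rcases x with x | x <;> rfl
  simp only [contractWire, Equiv.trans_apply, h, Equiv.sumCongr_apply, Sum.map_inl]
  rcases w₁ x with u | n | t
  · rfl
  · rfl
  · change Equiv.sumSumSumComm U₁ ν₁ U₂ ν₂ (Sum.inr (w₂ (Sum.inr (Sum.inr t)))) =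
      Sum.map Sum.inr Sum.inr (w₂ (Sum.inr (Sum.inr t)))
    rcases w₂ (Sum.inr (Sum.inr t)) with u | n <;> rfl

lemma contractWire_snd (x : A₂ ⊕ κ₂) : contractWire w₁ w₂ (Sum.map Sum.inr Sum.inr x) =
    Sum.map Sum.inr Sum.inr (w₂ (Sum.map id Sum.inl x)) := by
  have h : Equiv.sumSumSumComm A₁ A₂ κ₁ κ₂ (Sum.map Sum.inr Sum.inr x) = Sum.inr x := by
    rcases x with x | x <;> rfl
  have h' : connectSlots A₂ U₁ κ₂ ν₁ τ (Sum.inr x) = Sum.inr (Sum.map id Sum.inl x) := by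
    rcases x with x | x <;> rfl
  simp only [contractWire, Equiv.trans_apply, h, Equiv.sumCongr_apply, Sum.map_inr,
    Equiv.refl_apply, h']
  rcases w₂ (Sum.map id Sum.inl x) with u | n <;> rfl

lemma elim_contractWire_fst (c₁ : U₁ → β) (c₂ : U₂ → β) (i₁ : ν₁ → β) (i₂ : ν₂ → β) (x : A₁ ⊕ κ₁) :
    Sum.elim (Sum.elim c₁ c₂) (Sum.elim i₁ i₂) (contractWire w₁ w₂ (Sum.map Sum.inl Sum.inl x)) =
      Sum.elim c₁ (Sum.elim i₁ fun t => Sum.elim c₂ i₂ (w₂ (Sum.inr (Sum.inr t)))) (w₁ x) := by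
  rw [contractWire_fst]
  rcases w₁ x with u | n | t
  · rfl
  · rfl
  · simp only [Sum.elim_inr]
    rcases w₂ (Sum.inr (Sum.inr t)) with u | n <;> rfl

lemma elim_contractWire_snd (c₁ : U₁ → β) (c₂ : U₂ → β) (i₁ : ν₁ → β) (i₂ : ν₂ → β) (x : A₂ ⊕ κ₂) :
    Sum.elim (Sum.elim c₁ c₂) (Sum.elim i₁ i₂) (contractWire w₁ w₂ (Sum.map Sum.inr Sum.inr x)) =
      Sum.elim c₂ i₂ (w₂ (Sum.map id Sum.inl x)) := by
  rw [contractWire_snd]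
  rcases w₂ (Sum.map id Sum.inl x) with u | n <;> rfl

/-- Renaming the outer slots of a wiring. -/
def reindexWire {A U κ κ' ν ν' : Type} (w : A ⊕ κ ≃ U ⊕ ν) (φ : ν ≃ ν') (ψ : κ ≃ κ') :
    A ⊕ κ' ≃ U ⊕ ν' :=
  (Equiv.sumCongr (Equiv.refl A) ψ.symm).trans (w.trans (Equiv.sumCongr (Equiv.refl U) φ))

lemma reindexWire_apply {A U κ κ' ν ν' : Type} (w : A ⊕ κ ≃ U ⊕ ν) (φ : ν ≃ ν') (ψ : κ ≃ κ')
    (x : A ⊕ κ') : reindexWire w φ ψ x = Sum.map id φ (w (Sum.map id ψ.symm x)) := rfl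

end Wiring

section Networks

variable {d : ℕ} {R : Type*} [CommRing R] {V V₁ V₂ κ κ' ν ν' κ₁ κ₂ ν₁ ν₂ τ : Type}

open Classical in
/-- The value of a network of tensors: the sum over all values of the inner indices which agree
with the prescribed outer indices. -/
def netEval [Fintype V] [DecidableEq V] {A U : V → Type} [∀ f, Fintype (U f)]
    [∀ f, DecidableEq (U f)] (val : (f : V) → (A f → Fin d) → (U f → Fin d) → R)
    (w : (Σ f, A f) ⊕ κ ≃ (Σ f, U f) ⊕ ν) (I : ν → Fin d) (J : κ → Fin d) : R :=
  ∑ c : (Σ f, U f) → Fin d, if ∀ j, Sum.elim c I (w (Sum.inr j)) = J j then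
    ∏ f, val f (fun t => Sum.elim c I (w (Sum.inl ⟨f, t⟩))) fun v => c ⟨f, v⟩ else 0

lemma netEval_reindex [Fintype V] [DecidableEq V] {A U : V → Type} [∀ f, Fintype (U f)]
    [∀ f, DecidableEq (U f)] (val : (f : V) → (A f → Fin d) → (U f → Fin d) → R)
    (w : (Σ f, A f) ⊕ κ ≃ (Σ f, U f) ⊕ ν) (φ : ν ≃ ν') (ψ : κ ≃ κ') (I : ν' → Fin d)
    (J : κ' → Fin d) : netEval val (reindexWire w φ ψ) I J = netEval val w (I ∘ φ) (J ∘ ψ) := by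
  classical
  have h0 : ∀ (c : (Σ f, U f) → Fin d) x, Sum.elim c I (reindexWire w φ ψ x) =
      Sum.elim c (I ∘ φ) (w (Sum.map id ψ.symm x)) := fun c x => by
    rw [reindexWire_apply]
    rcases w (Sum.map id ψ.symm x) with u | n <;> rfl
  refine sum_congr rfl fun c _ => ?_
  simp only [h0]
  refine if_congr ?_ rfl rfl
  rw [← ψ.forall_congr_right]
  simp

/-- The wiring of a contraction of two networks. -/
def sumWire {A U : V₁ ⊕ V₂ → Type}
    (w₁ : (Σ f, A (Sum.inl f)) ⊕ κ₁ ≃ (Σ f, U (Sum.inl f)) ⊕ (ν₁ ⊕ τ))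
    (w₂ : (Σ f, A (Sum.inr f)) ⊕ (κ₂ ⊕ τ) ≃ (Σ f, U (Sum.inr f)) ⊕ ν₂) :
    (Σ f, A f) ⊕ (κ₁ ⊕ κ₂) ≃ (Σ f, U f) ⊕ (ν₁ ⊕ ν₂) :=
  (Equiv.sumCongr (Equiv.sumSigmaDistrib A) (Equiv.refl _)).trans ((contractWire w₁ w₂).trans
    (Equiv.sumCongr (Equiv.sumSigmaDistrib U).symm (Equiv.refl _)))

section SumWire

variable {A U : V₁ ⊕ V₂ → Type} (w₁ : (Σ f, A (Sum.inl f)) ⊕ κ₁ ≃ (Σ f, U (Sum.inl f)) ⊕ (ν₁ ⊕ τ))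
  (w₂ : (Σ f, A (Sum.inr f)) ⊕ (κ₂ ⊕ τ) ≃ (Σ f, U (Sum.inr f)) ⊕ ν₂)

lemma sumWire_inl (f : V₁ ⊕ V₂) (s : A f) : sumWire w₁ w₂ (Sum.inl ⟨f, s⟩) =
    Sum.map (Equiv.sumSigmaDistrib U).symm id
      (contractWire w₁ w₂ (Sum.inl (Equiv.sumSigmaDistrib A ⟨f, s⟩))) := rfl

lemma sumWire_inr (j : κ₁ ⊕ κ₂) : sumWire w₁ w₂ (Sum.inr j) =
    Sum.map (Equiv.sumSigmaDistrib U).symm id (contractWire w₁ w₂ (Sum.inr j)) := rfl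

lemma sumWire_no_loop (h₁ : ∀ f s t, w₁ (Sum.inl ⟨f, s⟩) ≠ Sum.inl ⟨f, t⟩)
    (h₂ : ∀ f s t, w₂ (Sum.inl ⟨f, s⟩) ≠ Sum.inl ⟨f, t⟩) (f : V₁ ⊕ V₂) (s : A f) (t : U f) :
    sumWire w₁ w₂ (Sum.inl ⟨f, s⟩) ≠ Sum.inl ⟨f, t⟩ := by
  intro h
  rw [sumWire_inl] at h
  rcases f with f | f
  · have h3 := contractWire_fst w₁ w₂ (Sum.inl ⟨f, s⟩)
    change contractWire w₁ w₂ (Sum.inl (Sum.inl ⟨f, s⟩)) = _ at h3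
    change Sum.map _ _ (contractWire w₁ w₂ (Sum.inl (Sum.inl ⟨f, s⟩))) = _ at h
    rw [h3] at h
    have h4 := h₁ f s
    generalize w₁ (Sum.inl ⟨f, s⟩) = z at h h4
    rcases z with u | n | v
    · have h5 : (Sum.inl u : (Σ f, U (Sum.inl f)) ⊕ Σ f, U (Sum.inr f)) = Sum.inl ⟨f, t⟩ :=
        (Equiv.sumSigmaDistrib U).symm.injective (Sum.inl_injective h)
      exact h4 t (congrArg Sum.inl (Sum.inl_injective h5))
    · cases h
    · simp only [Sum.elim_inr] at h
      generalize w₂ (Sum.inr (Sum.inr v)) = z at h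
      rcases z with u | n <;> cases h
  · have h3 := contractWire_snd w₁ w₂ (Sum.inl ⟨f, s⟩)
    change contractWire w₁ w₂ (Sum.inl (Sum.inr ⟨f, s⟩)) = _ at h3
    change Sum.map _ _ (contractWire w₁ w₂ (Sum.inl (Sum.inr ⟨f, s⟩))) = _ at h
    rw [h3, Sum.map_inl, id] at h
    have h4 := h₂ f s
    generalize w₂ (Sum.inl ⟨f, s⟩) = z at h h4
    rcases z with u | n
    · have h5 : (Sum.inr u : (Σ f, U (Sum.inl f)) ⊕ Σ f, U (Sum.inr f)) = Sum.inr ⟨f, t⟩ :=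
        (Equiv.sumSigmaDistrib U).symm.injective (Sum.inl_injective h)
      exact h4 t (congrArg Sum.inl (Sum.inr_injective h5))
    · cases h

lemma sumWire_no_delta (h₁ : ∀ j i, w₁ (Sum.inr j) ≠ Sum.inr i)
    (h₂ : ∀ j i, w₂ (Sum.inr j) ≠ Sum.inr i) (j : κ₁ ⊕ κ₂) (i : ν₁ ⊕ ν₂) :
    sumWire w₁ w₂ (Sum.inr j) ≠ Sum.inr i := by
  intro h
  rw [sumWire_inr] at h
  rcases j with j | j
  · have h3 := contractWire_fst w₁ w₂ (Sum.inr j)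
    change contractWire w₁ w₂ (Sum.inr (Sum.inl j)) = _ at h3
    rw [h3] at h
    have h4 := h₁ j
    generalize w₁ (Sum.inr j) = z at h h4
    rcases z with u | n
    · cases h
    · exact h4 n rfl
  · have h3 := contractWire_snd w₁ w₂ (Sum.inr j)
    change contractWire w₁ w₂ (Sum.inr (Sum.inr j)) = _ at h3
    rw [h3, Sum.map_inr] at h
    have h4 := h₂ (Sum.inl j)
    generalize w₂ (Sum.inr (Sum.inl j)) = z at h h4
    rcases z with u | n
    · cases h
    · exact h4 n rfl

lemma netEval_contract [Fintype V₁] [DecidableEq V₁] [Fintype V₂] [DecidableEq V₂]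
    [∀ f, Fintype (U f)] [∀ f, DecidableEq (U f)] [Fintype τ] [DecidableEq τ]
    (val : (f : V₁ ⊕ V₂) → (A f → Fin d) → (U f → Fin d) → R) (I : ν₁ ⊕ ν₂ → Fin d)
    (J : κ₁ ⊕ κ₂ → Fin d) : netEval val (sumWire w₁ w₂) I J =
      contract (netEval (fun f => val (Sum.inl f)) w₁) (netEval (fun f => val (Sum.inr f)) w₂) I J := by
  classical
  let E : (((Σ f, U (Sum.inl f)) → Fin d) × ((Σ f, U (Sum.inr f)) → Fin d)) ≃ ((Σ f, U f) → Fin d) :=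
    (Equiv.sumArrowEquivProdArrow _ _ _).symm.trans
      (Equiv.arrowCongr (Equiv.sumSigmaDistrib U).symm (Equiv.refl _))
  have hE1 : ∀ p f v, E p ⟨Sum.inl f, v⟩ = p.1 ⟨f, v⟩ := fun p f v => rfl
  have hE2 : ∀ p f v, E p ⟨Sum.inr f, v⟩ = p.2 ⟨f, v⟩ := fun p f v => rfl
  have hE : ∀ p x, Sum.elim (E p) I (Sum.map (Equiv.sumSigmaDistrib U).symm id x) =
      Sum.elim (Sum.elim p.1 p.2) (Sum.elim (I ∘ Sum.inl) (I ∘ Sum.inr)) x := by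
    rintro p ((⟨f, v⟩ | ⟨f, v⟩) | (n | n)) <;> rfl
  let tv : ((Σ f, U (Sum.inr f)) → Fin d) → τ → Fin d := fun c₂ t =>
    Sum.elim c₂ (I ∘ Sum.inr) (w₂ (Sum.inr (Sum.inr t)))
  have h1 : ∀ p x, Sum.elim (E p) I (Sum.map (Equiv.sumSigmaDistrib U).symm id
      (contractWire w₁ w₂ (Sum.map Sum.inl Sum.inl x))) =
        Sum.elim p.1 (Sum.elim (I ∘ Sum.inl) (tv p.2)) (w₁ x) := fun p x => by
    rw [hE, elim_contractWire_fst]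
  have h2 : ∀ p x, Sum.elim (E p) I (Sum.map (Equiv.sumSigmaDistrib U).symm id
      (contractWire w₁ w₂ (Sum.map Sum.inr Sum.inr x))) =
        Sum.elim p.2 (I ∘ Sum.inr) (w₂ (Sum.map id Sum.inl x)) := fun p x => by
    rw [hE, elim_contractWire_snd]
  rw [netEval, ← E.sum_comp, Fintype.sum_prod_type, contract]
  simp only [netEval, sum_mul_sum]
  symm
  rw [sum_comm]
  refine sum_congr rfl fun c₁ _ => ?_
  rw [sum_comm]
  refine sum_congr rfl fun c₂ _ => ?_
  rw [sum_eq_single (tv c₂)]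
  · rw [ite_zero_mul_ite_zero]
    symm
    refine if_congr ?_ ?_ rfl
    · rw [Sum.forall, Sum.forall]
      refine and_congr (forall_congr' fun j => ?_) ?_
      · rw [sumWire_inr]
        exact Eq.congr (h1 (c₁, c₂) (Sum.inr j)) rfl
      · refine Iff.trans (forall_congr' fun j => ?_) (and_iff_left fun t => rfl).symm
        rw [sumWire_inr]
        exact Eq.congr (h2 (c₁, c₂) (Sum.inr j)) rfl
    · rw [Fintype.prod_sum_type]
      refine congrArg₂ (· * ·) (prod_congr rfl fun f _ => ?_) (prod_congr rfl fun f _ => ?_)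
      · refine congrArg₂ (val (Sum.inl f)) (funext fun t => ?_) rfl
        rw [sumWire_inl]
        exact h1 (c₁, c₂) (Sum.inl ⟨f, t⟩)
      · refine congrArg₂ (val (Sum.inr f)) (funext fun t => ?_) rfl
        rw [sumWire_inl]
        exact h2 (c₁, c₂) (Sum.inl ⟨f, t⟩)
  · intro t _ ht
    refine mul_eq_zero_of_right _ (if_neg fun h => ht (funext fun x => ?_))
    exact (h (Sum.inr x)).symm
  · simp

end SumWire

/-- Renaming the factors of a network. -/
def factorWire {A U : V₁ → Type} (φ : V₂ ≃ V₁) (w : (Σ f, A f) ⊕ κ ≃ (Σ f, U f) ⊕ ν) :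
    (Σ f, A (φ f)) ⊕ κ ≃ (Σ f, U (φ f)) ⊕ ν :=
  (Equiv.sumCongr (Equiv.sigmaCongrLeft φ) (Equiv.refl κ)).trans
    (w.trans (Equiv.sumCongr (Equiv.sigmaCongrLeft φ).symm (Equiv.refl ν)))

lemma map_factorWire {A U : V₁ → Type} (φ : V₂ ≃ V₁) (w : (Σ f, A f) ⊕ κ ≃ (Σ f, U f) ⊕ ν)
    (x : (Σ f, A (φ f)) ⊕ κ) : Sum.map (Equiv.sigmaCongrLeft (β := U) φ) id (factorWire φ w x) =
      w (Sum.map (Equiv.sigmaCongrLeft (β := A) φ) id x) := by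
  change Sum.map _ _ (Sum.map (Equiv.sigmaCongrLeft (β := U) φ).symm id
    (w (Sum.map (Equiv.sigmaCongrLeft (β := A) φ) id x))) = _
  rw [Sum.map_map]
  simp

lemma netEval_factorWire [Fintype V₁] [DecidableEq V₁] [Fintype V₂] [DecidableEq V₂]
    {A U : V₁ → Type} [∀ f, Fintype (U f)] [∀ f, DecidableEq (U f)] (φ : V₂ ≃ V₁)
    (val : (f : V₁) → (A f → Fin d) → (U f → Fin d) → R)
    (w : (Σ f, A f) ⊕ κ ≃ (Σ f, U f) ⊕ ν) (I : ν → Fin d) (J : κ → Fin d) :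
    netEval (fun f => val (φ f)) (factorWire φ w) I J = netEval val w I J := by
  classical
  rw [netEval, netEval,
    ← (Equiv.arrowCongr (Equiv.sigmaCongrLeft (β := U) φ).symm (Equiv.refl (Fin d))).sum_comp]
  refine sum_congr rfl fun c _ => ?_
  have h1 : ∀ x, Sum.elim ((Equiv.arrowCongr (Equiv.sigmaCongrLeft (β := U) φ).symm
      (Equiv.refl (Fin d))) c) I (factorWire φ w x) =
        Sum.elim c I (w (Sum.map (Equiv.sigmaCongrLeft (β := A) φ) id x)) := fun x => by
    rw [← map_factorWire]
    rcases factorWire φ w x with u | n <;> rfl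
  simp only [h1]
  refine if_congr Iff.rfl ?_ rfl
  rw [← φ.prod_comp]
  rfl

end Networks

section Diagrams

/-- Universal monomials of no-loop type, with factors and slots indexed by arbitrary types. -/
structure Diagram (L : Type) (up : L → Type) (ν κ : Type) where
  V : Type
  fintype : Fintype V
  decEq : DecidableEq V
  letter : V → Option L
  order : V → ℕ
  wire : ((Σ f : V, Fin (lowArity (letter f) + order f)) ⊕ κ) ≃ ((Σ f : V, UpSlot up (letter f)) ⊕ ν)
  no_loop : ∀ f s t, wire (Sum.inl ⟨f, s⟩) ≠ Sum.inl ⟨f, t⟩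
  no_delta : ∀ j i, wire (Sum.inr j) ≠ Sum.inr i

variable {L : Type} {up : L → Type} {ν κ ν' κ' ν₁ ν₂ κ₁ κ₂ τ : Type}

instance (D : Diagram L up ν κ) : Fintype D.V := D.fintype

instance (D : Diagram L up ν κ) : DecidableEq D.V := D.decEq

/-- The diagram of one letter. -/
def Diagram.single (up : L → Type) (o : Option L) (k : ℕ) :
    Diagram L up (Fin (lowArity o + k)) (UpSlot up o) where
  V := Unit
  fintype := inferInstance
  decEq := inferInstance
  letter _ := o
  order _ := k
  wire :=
    { toFun := Sum.elim (fun x => Sum.inr x.2) fun j => Sum.inl ⟨(), j⟩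
      invFun := Sum.elim (fun x => Sum.inr x.2) fun j => Sum.inl ⟨(), j⟩
      left_inv := by rintro (⟨⟨⟩, x⟩ | x) <;> rfl
      right_inv := by rintro (⟨⟨⟩, x⟩ | x) <;> rfl }
  no_loop _ _ _ h := by cases h
  no_delta _ _ h := by cases h

/-- Renaming the slots of a diagram. -/
def Diagram.reindex (D : Diagram L up ν κ) (φ : ν ≃ ν') (ψ : κ ≃ κ') : Diagram L up ν' κ' where
  V := D.V
  fintype := D.fintype
  decEq := D.decEq
  letter := D.letter
  order := D.order
  wire := reindexWire D.wire φ ψ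
  no_loop f s t h := by
    have h' := D.no_loop f s t
    rw [reindexWire_apply, Sum.map_inl, id] at h
    generalize D.wire (Sum.inl ⟨f, s⟩) = z at h h'
    rcases z with u | n
    · exact h' (congrArg Sum.inl (Sum.inl_injective h))
    · cases h
  no_delta j i h := by
    have h' := D.no_delta (ψ.symm j)
    rw [reindexWire_apply, Sum.map_inr] at h
    generalize D.wire (Sum.inr (ψ.symm j)) = z at h h'
    rcases z with u | n
    · cases h
    · exact h' n rfl

/-- The contraction of two diagrams. -/
def Diagram.contract (D₁ : Diagram L up (ν₁ ⊕ τ) κ₁) (D₂ : Diagram L up ν₂ (κ₂ ⊕ τ)) :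
    Diagram L up (ν₁ ⊕ ν₂) (κ₁ ⊕ κ₂) where
  V := D₁.V ⊕ D₂.V
  fintype := inferInstance
  decEq := inferInstance
  letter := Sum.elim D₁.letter D₂.letter
  order := Sum.elim D₁.order D₂.order
  wire := sumWire (A := fun f => Fin (lowArity (Sum.elim D₁.letter D₂.letter f) +
    Sum.elim D₁.order D₂.order f)) (U := fun f => UpSlot up (Sum.elim D₁.letter D₂.letter f))
    D₁.wire D₂.wire
  no_loop := sumWire_no_loop _ _ D₁.no_loop D₂.no_loop
  no_delta := sumWire_no_delta _ _ D₁.no_delta D₂.no_delta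

variable [∀ l, Fintype (up l)] [∀ l, DecidableEq (up l)]

/-- The value of a diagram. -/
def Diagram.eval (D : Diagram L up ν κ) (s : Situation L up) (I : ν → Fin s.d) (J : κ → Fin s.d) :
    smoothRing s.conn.dom :=
  netEval (fun f => s.letter (D.letter f) (D.order f)) D.wire I J

lemma Diagram.eval_single (s : Situation L up) (o : Option L) (k : ℕ) (I J) :
    (Diagram.single up o k).eval s I J = s.letter o k I J := by
  classical
  have h : ∀ c : (Σ _ : Unit, UpSlot up o) → Fin s.d, (∀ j : UpSlot up o, c ⟨(), j⟩ = J j) ↔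
      c = fun x => J x.2 := fun c => ⟨fun h => funext fun x => h x.2, fun h j => by rw [h]⟩
  refine (sum_eq_single (fun x : (Σ _ : Unit, UpSlot up o) => J x.2) ?_ ?_).trans ?_
  · intro c _ hc
    exact if_neg fun h' => hc ((h c).1 h')
  · exact fun h => absurd (mem_univ _) h
  · exact (if_pos fun j => rfl).trans (Finset.prod_singleton (fun _ : Unit => s.letter o k I J) ())

lemma Diagram.eval_reindex (D : Diagram L up ν κ) (φ : ν ≃ ν') (ψ : κ ≃ κ') (s : Situation L up)
    (I : ν' → Fin s.d) (J : κ' → Fin s.d) :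
    (D.reindex φ ψ).eval s I J = D.eval s (I ∘ φ) (J ∘ ψ) := netEval_reindex _ _ _ _ _ _

lemma Diagram.eval_contract [Fintype τ] [DecidableEq τ] (D₁ : Diagram L up (ν₁ ⊕ τ) κ₁)
    (D₂ : Diagram L up ν₂ (κ₂ ⊕ τ)) (s : Situation L up) (I : ν₁ ⊕ ν₂ → Fin s.d)
    (J : κ₁ ⊕ κ₂ → Fin s.d) : (D₁.contract D₂).eval s I J =
      FormalGeometry.contract (D₁.eval s) (D₂.eval s) I J :=
  netEval_contract _ _ (fun f => s.letter (Sum.elim D₁.letter D₂.letter f)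
    (Sum.elim D₁.order D₂.order f)) I J

variable {ι : Type} (sit : ι → Situation L up)

/-- The families which are linear combinations of diagrams. -/
def diagramSpan (ν κ : Type) : Submodule ℝ (Family sit ν κ) :=
  Submodule.span ℝ (Set.range fun (D : Diagram L up ν κ) s => D.eval (sit s))

variable {sit}

theorem Univ.mem_diagramSpan {X : Family sit ν κ} (h : Univ sit ν κ X) : X ∈ diagramSpan sit ν κ := by
  induction h with
  | letter o k =>
    refine Submodule.subset_span ⟨Diagram.single up o k, ?_⟩
    funext s I J
    exact Diagram.eval_single (sit s) o k I J
  | zero ν κ => exact Submodule.zero_mem _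
  | add _ _ h h' => exact Submodule.add_mem _ h h'
  | smul r _ h => exact Submodule.smul_mem _ r h
  | @reindex ν κ ν' κ' X φ ψ _ h =>
    refine Submodule.span_induction (p := fun X _ => (fun s I J => X s (I ∘ φ) (J ∘ ψ)) ∈
      diagramSpan sit ν' κ') ?_ ?_ ?_ ?_ h
    · rintro _ ⟨D, rfl⟩
      refine Submodule.subset_span ⟨D.reindex φ ψ, ?_⟩
      funext s I J
      exact D.eval_reindex φ ψ (sit s) I J
    · exact Submodule.zero_mem _
    · exact fun X Y _ _ h h' => Submodule.add_mem _ h h'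
    · exact fun r X _ h => Submodule.smul_mem _ r h
  | @contract ν₁ ν₂ κ₁ κ₂ τ _ _ _ _ _ _ _ _ _ _ X Y _ _ h h' =>
    refine Submodule.span_induction (p := fun X _ => (fun s => FormalGeometry.contract (X s) (Y s)) ∈
      diagramSpan sit (ν₁ ⊕ ν₂) (κ₁ ⊕ κ₂)) ?_ ?_ ?_ ?_ h
    · rintro _ ⟨D, rfl⟩
      refine Submodule.span_induction (p := fun Y _ =>
        (fun s => FormalGeometry.contract (D.eval (sit s)) (Y s)) ∈
          diagramSpan sit (ν₁ ⊕ ν₂) (κ₁ ⊕ κ₂)) ?_ ?_ ?_ ?_ h'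
      · rintro _ ⟨D', rfl⟩
        refine Submodule.subset_span ⟨D.contract D', ?_⟩
        funext s I J
        exact D.eval_contract D' (sit s) I J
      · have h0 : (fun s => FormalGeometry.contract (D.eval (sit s))
            ((0 : Family sit ν₂ (κ₂ ⊕ τ)) s)) = (0 : Family sit (ν₁ ⊕ ν₂) (κ₁ ⊕ κ₂)) := by
          funext s I J
          simp [FormalGeometry.contract]
        rw [h0]
        exact Submodule.zero_mem _
      · intro Y Y' _ _ h h'
        convert Submodule.add_mem _ h h' using 1
        funext s I J
        simp [FormalGeometry.contract, mul_add, sum_add_distrib]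
      · intro r Y _ h
        convert Submodule.smul_mem _ r h using 1
        funext s I J
        simp [FormalGeometry.contract, smul_sum]
    · have h0 : (fun s => FormalGeometry.contract ((0 : Family sit (ν₁ ⊕ τ) κ₁) s) (Y s)) =
          (0 : Family sit (ν₁ ⊕ ν₂) (κ₁ ⊕ κ₂)) := by
        funext s I J
        simp [FormalGeometry.contract]
      rw [h0]
      exact Submodule.zero_mem _
    · intro X X' _ _ h h'
      convert Submodule.add_mem _ h h' using 1
      funext s I J
      simp [FormalGeometry.contract, add_mul, sum_add_distrib]
    · intro r X _ h
      convert Submodule.smul_mem _ r h using 1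
      funext s I J
      simp [FormalGeometry.contract, smul_sum]

/-- The monomial of a diagram. -/
def Diagram.toMonomial {n : ℕ} (D : Diagram L up (Fin n) κ) : NoLoopMonomial L up n κ where
  size := Fintype.card D.V
  letter f := D.letter ((Fintype.equivFin D.V).symm f)
  order f := D.order ((Fintype.equivFin D.V).symm f)
  wire := factorWire (Fintype.equivFin D.V).symm D.wire
  no_loop f s t h := by
    have h1 := map_factorWire (Fintype.equivFin D.V).symm D.wire (Sum.inl ⟨f, s⟩)
    rw [h] at h1
    exact D.no_loop _ _ _ h1.symm
  no_delta j i h := by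
    have h1 := map_factorWire (Fintype.equivFin D.V).symm D.wire (Sum.inr j)
    rw [h] at h1
    exact D.no_delta _ _ h1.symm

lemma Diagram.eval_toMonomial [Fintype κ] {n : ℕ} (D : Diagram L up (Fin n) κ) (s : Situation L up)
    {T : (l : L) → Vec s.d → (up l → Fin s.d) → ℝ}
    (hT : ∀ l J (q : s.conn.dom), evalAt q (s.tensor l J) = T l q J) (q : s.conn.dom)
    (I : Fin n → Fin s.d) (J : κ → Fin s.d) :
    D.toMonomial.eval s.conn.Γ T q I J = evalAt q (D.eval s I J) := by
  classical
  rw [Diagram.eval, ← netEval_factorWire (Fintype.equivFin D.V).symm, netEval, map_sum]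
  refine sum_congr (by congr!) fun c _ => ?_
  rw [apply_ite (evalAt q), map_zero, map_prod]
  have h1 : (∀ j v, D.toMonomial.wire (Sum.inr j) = Sum.inl v → c v = J j) ↔
      ∀ j, Sum.elim c I (D.toMonomial.wire (Sum.inr j)) = J j := by
    refine forall_congr' fun j => ?_
    have h1 := D.toMonomial.no_delta j
    generalize D.toMonomial.wire (Sum.inr j) = z at h1
    rcases z with u | n
    · exact ⟨fun h => h u rfl, fun h v hv => by cases hv; exact h⟩
    · exact absurd rfl (h1 n)
  by_cases h2 : ∀ j, Sum.elim c I (D.toMonomial.wire (Sum.inr j)) = J j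
  · refine (if_pos (h1.2 h2)).trans (Eq.trans ?_ (if_pos h2).symm)
    exact prod_congr rfl fun f _ => (s.evalAt_letter hT _ _ q _ _).symm
  · exact (if_neg fun h => h2 (h1.1 h)).trans (if_neg h2).symm

theorem Univ.exists_polynomial [Fintype κ] {n : ℕ} {X : Family sit (Fin n) κ}
    (h : Univ sit (Fin n) κ X) : ∃ P : NoLoopPolynomial L up n κ,
      ∀ s (T : (l : L) → Vec (sit s).d → (up l → Fin (sit s).d) → ℝ),
        (∀ l J (q : (sit s).conn.dom), evalAt q ((sit s).tensor l J) = T l q J) →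
        ∀ (q : (sit s).conn.dom) I J, evalAt q (X s I J) = P.eval (sit s).conn.Γ T q I J := by
  refine Submodule.span_induction (p := fun X _ => ∃ P : NoLoopPolynomial L up n κ,
      ∀ s (T : (l : L) → Vec (sit s).d → (up l → Fin (sit s).d) → ℝ),
        (∀ l J (q : (sit s).conn.dom), evalAt q ((sit s).tensor l J) = T l q J) →
        ∀ (q : (sit s).conn.dom) I J, evalAt q (X s I J) = P.eval (sit s).conn.Γ T q I J)
    ?_ ?_ ?_ ?_ h.mem_diagramSpan
  · rintro _ ⟨D, rfl⟩
    refine ⟨[(1, D.toMonomial)], fun s T hT q I J => ?_⟩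
    simp [NoLoopPolynomial.eval, D.eval_toMonomial (sit s) hT q I J]
  · exact ⟨[], fun s T hT q I J => by simp [NoLoopPolynomial.eval]⟩
  · rintro X Y _ _ ⟨P, hP⟩ ⟨P', hP'⟩
    refine ⟨P ++ P', fun s T hT q I J => ?_⟩
    rw [NoLoopPolynomial.eval, List.map_append, List.sum_append]
    exact (map_add (evalAt q) _ _).trans (congrArg₂ (· + ·) (hP s T hT q I J) (hP' s T hT q I J))
  · rintro r X _ ⟨P, hP⟩
    refine ⟨P.map fun t => (r * t.1, t.2), fun s T hT q I J => ?_⟩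
    refine (map_smul (evalAt q) r _).trans ?_
    rw [hP s T hT q I J, NoLoopPolynomial.eval, NoLoopPolynomial.eval, List.map_map, smul_eq_mul,
      ← List.sum_map_mul_left]
    simp [Function.comp_def, mul_assoc]

end Diagrams

section GenPoly

variable {d n n' : ℕ} {R : Type*} [CommRing R]

lemma genPoly_mul (t : (Fin n → Fin d) → R) (t' : (Fin n' → Fin d) → R) :
    genPoly t * genPoly t' = genPoly fun K : Fin (n + n') → Fin d =>
      t (fun a => K (Fin.castAdd n' a)) * t' fun a => K (Fin.natAdd n a) := by
  simp only [genPoly]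
  rw [sum_mul_sum, ← Fintype.sum_prod_type', ← (Fin.appendEquiv n n').sum_comp]
  refine sum_congr rfl fun p _ => ?_
  rw [Fin.prod_univ_add]
  simp only [Fin.appendEquiv, Equiv.coe_fn_mk, Fin.append_left, Fin.append_right, map_mul]
  ring

lemma pderiv_genPoly (b : Fin d) (t : (Fin (n + 1) → Fin d) → R) : pderiv R b (genPoly t) =
      genPoly fun K => ∑ a, t (Fin.insertNth (α := fun _ => Fin d) a b K) := by
  induction n with
  | zero =>
    rw [genPoly_succ, map_sum]
    simp only [genPoly_zero_arity]
    rw [sum_eq_single b]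
    · rw [Derivation.leibniz]
      simp [pderiv_C]
    · intro i _ hi
      rw [Derivation.leibniz]
      simp [pderiv_C, hi]
    · simp
  | succ n ih =>
    have h : ∀ i, pderiv R b (X i : Series d R) = if i = b then 1 else 0 := fun i => by
      rw [pderiv_X]
      simp [Pi.single_apply]
    rw [genPoly_succ, map_sum]
    simp only [Derivation.leibniz, ih, sum_add_distrib, smul_eq_mul, h, mul_ite, mul_one,
      mul_zero, sum_ite_eq', mem_univ, if_true]
    have hs : ∑ i, X i * genPoly (fun K => ∑ a : Fin (n + 1),
        t (Fin.cons i (Fin.insertNth (α := fun _ => Fin d) a b K))) =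
        genPoly fun K => ∑ a : Fin (n + 1),
          t (Fin.cons (K 0) (Fin.insertNth (α := fun _ => Fin d) a b (Fin.tail K))) := by
      rw [genPoly_succ]
      simp
    rw [hs, ← genPoly_add]
    refine congrArg genPoly (funext fun K => ?_)
    rw [Fin.sum_univ_succ (n := n + 1), add_comm]
    refine congrArg₂ (· + ·) ?_ (sum_congr rfl fun a _ => congrArg t ?_)
    · rw [Fin.insertNth_zero]
      rfl
    · refine (Fin.insertNth_eq_iff.2 ⟨?_, ?_⟩).symm
      · simp
      · funext j
        refine Fin.cases ?_ (fun j => ?_) j <;> simp [Fin.removeNth, Fin.tail]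

lemma smul_genPoly [Algebra ℝ R] (r : ℝ) (t : (Fin n → Fin d) → R) :
    r • genPoly t = genPoly fun K => r • t K := by
  rw [← algebraMap_smul R r (genPoly t), smul_eq_C_mul, ← genPoly_C_mul]
  simp only [Algebra.smul_def]

lemma hom_real_smul [Algebra ℝ R] (r : ℝ) (n : ℕ) (s : Series d R) :
    hom n (r • s) = r • hom n s := (hom n).map_smul_of_tower r s

end GenPoly

section IteratedDerivatives

variable {d : ℕ} {R : Type*} [CommRing R]

/-- The iterated derivative along a multiset of directions. -/
def pdMulti (u : Multiset (Fin d)) : Series d R →ₗ[R] Series d R :=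
  Quotient.liftOn u (pdList R) fun _ _ h => LinearMap.ext fun s => pdList_perm h s

lemma pdMulti_coe (L : List (Fin d)) : pdMulti (R := R) (L : Multiset (Fin d)) = pdList R L := rfl

lemma pdMulti_zero (s : Series d R) : pdMulti 0 s = s := rfl

lemma pdMulti_cons (i : Fin d) (u : Multiset (Fin d)) (s : Series d R) :
    pdMulti (i ::ₘ u) s = pderiv R i (pdMulti u s) :=
  Quotient.inductionOn u fun _ => rfl

lemma hom_pdMulti (n : ℕ) (u : Multiset (Fin d)) (s : Series d R) :
    hom n (pdMulti u s) = pdMulti u (hom (n + u.card) s) :=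
  Quotient.inductionOn u fun L => hom_pdList L n s

lemma pdMulti_mul {β : Type*} [DecidableEq β] (u : Finset β) (J : β → Fin d)
    (s t : Series d R) : pdMulti (u.val.map J) (s * t) =
      ∑ ε ∈ u.powerset, pdMulti (ε.val.map J) s * pdMulti ((u \ ε).val.map J) t := by
  induction u using induction_on with
  | empty => simp [pdMulti_zero]
  | insert b u hb ih =>
    rw [Finset.sum_powerset_insert hb, Finset.insert_val_of_notMem hb, Multiset.map_cons,
      pdMulti_cons, ih, map_sum, ← sum_add_distrib]
    refine sum_congr rfl fun ε hε => ?_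
    have h : b ∉ ε := fun h => hb (mem_powerset.1 hε h)
    rw [Derivation.leibniz, Finset.insert_val_of_notMem h, Multiset.map_cons, pdMulti_cons,
      Finset.insert_sdiff_of_notMem _ h, Finset.insert_val_of_notMem (by simp [hb]),
      Multiset.map_cons, pdMulti_cons, Finset.insert_sdiff_insert, Finset.sdiff_insert_of_notMem hb]
    simp only [smul_eq_mul]
    ring

end IteratedDerivatives

section SeriesCovariant

variable {d : ℕ} {R : Type*} [CommRing R] [Algebra ℝ R] (Q : ConnRing d R) {ν κ : Type}
  [Fintype ν] [DecidableEq ν] [Fintype κ] [DecidableEq κ]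

/-- The covariant derivative of a tensor with values in formal series, in components. -/
def ConnRing.scov (i : Fin d) (Φ : (ν → Fin d) → (κ → Fin d) → Series d R)
    (I : ν → Fin d) (J : κ → Fin d) : Series d R :=
  Q.nab i (Φ I J) - ∑ a, ∑ l, C (Q.Gam i (I a) l) * Φ (Function.update I a l) J
    + ∑ b, ∑ l, C (Q.Gam i l (J b)) * Φ I (Function.update J b l)

lemma ConnRing.hom_scov (n : ℕ) (i : Fin d)
    (Φ : (ν → Fin d) → (κ → Fin d) → Series d R) (I : ν → Fin d) (J : κ → Fin d) :
    hom n (Q.scov i Φ I J) = Q.scov i (fun I J => hom n (Φ I J)) I J := by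
  simp only [ConnRing.scov, map_add, map_sub, map_sum, Q.hom_nab, hom_C_mul]

lemma ConnRing.scov_genPoly (n : ℕ) (i : Fin d) (X : (ν ⊕ Fin n → Fin d) → (κ → Fin d) → R)
    (I : ν → Fin d) (J : κ → Fin d) :
    Q.scov i (fun I J => genPoly fun K => X (Sum.elim I K) J) I J =
      genPoly fun K => Q.cov i X (Sum.elim I K) J := by
  have h : ∀ t : (Fin n → Fin d) → R, Q.covLow i t = fun I =>
    Q.der i (t I) - ∑ a, ∑ l, Q.Gam i (I a) l * t (Function.update I a l) := fun t => rfl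
  simp only [ConnRing.scov, ConnRing.cov, ConnRing.covLow, Q.nab_genPoly, h, Fintype.sum_sum_type,
    genPoly_add, genPoly_sum, genPoly_C_mul, sub_eq_add_neg, genPoly_neg, Sum.elim_inl,
    Sum.elim_inr, Sum.update_elim_inl, Sum.update_elim_inr, neg_add, ← sum_neg_distrib]
  abel

end SeriesCovariant

section Slots

variable {ν : Type} {n : ℕ}

/-- Moving one of the last slots to the front. -/
def slotEquiv (ν : Type) (a : Fin (n + 1)) : ν ⊕ Fin (n + 1) ≃ (Unit ⊕ ν) ⊕ Fin n :=
  (Equiv.sumCongr (Equiv.refl ν) ((finSuccEquiv' a).trans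
    ((Equiv.optionEquivSumPUnit.{0} _).trans (Equiv.sumComm _ _)))).trans
  ((Equiv.sumAssoc ν Unit (Fin n)).symm.trans
    (Equiv.sumCongr (Equiv.sumComm ν Unit) (Equiv.refl _)))

lemma elim_comp_slotEquiv {d : ℕ} (a : Fin (n + 1)) (I : Unit ⊕ ν → Fin d) (K : Fin n → Fin d) :
    Sum.elim I K ∘ slotEquiv ν a =
      Sum.elim (I ∘ Sum.inr) (Fin.insertNth (α := fun _ => Fin d) a (I (Sum.inl ())) K) := by
  funext x
  rcases x with x | x
  · rfl
  · refine Fin.succAboveCases a ?_ (fun j => ?_) x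
    · simp [slotEquiv]
    · simp [slotEquiv]

lemma elim_comp_slotEquiv_symm {d : ℕ} (I : ν → Fin d) (K : Fin (n + 1) → Fin d) :
    Sum.elim I K ∘ (slotEquiv ν 0).symm = Sum.elim (Sum.elim (fun _ => K 0) I) (Fin.tail K) := by
  rw [Equiv.comp_symm_eq, elim_comp_slotEquiv]
  congr 1
  simp

end Slots

section HomogeneousUniversal

variable {L : Type} {up : L → Type} [∀ l, Fintype (up l)] [∀ l, DecidableEq (up l)] {ι : Type}
  {sit : ι → Situation L up}

/-- Families of tensors with values in formal series, one in each situation. -/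
abbrev SFamily (sit : ι → Situation L up) (ν κ : Type) : Type :=
  (s : ι) → (ν → Fin (sit s).d) → (κ → Fin (sit s).d) →
    MvPowerSeries (Fin (sit s).d) (smoothRing (sit s).conn.dom)

/-- The homogeneous part of degree `n` of the series is given by tensors generated by the letters
and contractions without loops. -/
def HomUniv (n : ℕ) {ν κ : Type} (Φ : SFamily sit ν κ) : Prop :=
  ∃ X : Family sit (ν ⊕ Fin n) κ, Univ sit (ν ⊕ Fin n) κ X ∧
    ∀ s I J, hom n (Φ s I J) = genPoly fun K => X s (Sum.elim I K) J

variable {ν κ ν' κ' ν₁ ν₂ κ₁ κ₂ τ : Type} {n : ℕ} {Φ Ψ : SFamily sit ν κ}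

lemma HomUniv.congr (h : HomUniv n Φ) (he : ∀ s I J, hom n (Φ s I J) = hom n (Ψ s I J)) :
    HomUniv n Ψ := by
  obtain ⟨X, hX, h⟩ := h
  exact ⟨X, hX, fun s I J => (he s I J).symm.trans (h s I J)⟩

lemma HomUniv.of_eq_zero (h : ∀ s I J, hom n (Φ s I J) = 0) : HomUniv n Φ :=
  ⟨_, Univ.zero _ _, fun s I J => by rw [h]; simp [genPoly]⟩

lemma HomUniv.add (h : HomUniv n Φ) (h' : HomUniv n Ψ) :
    HomUniv n fun s I J => Φ s I J + Ψ s I J := by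
  obtain ⟨X, hX, h⟩ := h
  obtain ⟨Y, hY, h'⟩ := h'
  exact ⟨_, hX.add hY, fun s I J => by rw [map_add, h, h', genPoly_add]⟩

lemma HomUniv.smul (r : ℝ) (h : HomUniv n Φ) : HomUniv n fun s I J => r • Φ s I J := by
  obtain ⟨X, hX, h⟩ := h
  exact ⟨_, hX.smul r, fun s I J => by rw [hom_real_smul, h, smul_genPoly]⟩

lemma HomUniv.neg (h : HomUniv n Φ) : HomUniv n fun s I J => - Φ s I J :=
  (h.smul (-1)).congr fun s I J => by rw [neg_smul, one_smul]

lemma HomUniv.sub (h : HomUniv n Φ) (h' : HomUniv n Ψ) : HomUniv n fun s I J => Φ s I J - Ψ s I J :=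
  (h.add h'.neg).congr fun s I J => by rw [sub_eq_add_neg]

lemma HomUniv.sum {β : Type*} (u : Finset β) {Φ : β → SFamily sit ν κ}
    (h : ∀ b ∈ u, HomUniv n (Φ b)) : HomUniv n fun s I J => ∑ b ∈ u, Φ b s I J := by
  classical
  induction u using induction_on with
  | empty => exact HomUniv.of_eq_zero fun s I J => by simp
  | insert b u hb ih =>
    exact ((h b (mem_insert_self b u)).add
      (ih fun b hb => h b (mem_insert_of_mem hb))).congr fun _ _ _ => by
        rw [sum_insert hb]

lemma HomUniv.reindex (φ : ν ≃ ν') (ψ : κ ≃ κ') (h : HomUniv n Φ) :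
    HomUniv n (sit := sit) (ν := ν') (κ := κ') fun s I J => Φ s (I ∘ φ) (J ∘ ψ) := by
  obtain ⟨X, hX, h⟩ := h
  refine ⟨_, hX.reindex (Equiv.sumCongr φ (Equiv.refl _)) ψ, fun s I J => ?_⟩
  rw [h]
  refine congrArg genPoly (funext fun K => ?_)
  congr 1
  funext x
  rcases x with x | x <;> rfl

lemma HomUniv.const {X : Family sit ν κ} (h : Univ sit ν κ X) (n : ℕ) :
    HomUniv n (sit := sit) fun s I J => C (X s I J) := by
  cases n with
  | zero =>
    refine ⟨_, h.reindex (Equiv.sumEmpty ν (Fin 0)).symm (Equiv.refl κ), fun s I J => ?_⟩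
    rw [hom_C, if_pos rfl, genPoly_zero_arity]
    rfl
  | succ n => exact HomUniv.of_eq_zero fun s I J => by rw [hom_C, if_neg (Nat.succ_ne_zero n)]

lemma HomUniv.contract_hom [Fintype ν₁] [DecidableEq ν₁] [Fintype ν₂] [DecidableEq ν₂]
    [Fintype κ₁] [DecidableEq κ₁] [Fintype κ₂] [DecidableEq κ₂] [Fintype τ] [DecidableEq τ]
    {p p' : ℕ} {Φ : SFamily sit (ν₁ ⊕ τ) κ₁} {Ψ : SFamily sit ν₂ (κ₂ ⊕ τ)} (h : HomUniv p Φ)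
    (h' : HomUniv p' Ψ) : HomUniv (p + p') (sit := sit) fun s =>
      contract (fun I J => hom p (Φ s I J)) fun I J => hom p' (Ψ s I J) := by
  obtain ⟨X, hX, h⟩ := h
  obtain ⟨Y, hY, h'⟩ := h'
  refine ⟨_, (Univ.contract (hX.reindex ((Equiv.sumAssoc ν₁ τ (Fin p)).trans
    ((Equiv.sumCongr (Equiv.refl _) (Equiv.sumComm _ _)).trans (Equiv.sumAssoc ν₁ (Fin p) τ).symm))
    (Equiv.refl _)) hY).reindex ((Equiv.sumSumSumComm ν₁ (Fin p) ν₂ (Fin p')).trans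
      (Equiv.sumCongr (Equiv.refl _) finSumFinEquiv)) (Equiv.refl _), fun s I J => ?_⟩
  simp only [contract, h, h', genPoly_mul, ← genPoly_sum]
  rw [hom_genPoly_self]
  refine congrArg genPoly (funext fun K => sum_congr rfl fun c _ => ?_)
  congr 2 <;> funext x
  · rcases x with (x | x) | x <;> simp
  · rcases x with x | x <;> simp

lemma HomUniv.contract [Fintype ν₁] [DecidableEq ν₁] [Fintype ν₂] [DecidableEq ν₂]
    [Fintype κ₁] [DecidableEq κ₁] [Fintype κ₂] [DecidableEq κ₂] [Fintype τ] [DecidableEq τ]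
    {Φ : SFamily sit (ν₁ ⊕ τ) κ₁} {Ψ : SFamily sit ν₂ (κ₂ ⊕ τ)}
    (h : ∀ p p', p + p' = n → (HomUniv p Φ ∧ HomUniv p' Ψ) ∨ (∀ s I J, hom p (Φ s I J) = 0) ∨
      ∀ s I J, hom p' (Ψ s I J) = 0) :
    HomUniv n (sit := sit) fun s => FormalGeometry.contract (Φ s) (Ψ s) := by
  have key : HomUniv n (sit := sit) fun s I J => ∑ pr ∈ Finset.HasAntidiagonal.antidiagonal n,
      FormalGeometry.contract (fun I J => hom pr.1 (Φ s I J)) (fun I J => hom pr.2 (Ψ s I J)) I J := by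
    refine HomUniv.sum _ fun pr hpr => ?_
    rw [Finset.HasAntidiagonal.mem_antidiagonal] at hpr
    rcases h pr.1 pr.2 hpr with ⟨h, h'⟩ | h | h
    · rw [← hpr]
      exact h.contract_hom h'
    · exact HomUniv.of_eq_zero fun s I J => by simp [FormalGeometry.contract, h]
    · exact HomUniv.of_eq_zero fun s I J => by simp [FormalGeometry.contract, h]
  refine key.congr fun s I J => ?_
  simp only [FormalGeometry.contract, map_sum]
  rw [sum_comm]
  refine sum_congr rfl fun c _ => ?_
  conv_rhs => rw [hom_mul]
  refine sum_congr rfl fun pr hpr => ?_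
  rw [Finset.HasAntidiagonal.mem_antidiagonal] at hpr
  rw [hom_mul, sum_eq_single pr]
  · simp [hom_hom]
  · rintro ⟨a, b⟩ _ hne
    rw [hom_hom, hom_hom]
    split_ifs with h1 h2
    · exact absurd (Prod.ext h1 h2) hne
    all_goals simp
  · intro hn
    exact absurd (Finset.HasAntidiagonal.mem_antidiagonal.2 hpr) hn

lemma HomUniv.pderiv (h : HomUniv (n + 1) Φ) :
    HomUniv n (sit := sit) (ν := Unit ⊕ ν) (κ := κ) fun s I J =>
      pderiv _ (I (Sum.inl ())) (Φ s (I ∘ Sum.inr) J) := by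
  obtain ⟨X, hX, h⟩ := h
  refine ⟨_, Univ.sum univ fun a _ => hX.reindex (slotEquiv ν a) (Equiv.refl _), fun s I J => ?_⟩
  rw [hom_pderiv, h, pderiv_genPoly]
  simp only [elim_comp_slotEquiv]
  rfl

lemma HomUniv.pdMulti [Fintype τ] (h : ∀ n, HomUniv n Φ) (n : ℕ) :
    HomUniv n (sit := sit) (ν := τ ⊕ ν) (κ := κ) fun s I J =>
      pdMulti ((univ : Finset τ).val.map (I ∘ Sum.inl)) (Φ s (I ∘ Sum.inr) J) := by
  have key : ∀ r n, HomUniv n (sit := sit) (ν := Fin r ⊕ ν) (κ := κ) fun s I J =>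
      pdList _ (List.ofFn (I ∘ Sum.inl)) (Φ s (I ∘ Sum.inr) J) := by
    intro r
    induction r with
    | zero =>
      intro n
      refine ((h n).reindex (Equiv.emptySum (Fin 0) ν).symm (Equiv.refl κ)).congr fun s I J => ?_
      rw [List.ofFn_zero]
      rfl
    | succ r ih =>
      intro n
      let φ : Unit ⊕ (Fin r ⊕ ν) ≃ Fin (r + 1) ⊕ ν := (Equiv.sumAssoc Unit (Fin r) ν).symm.trans
        (Equiv.sumCongr ((Equiv.sumComm _ _).trans ((Equiv.optionEquivSumPUnit.{0} _).symm.trans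
          (finSuccEquiv r).symm)) (Equiv.refl ν))
      refine ((ih (n + 1)).pderiv.reindex φ (Equiv.refl κ)).congr fun s I J => ?_
      rw [List.ofFn_succ]
      rfl
  refine ((key (Fintype.card τ) n).reindex (Equiv.sumCongr (Fintype.equivFin τ).symm
    (Equiv.refl ν)) (Equiv.refl κ)).congr fun s I J => ?_
  have h1 : (univ : Finset τ).val =
      (univ : Finset (Fin (Fintype.card τ))).val.map (Fintype.equivFin τ).symm := by
    rw [← Finset.univ_map_equiv_to_embedding (Fintype.equivFin τ).symm, Finset.map_val]
    rfl
  rw [← pdMulti_coe, ← Fin.univ_val_map, h1, Multiset.map_map]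
  rfl

lemma HomUniv.sum_X_mul {Φ : SFamily sit (Unit ⊕ ν) κ} (h : ∀ k, k + 1 = n → HomUniv k Φ) :
    HomUniv n (sit := sit) fun s I J => ∑ i, X i * Φ s (Sum.elim (fun _ => i) I) J := by
  cases n with
  | zero => exact HomUniv.of_eq_zero fun s I J => by simp [map_sum, hom_zero_X_mul]
  | succ n =>
    obtain ⟨X, hX, h⟩ := h n rfl
    refine ⟨_, hX.reindex (slotEquiv ν 0).symm (Equiv.refl _), fun s I J => ?_⟩
    rw [map_sum, genPoly_succ]
    refine sum_congr rfl fun i _ => ?_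
    rw [hom_succ_X_mul, h]
    simp only [elim_comp_slotEquiv_symm]
    rfl

lemma HomUniv.scov [Fintype ν] [DecidableEq ν] [Fintype κ] [DecidableEq κ] (h : HomUniv n Φ) :
    HomUniv n (sit := sit) (ν := Unit ⊕ ν) (κ := κ) fun s I J =>
      (sit s).conn.ring.scov (I (Sum.inl ())) (Φ s) (I ∘ Sum.inr) J := by
  obtain ⟨X, hX, h⟩ := h
  refine ⟨_, hX.covariant.reindex (Equiv.sumAssoc Unit ν (Fin n)).symm (Equiv.refl κ),
    fun s I J => ?_⟩
  rw [ConnRing.hom_scov]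
  simp only [h]
  rw [ConnRing.scov_genPoly]
  refine congrArg genPoly (funext fun K => ?_)
  have h1 : (Sum.elim I K ∘ (Equiv.sumAssoc Unit ν (Fin n)).symm) ∘ Sum.inr =
      Sum.elim (I ∘ Sum.inr) K := by
    funext x
    rcases x with x | x <;> rfl
  rw [h1]
  rfl

end HomogeneousUniversal

section Recursion

variable {d : ℕ} {R : Type*} [CommRing R] [Algebra ℝ R] (Q : ConnRing d R)

/-- The Fedosov form as a tensor with values in formal series. -/
def ConnRing.fedTensor (I J : Unit → Fin d) : Series d R := Q.fedForm (I ()) (J ())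

lemma derivation_sum_X_fedForm (D : Derivation ℝ (Series d R) (Series d R)) (l : Fin d) :
    ∑ i, X i * D (Q.fedForm i l) = - ∑ i, Q.fedForm i l * D (X i) := by
  have h := congrArg D (Q.sum_X_mul_fedForm l)
  rw [map_zero, map_sum] at h
  simp only [Derivation.leibniz, smul_eq_mul, sum_add_distrib] at h
  exact eq_neg_of_add_eq_zero_left h

lemma sum_X_mul_vert_fedForm (s : Series d R) : ∑ i, X i * vert (Q.fedForm i) s = 0 := by
  rw [← vert_sum_mul]
  simp [vert_apply, Q.sum_X_mul_fedForm]

lemma ConnRing.fedTensor_recursion (I J : Unit → Fin d) :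
    ConnRing.eul (Q.fedTensor I J) + Q.fedTensor I J = - ∑ i, X i * ∑ k, X k *
          C (Q.curvR i (I ()) k (J ()))
        + ∑ i, X i * Q.scov i Q.fedTensor I J
        + ∑ b, Q.fedForm (I ()) b * Q.fedForm b (J ()) := by
  generalize hj : I () = j
  generalize hl : J () = l
  have h0 : Q.fedTensor I J = Q.fedForm j l := by rw [ConnRing.fedTensor, hj, hl]
  have hs : ∀ i, Q.scov i Q.fedTensor I J = Q.nab i (Q.fedForm j l)
      - ∑ k, C (Q.Gam i j k) * Q.fedForm k l
      + ∑ k, C (Q.Gam i k l) * Q.fedForm j k := fun i => by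
    simp [ConnRing.scov, ConnRing.fedTensor, hj, hl]
  have h1 : ∀ k i, pderiv R k (Q.conn i l) = - C (Q.Gam i k l) := fun k i => Q.pderiv_conn k i l
  have h2 := derivation_sum_X_fedForm Q (Q.nab j) l
  have h3 := derivation_sum_X_fedForm Q (vert (Q.fedForm j)) l
  have h4 := sum_X_mul_vert_fedForm Q (Q.fedForm j l)
  have h5 := sum_X_mul_vert_fedForm Q (Q.conn j l)
  simp only [vert_X] at h3
  have h6 : ∀ i, Q.nab j (X i) = Q.conn j i := fun i => by
    rw [Q.nab_apply, vert_X]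
    have : Q.dx j (X i) = 0 := by
      ext α
      rw [ConnRing.dx, coeff_mapDer, coeff_X]
      split_ifs <;> simp
    rw [this, zero_add]
  have h7 : ∑ i, Q.fedForm i l * Q.nab j (X i) =
      - ∑ i, X i * ∑ k, C (Q.Gam i j k) * Q.fedForm k l := by
    simp only [h6, ConnRing.conn, mul_neg, sum_neg_distrib, mul_sum]
    rw [sum_comm]
    refine congrArg _ (sum_congr rfl fun i _ => sum_congr rfl fun k _ => ?_)
    rw [Q.Gam_symm j i k]
    ring
  have h8 : ∀ i, vert (Q.fedForm j) (Q.conn i l) =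
      - ∑ k, C (Q.Gam i k l) * Q.fedForm j k := fun i => by
    simp only [vert_apply, h1, mul_neg, sum_neg_distrib, mul_comm]
  rw [h0, ← Q.fedForm_recursion j l]
  simp only [hs]
  simp only [Q.nab_apply, mul_add, mul_sub, mul_neg, sum_add_distrib, sum_sub_distrib,
    sum_neg_distrib, h4, h5, h3, h8] at h2 h7 ⊢
  have h9 : ∑ i, X i * ∑ k, C (Q.curvR i j k l) * X k =
      ∑ i, X i * ∑ k, X k * C (Q.curvR i j k l) := by
    simp only [mul_comm]
  have h10 : ∑ b, Q.fedForm j b * Q.fedForm b l = ∑ i, Q.fedForm i l * Q.fedForm j i := by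
    simp only [mul_comm]
  rw [h9, h10]
  linear_combination - h2 + h7

end Recursion

section FedosovUniversal

variable {L : Type} {up : L → Type} [∀ l, Fintype (up l)] [∀ l, DecidableEq (up l)] {ι : Type}
  {sit : ι → Situation L up}

variable (sit) in
lemma univ_curvR : Univ sit (Fin 3) Unit fun s I J =>
    (sit s).conn.ring.curvR (I 0) (I 1) (I 2) (J ()) :=
  Univ.letter none 0

lemma hom_zero_fedTensor {d : ℕ} {R : Type*} [CommRing R] [Algebra ℝ R] (Q : ConnRing d R)
    (I J : Unit → Fin d) : hom 0 (Q.fedTensor I J) = 0 := by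
  rw [hom_zero_eq, ConnRing.fedTensor, Q.constantCoeff_fedForm, map_zero]

/-- The Fedosov form is given by universal tensors. -/
theorem homUniv_fedTensor (n : ℕ) :
    HomUniv n (sit := sit) fun s => (sit s).conn.ring.fedTensor := by
  induction n using Nat.strong_induction_on with
  | _ n ih =>
  let φ : Fin 3 ≃ Unit ⊕ (Unit ⊕ Unit) :=
    { toFun := ![Sum.inr (Sum.inl ()), Sum.inr (Sum.inr ()), Sum.inl ()]
      invFun := Sum.elim (fun _ => 2) (Sum.elim (fun _ => 0) fun _ => 1)
      left_inv := fun x => by fin_cases x <;> rfl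
      right_inv := fun x => by rcases x with x | x | x <;> rfl }
  have h1 : HomUniv n (sit := sit) (ν := Unit) (κ := Unit) fun s I J => ∑ i, X i * ∑ k, X k *
        C ((sit s).conn.ring.curvR i (I ()) k (J ())) :=
    HomUniv.sum_X_mul (Φ := fun s (I : Unit ⊕ Unit → Fin (sit s).d) (J : Unit → Fin (sit s).d) =>
        ∑ k, X k * C
          ((sit s).conn.ring.curvR (I (Sum.inl ())) (I (Sum.inr ())) k (J ()))) fun k _ =>
      HomUniv.sum_X_mul (Φ := fun s (I : Unit ⊕ (Unit ⊕ Unit) → Fin (sit s).d)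
        (J : Unit → Fin (sit s).d) => C ((sit s).conn.ring.curvR
          (I (Sum.inr (Sum.inl ()))) (I (Sum.inr (Sum.inr ()))) (I (Sum.inl ())) (J ()))) fun k _ =>
        HomUniv.const ((univ_curvR sit).reindex φ (Equiv.refl _)) k
  have h2 : HomUniv n (sit := sit) (ν := Unit) (κ := Unit) fun s I J => ∑ i, X i *
      (sit s).conn.ring.scov i (sit s).conn.ring.fedTensor I J :=
    HomUniv.sum_X_mul (Φ := fun s (I : Unit ⊕ Unit → Fin (sit s).d) (J : Unit → Fin (sit s).d) =>
      (sit s).conn.ring.scov (I (Sum.inl ())) (sit s).conn.ring.fedTensor (I ∘ Sum.inr) J)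
      fun k hk => (ih k (by omega)).scov
  have h3 : HomUniv n (sit := sit) (ν := Unit) (κ := Unit) fun s I J =>
      ∑ b, (sit s).conn.ring.fedForm (I ()) b * (sit s).conn.ring.fedForm b (J ()) := by
    have h : HomUniv n (sit := sit) (ν := Empty ⊕ Unit) (κ := Unit ⊕ Empty) fun s => contract
        (τ := Unit) (fun I J => (sit s).conn.ring.fedTensor (I ∘ Sum.inr) J)
        (fun I J => (sit s).conn.ring.fedTensor I (J ∘ Sum.inr)) := by
      refine HomUniv.contract fun p p' hp => ?_
      rcases Nat.eq_zero_or_pos p with rfl | h0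
      · exact Or.inr (Or.inl fun s I J => hom_zero_fedTensor _ _ _)
      rcases Nat.eq_zero_or_pos p' with rfl | h0'
      · exact Or.inr (Or.inr fun s I J => hom_zero_fedTensor _ _ _)
      exact Or.inl ⟨(ih p (by omega)).reindex (Equiv.emptySum Empty Unit).symm (Equiv.refl _),
        (ih p' (by omega)).reindex (Equiv.refl _) (Equiv.emptySum Empty Unit).symm⟩
    refine (h.reindex (Equiv.emptySum Empty Unit) (Equiv.sumEmpty Unit Empty)).congr
      fun s I J => congrArg _ ?_
    refine (Fintype.sum_equiv (Equiv.funUnique Unit (Fin (sit s).d)) _ _ fun c => ?_)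
    rw [mul_comm]
    rfl
  refine (((h1.neg.add h2).add h3).smul ((n : ℝ) + 1)⁻¹).congr fun s I J => ?_
  rw [← ConnRing.fedTensor_recursion, hom_real_smul, map_add, ConnRing.hom_eul, ← succ_nsmul,
    ← Nat.cast_smul_eq_nsmul ℝ, smul_smul]
  push_cast
  rw [inv_mul_cancel₀ (by positivity), one_smul]

end FedosovUniversal

section Exponential

variable {d m : ℕ} {R : Type*} [CommRing R] [Algebra ℝ R]

lemma exists_exponential (ξ : Fin d → ℝ) : ∃ E : Series d R, IsUnit E ∧
    (∀ k, pderiv R k E = algebraMap ℝ _ (ξ k) * E) ∧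
    ∀ D : Derivation ℝ R R, mapDer D E = 0 := by
  refine ⟨MvPowerSeries.map (algebraMap ℝ R) (expSeries ξ), ?_, fun k => ?_, fun D => ?_⟩
  · have h := isUnit_prod_expSeries (m := 1) fun _ => ξ
    rw [Fin.prod_univ_one] at h
    exact h.map _
  · have h := congrArg (MvPowerSeries.map (algebraMap ℝ R)) (pderiv_expSeries ξ k)
    rw [map_mul, MvPowerSeries.map_C] at h
    rw [MvPowerSeries.algebraMap_apply]
    refine Eq.trans ?_ h
    ext α
    simp [coeff_pderiv]
  · ext α
    rw [coeff_mapDer, MvPowerSeries.coeff_map, Derivation.map_algebraMap, map_zero]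

lemma pdMulti_algebraMap_mul (r : ℝ) (u : Multiset (Fin d)) (s : Series d R) :
    pdMulti u (algebraMap ℝ _ r * s) = algebraMap ℝ _ r * pdMulti u s := by
  rw [← Algebra.smul_def, ← Algebra.smul_def, LinearMap.map_smul_of_tower]

lemma pdMulti_exponential {β : Type*} [DecidableEq β] {ξ : Fin d → ℝ}
    {E : Series d R}
    (hE : ∀ k, pderiv R k E = algebraMap ℝ _ (ξ k) * E) (u : Finset β)
    (J : β → Fin d) :
    pdMulti (u.val.map J) E = (∏ b ∈ u, algebraMap ℝ _ (ξ (J b))) * E := by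
  induction u using induction_on with
  | empty => simp [pdMulti_zero]
  | insert b u hb ih =>
    have h : ∀ r : ℝ, pderiv R (J b) (algebraMap ℝ (Series d R) r * E) =
        algebraMap ℝ (Series d R) r * pderiv R (J b) E := fun r =>
      pdMulti_algebraMap_mul r {J b} E
    rw [Finset.insert_val_of_notMem hb, Multiset.map_cons, pdMulti_cons, ih,
      prod_insert hb, ← map_prod, h, hE]
    ring

end Exponential

section BlockSlots

variable {d m : ℕ} {R : Type*} [CommRing R]

/-- The slots of a block. -/
def blockSlots (a : Fin m → ℕ) (l : Fin m) : Finset (Blocks a) := univ.filter (·.1 = l)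

lemma mem_blockSlots {a : Fin m → ℕ} {l : Fin m} {b : Blocks a} :
    b ∈ blockSlots a l ↔ b.1 = l := by simp [blockSlots]

lemma blockSlots_eq_map (a : Fin m → ℕ) (l : Fin m) :
    blockSlots a l = univ.map (Function.Embedding.sigmaMk l) := by
  ext b
  rw [mem_blockSlots, mem_map]
  constructor
  · rintro rfl
    exact ⟨b.2, mem_univ _, rfl⟩
  · rintro ⟨j, _, rfl⟩
    rfl

lemma card_blockSlots (a : Fin m → ℕ) (l : Fin m) : (blockSlots a l).card = a l := by
  rw [blockSlots_eq_map, Finset.card_map, card_univ, Fintype.card_fin]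

lemma pdList_blockList {a : Fin m → ℕ} (J : Blocks a → Fin d) (l : Fin m) (s : Series d R) :
    pdList R (blockList J l) s = pdMulti ((blockSlots a l).val.map J) s := by
  rw [blockSlots_eq_map, Finset.map_val, Multiset.map_map, ← pdMulti_coe, blockList,
    ← Fin.univ_val_map]
  rfl

lemma prod_sdiff_blockSlots {P : Type*} [CommMonoid P] {a : Fin m → ℕ} (ε : Finset (Blocks a))
    (x : Blocks a → P) : ∏ l, ∏ b ∈ blockSlots a l \ ε, x b = ∏ b ∈ εᶜ, x b := by
  rw [← Finset.prod_fiberwise (εᶜ) (fun b => b.1) x]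
  refine prod_congr rfl fun l _ => prod_congr ?_ fun _ _ => rfl
  ext b
  simp [blockSlots, and_comm]

end BlockSlots

section SymbolIdentity

variable {d m : ℕ} {R : Type*} [CommRing R] [Algebra ℝ R] (A : Finset (Fin m → ℕ))
  (C : Coeffs m d (Series d R)) (ξ : Fin m → Fin d → ℝ)

/-- The monomial of the symbol variables which belongs to a set of slots. -/
def symMon {a : Fin m → ℕ} (u : Finset (Blocks a)) (J : Blocks a → Fin d) : Series d R :=
  ∏ b ∈ u, algebraMap ℝ _ (ξ b.1 (J b))

variable {E : Fin m → Series d R} (hE : ∀ l k, pderiv R k (E l) = algebraMap ℝ _ (ξ l k) * E l)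

include hE

lemma prod_pdList_exponential {a : Fin m → ℕ} (J : Blocks a → Fin d) (l₀ : Fin m) (W : Series d R) :
    ∏ l, pdList R (blockList J l) (Function.update E l₀ (W * E l₀) l) =
      (∑ ε ∈ (blockSlots a l₀).powerset, pdMulti (ε.val.map J) W * symMon ξ εᶜ J) * ∏ l, E l := by
  have h1 : ∀ l u, u ⊆ blockSlots a l → pdMulti (u.val.map J) (E l) =
      (∏ b ∈ u, algebraMap ℝ _ (ξ b.1 (J b))) * E l := fun l u hu => by
    rw [pdMulti_exponential (hE l)]
    congr 1
    refine prod_congr rfl fun b hb => ?_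
    rw [mem_blockSlots.1 (hu hb)]
  rw [← mul_prod_erase _ _ (mem_univ l₀), Function.update_self, pdList_blockList,
    pdMulti_mul, sum_mul, sum_mul]
  refine sum_congr rfl fun ε hε => ?_
  have h2 : ∀ l ∈ univ.erase l₀, pdList R (blockList J l) (Function.update E l₀ (W * E l₀) l) =
      (∏ b ∈ blockSlots a l \ ε, algebraMap ℝ _ (ξ b.1 (J b))) * E l := fun l hl => by
    have hne := ne_of_mem_erase hl
    have hd : blockSlots a l \ ε = blockSlots a l := Finset.sdiff_eq_self_of_disjoint
      (Finset.disjoint_left.2 fun b hb hb' => hne ((mem_blockSlots.1 hb).symm.trans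
        (mem_blockSlots.1 (mem_powerset.1 hε hb'))))
    rw [Function.update_of_ne hne, pdList_blockList, h1 l _ subset_rfl, hd]
  rw [prod_congr rfl h2, h1 l₀ _ Finset.sdiff_subset, symMon, ← prod_sdiff_blockSlots,
    ← mul_prod_erase univ E (mem_univ l₀),
    ← mul_prod_erase univ _ (mem_univ l₀), prod_mul_distrib]
  ring

lemma dop_exponential : dop A C E = (∑ a ∈ A, ∑ J, C a J * symMon ξ univ J) * ∏ l, E l := by
  rw [dop_apply, sum_mul]
  refine sum_congr rfl fun a _ => ?_
  rw [sum_mul]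
  refine sum_congr rfl fun J _ => ?_
  have h := prod_sdiff_blockSlots ∅ fun b : Blocks a => algebraMap ℝ (Series d R) (ξ b.1 (J b))
  simp only [Finset.sdiff_empty, Finset.compl_empty] at h
  rw [mul_assoc, symMon, ← h, ← prod_mul_distrib]
  refine congrArg _ (prod_congr rfl fun l _ => ?_)
  rw [pdList_blockList, pdMulti_exponential (hE l)]
  congr 1
  exact prod_congr rfl fun b hb => by rw [mem_blockSlots.1 hb]

variable (V : Fin d → Series d R) (D : Derivation ℝ (Series d R) (Series d R))

/-- The action on symbols of the commutator with a formal vector field. -/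
theorem symbol_identity (hD : ∀ l, D (E l) = (∑ k, V k * algebraMap ℝ _ (ξ l k)) * E l)
    (hu : ∀ l, IsUnit (E l))
    (h : D (dop A C E) = ∑ l, dop A C (Function.update E l (D (E l)))) :
    ∑ a ∈ A, ∑ J, D (C a J) * symMon ξ univ J =
      ∑ a ∈ A, ∑ J, C a J * ∑ l, ∑ ε ∈ (blockSlots a l).powerset.erase ∅,
        (∑ k, pdMulti (ε.val.map J) (V k) * algebraMap ℝ _ (ξ l k)) * symMon ξ εᶜ J := by
  have hun : IsUnit (∏ l, E l) := IsUnit.prod_univ_iff.2 hu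
  have hx : ∀ {a : Fin m → ℕ} (u : Finset (Blocks a)) J, D (symMon ξ u J) = 0 := fun u J => by
    rw [symMon, ← map_prod, Derivation.map_algebraMap]
  have hP : D (∏ l, E l) = (∑ l, ∑ k, V k * algebraMap ℝ _ (ξ l k)) * ∏ l, E l := by
    rw [derivation_prod, sum_mul]
    refine sum_congr rfl fun l _ => ?_
    rw [hD, Finset.prod_update_of_mem (mem_univ l), mul_assoc,
      Finset.sdiff_singleton_eq_erase, mul_prod_erase _ _ (mem_univ l)]
  have hlin : ∀ (l : Fin m) {a : Fin m → ℕ} (ε : Finset (Blocks a)) J,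
      pdMulti (ε.val.map J) (∑ k, V k * algebraMap ℝ _ (ξ l k)) =
        ∑ k, pdMulti (ε.val.map J) (V k) * algebraMap ℝ _ (ξ l k) := fun l a ε J => by
    rw [map_sum]
    refine sum_congr rfl fun k _ => ?_
    rw [mul_comm, pdMulti_algebraMap_mul, mul_comm]
  rw [dop_exponential A C ξ hE, Derivation.leibniz, hP, smul_eq_mul, smul_eq_mul] at h
  have h1 : ∑ l, dop A C (Function.update E l (D (E l))) = (∑ a ∈ A, ∑ J, C a J * ∑ l,
      ∑ ε ∈ (blockSlots a l).powerset,
        (∑ k, pdMulti (ε.val.map J) (V k) * algebraMap ℝ _ (ξ l k)) * symMon ξ εᶜ J) *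
      ∏ l, E l := by
    simp only [dop_apply, hD, prod_pdList_exponential ξ hE, hlin]
    rw [sum_comm, sum_mul]
    refine sum_congr rfl fun a _ => ?_
    rw [sum_comm, sum_mul]
    refine sum_congr rfl fun J _ => ?_
    rw [mul_assoc, sum_mul, mul_sum]
  have h2 : ∀ a (J : Blocks a → Fin d), C a J * ∑ l, ∑ ε ∈ (blockSlots a l).powerset,
      (∑ k, pdMulti (ε.val.map J) (V k) * algebraMap ℝ _ (ξ l k)) * symMon ξ εᶜ J =
      C a J * symMon ξ univ J * (∑ l, ∑ k, V k * algebraMap ℝ _ (ξ l k)) +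
        C a J * ∑ l, ∑ ε ∈ (blockSlots a l).powerset.erase ∅,
          (∑ k, pdMulti (ε.val.map J) (V k) * algebraMap ℝ _ (ξ l k)) * symMon ξ εᶜ J :=
    fun a J => by
      rw [mul_assoc, ← mul_add, mul_sum univ _ (symMon ξ univ J), ← sum_add_distrib]
      refine congrArg _ (sum_congr rfl fun l _ => ?_)
      rw [← Finset.add_sum_erase _ _ (Finset.empty_mem_powerset _)]
      simp only [Finset.empty_val, Multiset.map_zero, pdMulti_zero, Finset.compl_empty]
      rw [mul_comm (symMon _ _ _)]
  have h3 : D (∑ a ∈ A, ∑ J, C a J * symMon ξ univ J) =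
      ∑ a ∈ A, ∑ J, D (C a J) * symMon ξ univ J := by
    simp only [map_sum, Derivation.leibniz, hx, mul_zero, zero_add, smul_eq_mul, mul_comm]
  simp only [h2, sum_add_distrib, ← sum_mul] at h1
  rw [h1, h3] at h
  refine hun.mul_right_cancel ?_
  linear_combination h

end SymbolIdentity

section ContractedSymbol

variable {d m : ℕ} {R : Type*} [CommRing R] [Algebra ℝ R] (Q : ConnRing d R)

lemma pdMulti_eq_zero {n : ℕ} {s : Series d R} (h : hom n s = s)
    {u : Multiset (Fin d)} (hu : n < u.card) : pdMulti u s = 0 := by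
  refine ext_hom fun k => ?_
  rw [hom_pdMulti, ← h, hom_hom, if_neg (by omega), map_zero, map_zero]

lemma hom_one_conn (i k : Fin d) : hom 1 (Q.conn i k) = Q.conn i k := by
  rw [Q.conn_eq, map_sum]
  exact sum_congr rfl fun j _ => by rw [hom_succ_X_mul, hom_C, if_pos rfl]

lemma pdMulti_flatField {β : Type*} [DecidableEq β] {B : Finset β} (J : β → Fin d) (i k : Fin d)
    (F : Finset β → Series d R) :
    ∑ ε ∈ B.powerset.erase ∅, pdMulti (ε.val.map J) (Q.flatField i k) * F ε =
      - ∑ b ∈ B, MvPowerSeries.C (Q.Gam i (J b) k) * F {b}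
        + ∑ ε ∈ B.powerset.erase ∅, pdMulti (ε.val.map J) (Q.fedForm i k) * F ε := by
  have h1 : ∀ ε ∈ B.powerset.erase ∅, pdMulti (ε.val.map J) (Q.flatField i k) * F ε =
      pdMulti (ε.val.map J) (Q.conn i k) * F ε +
        pdMulti (ε.val.map J) (Q.fedForm i k) * F ε := fun ε hε => by
    have h0 : pdMulti (ε.val.map J) (Pi.single (M := fun _ => Series d R) i 1 k) = 0 := by
      refine pdMulti_eq_zero (n := 0) ?_ ?_
      · rcases eq_or_ne k i with rfl | h
        · rw [Pi.single_eq_same]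
          exact (hom_C 0 1).trans (if_pos rfl)
        · rw [Pi.single_eq_of_ne h, map_zero]
      · rw [Multiset.card_map]
        exact card_pos.2 (Finset.nonempty_iff_ne_empty.2 (ne_of_mem_erase hε))
    have h2 : Q.flatField i k = Q.fedForm i k -
        Pi.single (M := fun _ => Series d R) i 1 k + Q.conn i k := by
      rw [ConnRing.fedForm]
      ring
    rw [h2, map_add, map_sub, h0]
    ring
  rw [sum_congr rfl h1, sum_add_distrib]
  congr 1
  rw [← sum_neg_distrib]
  refine (sum_subset (s₁ := B.map ⟨fun b => {b}, Finset.singleton_injective⟩) ?_ ?_).symm.trans ?_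
  · intro ε hε
    obtain ⟨b, hb, rfl⟩ := mem_map.1 hε
    exact Finset.mem_erase.2 ⟨Finset.singleton_ne_empty b,
      mem_powerset.2 (Finset.singleton_subset_iff.2 hb)⟩
  · intro ε hε hn
    rw [pdMulti_eq_zero (hom_one_conn Q i k), zero_mul]
    rw [Multiset.card_map]
    refine lt_of_le_of_ne (card_pos.2 (Finset.nonempty_iff_ne_empty.2
      (ne_of_mem_erase hε))) fun h => hn ?_
    obtain ⟨b, rfl⟩ := Finset.card_eq_one.1 h.symm
    exact mem_map.2 ⟨b, Finset.singleton_subset_iff.1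
      (mem_powerset.1 (Finset.mem_of_mem_erase hε)), rfl⟩
  · rw [Finset.sum_map]
    refine sum_congr rfl fun b _ => ?_
    rw [← neg_mul, ← Q.pderiv_conn]
    rfl

variable {A : Finset (Fin m → ℕ)}
  {C : Coeffs m d (Series d R)} (ξ : Fin m → Fin d → ℝ)

lemma symMon_compl_singleton {a : Fin m → ℕ} (b : Blocks a) (J : Blocks a → Fin d) (k : Fin d) :
    algebraMap ℝ (Series d R) (ξ b.1 k) * symMon ξ {b}ᶜ J =
      symMon ξ univ (Function.update J b k) := by
  rw [symMon, symMon, ← mul_prod_erase univ _ (mem_univ b), Function.update_self]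
  refine congrArg _ (prod_congr ?_ fun b' hb' => ?_)
  · ext x
    simp
  · rw [Function.update_of_ne (by simpa using hb')]

variable (h : ∀ i s, Q.flatDer i (dop A C s) =
  ∑ l, dop A C (Function.update s l (Q.flatDer i (s l))))

include h

lemma symbol_flatDer (i : Fin d) :
    ∑ a ∈ A, ∑ J, (Q.scov i (fun (_ : Empty → Fin d) J => C a J) Empty.elim J
        - pderiv R i (C a J) + vert (Q.fedForm i) (C a J)) *
        symMon ξ univ J =
      ∑ a ∈ A, ∑ J, C a J * ∑ l, ∑ ε ∈ (blockSlots a l).powerset.erase ∅,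
        (∑ k, pdMulti (ε.val.map J) (Q.fedForm i k) * algebraMap ℝ _ (ξ l k)) * symMon ξ εᶜ J := by
  choose E hu hE hm using fun l => exists_exponential (R := R) (ξ l)
  have h1 := symbol_identity A C ξ hE (Q.flatField i) (Q.flatDer i) (fun l => by
    rw [Q.flatDer_apply, vert_apply, sum_mul]
    simp only [hE, mul_assoc]
    rw [ConnRing.dx, hm, zero_add]) hu (h i E)
  have h2 : ∀ a (J : Blocks a → Fin d), ∑ l, ∑ ε ∈ (blockSlots a l).powerset.erase ∅,
      (∑ k, pdMulti (ε.val.map J) (Q.flatField i k) * algebraMap ℝ _ (ξ l k)) * symMon ξ εᶜ J =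
      - ∑ b : Blocks a, ∑ k, MvPowerSeries.C (Q.Gam i (J b) k) *
          symMon ξ univ (Function.update J b k) +
        ∑ l, ∑ ε ∈ (blockSlots a l).powerset.erase ∅,
          (∑ k, pdMulti (ε.val.map J) (Q.fedForm i k) * algebraMap ℝ _ (ξ l k)) *
            symMon ξ εᶜ J := fun a J => by
    have h3 : ∑ b : Blocks a, ∑ k, MvPowerSeries.C (Q.Gam i (J b) k) *
          symMon ξ univ (Function.update J b k) =
        ∑ l, ∑ k, ∑ b ∈ blockSlots a l, MvPowerSeries.C (Q.Gam i (J b) k) *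
          (algebraMap ℝ _ (ξ l k) * symMon ξ {b}ᶜ J) := by
      rw [← Finset.sum_fiberwise univ (fun b : Blocks a => b.1)]
      refine sum_congr rfl fun l _ => ?_
      rw [sum_comm]
      refine sum_congr rfl fun k _ => sum_congr rfl fun b hb => ?_
      rw [← symMon_compl_singleton, mem_blockSlots.1 hb]
    rw [h3, ← sum_neg_distrib, ← sum_add_distrib]
    refine sum_congr rfl fun l _ => ?_
    simp only [sum_mul, mul_assoc]
    rw [sum_comm, sum_comm (s := (blockSlots a l).powerset.erase ∅),
      ← sum_neg_distrib, ← sum_add_distrib]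
    refine sum_congr rfl fun k _ => ?_
    rw [pdMulti_flatField]
  have h4 : ∀ a, ∑ J : Blocks a → Fin d, C a J * ∑ b : Blocks a, ∑ k,
      MvPowerSeries.C (Q.Gam i (J b) k) * symMon ξ univ (Function.update J b k) =
      ∑ J : Blocks a → Fin d, (∑ b, ∑ k, MvPowerSeries.C (Q.Gam i k (J b)) *
        C a (Function.update J b k)) * symMon ξ univ J := fun a => by
    simp only [mul_sum, sum_mul]
    rw [sum_comm, sum_comm (s := (univ : Finset (Blocks a → Fin d)))]
    refine sum_congr rfl fun b _ => ?_
    rw [sum_update_swap b]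
    refine sum_congr rfl fun J _ => sum_congr rfl fun k _ => ?_
    simp only [Function.update_self, Function.update_idem, Function.update_eq_self]
    ring
  simp only [h2, mul_add, mul_neg, sum_add_distrib, sum_neg_distrib, h4] at h1
  rw [← sub_eq_iff_eq_add', sub_neg_eq_add, ← sum_add_distrib] at h1
  refine Eq.trans (sum_congr rfl fun a _ => ?_) h1
  rw [← sum_add_distrib]
  refine sum_congr rfl fun J _ => ?_
  rw [Q.flatDer_eq, ConnRing.scov]
  simp only [Finset.univ_eq_empty, sum_empty, sub_zero]
  ring

/-- The Euler derivative of the coefficients of a flat fiberwise operator. -/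
theorem symbol_eul : ∑ a ∈ A, ∑ J, (∑ i, X i *
        Q.scov i (fun (_ : Empty → Fin d) J => C a J) Empty.elim J - ConnRing.eul (C a J)) *
        symMon ξ univ J =
      ∑ a ∈ A, ∑ J, C a J * ∑ l, ∑ ε ∈ (blockSlots a l).powerset.erase ∅,
        (∑ k, (∑ i, X i * pdMulti (ε.val.map J) (Q.fedForm i k)) *
          algebraMap ℝ _ (ξ l k)) * symMon ξ εᶜ J := by
  have h1 : ∑ i, X i * _ = ∑ i, X i * _ :=
    sum_congr rfl fun i _ => congrArg (X i * ·) (symbol_flatDer Q ξ h i)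
  refine Eq.trans ?_ (h1.trans ?_)
  · simp only [mul_sum]
    rw [sum_comm]
    refine sum_congr rfl fun a _ => ?_
    rw [sum_comm]
    refine sum_congr rfl fun J _ => ?_
    simp only [← mul_assoc, ← sum_mul]
    congr 1
    simp only [mul_add, mul_sub, sum_add_distrib, sum_sub_distrib,
      sum_X_mul_vert_fedForm, ConnRing.sum_X_mul_pderiv, add_zero]
  · simp only [mul_sum, sum_mul]
    rw [sum_comm]
    refine sum_congr rfl fun a _ => ?_
    rw [sum_comm]
    refine sum_congr rfl fun J _ => ?_
    rw [sum_comm]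
    refine sum_congr rfl fun l _ => ?_
    rw [sum_comm]
    refine sum_congr rfl fun ε _ => ?_
    rw [sum_comm]
    refine sum_congr rfl fun k _ => sum_congr rfl fun i _ => ?_
    ring

end ContractedSymbol

section SeriesPolarization

variable {d : ℕ} {U : TopologicalSpace.Opens (Vec d)}

lemma coeff_mul_algebraMap {R : Type*} [CommRing R] [Algebra ℝ R] (s : Series d R)
    (r : ℝ) (α : Fin d →₀ ℕ) :
    coeff α (s * algebraMap ℝ _ r) = r • coeff α s := by
  rw [mul_comm, ← Algebra.smul_def, ConnRing.coeff_real_smul]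

/-- Polarization of an identity between two families of polynomials with values in series. -/
theorem polarize_series {τ₁ τ₂ T : Type} [Fintype τ₁] [Fintype τ₂] {κ₁ : τ₁ → Type}
    {κ₂ : τ₂ → Type} [i₁ : ∀ t, Fintype (κ₁ t)] [j₁ : ∀ t, DecidableEq (κ₁ t)]
    [i₂ : ∀ t, Fintype (κ₂ t)] [j₂ : ∀ t, DecidableEq (κ₂ t)] [DecidableEq T] (col₁ : (t : τ₁) → κ₁ t → T)
    (col₂ : (t : τ₂) → κ₂ t → T)
    (Z₁ : (t : τ₁) → (κ₁ t → Fin d) → Series d (smoothRing U))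
    (Z₂ : (t : τ₂) → (κ₂ t → Fin d) → Series d (smoothRing U))
    (hZ : ∀ ξ : T → Fin d → ℝ, ∑ t, ∑ g, Z₁ t g * ∏ k, algebraMap ℝ _ (ξ (col₁ t k) (g k)) +
      ∑ t, ∑ g, Z₂ t g * ∏ k, algebraMap ℝ _ (ξ (col₂ t k) (g k)) = 0)
    {μ : Type} [Fintype μ] [DecidableEq μ] (colμ : μ → T) (f : μ → Fin d) :
    ∑ t, ∑ h : κ₁ t ≃ μ, (if ∀ k, colμ (h k) = col₁ t k then Z₁ t (f ∘ h) else 0) +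
      ∑ t, ∑ h : κ₂ t ≃ μ, (if ∀ k, colμ (h k) = col₂ t k then Z₂ t (f ∘ h) else 0) = 0 := by
  refine ext_evalSeries fun q => ?_
  ext α
  let κ : τ₁ ⊕ τ₂ → Type := Sum.elim κ₁ κ₂
  let _ : ∀ t, Fintype (κ t) := fun t => Sum.rec (motive := fun t => Fintype (κ t)) i₁ i₂ t
  let _ : ∀ t, DecidableEq (κ t) := fun t => Sum.rec (motive := fun t => DecidableEq (κ t)) j₁ j₂ t
  let col : (t : τ₁ ⊕ τ₂) → κ t → T := fun t => match t with
    | Sum.inl t => col₁ t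
    | Sum.inr t => col₂ t
  let Z : (t : τ₁ ⊕ τ₂) → (κ t → Fin d) → ℝ := fun t => match t with
    | Sum.inl t => fun g => evalAt q (coeff α (Z₁ t g))
    | Sum.inr t => fun g => evalAt q (coeff α (Z₂ t g))
  have h := polarize col Z (fun ξ => by
    have h := congrArg (fun s => evalAt q (coeff α s)) (hZ ξ)
    rw [Fintype.sum_sum_type]
    simp only [map_add, map_sum, ← map_prod, coeff_mul_algebraMap, map_smul, map_zero,
      smul_eq_mul] at h
    refine Eq.trans (congrArg₂ (· + ·) ?_ ?_) h
    · exact sum_congr rfl fun t _ => sum_congr rfl fun g _ => mul_comm _ _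
    · exact sum_congr rfl fun t _ => sum_congr rfl fun g _ => mul_comm _ _) colμ f
  rw [Fintype.sum_sum_type] at h
  rw [coeff_evalSeries, map_zero, MvPowerSeries.coeff_zero]
  simp only [map_add, map_sum]
  refine Eq.trans (congrArg₂ (· + ·) ?_ ?_) h
  · refine sum_congr rfl fun t _ => sum_congr rfl fun g _ => ?_
    rw [apply_ite (coeff α), apply_ite (evalAt q), map_zero, map_zero]
    rfl
  · refine sum_congr rfl fun t _ => sum_congr rfl fun g _ => ?_
    rw [apply_ite (coeff α), apply_ite (evalAt q), map_zero, map_zero]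
    rfl

end SeriesPolarization

section SymbolRecursion

variable {d m : ℕ}

/-- A nonempty set of slots in one block. -/
abbrev SlotSet (a : Fin m → ℕ) (l : Fin m) : Type :=
  {ε : Finset (Blocks a) // ε ∈ (blockSlots a l).powerset.erase ∅}

/-- The contraction of the coefficients of an operator with the derivatives of the Fedosov form
along a set of slots. -/
def symbolTerm {R : Type*} [CommRing R] [Algebra ℝ R] (Q : ConnRing d R) {a : Fin m → ℕ}
    (C : (Blocks a → Fin d) → Series d R) (ε : Finset (Blocks a))
    (g : Option {b // b ∉ ε} → Fin d) : Series d R :=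
  ∑ K : {b // b ∈ ε} → Fin d, (∑ i, X i * pdMulti (univ.val.map K) (Q.fedForm i (g none))) *
      C (Sum.elim K (fun b => g (some b)) ∘ (Equiv.sumCompl (· ∈ ε)).symm)

lemma sum_symbolTerm {R : Type*} [CommRing R] [Algebra ℝ R] (Q : ConnRing d R) {a : Fin m → ℕ}
    (C : (Blocks a → Fin d) → Series d R) (l : Fin m) (ε : Finset (Blocks a))
    (ξ : Fin m → Fin d → ℝ) :
    ∑ g : Option {b // b ∉ ε} → Fin d, symbolTerm Q C ε g *
      ∏ k, algebraMap ℝ _ (ξ (k.elim l fun b => b.1.1) (g k)) =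
    ∑ J, C J * ((∑ k, (∑ i, X i * pdMulti (ε.val.map J) (Q.fedForm i k)) *
          algebraMap ℝ _ (ξ l k)) * symMon ξ εᶜ J) := by
  let e : ({b // b ∈ ε} → Fin d) × ({b // b ∉ ε} → Fin d) ≃ (Blocks a → Fin d) :=
    (Equiv.sumArrowEquivProdArrow _ _ _).symm.trans
      ((Equiv.sumCompl (· ∈ ε)).arrowCongr (Equiv.refl _))
  have he : ∀ p, e p = Sum.elim p.1 p.2 ∘ (Equiv.sumCompl (· ∈ ε)).symm := fun p => rfl
  have hin : ∀ p (b : {b // b ∈ ε}), e p b.1 = p.1 b := fun p b => by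
    rw [he, Function.comp_apply, Equiv.sumCompl_symm_apply_of_pos b.2]
    rfl
  have hout : ∀ p (b : {b // b ∉ ε}), e p b.1 = p.2 b := fun p b => by
    rw [he, Function.comp_apply, Equiv.sumCompl_symm_apply_of_neg b.2]
    rfl
  have hmap : ∀ p, ε.val.map (e p) = univ.val.map p.1 := fun p => by
    rw [← Multiset.attach_map_val ε.val, Multiset.map_map]
    exact Multiset.map_congr rfl fun b _ => hin p b
  have hmon : ∀ p, symMon (R := R) ξ εᶜ (e p) =
      ∏ b : {b // b ∉ ε}, algebraMap ℝ _ (ξ b.1.1 (p.2 b)) := fun p => by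
    have h := Finset.prod_subtype (p := fun b : Blocks a => b ∉ ε) (F := inferInstance) εᶜ (by simp) fun b =>
      algebraMap ℝ (Series d R) (ξ b.1 (e p b))
    rw [symMon, h]
    simp only [hout]
  rw [← e.sum_comp, Fintype.sum_prod_type_right,
    ← (Equiv.piOptionEquivProd (β := fun _ => Fin d)).symm.sum_comp, Fintype.sum_prod_type_right]
  refine sum_congr rfl fun g _ => ?_
  simp only [hmap, hmon, Fintype.prod_option, symbolTerm]
  simp only [sum_mul, mul_sum]
  rw [sum_comm]
  refine sum_congr rfl fun K _ => sum_congr rfl fun k _ => sum_congr rfl fun i _ => ?_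
  rw [he]
  simp only [Equiv.piOptionEquivProd, Equiv.coe_fn_symm_mk, Option.elim]
  ring

variable (c : LocalConn d) {A : Finset (Fin m → ℕ)}
  {C : Coeffs m d (Series d (smoothRing c.dom))}
  (hz : ∀ q i, fedosovAt c A C q i = 0)

include hz in
lemma flatDer_dop_of_fedosovAt (i : Fin d) (s : Fin m → Series d (smoothRing c.dom)) :
    c.ring.flatDer i (dop A C s) = ∑ l, dop A C (Function.update s l (c.ring.flatDer i (s l))) := by
  refine ext_evalSeries fun q => ?_
  rw [evalSeries_flatDer_dop, hz q i, map_sum]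
  simp only [Pi.zero_apply, zero_add, evalSeries_dop]
  refine sum_congr rfl fun l _ => congrArg _ (funext fun l' => ?_)
  rcases eq_or_ne l' l with rfl | hne
  · simp
  · simp [hne]

/-- The permutations of the slots which preserve the blocks. -/
def blockPerms (a : Fin m → ℕ) : Finset (Blocks a ≃ Blocks a) :=
  univ.filter fun h => ∀ k, (h k).1 = k.1

lemma blockPerms_card_pos (a : Fin m → ℕ) : 0 < (blockPerms a).card :=
  card_pos.2 ⟨Equiv.refl _, by simp [blockPerms]⟩

/-- The bijections between slots which preserve the blocks. -/
def slotEquivs {a a₀ : Fin m → ℕ} (l : Fin m) (ε : Finset (Blocks a)) :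
    Finset (Option {b // b ∉ ε} ≃ Blocks a₀) :=
  univ.filter fun h => ∀ k, (h k).1 = k.elim l fun b => b.1.1

include hz in
/-- The recursion for the coefficients of a flat fiberwise operator. -/
theorem symbol_recursion {a₀ : Fin m → ℕ} (ha₀ : a₀ ∈ A) (hs : BlockSymm (C a₀))
    (f : Blocks a₀ → Fin d) :
    (blockPerms a₀).card • ConnRing.eul (C a₀ f) = ∑ h ∈ blockPerms a₀, ∑ i, X i *
        c.ring.scov i (fun (_ : Empty → Fin d) J => C a₀ J) Empty.elim (f ∘ h) -
      ∑ a ∈ A, ∑ l, ∑ ε ∈ (blockSlots a l).powerset.erase ∅, ∑ h ∈ slotEquivs (a₀ := a₀) l ε,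
        symbolTerm c.ring (C a) ε (f ∘ h) := by
  have h1 := polarize_series (T := Fin m) (τ₁ := A) (τ₂ := Σ a : A, Σ l, SlotSet a.1 l)
    (κ₁ := fun a => Blocks a.1) (κ₂ := fun t => Option {b // b ∉ t.2.2.1}) (fun _ b => b.1)
    (fun t k => k.elim t.2.1 fun b => b.1.1)
    (fun a J => ConnRing.eul (C a.1 J) - ∑ i, X i *
      c.ring.scov i (fun (_ : Empty → Fin d) J => C a.1 J) Empty.elim J)
    (fun t g => symbolTerm c.ring (C t.1.1) t.2.2.1 g)
    (fun ξ => by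
      have h2 := symbol_eul c.ring ξ (flatDer_dop_of_fedosovAt c hz)
      simp only [sum_symbolTerm, Fintype.sum_sigma]
      rw [← sub_eq_zero, ← neg_eq_zero] at h2
      refine Eq.trans ?_ h2
      rw [neg_sub, sub_eq_add_neg, add_comm]
      refine congrArg₂ (· + ·) ?_ ?_
      · rw [← sum_coe_sort A]
        refine sum_congr rfl fun a _ => ?_
        simp only [mul_sum (univ : Finset (Fin m)), mul_sum (Finset.erase _ _)]
        rw [sum_comm]
        refine sum_congr rfl fun l _ => ?_
        rw [sum_comm, ← sum_coe_sort ((blockSlots a.1 l).powerset.erase ∅)]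
      · rw [← sum_neg_distrib, ← sum_coe_sort A]
        refine sum_congr rfl fun a _ => ?_
        rw [← sum_neg_distrib]
        refine sum_congr rfl fun J _ => ?_
        rw [symMon]
        ring)
    (fun b : Blocks a₀ => b.1) f
  rw [sum_eq_single ⟨a₀, ha₀⟩, ← sum_filter] at h1
  · have h2 : ∀ h ∈ blockPerms a₀, C a₀ (f ∘ h) = C a₀ f := fun h hh => by
      obtain ⟨σ, rfl⟩ := exists_sigmaCongrRight h (mem_filter.1 hh).2
      exact hs σ f
    have h3 : ∑ h ∈ blockPerms a₀, ConnRing.eul (C a₀ (f ∘ h)) =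
        (blockPerms a₀).card • ConnRing.eul (C a₀ f) := by
      rw [sum_congr rfl fun h hh => congrArg ConnRing.eul (h2 h hh), sum_const]
    have h4 : ∑ a ∈ A, ∑ l, ∑ ε ∈ (blockSlots a l).powerset.erase ∅,
        ∑ h ∈ slotEquivs (a₀ := a₀) l ε, symbolTerm c.ring (C a) ε (f ∘ h) =
        ∑ t : Σ a : A, Σ l, SlotSet a.1 l, ∑ h ∈ slotEquivs (a₀ := a₀) t.2.1 t.2.2.1,
          symbolTerm c.ring (C t.1.1) t.2.2.1 (f ∘ h) := by
      simp only [Fintype.sum_sigma]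
      rw [← sum_coe_sort A]
      refine sum_congr rfl fun a _ => sum_congr rfl fun l _ => ?_
      rw [← sum_coe_sort ((blockSlots a.1 l).powerset.erase ∅)]
    rw [h4, ← h3]
    simp only [← sum_filter] at h1
    rw [sum_sub_distrib] at h1
    refine eq_sub_of_add_eq ?_
    rw [← sub_eq_zero]
    refine Eq.trans ?_ h1
    unfold blockPerms slotEquivs
    ring
  · rintro ⟨b, hb⟩ _ hne
    refine sum_eq_zero fun g _ => if_neg fun hg => hne ?_
    exact Subtype.ext (orders_eq_of_equiv g hg)
  · intro h
    exact absurd (mem_univ _) h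

end SymbolRecursion

section Orders

variable {d m : ℕ}

lemma le_of_mem_slotEquivs {a a₀ : Fin m → ℕ} {l : Fin m} {ε : Finset (Blocks a)}
    (hε : ε ∈ (blockSlots a l).powerset.erase ∅) {h : Option {b // b ∉ ε} ≃ Blocks a₀}
    (hh : h ∈ slotEquivs l ε) (l' : Fin m) : a₀ l' ≤ a l' := by
  obtain ⟨b₀, hb₀⟩ := Finset.nonempty_iff_ne_empty.2 (ne_of_mem_erase hε)
  have hl := mem_blockSlots.1 (mem_powerset.1 (Finset.mem_of_mem_erase hε) hb₀)
  have hc : ∀ k, (h k).1 = k.elim l fun b => b.1.1 := (mem_filter.1 hh).2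
  let g : Option {b // b ∉ ε} → Blocks a := fun k => k.elim b₀ Subtype.val
  have hg : Function.Injective g := by
    rintro (_ | x) (_ | y) hxy
    · rfl
    · exact absurd (show b₀ = y.1 from hxy) fun h => y.2 (h ▸ hb₀)
    · exact absurd (show x.1 = b₀ from hxy) fun h => x.2 (h ▸ hb₀)
    · exact congrArg some (Subtype.ext hxy)
  have hg1 : ∀ k, (g k).1 = (h k).1 := by
    rintro (_ | x)
    · exact hl.trans (hc none).symm
    · exact (hc (some x)).symm
  rw [← card_blockSlots a₀ l', ← card_blockSlots a l']
  refine Finset.card_le_card_of_injOn (fun x => g (h.symm x)) (fun x hx => ?_)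
    fun x _ y _ hxy => h.symm.injective (hg hxy)
  refine mem_blockSlots.2 ?_
  rw [hg1, Equiv.apply_symm_apply]
  exact mem_blockSlots.1 hx

lemma hom_symbolTerm_eq_zero {R : Type*} [CommRing R] [Algebra ℝ R] (Q : ConnRing d R)
    {a : Fin m → ℕ} {C : (Blocks a → Fin d) → Series d R} {n : ℕ}
    (h : ∀ p < n, ∀ J, hom p (C J) = 0) (ε : Finset (Blocks a))
    (g : Option {b // b ∉ ε} → Fin d) : hom n (symbolTerm Q C ε g) = 0 := by
  rw [symbolTerm, map_sum]
  exact sum_eq_zero fun K _ => hom_mul_eq_zero_of_lt n (by simp) fun p hp => h p hp _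

variable (c : LocalConn d) {A : Finset (Fin m → ℕ)}
  {C : Coeffs m d (Series d (smoothRing c.dom))}
  (hz : ∀ q i, fedosovAt c A C q i = 0)

include hz

lemma hom_symbol_recursion {a₀ : Fin m → ℕ} (ha₀ : a₀ ∈ A) (hs : BlockSymm (C a₀)) (n : ℕ)
    (f : Blocks a₀ → Fin d) :
    ((blockPerms a₀).card * n : ℝ) • hom n (C a₀ f) = hom n (∑ h ∈ blockPerms a₀, ∑ i, X i *
        c.ring.scov i (fun (_ : Empty → Fin d) J => C a₀ J) Empty.elim (f ∘ h) -
      ∑ a ∈ A, ∑ l, ∑ ε ∈ (blockSlots a l).powerset.erase ∅, ∑ h ∈ slotEquivs (a₀ := a₀) l ε,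
        symbolTerm c.ring (C a) ε (f ∘ h)) := by
  rw [← symbol_recursion c hz ha₀ hs f, map_nsmul, ConnRing.hom_eul, mul_smul,
    Nat.cast_smul_eq_nsmul, Nat.cast_smul_eq_nsmul]

/-- A flat fiberwise operator has the order of its lowest part. -/
theorem eq_zero_of_hom_zero {N : ℕ} (hs : ∀ a ∈ A, BlockSymm (C a))
    (h0 : ∀ a ∈ A, a ∉ arityBox m N → ∀ J, hom 0 (C a J) = 0) :
    ∀ a ∈ A, a ∉ arityBox m N → ∀ J, C a J = 0 := by
  suffices h : ∀ n, ∀ a ∈ A, a ∉ arityBox m N → ∀ J, hom n (C a J) = 0 from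
    fun a ha hN J => ext_hom fun n => by rw [h n a ha hN J, map_zero]
  intro n
  induction n using Nat.strong_induction_on with
  | _ n ih =>
  intro a₀ ha₀ hN f
  cases n with
  | zero => exact h0 a₀ ha₀ hN f
  | succ n =>
    have h1 := hom_symbol_recursion c hz ha₀ (hs a₀ ha₀) (n + 1) f
    have h2 : ∀ J, hom n (C a₀ J) = 0 := ih n (Nat.lt_succ_self n) a₀ ha₀ hN
    simp only [map_sub, map_sum, hom_succ_X_mul, ConnRing.hom_scov, h2] at h1
    rw [sum_eq_zero, sum_eq_zero, sub_zero] at h1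
    · have h3 : ((blockPerms a₀).card * (n + 1 : ℕ) : ℝ) ≠ 0 :=
        mul_ne_zero (Nat.cast_ne_zero.2 (blockPerms_card_pos a₀).ne')
          (Nat.cast_ne_zero.2 (Nat.succ_ne_zero n))
      rw [← inv_smul_smul₀ h3 (hom (n + 1) (C a₀ f)), h1, smul_zero]
    · intro a ha
      refine sum_eq_zero fun l _ => sum_eq_zero fun ε hε =>
        sum_eq_zero fun h hh => hom_symbolTerm_eq_zero _ (fun p hp J => ?_) _ _
      refine ih p hp a ha (fun hb => hN ?_) J
      exact mem_arityBox.2 fun l' => (le_of_mem_slotEquivs hε hh l').trans (mem_arityBox.1 hb l')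
    · intro h _
      simp [ConnRing.scov]

end Orders

section SymbolUniversal

variable {L : Type} {up : L → Type} [∀ l, Fintype (up l)] [∀ l, DecidableEq (up l)] {ι : Type}
  {sit : ι → Situation L up} {m n : ℕ}

lemma HomUniv.symbolTerm {a : Fin m → ℕ} {Φ : SFamily sit Empty (Blocks a)}
    (h : ∀ p < n, HomUniv p Φ) (ε : Finset (Blocks a)) :
    HomUniv n (sit := sit) fun s (I : Empty → Fin (sit s).d) g =>
      symbolTerm (sit s).conn.ring (Φ s I) ε g := by
  let φ : {b // b ∈ ε} ⊕ Unit ≃ Unit ⊕ (Empty ⊕ {b // b ∈ ε}) :=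
    (Equiv.sumComm _ _).trans (Equiv.sumCongr (Equiv.refl _) (Equiv.emptySum Empty _).symm)
  let ψ : Blocks a ≃ {b // b ∉ ε} ⊕ {b // b ∈ ε} :=
    (Equiv.sumCompl (· ∈ ε)).symm.trans (Equiv.sumComm _ _)
  let X : SFamily sit (Empty ⊕ {b // b ∈ ε}) Unit := fun s I J => ∑ i, X i *
    FormalGeometry.pdMulti (univ.val.map (I ∘ Sum.inr)) ((sit s).conn.ring.fedForm i (J ()))
  let Y : SFamily sit Empty ({b // b ∉ ε} ⊕ {b // b ∈ ε}) := fun s I J => Φ s I (J ∘ ψ)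
  have hX : ∀ p, HomUniv p X := fun p =>
    HomUniv.sum_X_mul (Φ := fun s (I : Unit ⊕ (Empty ⊕ {b // b ∈ ε}) → Fin (sit s).d)
      (J : Unit → Fin (sit s).d) => FormalGeometry.pdMulti (univ.val.map (I ∘ Sum.inr ∘ Sum.inr))
        ((sit s).conn.ring.fedForm (I (Sum.inl ())) (J ()))) fun k _ =>
      (HomUniv.pdMulti (τ := {b // b ∈ ε}) (homUniv_fedTensor (sit := sit)) k).reindex φ
        (Equiv.refl _)
  have hXY : HomUniv n (sit := sit) fun s => FormalGeometry.contract (X s) (Y s) := by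
    refine HomUniv.contract fun p p' hp => ?_
    rcases Nat.eq_zero_or_pos p with rfl | h0
    · exact Or.inr (Or.inl fun s I J => by simp [X, map_sum, hom_zero_X_mul])
    · exact Or.inl ⟨hX p, (h p' (by omega)).reindex (Equiv.refl _) ψ⟩
  refine (hXY.reindex (Equiv.emptySum Empty Empty)
    ((Equiv.sumComm _ _).trans (Equiv.optionEquivSumPUnit.{0} _).symm)).congr fun s I g => ?_
  refine congrArg _ (sum_congr rfl fun K _ => congrArg₂ (· * ·) rfl ?_)
  have h1 : ∀ J, Y s ((I ∘ Equiv.emptySum Empty Empty) ∘ Sum.inr) J = Φ s I (J ∘ ψ) := fun J =>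
    congrArg (fun I => Φ s I (J ∘ ψ)) (Subsingleton.elim _ _)
  rw [h1]
  refine congrArg (Φ s I) (funext fun b => ?_)
  simp only [Function.comp_apply, ψ, Equiv.trans_apply, Equiv.sumComm_apply]
  generalize (Equiv.sumCompl (· ∈ ε)).symm b = z
  rcases z with z | z <;> rfl

/-- The coefficients of flat fiberwise operators are universal if their lowest parts are. -/
theorem homUniv_of_flat {A : Finset (Fin m → ℕ)}
    {C : (s : ι) → (a : Fin m → ℕ) → (Blocks a → Fin (sit s).d) →
      MvPowerSeries (Fin (sit s).d) (smoothRing (sit s).conn.dom)}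
    (hz : ∀ s q i, fedosovAt (sit s).conn A (C s) q i = 0)
    (hs : ∀ s, ∀ a ∈ A, BlockSymm (C s a)) (hA : ∀ s, ∀ a ∉ A, ∀ J, C s a J = 0)
    (h0 : ∀ a, HomUniv 0 (sit := sit) fun s (_ : Empty → Fin (sit s).d) J => C s a J) (n : ℕ) :
    ∀ a, HomUniv n (sit := sit) fun s (_ : Empty → Fin (sit s).d) J => C s a J := by
  induction n using Nat.strong_induction_on with
  | _ n ih =>
  intro a₀
  rcases Nat.eq_zero_or_pos n with rfl | hn
  · exact h0 a₀
  by_cases ha₀ : a₀ ∈ A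
  swap
  · exact HomUniv.of_eq_zero fun s I J => by rw [hA s a₀ ha₀, map_zero]
  have h1 : ∀ h : Blocks a₀ ≃ Blocks a₀, HomUniv n (sit := sit) (ν := Empty) (κ := Blocks a₀)
      fun s _ f => ∑ i, X i * (sit s).conn.ring.scov i
        (fun (_ : Empty → Fin (sit s).d) J => C s a₀ J) Empty.elim (f ∘ h) := fun h => by
    refine ((HomUniv.sum_X_mul (Φ := fun s (I : Unit ⊕ Empty → Fin (sit s).d) J =>
      (sit s).conn.ring.scov (I (Sum.inl ())) (fun (_ : Empty → Fin (sit s).d) J => C s a₀ J)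
        (I ∘ Sum.inr) J) fun k hk => (ih k (by omega) a₀).scov).reindex (Equiv.refl _) h).congr
      fun s I J => ?_
    refine congrArg _ (sum_congr rfl fun i _ => congrArg _ ?_)
    exact congrArg (fun K => (sit s).conn.ring.scov i (fun (_ : Empty → Fin (sit s).d) J => C s a₀ J)
      K (J ∘ h)) (Subsingleton.elim _ _)
  have h2 : ∀ (a : Fin m → ℕ) (l : Fin m) (ε : Finset (Blocks a))
      (h : Option {b // b ∉ ε} ≃ Blocks a₀), HomUniv n (sit := sit) (ν := Empty) (κ := Blocks a₀)
        fun s _ f => FormalGeometry.symbolTerm (sit s).conn.ring (C s a) ε (f ∘ h) :=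
    fun a l ε h => (HomUniv.symbolTerm (fun p hp => ih p hp a) ε).reindex (Equiv.refl _) h
  refine (((HomUniv.sum (blockPerms a₀) fun h _ => h1 h).sub (HomUniv.sum A fun a _ =>
    HomUniv.sum univ fun l _ => HomUniv.sum ((blockSlots a l).powerset.erase ∅) fun ε _ =>
      HomUniv.sum (slotEquivs (a₀ := a₀) l ε) fun h _ => h2 a l ε h)).smul
        ((blockPerms a₀).card * n : ℝ)⁻¹).congr fun s I f => ?_
  rw [hom_real_smul, ← hom_symbol_recursion (sit s).conn (hz s) ha₀ (hs s a₀ ha₀) n f,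
    inv_smul_smul₀]
  exact mul_ne_zero (Nat.cast_ne_zero.2 (blockPerms_card_pos a₀).ne') (Nat.cast_ne_zero.2 hn.ne')

theorem HomUniv.exists_polynomial {κ : Type} [Fintype κ] {Φ : SFamily sit Empty κ}
    (h : HomUniv n Φ) : ∃ P : NoLoopPolynomial L up n κ,
      ∀ (s : ι) (T : (l : L) → Vec (sit s).d → (up l → Fin (sit s).d) → ℝ),
        (∀ l J (q : (sit s).conn.dom), evalAt q ((sit s).tensor l J) = T l q J) →
        ∀ (q : (sit s).conn.dom) I J, symCoeff (evalSeries q (Φ s Empty.elim J)) n I =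
          NoLoopPolynomial.eval P (sit s).conn.Γ T q I J := by
  obtain ⟨X, hX, h⟩ := h
  have hY : Univ sit (Fin n) κ fun s I J => (n.factorial : ℝ)⁻¹ •
      ∑ σ : Equiv.Perm (Fin n), X s (Sum.elim Empty.elim (I ∘ σ)) J := by
    refine (Univ.sum univ fun (σ : Equiv.Perm (Fin n)) _ => (hX.reindex
      ((Equiv.emptySum Empty (Fin n)).trans σ) (Equiv.refl κ)).congr fun s I J => ?_).smul _
    refine congrArg (fun K => X s K J) (funext fun x => ?_)
    rcases x with x | x
    · exact x.elim
    · rfl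
  obtain ⟨P, hP⟩ := hY.exists_polynomial
  refine ⟨P, fun s T hT q I J => ?_⟩
  rw [← hP s T hT q I J]
  have h1 := hom_evalSeries n q (Φ s Empty.elim J)
  rw [h, evalSeries_genPoly] at h1
  rw [symCoeff_eq_of_hom h1, map_smul, map_sum]
  rfl

end SymbolUniversal

section FlatOperators

/-- A flat fiberwise operator over a connection with tensors, the lowest parts of its coefficients
being given by these tensors. -/
structure FlatOperator (L : Type) (up : L → Type) {m : ℕ} (A : Finset (Fin m → ℕ))
    (low : (b : A) → Σ l, up l ≃ Blocks b.1) where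
  sit : Situation L up
  coeff : (a : Fin m → ℕ) → (Blocks a → Fin sit.d) →
    MvPowerSeries (Fin sit.d) (smoothRing sit.conn.dom)
  flat : ∀ q i, fedosovAt sit.conn A coeff q i = 0
  symm : ∀ a ∈ A, BlockSymm (coeff a)
  eq_zero : ∀ a ∉ A, ∀ J, coeff a J = 0
  lowest : ∀ (b : A) J, hom 0 (coeff b.1 J) = C (sit.tensor (low b).1 (J ∘ (low b).2))

variable {m : ℕ}

/-- The tensor which belongs to a letter, as a universal family. -/
lemma univ_tensor {L : Type} {up : L → Type} [∀ l, Fintype (up l)] [∀ l, DecidableEq (up l)]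
    {ι : Type} (sit : ι → Situation L up) (l : L) :
    Univ sit Empty (up l) fun s _ J => (sit s).tensor l J :=
  (Univ.letter (sit := sit) (some l) 0).reindex
    (Equiv.equivOfIsEmpty (Fin 0) Empty : Fin (lowArity (some l) + 0) ≃ Empty)
    (Equiv.refl (up l) : UpSlot up (some l) ≃ up l)

variable {L : Type} {up : L → Type} [∀ l, Fintype (up l)] [∀ l, DecidableEq (up l)]
  {A : Finset (Fin m → ℕ)}

lemma homUniv_zero_of_letter {ι κ : Type} {sit : ι → Situation L up} (l : L) (ψ : up l ≃ κ)
    (Φ : SFamily sit Empty κ) (h : ∀ s I J, hom 0 (Φ s I J) =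
      C ((sit s).tensor l (J ∘ ψ))) : HomUniv 0 Φ :=
  ((HomUniv.const (univ_tensor sit l) 0).reindex (Equiv.refl _) ψ).congr fun s I J => by
    rw [h, hom_C, if_pos rfl]

/-- The coefficients of flat operators, in terms of their lowest parts. -/
theorem exists_polynomial_of_flat {κ : Type} [Fintype κ] (low : (b : A) → Σ l, up l ≃ Blocks b.1)
    (n : ℕ) (a : Fin m → ℕ) (ψ : Blocks a ≃ κ) :
    ∃ P : NoLoopPolynomial L up n κ,
      ∀ (s : FlatOperator L up A low) (T : (l : L) → Vec s.sit.d → (up l → Fin s.sit.d) → ℝ)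
        (_ : ∀ l J (q : s.sit.conn.dom), evalAt q (s.sit.tensor l J) = T l q J)
        (q : s.sit.conn.dom) I J, symCoeff (evalSeries q (s.coeff a (J ∘ ψ))) n I =
          NoLoopPolynomial.eval P s.sit.conn.Γ T q I J := by
  have h0 : ∀ b, HomUniv 0 (sit := fun s : FlatOperator L up A low => s.sit)
      fun s (_ : Empty → Fin s.sit.d) J => s.coeff b J := fun b => by
    by_cases hb : b ∈ A
    · exact homUniv_zero_of_letter (low ⟨b, hb⟩).1 (low ⟨b, hb⟩).2 _ fun s _ J => s.lowest ⟨b, hb⟩ J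
    · exact HomUniv.of_eq_zero fun s I J => by rw [s.eq_zero b hb, map_zero]
  exact ((homUniv_of_flat (fun s => s.flat) (fun s => s.symm) (fun s => s.eq_zero) h0 n a).reindex
    (Equiv.refl Empty) ψ).exists_polynomial

lemma constantCoeff_liftPoly {d : ℕ} {R : Type*} [CommRing R] [Algebra ℝ R] (Q : ConnRing d R)
    (F : (Fin m → Fin d) → R) (K : Fin m → Fin d) :
    constantCoeff (Q.liftPoly F K) = F K := by
  rw [ConnRing.liftPoly, map_sum, sum_eq_single K]
  · simp [ConnRing.constantCoeff_jacInv, ConnRing.constantCoeff_tau]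
  · intro I _ hI
    obtain ⟨a, ha⟩ := Function.ne_iff.1 hI
    rw [map_mul, map_prod, Finset.prod_eq_zero (mem_univ a), zero_mul]
    rw [ConnRing.constantCoeff_jacInv, if_neg ha.symm]
  · simp

lemma fedosovAt_congr {d : ℕ} (c : LocalConn d) {A A' : Finset (Fin m → ℕ)}
    {C : Coeffs m d (Series d (smoothRing c.dom))}
    (hA : ∀ a ∉ A, ∀ J, C a J = 0) (hA' : ∀ a ∉ A', ∀ J, C a J = 0) (q : c.dom) (i : Fin d) :
    fedosovAt c A C q i = fedosovAt c A' C q i := by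
  have h : ∀ D : Coeffs m d (FPS d), (∀ a ∉ A, ∀ J, D a J = 0) →
      (∀ a ∉ A', ∀ J, D a J = 0) → (dop A D : (Fin m → FPS d) → FPS d) = dop A' D :=
    fun D hD hD' => by rw [← dpolyOp_eq_dop A D hD, ← dpolyOp_eq_dop A' D hD']
  rw [fedosovAt, fedosovAt, h, h]
  all_goals
    intro a ha J
    first | rw [hA a ha] | rw [hA' a ha]
    simp

end FlatOperators

section UniversalTensors

variable {d m : ℕ} {M : Type u} [TopologicalSpace M] [ChartedSpace (Vec d) M]
  [IsManifold (𝓡 d) ∞ M] {e : OpenPartialHomeomorph M (Vec d)}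
  {nabla : Connection d M} [T2Space M] [nabla.ContMDiffCovariantDerivative ∞]
  (htor : nabla.torsion = 0)

lemma symCoeff_chartSeries {κ : Type} {T : (n : ℕ) → TensorField d M n κ} (he : IsChart e)
    (hs : ∀ n x (σ : Equiv.Perm (Fin n)) v w, (T n).toFun x (v ∘ σ) w = (T n).toFun x v w)
    (q : (chartConn htor he).dom) {n : ℕ} (I : Fin n → Fin d) (J : κ → Fin d) :
    symCoeff (evalSeries q (chartSeries htor T he J)) n I = (T n).comp e q I J := by
  rw [evalSeries_chartSeries]
  exact symCoeff_genSeries (T := fun n I => (T n).comp e q I J)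
    (fun σ I => hs n _ σ (fun a => coordVec e (I a) q) _) I

lemma hom_zero_chartSeries {κ : Type} (T : (n : ℕ) → TensorField d M n κ) (he : IsChart e)
    (J : κ → Fin d) : hom 0 (chartSeries htor T he J) = C ((T 0).chartComp htor he J) := by
  rw [hom_zero_eq]
  refine congrArg _ (smoothRing.ext_evalAt fun q => ?_)
  have h := constantCoeff_genSeries fun n I => (T n).comp e q I J
  rw [← evalSeries_chartSeries htor T he J q] at h
  exact h

lemma DPolySection.blockSymm_coeffs (S : DPolySection d M m) (he : IsChart e) (a : Fin m → ℕ) :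
    BlockSymm (S.coeffs htor he a) := by
  intro σ J
  refine ext_evalSeries fun q => ?_
  rw [DPolySection.coeffs, DPolySection.coeffs, evalSeries_chartSeries, evalSeries_chartSeries]
  exact congrArg genSeries (funext fun n => funext fun I =>
    S.block_symm n a (e.symm q) (fun b => coordVec e (I b) q) σ fun b => coordCovec e (J b) q)

lemma DPolySection.fedosovAt_coeffs {S : DPolySection d M m} (hS : S.IsHorizontal nabla)
    (he : IsChart e) {N : ℕ}
    (hN : ∀ p ∈ e.source, ∀ n a, (∃ l, N < a l) → (S.tensor n a).at p = 0)
    (q : (chartConn htor he).dom) (i : Fin d) :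
    fedosovAt (chartConn htor he) (arityBox m N) (S.coeffs htor he) q i = 0 :=
  (S.fedosovD_eq htor he hN q i).symm.trans (hS e he q q.2 i)

lemma DPolySection.coeffs_eq_zero_of_order {S : DPolySection d M m} (hS : S.IsHorizontal nabla)
    (he : IsChart e) {N N' : ℕ}
    (hN' : ∀ p ∈ e.source, ∀ n a, (∃ l, N' < a l) → (S.tensor n a).at p = 0)
    (hN : ∀ p ∈ e.source, ∀ a, (∃ l, N < a l) → (S.tensor 0 a).at p = 0)
    {a : Fin m → ℕ} (ha : a ∉ arityBox m N) (J : Blocks a → Fin d) :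
    S.coeffs htor he a J = 0 := by
  by_cases ha' : a ∈ arityBox m N'
  · refine eq_zero_of_hom_zero _ (S.fedosovAt_coeffs htor hS he hN') (N := N)
      (fun b _ => S.blockSymm_coeffs htor he b) (fun b _ hb J => ?_) a ha' ha J
    refine (hom_zero_chartSeries htor (S.tensor · b) he J).trans ?_
    have h0 : (S.tensor 0 b).chartComp htor he J = 0 := by
      refine smoothRing.ext_evalAt fun q => ?_
      rw [map_zero]
      refine (he.comp_eq (S.tensor 0 b) q.2 Fin.elim0 J).trans ?_
      rw [mem_arityBox] at hb
      push Not at hb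
      rw [hN _ (e.map_target q.2) b hb]
      rfl
    rw [h0, map_zero]
  · exact S.coeffs_eq_zero htor he hN' ha' J

/-- A horizontal section of fiberwise polydifferential operators in a chart. -/
def DPolySection.flatOperator {S : DPolySection d M m} (hS : S.IsHorizontal nabla) (he : IsChart e)
    {N N' : ℕ} (hN' : ∀ p ∈ e.source, ∀ n a, (∃ l, N' < a l) → (S.tensor n a).at p = 0)
    (hN : ∀ p ∈ e.source, ∀ a, (∃ l, N < a l) → (S.tensor 0 a).at p = 0) :
    FlatOperator (Fin m → ℕ) (fun b => Blocks b) (arityBox m N) fun b => ⟨b.1, Equiv.refl _⟩ where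
  sit := ⟨d, chartConn htor he, fun b J => (S.tensor 0 b).chartComp htor he J⟩
  coeff := S.coeffs htor he
  flat q i := (fedosovAt_congr _ (fun _ ha J => S.coeffs_eq_zero_of_order htor hS he hN' hN ha J)
    (fun _ ha J => S.coeffs_eq_zero htor he hN' ha J) q i).trans
      (S.fedosovAt_coeffs htor hS he hN' q i)
  symm a _ := S.blockSymm_coeffs htor he a
  eq_zero _ ha J := S.coeffs_eq_zero_of_order htor hS he hN' hN ha J
  lowest b J := hom_zero_chartSeries htor (S.tensor · b.1) he J

/-- A horizontal section of fiberwise polyvector fields in a chart. -/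
def TPolySection.flatOperator {S : TPolySection d M m} {F : PolyvectorField d M m}
    (hS : S.IsTaylorExpansion nabla F) (he : IsChart e) :
    FlatOperator Unit (fun _ => Fin m) ({1} : Finset (Fin m → ℕ)) fun b =>
      ⟨(), (blocksOne m).trans (Equiv.sigmaCongrRight fun l =>
        finCongr (congrFun (mem_singleton.1 b.2) l).symm)⟩ where
  sit := ⟨d, chartConn htor he, fun _ J => F.tensor.chartComp htor he J⟩
  coeff := firstOrder (S.coeffs htor he)
  flat q i := (S.fedosovD_eq htor he q i).symm.trans
    ((S.isHorizontal_iff htor).2 ⟨F, hS⟩ e he q q.2 i)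
  symm a _ := blockSymm_firstOrder _ a
  eq_zero a ha J := firstOrder_of_ne _ (by simpa using ha) J
  lowest := by
    rintro ⟨b, hb⟩ J
    obtain rfl := mem_singleton.1 hb
    change hom 0 (firstOrder (S.coeffs htor he) 1 J) = _
    rw [firstOrder_one, (S.isTaylorExpansion_iff htor F).1 hS e he, hom_zero_eq,
      constantCoeff_liftPoly]
    rfl

include htor in
lemma DPolySection.tensor_zero_eq {O : PolyDiffOp d M m} {S : DPolySection d M m}
    {T : OperatorTensors d M m} (hS : S.IsTaylorExpansion nabla O) (hT : IsAssociated nabla O T)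
    (a : Fin m → ℕ) : S.tensor 0 a = T.tensor a := by
  rw [← OperatorTensors.unique htor (S.isAssociated_symbolTensors htor hS) hT]
  rfl

omit [IsManifold (𝓡 d) ∞ M] [T2Space M] in
lemma TensorField.comp_restr {n : ℕ} {κ : Type} (T : TensorField d M n κ) (V : Set M)
    (q : Vec d) (I : Fin n → Fin d) (J : κ → Fin d) : T.comp (e.restr V) q I J = T.comp e q I J :=
  rfl

lemma christoffel_restr (nabla : Connection d M) (V : Set M) :
    christoffel nabla (e.restr V) = christoffel nabla e := rfl

theorem exists_polynomial_tPoly (m n : ℕ) : ∃ P : NoLoopPolynomial Unit (fun _ => Fin m) n (Fin m),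
    ∀ (d : ℕ) (M : Type u) [TopologicalSpace M] [ChartedSpace (Vec d) M]
      [IsManifold (𝓡 d) ∞ M] [T2Space M] (nabla : Connection d M)
      [nabla.ContMDiffCovariantDerivative ∞], nabla.torsion = 0 →
      ∀ (F : PolyvectorField d M m) (S : TPolySection d M m), S.IsTaylorExpansion nabla F →
      ∀ e : OpenPartialHomeomorph M (Vec d), IsChart e → ∀ q ∈ e.target,
      ∀ (I : Fin n → Fin d) (J : Fin m → Fin d), (S.tensor n).comp e q I J =
          NoLoopPolynomial.eval P (christoffel nabla e)
            (fun _ q' J' => F.tensor.comp e q' Fin.elim0 J') q I J := by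
  obtain ⟨P, hP⟩ := exists_polynomial_of_flat (L := Unit) (up := fun _ => Fin m)
    (A := ({1} : Finset (Fin m → ℕ))) (fun b =>
      ⟨(), (blocksOne m).trans (Equiv.sigmaCongrRight fun l =>
        finCongr (congrFun (mem_singleton.1 b.2) l).symm)⟩) n 1 (blocksOne m).symm
  refine ⟨P, ?_⟩
  intro d M _ _ _ _ nabla _ htor F S hS e he q hq I J
  have h := hP (TPolySection.flatOperator htor hS he)
    (fun _ q' J' => F.tensor.comp e q' Fin.elim0 J') (fun _ _ _ => rfl) ⟨q, hq⟩ I J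
  refine Eq.trans ?_ h
  refine (symCoeff_chartSeries htor he S.symm ⟨q, hq⟩ I J).symm.trans ?_
  refine congrArg (fun s => symCoeff (evalSeries (⟨q, hq⟩ : (chartConn htor he).dom) s) n I) ?_
  exact (firstOrder_one (S.coeffs htor he) (J ∘ (blocksOne m).symm)).symm

/-- The coefficients of horizontal sections in a chart with bounds on the orders. -/
theorem exists_polynomial_of_isHorizontal (m n : ℕ) (a : Fin m → ℕ) (N : ℕ) :
    ∃ P : NoLoopPolynomial (Fin m → ℕ) (fun b => Blocks b) n (Blocks a),
    ∀ (d : ℕ) (M : Type u) [TopologicalSpace M] [ChartedSpace (Vec d) M]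
      [IsManifold (𝓡 d) ∞ M] [T2Space M] (nabla : Connection d M)
      [nabla.ContMDiffCovariantDerivative ∞], nabla.torsion = 0 →
      ∀ S : DPolySection d M m, S.IsHorizontal nabla →
      ∀ e : OpenPartialHomeomorph M (Vec d), IsChart e → ∀ N',
        (∀ p ∈ e.source, ∀ n a, (∃ l, N' < a l) → (S.tensor n a).at p = 0) →
        (∀ p ∈ e.source, ∀ a, (∃ l, N < a l) → (S.tensor 0 a).at p = 0) →
      ∀ q ∈ e.target, ∀ (I : Fin n → Fin d) (J : Blocks a → Fin d), (S.tensor n a).comp e q I J =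
          NoLoopPolynomial.eval P (christoffel nabla e)
            (fun b q' J' => (S.tensor 0 b).comp e q' Fin.elim0 J') q I J := by
  obtain ⟨P, hP⟩ := exists_polynomial_of_flat (L := Fin m → ℕ) (up := fun b => Blocks b)
    (A := arityBox m N) (fun b => ⟨b.1, Equiv.refl _⟩) n a (Equiv.refl _)
  refine ⟨P, ?_⟩
  intro d M _ _ _ _ nabla _ htor S hS e he N' hN' hN q hq I J
  have h := hP (DPolySection.flatOperator htor hS he hN' hN)
    (fun b q' J' => (S.tensor 0 b).comp e q' Fin.elim0 J') (fun _ _ _ => rfl) ⟨q, hq⟩ I J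
  exact (symCoeff_chartSeries htor he (S.symm · a) ⟨q, hq⟩ I J).symm.trans h

theorem exists_polynomial_dPoly (m n : ℕ) (a : Fin m → ℕ) (N : ℕ) :
    ∃ P : NoLoopPolynomial (Fin m → ℕ) (fun b => Blocks b) n (Blocks a),
    ∀ (d : ℕ) (M : Type u) [TopologicalSpace M] [ChartedSpace (Vec d) M]
      [IsManifold (𝓡 d) ∞ M] [T2Space M] (nabla : Connection d M)
      [nabla.ContMDiffCovariantDerivative ∞], nabla.torsion = 0 →
      ∀ (O : PolyDiffOp d M m) (S : DPolySection d M m) (T : OperatorTensors d M m),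
      S.IsTaylorExpansion nabla O → IsAssociated nabla O T →
      ∀ e : OpenPartialHomeomorph M (Vec d), IsChart e → ∀ q ∈ e.target,
        (∀ᶠ p in 𝓝 (e.symm q), ∀ b, (∃ l, N < b l) → (T.tensor b).toFun p = 0) →
      ∀ (I : Fin n → Fin d) (J : Blocks a → Fin d), (S.tensor n a).comp e q I J =
          NoLoopPolynomial.eval P (christoffel nabla e)
            (fun b q' J' => (T.tensor b).comp e q' Fin.elim0 J') q I J := by
  obtain ⟨P, hP⟩ := exists_polynomial_of_isHorizontal.{u} m n a N
  refine ⟨P, ?_⟩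
  intro d M _ _ _ _ nabla _ htor O S T hS hT e he q hq hN I J
  obtain ⟨N', hN'⟩ := S.order_bdd_at (e.symm q)
  have hx := e.map_target hq
  obtain ⟨V, he', hxV, hV⟩ := he.exists_restr hx (hN.and hN')
  have h0 := DPolySection.tensor_zero_eq htor hS hT
  have hor := S.isHorizontal_of_isTaylorExpansion htor hS
  have hq' : q ∈ (e.restr V).target := by
    have := (e.restr V).map_source hxV
    rwa [show (e.restr V) (e.symm q) = q from e.right_inv hq] at this
  have h := hP d M nabla htor S hor (e.restr V) he' N' (fun p hp => (hV p hp).2)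
    (fun p hp b hb => by rw [h0]; exact (hV p hp).1 b hb) q hq' I J
  simp only [TensorField.comp_restr, christoffel_restr, h0] at h
  exact h

end UniversalTensors

end FormalGeometry

end

theorem mainTheorem10 :
    (∀ (d : ℕ) (M : Type u) [TopologicalSpace M] [ChartedSpace (Vec d) M] [IsManifold (𝓡 d) ∞ M]
      [T2Space M] [SecondCountableTopology M] (nabla : Connection d M)
      [nabla.ContMDiffCovariantDerivative ∞], nabla.torsion = 0 → ∀ m : ℕ,
        (∀ F : PolyvectorField d M m, ∃! S : TPolySection d M m, S.IsTaylorExpansion nabla F) ∧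
        (∀ S : TPolySection d M m,
          S.IsHorizontal nabla ↔ ∃ F : PolyvectorField d M m, S.IsTaylorExpansion nabla F) ∧
        (∀ O : PolyDiffOp d M m, ∃! S : DPolySection d M m, S.IsTaylorExpansion nabla O) ∧
        (∀ S : DPolySection d M m,
          S.IsHorizontal nabla ↔ ∃ O : PolyDiffOp d M m, S.IsTaylorExpansion nabla O) ∧
        (∀ O : PolyDiffOp d M m, ∃! T : OperatorTensors d M m, IsAssociated nabla O T)) ∧
    (∀ m n : ℕ, ∃ P : NoLoopPolynomial Unit (fun _ => Fin m) n (Fin m),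
      ∀ (d : ℕ) (M : Type u) [TopologicalSpace M] [ChartedSpace (Vec d) M]
        [IsManifold (𝓡 d) ∞ M] [T2Space M] [SecondCountableTopology M] (nabla : Connection d M)
        [nabla.ContMDiffCovariantDerivative ∞], nabla.torsion = 0 →
        ∀ (F : PolyvectorField d M m) (S : TPolySection d M m), S.IsTaylorExpansion nabla F →
        ∀ e : OpenPartialHomeomorph M (Vec d), IsChart e → ∀ q ∈ e.target,
        ∀ (I : Fin n → Fin d) (J : Fin m → Fin d),
          (S.tensor n).comp e q I J =
            NoLoopPolynomial.eval P (christoffel nabla e)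
              (fun _ q' J' => F.tensor.comp e q' Fin.elim0 J') q I J) ∧
    (∀ (m n : ℕ) (a : Fin m → ℕ) (N : ℕ),
      ∃ P : NoLoopPolynomial (Fin m → ℕ) (fun b => Blocks b) n (Blocks a),
      ∀ (d : ℕ) (M : Type u) [TopologicalSpace M] [ChartedSpace (Vec d) M]
        [IsManifold (𝓡 d) ∞ M] [T2Space M] [SecondCountableTopology M] (nabla : Connection d M)
        [nabla.ContMDiffCovariantDerivative ∞], nabla.torsion = 0 →
        ∀ (O : PolyDiffOp d M m) (S : DPolySection d M m) (T : OperatorTensors d M m),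
        S.IsTaylorExpansion nabla O → IsAssociated nabla O T →
        ∀ e : OpenPartialHomeomorph M (Vec d), IsChart e → ∀ q ∈ e.target,
          (∀ᶠ p in 𝓝 (e.symm q), ∀ b, (∃ l, N < b l) → (T.tensor b).toFun p = 0) →
        ∀ (I : Fin n → Fin d) (J : Blocks a → Fin d),
          (S.tensor n a).comp e q I J =
            NoLoopPolynomial.eval P (christoffel nabla e)
              (fun b q' J' => (T.tensor b).comp e q' Fin.elim0 J') q I J) := by
  refine ⟨fun d M _ _ _ _ _ nabla _ htor m => ⟨fun F => existsUnique_tPoly htor F,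
    fun S => S.isHorizontal_iff htor, fun O => existsUnique_dPoly htor O,
    fun S => S.isHorizontal_iff htor, fun O => existsUnique_operatorTensors htor O⟩,
    fun m n => ?_, fun m n a N => ?_⟩
  · obtain ⟨P, hP⟩ := exists_polynomial_tPoly.{u} m n
    exact ⟨P, fun d M _ _ _ _ _ nabla _ htor => hP d M nabla htor⟩
  · obtain ⟨P, hP⟩ := exists_polynomial_dPoly.{u} m n a N
    exact ⟨P, fun d M _ _ _ _ _ nabla _ htor => hP d M nabla htor⟩
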